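/- **Setting.** Let $\beta\in\{-1,0,1\}$, $\lambda\ge1$, $\mathbb T_\lambda=\mathbb R/2\pi\lambda\mathbb Z$, $\dot{\mathbb Z}_\lambda=\lambda^{-1}(\mathbb Z\setminus\{0\})$, $\langle x\rangle=(1+x^2)^{1/2}$, $p_\lambda(k)=k^5+\beta\lambda^{-2}k^3$, $\widehat f(k)=(2\pi)^{-1/2}\int_0^{2\pi\lambda}e^{-ikx}f(x)\,dx$, and $\|g\|_{\ell^2_k}^2=\lambda^{-1}\sum_{k\in\dot{\mathbb Z}_\lambda}|g(k)|^2$. For functions $v$ on $\mathbb R\times\mathbb T_\lambda$ with mean zero in $x$ and space-time Fourier transform $\widehat v(\tau,k)$ put $$\|v\|_{X^{s,b}}=\|\langle k\rangle^s\langle\tau-p_\lambda(k)\rangle^b\,\widehat v\|_{\ell^2_kL^2_\tau},\quad \|v\|_{Y^s}=\|\langle k\rangle^s\,\widehat v\|_{\ell^2_kL^1_\tau},\quad \|v\|_{W^s}=\|v\|_{X^{s,1/2}}+\|v\|_{Y^s},$$ and for a time interval $J$ let $\|u\|_{W^s(J)}=\inf\{\|v\|_{W^s}:\ v(t)=u(t)\text{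 for }t\in J\}$. A *solution* on $J=[t_0-1,t_0+1]$ is a real-valued $u\in W^s(J)$ with mean zero in $x$ which satisfies $$\partial_tu-\partial_x^5u+\lambda^{-2}\beta\,\partial_x^3u+\partial_x(u^2)=0$$ in the integral form $u(t)=U_\lambda(t-t_0)u(t_0)-\int_{t_0}^tU_\lambda(t-t')\,\partial_x(u(t')^2)\,dt'$ for $t\in J$, where $\widehat{U_\lambda(t)f}(k)=e^{ip_\lambda(k)t}\widehat f(k)$; for each Fourier coefficient the integral is understood as the limit, as $M\to\infty$, of the one in which $u^2$ is replaced by the square of the restriction of $u$ to the frequencies $|k|\le M/\lambda$. For $s<0$ and $N\geq 1$ let $m:\mathbb R\to\mathbb R$ be smooth, even, nonincreasing on $[0,\infty)$, with $m(\xi)=1$ for $|\xi|\le N$, $m(\xi)=|\xi|^sN^{-s}$ for $|\xi|\ge2N$, and $|m^{(j)}(\xi)|\le B_jN^{-j}$ for all $j\ge0$ and $\xi\in\mathbb R$, where $B=(B_j)_{j\ge0}$ is a fixed sequence of constants. Let $\widehat{If}(k)=m(k)\widehat f(k)$. Put $a_l=i\sum_{j=1}^lk_j^5$, $b_l=i\sum_{j=1}^lk_j^3$,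 let $[M]_{sym}$ be the average of $M(k_{\sigma(1)},\dots,k_{\sigma(l)})$ over all permutations $\sigma$, and $$\Lambda_l(M)(t)=(2\pi)^{1-l/2}\lambda^{1-l}\sum_{k_1+\dots+k_l=0,\ k_j\in\dot{\mathbb Z}_\lambda}M(k_1,\dots,k_l)\prod_{j=1}^l\widehat{u(t)}(k_j)$$ (so that $\Lambda_l(1)=\int_{\mathbb T_\lambda}u^l\,dx$). Define $E_I^{(2)}(u)(t)=\|Iu(t)\|_{L^2}^2$ and $$M_3=-2i\,[m(k_1)m(k_2+k_3)(k_2+k_3)]_{sym},\qquad\sigma_3=-\frac{M_3}{a_3+\lambda^{-2}\beta b_3},$$ $$M_4=-3i\,[\sigma_3(k_1,k_2,k_3+k_4)(k_3+k_4)]_{sym},\qquad\sigma_4=-\frac{M_4}{a_4+\lambda^{-2}\beta b_4},$$ where a term of $M_4$ with vanishing factor $k_i+k_j$ is $0$ and $\sigma_4:=0$ where $a_4+\lambda^{-2}\beta b_4=0$ (there $M_4=0$ as well). Finally $E_I^{(4)}(u)=E_I^{(2)}(u)+\Lambda_3(\sigma_3)+\Lambda_4(\sigma_4)$. **Proposition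 5.2 (almost conservation law).** Let $-1\le s<0$ and let $B$ be a sequence of constants. There are $N_0\ge1$ and $C>0$, depending only on $s$ and $B$, such that for all $\beta\in\{-1,0,1\}$, $\lambda\ge1$, $N\ge N_0$, all $m$ as above, all $t_0\in\mathbb R$ and all solutions $u$ on $[t_0-1,t_0+1]$: the series defining $E_I^{(4)}(u)(t)$ converge absolutely for every $t\in[t_0-1,t_0+1]$, and $$\bigl|E_I^{(4)}(u)(t)-E_I^{(4)}(u)(t_0)\bigr|\le C\,N^{5s}\,\|Iu\|_{W^0([t_0-1,t_0+1])}^5\qquad\text{for all }t\in[t_0-1,t_0+1].$$ -/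

import Mathlib

open scoped ENNReal ContDiff
open MeasureTheory Filter Topology

noncomputable section

namespace Kawahara

/-- The Japanese bracket `⟨x⟩ = (1 + |x|²)^{1/2}`. -/
def bracket (x : ℝ) : ℝ := Real.sqrt (1 + x ^ 2)

/-- The frequency `k = n / lam` of the torus `ℝ / 2π lam ℤ` with index `n`. -/
def freq (lam : ℝ) (n : ℤ) : ℝ := (n : ℝ) / lam

/-- The dispersion relation `p(k) = k⁵ + β lam⁻² k³` of the rescaled equation. -/
def dispersion (β lam k : ℝ) : ℝ := k ^ 5 + β * (lam ^ 2)⁻¹ * k ^ 3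

/-- A periodic distribution `f` on `ℝ / 2π lam ℤ`, given by its Fourier coefficients
`n ↦ f̂(n / lam)`, where `f̂(k) = (2π)^{-1/2} ∫_0^{2π lam} e^{-ikx} f(x) dx`, so that
`f(x) = ((2π)^{1/2} lam)⁻¹ ∑_n f̂(n / lam) e^{i n x / lam}`. -/
abbrev PeriodicDistribution : Type := ℤ → ℂ

/-- The Fourier multiplier operator with symbol `m`. -/
def fourierMultiplier (lam : ℝ) (m : ℝ → ℝ) (f : PeriodicDistribution) : PeriodicDistribution :=
  fun n => (m (freq lam n) : ℂ) * f n

/-! ### The function spaces `X^{s,b}`, `Y^s`, `W^s`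

A function on `ℝ × (ℝ / 2π lam ℤ)` with mean zero in space is given by its space-time Fourier
transform `G n τ = û(τ, n / lam)`, `n ≠ 0`. -/

/-- The norm `‖⟨k⟩^s ⟨τ - p(k)⟩^b û‖_{ℓ²_k L²_τ}`, with `(1 / lam) ∑_{k ≠ 0}` as measure in `k`. -/
def xNorm (β lam s b : ℝ) (G : ℤ → ℝ → ℂ) : ℝ≥0∞ :=
  (ENNReal.ofReal lam⁻¹ * ∑' n : {n : ℤ // n ≠ 0}, ∫⁻ τ : ℝ,
    (ENNReal.ofReal (bracket (freq lam n) ^ s *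
        bracket (τ - dispersion β lam (freq lam n)) ^ b) * ‖G n τ‖ₑ) ^ 2) ^ (1 / 2 : ℝ)

/-- The norm `‖⟨k⟩^s û‖_{ℓ²_k L¹_τ}`. -/
def yNorm (lam s : ℝ) (G : ℤ → ℝ → ℂ) : ℝ≥0∞ :=
  (ENNReal.ofReal lam⁻¹ * ∑' n : {n : ℤ // n ≠ 0},
    (ENNReal.ofReal (bracket (freq lam n) ^ s) * ∫⁻ τ : ℝ, ‖G n τ‖ₑ) ^ 2) ^ (1 / 2 : ℝ)

/-- The norm of `W^s = X^{s,1/2} ∩ Y^s`. -/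
def wNorm (β lam s : ℝ) (G : ℤ → ℝ → ℂ) : ℝ≥0∞ :=
  xNorm β lam s (1 / 2) G + yNorm lam s G

/-- The function with space-time Fourier transform `G` coincides on the time interval `J` with
`u` (at all nonzero frequencies). The function is recovered by Fourier inversion in time; the
transforms in `W^s` are integrable in `τ` for every nonzero frequency. -/
def IsExtension (J : Set ℝ) (u : ℝ → PeriodicDistribution) (G : ℤ → ℝ → ℂ) : Prop :=
  ∀ n : ℤ, n ≠ 0 → Integrable (G n) ∧ ∀ t ∈ J,
    u t n = ((Real.sqrt (2 * Real.pi))⁻¹ : ℂ) *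
      ∫ τ : ℝ, Complex.exp (Complex.I * t * τ) * G n τ

/-- The restricted norm of `W^s(J)`: the infimum of `‖v‖_{W^s}` over all `v` with `v = u` on the
time interval `J`. It is `∞` if there is no such `v` in `W^s`. -/
def wNormOn (β lam s : ℝ) (J : Set ℝ) (u : ℝ → PeriodicDistribution) : ℝ≥0∞ :=
  ⨅ (G : ℤ → ℝ → ℂ) (_ : IsExtension J u G), wNorm β lam s G

/-! ### Solutions of `∂_t u - ∂_x⁵ u + lam⁻² β ∂_x³ u + ∂_x(u²) = 0` -/

/-- The Fourier coefficient at `n / lam` of `(P_{≤ M} f)²`, where `P_{≤ M}` is the projection onto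
the frequencies `j / lam` with `|j| ≤ M`. -/
def truncatedSquare (lam : ℝ) (M : ℕ) (f : PeriodicDistribution) (n : ℤ) : ℂ :=
  ((Real.sqrt (2 * Real.pi) * lam)⁻¹ : ℂ) *
    ∑ j ∈ Finset.Icc (-(M : ℤ)) M, if |n - j| ≤ (M : ℤ) then f j * f (n - j) else 0

/-- `u` is a real-valued solution with mean zero, of class `W^s` on the time interval
`[t₀ - 1, t₀ + 1]`, of the integral equation
`u(t) = U(t - t₀) u(t₀) - ∫_{t₀}^t U(t - t') ∂_x(u(t')²) dt'`, `U(t) = exp(i p(k) t)`.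
As `u(t')` is a distribution of negative order, its square is understood as the limit of
`(P_{≤ M} u)²` as `M → ∞`, in the integral equation for each Fourier coefficient. -/
structure IsSolution (β lam s t₀ : ℝ) (u : ℝ → PeriodicDistribution) : Prop where
  mean_zero : ∀ t ∈ Set.Icc (t₀ - 1) (t₀ + 1), u t 0 = 0
  real_valued : ∀ t ∈ Set.Icc (t₀ - 1) (t₀ + 1), ∀ n : ℤ, u t (-n) = star (u t n)
  regular : wNormOn β lam s (Set.Icc (t₀ - 1) (t₀ + 1)) u < ⊤
  duhamel : ∀ t ∈ Set.Icc (t₀ - 1) (t₀ + 1), ∀ n : ℤ,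
    Tendsto (fun M : ℕ =>
        Complex.exp (Complex.I * dispersion β lam (freq lam n) * (t - t₀)) * u t₀ n -
        ∫ t' in t₀..t, Complex.exp (Complex.I * dispersion β lam (freq lam n) * (t - t')) *
          (Complex.I * freq lam n * truncatedSquare lam M (u t') n))
      atTop (𝓝 (u t n))

/-! ### The operator `I` -/

/-- `m` is an admissible symbol for the operator `I` with parameters `s < 0` and `N`: smooth, even,
monotone in `|ξ|`, equal to `1` for `|ξ| ≤ N` and to `|ξ|^s N^{-s}` for `|ξ| ≥ 2N`, and varying
at the scale `N`, that is, `|m^{(j)}| ≤ B j / N^j` for constants `B j`. -/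
structure IsSymbol (s N : ℝ) (B : ℕ → ℝ) (m : ℝ → ℝ) : Prop where
  smooth : ContDiff ℝ ∞ m
  even : ∀ ξ : ℝ, m (-ξ) = m ξ
  monotone : AntitoneOn m (Set.Ici 0)
  low : ∀ ξ : ℝ, |ξ| ≤ N → m ξ = 1
  high : ∀ ξ : ℝ, 2 * N ≤ |ξ| → m ξ = |ξ| ^ s * N ^ (-s)
  deriv_bound : ∀ (j : ℕ) (ξ : ℝ), |iteratedDeriv j m ξ| ≤ B j / N ^ j

/-! ### Multilinear forms and modified energies -/

/-- The symmetrization `[M]_sym` of an `l`-multiplier. -/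
def symmetrize {l : ℕ} (M : (Fin l → ℝ) → ℂ) : (Fin l → ℝ) → ℂ :=
  fun k => ((l.factorial : ℂ))⁻¹ * ∑ σ : Equiv.Perm (Fin l), M (fun i => k (σ i))

/-- The indices of the nonzero frequencies `k_1, …, k_l` with `k_1 + ⋯ + k_l = 0`. -/
def Hyperplane (l : ℕ) : Type := {n : Fin l → ℤ // ∑ i, n i = 0 ∧ ∀ i, n i ≠ 0}

/-- The term of `Λ_l(M; f, …, f)` at the frequencies `n / lam`. The measure on the hyperplane
`k_1 + ⋯ + k_l = 0` is the one for which `Λ_l(1; f, …, f) = ∫_0^{2π lam} f(x)^l dx`. -/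
def lambdaTerm {l : ℕ} (lam : ℝ) (M : (Fin l → ℝ) → ℂ) (f : PeriodicDistribution)
    (n : Hyperplane l) : ℂ :=
  ((2 * Real.pi * lam / (Real.sqrt (2 * Real.pi) * lam) ^ l : ℝ) : ℂ) *
    (M (fun i => freq lam (n.1 i)) * ∏ i, f (n.1 i))

/-- The form `Λ_l(M) = Λ_l(M; f, …, f)`. -/
def lambdaForm {l : ℕ} (lam : ℝ) (M : (Fin l → ℝ) → ℂ) (f : PeriodicDistribution) : ℂ :=
  ∑' n : Hyperplane l, lambdaTerm lam M f n

/-- `a_l + lam⁻² β b_l = i ∑_j k_j⁵ + lam⁻² β i ∑_j k_j³`. -/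
def resonance {l : ℕ} (β lam : ℝ) (k : Fin l → ℝ) : ℂ :=
  Complex.I * ((∑ j, k j ^ 5 : ℝ) : ℂ) +
    (((lam ^ 2)⁻¹ * β : ℝ) : ℂ) * (Complex.I * ((∑ j, k j ^ 3 : ℝ) : ℂ))

/-- `M_3 = -2i [m(k_1) m(k_2 + k_3) (k_2 + k_3)]_sym`. -/
def M3 (m : ℝ → ℝ) : (Fin 3 → ℝ) → ℂ :=
  fun k => -2 * Complex.I *
    symmetrize (fun k : Fin 3 → ℝ => ((m (k 0) * m (k 1 + k 2) * (k 1 + k 2) : ℝ) : ℂ)) k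

/-- `σ_3 = - M_3 / (a_3 + lam⁻² β b_3)`. (The denominator does not vanish for nonzero frequencies
with sum zero. Where an argument vanishes, the value of the quotient is irrelevant below: it is
multiplied by that argument.) -/
def sigma3 (β lam : ℝ) (m : ℝ → ℝ) : (Fin 3 → ℝ) → ℂ :=
  fun k => -M3 m k / resonance β lam k

/-- `M_4 = -3i [σ_3(k_1, k_2, k_3 + k_4) (k_3 + k_4)]_sym`. -/
def M4 (β lam : ℝ) (m : ℝ → ℝ) : (Fin 4 → ℝ) → ℂ :=
  fun k => -3 * Complex.I *
    symmetrize (fun k : Fin 4 → ℝ =>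
      sigma3 β lam m ![k 0, k 1, k 2 + k 3] * ((k 2 + k 3 : ℝ) : ℂ)) k

/-- `σ_4 = - M_4 / (a_4 + lam⁻² β b_4)`. For nonzero frequencies with sum zero the denominator
vanishes only where two of the frequencies cancel; there `M_4` vanishes as well (`m` is even), and
the quotient is `0`. -/
def sigma4 (β lam : ℝ) (m : ℝ → ℝ) : (Fin 4 → ℝ) → ℂ :=
  fun k => -M4 β lam m k / resonance β lam k

/-- The first modified energy `E_I^{(2)} = ‖I f‖_{L²}² = (1 / lam) ∑_k |m(k) f̂(k)|²`. -/
def energy2 (lam : ℝ) (m : ℝ → ℝ) (f : PeriodicDistribution) : ℝ :=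
  lam⁻¹ * ∑' n : ℤ, ‖fourierMultiplier lam m f n‖ ^ 2

/-- `E_I^{(3)} = E_I^{(2)} + Λ_3(σ_3)`. -/
def energy3 (β lam : ℝ) (m : ℝ → ℝ) (f : PeriodicDistribution) : ℂ :=
  (energy2 lam m f : ℂ) + lambdaForm lam (sigma3 β lam m) f

/-- `E_I^{(4)} = E_I^{(3)} + Λ_4(σ_4)`. -/
def energy4 (β lam : ℝ) (m : ℝ → ℝ) (f : PeriodicDistribution) : ℂ :=
  energy3 β lam m f + lambdaForm lam (sigma4 β lam m) f

/-- All the series in the definition of `E_I^{(4)}` converge absolutely at `f`. -/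
def EnergyConverges (β lam : ℝ) (m : ℝ → ℝ) (f : PeriodicDistribution) : Prop :=
  Summable (fun n : ℤ => ‖fourierMultiplier lam m f n‖ ^ 2) ∧
    Summable (lambdaTerm lam (sigma3 β lam m) f) ∧
    Summable (lambdaTerm lam (sigma4 β lam m) f)

end Kawahara

end

namespace Kawahara

/-! ### The Japanese bracket -/

/-! In the interaction picture `e^{-ip(k)t} û(t,k)` the equation is an infinite system with
quadratic right-hand side. Differentiating a form `Λ_l(X)` with symmetric `X` therefore gives
`Λ_l(iΩX)`, where `Ω` is the sum of the dispersions, plus a form with one more argument whose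
multiplier is a multiple of `X(k_1, …, k_l + k_{l+1}) (k_l + k_{l+1})`. Since `σ_3` and `σ_4` are
quotients by exactly these `iΩ`, the cubic and quartic contributions cancel. The increment of the
energy is the time integral of a quintic form with multiplier `σ_4(k_1, k_2, k_3, k_4 + k_5) (k_4 +
k_5)` up to a constant (`modeEnergy_sub`).

The quintic form is estimated one frequency tuple at a time. Waves, i.e. functions of time whose
transform lies in `L¹` and, with weight `⟨τ - p⟩^{1/2}`, in `L²`, are closed under products, and
their modulations `p` add up (`IsWave.mul`). The integral of a wave over a bounded interval gains
`⟨p⟩^{-1/2}` (`IsWave.norm_integral_le`). What remains is a pointwise inequality for the multiplier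
and a summation.

The pointwise inequality has two sources. The numerator of `σ_4` vanishes on the three resonant
planes, so that `σ_4` is bounded by inverse fourth powers of the largest and the third largest
frequency, cut off below at `N` (`IsNice.quartSymbol_le`). Where this does not suffice, the quintic
resonance function is large. Together (`IsNice.quintic_weight_le`) they control the multiplier times
`∏ max(N, |k_i|)` by `⟨Ω⟩^{1/2}` times products of three square summable weights `max(1,
|k|)^{-2/3}`. Because `s ≥ -1`, one has `1 / m(k) ≤ 2 N^s max(N, |k|)` (`IsSymbol.one_le_mul`): each
of the five coefficients of `u` is a coefficient of `Iu` at the price of `2 N^s max(N, |k|)`, and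
this produces `N^{5s}`. Cauchy–Schwarz sums the rest (`IsControlled.tsum_quinticSum_le`), and the
powers of `lam` from the sums cancel against the normalization of the form.

Two points need care at this low regularity. The series for the time derivatives are summed
absolutely only after integration in time; `HasWaveDeriv` records such weak derivatives, and
`HasWaveDeriv.mul` proves the product rule by averaging difference quotients. Moreover, the cubic
and quartic terms that cancel are shown to be summable only for `m` of compact support. The identity
is therefore proved for truncations of `m`, with an estimate that does not see the truncation, and
`tendsto_modeEnergy` passes to the limit. -/

lemma one_le_bracket (x : ℝ) : 1 ≤ bracket x := by
  rw [bracket, Real.one_le_sqrt]; nlinarith [sq_nonneg x]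

lemma bracket_pos (x : ℝ) : 0 < bracket x := lt_of_lt_of_le one_pos (one_le_bracket x)

lemma abs_le_bracket (x : ℝ) : |x| ≤ bracket x := by
  rw [bracket]; apply Real.abs_le_sqrt; linarith

lemma bracket_le_one_add (x : ℝ) : bracket x ≤ 1 + |x| := by
  rw [bracket]; apply Real.sqrt_le_iff.2
  refine ⟨by positivity, ?_⟩
  nlinarith [abs_nonneg x, sq_abs x]

lemma bracket_neg (x : ℝ) : bracket (-x) = bracket x := by simp [bracket]

lemma sq_bracket (x : ℝ) : bracket x ^ 2 = 1 + x ^ 2 := by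
  rw [bracket, Real.sq_sqrt (by positivity)]

lemma bracket_add_le (x y : ℝ) : bracket (x + y) ≤ bracket x + bracket y := by
  have hx := bracket_pos x
  have hy := bracket_pos y
  apply le_of_sq_le_sq _ (by positivity)
  have h1 : x * y ≤ bracket x * bracket y := by
    calc x * y ≤ |x| * |y| := by rw [← abs_mul]; exact le_abs_self _
      _ ≤ _ := mul_le_mul (abs_le_bracket x) (abs_le_bracket y) (abs_nonneg _) hx.le
  nlinarith [sq_bracket x, sq_bracket y, sq_bracket (x + y)]

lemma continuous_bracket : Continuous bracket := by unfold bracket; fun_prop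

/-- The square root of the Japanese bracket. -/
noncomputable def rbracket (x : ℝ) : ℝ := Real.sqrt (bracket x)

lemma rbracket_pos (x : ℝ) : 0 < rbracket x := Real.sqrt_pos.2 (bracket_pos x)

lemma one_le_rbracket (x : ℝ) : 1 ≤ rbracket x := by
  rw [rbracket, Real.one_le_sqrt]; exact one_le_bracket x

lemma sq_rbracket (x : ℝ) : rbracket x ^ 2 = bracket x := Real.sq_sqrt (bracket_pos x).le

lemma rbracket_neg (x : ℝ) : rbracket (-x) = rbracket x := by simp [rbracket, bracket_neg]

lemma continuous_rbracket : Continuous rbracket := continuous_bracket.sqrt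

/-- Subadditivity lets the modulation weight of a convolution in `τ` be placed on either one of the
two factors. -/
lemma rbracket_add_le (x y : ℝ) : rbracket (x + y) ≤ rbracket x + rbracket y := by
  have hx := rbracket_pos x
  have hy := rbracket_pos y
  apply le_of_sq_le_sq _ (by positivity)
  have := bracket_add_le x y
  nlinarith [sq_rbracket x, sq_rbracket y, sq_rbracket (x + y), mul_pos hx hy]

/-- A Peetre type inequality: multiplication by a fixed wave of modulation `q` changes `1 / rbracket
p` at most by a factor depending on `q`, so summability of a series of waves survives. -/
lemma rbracket_add_le_mul (x y : ℝ) : rbracket (x + y) ≤ 2 * (rbracket x * rbracket y) := by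
  have := rbracket_add_le x y
  nlinarith [one_le_rbracket x, one_le_rbracket y]

lemma lintegral_inv_sq_bracket :
    ∫⁻ x, ENNReal.ofReal ((bracket x)⁻¹) ^ 2 = ENNReal.ofReal Real.pi := by
  rw [← integral_univ_inv_one_add_sq, ofReal_integral_eq_lintegral_ofReal
    integrable_inv_one_add_sq (ae_of_all _ fun x => by positivity)]
  congr 1; ext x
  rw [← ENNReal.ofReal_pow (inv_nonneg.2 (bracket_pos x).le), inv_pow, sq_bracket]

/-! ### Inequalities for lower integrals -/

lemma ennreal_add_sq_le (a b : ℝ≥0∞) : (a + b) ^ 2 ≤ 2 * (a ^ 2 + b ^ 2) := by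
  rcases eq_or_ne a ⊤ with rfl | ha
  · simp
  rcases eq_or_ne b ⊤ with rfl | hb
  · simp
  lift a to NNReal using ha
  lift b to NNReal using hb
  have h : (a + b) ^ 2 ≤ 2 * (a ^ 2 + b ^ 2) := by
    have := add_sq_le (a := (a : ℝ)) (b := b)
    exact_mod_cast this
  exact_mod_cast h

/-- Cauchy–Schwarz, for a general measure because it is applied to Lebesgue measure, to a measure
with density (Young's inequality) and to the counting measure. -/
lemma lintegral_mul_sq_le {α : Type*} [MeasurableSpace α] (μ : Measure α) {f g : α → ℝ≥0∞}
    (hf : AEMeasurable f μ) (hg : AEMeasurable g μ) :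
    (∫⁻ x, f x * g x ∂μ) ^ 2 ≤ (∫⁻ x, f x ^ 2 ∂μ) * ∫⁻ x, g x ^ 2 ∂μ := by
  have h := ENNReal.lintegral_mul_le_Lp_mul_Lq μ Real.HolderConjugate.two_two hf hg
  simp only [Pi.mul_apply] at h
  calc (∫⁻ x, f x * g x ∂μ) ^ 2 ≤ _ := pow_le_pow_left₀ (by positivity) h 2
    _ = _ := by
      rw [mul_pow, ← ENNReal.rpow_natCast, ← ENNReal.rpow_mul, ← ENNReal.rpow_natCast,
        ← ENNReal.rpow_mul]
      norm_num

/-- Young's inequality `‖f * g‖_{L²} ≤ ‖f‖_{L²} ‖g‖_{L¹}`. -/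
lemma lintegral_convolution_sq_le {f g : ℝ → ℝ≥0∞} (hf : Measurable f) (hg : Measurable g) :
    ∫⁻ τ, (∫⁻ σ, f σ * g (τ - σ)) ^ 2 ≤ (∫⁻ σ, f σ ^ 2) * (∫⁻ σ, g σ) ^ 2 := by
  have hs : ∀ τ, Measurable fun σ => g (τ - σ) := fun τ => hg.comp (by fun_prop)
  have hint : ∀ τ : ℝ, ∫⁻ σ, g (τ - σ) = ∫⁻ σ, g σ := fun τ =>
    lintegral_sub_left_eq_self g τ
  have h1 : ∀ τ, (∫⁻ σ, f σ * g (τ - σ)) ^ 2 ≤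
      (∫⁻ σ, f σ ^ 2 * g (τ - σ)) * ∫⁻ σ, g σ := by
    intro τ
    -- Cauchy–Schwarz for `f` against `1` with respect to the measure `g (τ - σ) dσ`.
    have h := lintegral_mul_sq_le (volume.withDensity fun σ => g (τ - σ)) (f := f) (g := 1)
      hf.aemeasurable aemeasurable_const
    simp only [Pi.one_apply, mul_one, one_pow] at h
    rw [lintegral_withDensity_eq_lintegral_mul _ (hs τ) hf,
      lintegral_withDensity_eq_lintegral_mul _ (hs τ) (hf.pow_const 2),
      lintegral_withDensity_eq_lintegral_mul _ (hs τ) measurable_const] at h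
    simp only [Pi.mul_apply, mul_one] at h
    rw [hint] at h
    simpa only [mul_comm] using h
  have hm : Measurable (Function.uncurry fun τ σ => f σ ^ 2 * g (τ - σ)) :=
    ((hf.comp measurable_snd).pow_const 2).mul (hg.comp (by fun_prop))
  calc _ ≤ ∫⁻ τ, (∫⁻ σ, f σ ^ 2 * g (τ - σ)) * ∫⁻ σ, g σ := lintegral_mono h1
    _ = (∫⁻ τ, ∫⁻ σ, f σ ^ 2 * g (τ - σ)) * ∫⁻ σ, g σ :=
      lintegral_mul_const _ hm.lintegral_prod_right
    _ = (∫⁻ σ, ∫⁻ τ, f σ ^ 2 * g (τ - σ)) * ∫⁻ σ, g σ := by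
      rw [lintegral_lintegral_swap hm.aemeasurable]
    _ = (∫⁻ σ, f σ ^ 2 * ∫⁻ τ, g τ) * ∫⁻ σ, g σ := by
      congr 1; apply lintegral_congr; intro σ
      have hgc : Measurable fun τ => g (τ - σ) := hg.comp (measurable_id.sub_const σ)
      rw [lintegral_const_mul _ hgc]
      congr 1; exact lintegral_sub_right_eq_self g σ
    _ = _ := by rw [lintegral_mul_const _ (hf.pow_const 2)]; ring

lemma lintegral_convolution {f g : ℝ → ℝ≥0∞} (hf : Measurable f) (hg : Measurable g) :
    ∫⁻ τ, (∫⁻ σ, f σ * g (τ - σ)) = (∫⁻ σ, f σ) * (∫⁻ σ, g σ) := by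
  have hm : Measurable (Function.uncurry fun τ σ => f σ * g (τ - σ)) :=
    (hf.comp measurable_snd).mul (hg.comp (by fun_prop))
  rw [lintegral_lintegral_swap hm.aemeasurable, ← lintegral_mul_const _ hf]
  apply lintegral_congr; intro σ
  have hgc : Measurable fun τ => g (τ - σ) := hg.comp (measurable_id.sub_const σ)
  rw [lintegral_const_mul _ hgc]
  congr 1; exact lintegral_sub_right_eq_self g σ

/-! ### Functions of time with modulation near a given frequency -/

/-- `f` is the inverse Fourier transform of some `g` with `‖g‖_{L¹} ≤ A` and
`‖⟨τ - p⟩^{1/2} g‖_{L²} ≤ A`. -/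
def IsWave (p A : ℝ) (f : ℝ → ℂ) : Prop :=
  0 ≤ A ∧ ∃ g : ℝ → ℂ, Measurable g ∧ (∀ t, f t = ∫ τ : ℝ, Complex.exp (Complex.I * t * τ) * g τ) ∧
    ∫⁻ τ, ‖g τ‖ₑ ≤ ENNReal.ofReal A ∧
    ∫⁻ τ, (ENNReal.ofReal (rbracket (τ - p)) * ‖g τ‖ₑ) ^ 2 ≤ ENNReal.ofReal A ^ 2

lemma norm_exp_I_mul (t τ : ℝ) : ‖Complex.exp (Complex.I * t * τ)‖ = 1 := by
  rw [Complex.norm_exp]; simp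

lemma norm_exp_I_mul' (t τ : ℝ) (g : ℂ) : ‖Complex.exp (Complex.I * t * τ) * g‖ = ‖g‖ := by
  rw [norm_mul, norm_exp_I_mul, one_mul]

lemma enorm_exp_I_mul (t τ : ℝ) (g : ℂ) : ‖Complex.exp (Complex.I * t * τ) * g‖ₑ = ‖g‖ₑ := by
  rw [← ofReal_norm, norm_exp_I_mul', ofReal_norm]

lemma integrable_of_lintegral_le {g : ℝ → ℂ} (hg : Measurable g) {A : ℝ}
    (h : ∫⁻ τ, ‖g τ‖ₑ ≤ ENNReal.ofReal A) : Integrable g :=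
  ⟨hg.aestronglyMeasurable, lt_of_le_of_lt h ENNReal.ofReal_lt_top⟩

lemma integrable_exp_mul {g : ℝ → ℂ} (hg : Integrable g) (t : ℝ) :
    Integrable fun τ : ℝ => Complex.exp (Complex.I * t * τ) * g τ := by
  refine (integrable_norm_iff ?_).1 ?_
  · exact (Continuous.aestronglyMeasurable (by fun_prop)).mul hg.aestronglyMeasurable
  · simpa only [norm_exp_I_mul'] using hg.norm

lemma norm_integral_exp_le {g : ℝ → ℂ} {A : ℝ} (hA : 0 ≤ A)
    (h : ∫⁻ τ, ‖g τ‖ₑ ≤ ENNReal.ofReal A) (t : ℝ) :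
    ‖∫ τ : ℝ, Complex.exp (Complex.I * t * τ) * g τ‖ ≤ A := by
  have h1 := enorm_integral_le_lintegral_enorm (μ := volume)
    (fun τ : ℝ => Complex.exp (Complex.I * t * τ) * g τ)
  simp only [enorm_exp_I_mul] at h1
  rw [← ofReal_norm] at h1
  exact (ENNReal.ofReal_le_ofReal_iff hA).1 (h1.trans h)

lemma IsWave.nonneg {p A : ℝ} {f : ℝ → ℂ} (h : IsWave p A f) : 0 ≤ A := h.1

lemma IsWave.norm_le {p A : ℝ} {f : ℝ → ℂ} (h : IsWave p A f) (t : ℝ) : ‖f t‖ ≤ A := by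
  obtain ⟨hA, g, -, hf, h1, -⟩ := h
  rw [hf]; exact norm_integral_exp_le hA h1 t

lemma IsWave.continuous {p A : ℝ} {f : ℝ → ℂ} (h : IsWave p A f) : Continuous f := by
  obtain ⟨hA, g, hg, hf, h1, -⟩ := h
  have hi := integrable_of_lintegral_le hg h1
  rw [show f = _ from funext hf]
  refine continuous_of_dominated (bound := fun τ => ‖g τ‖)
    (fun t => (integrable_exp_mul hi t).aestronglyMeasurable)
    (fun t => ae_of_all _ fun τ => (norm_exp_I_mul' t τ _).le) hi.norm
    (ae_of_all _ fun τ => by fun_prop)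

lemma IsWave.of_ae {p A : ℝ} {f : ℝ → ℂ} (hA : 0 ≤ A) {g : ℝ → ℂ} (hg : AEStronglyMeasurable g)
    (hf : ∀ t, f t = ∫ τ : ℝ, Complex.exp (Complex.I * t * τ) * g τ)
    (h1 : ∫⁻ τ, ‖g τ‖ₑ ≤ ENNReal.ofReal A)
    (h2 : ∫⁻ τ, (ENNReal.ofReal (rbracket (τ - p)) * ‖g τ‖ₑ) ^ 2 ≤ ENNReal.ofReal A ^ 2) :
    IsWave p A f := by
  have he := hg.ae_eq_mk
  refine ⟨hA, hg.mk g, hg.stronglyMeasurable_mk.measurable, fun t => ?_, ?_, ?_⟩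
  · rw [hf]; apply integral_congr_ae; filter_upwards [he] with τ hτ; rw [hτ]
  · refine le_of_eq_of_le (lintegral_congr_ae ?_) h1; filter_upwards [he] with τ hτ; rw [hτ]
  · refine le_of_eq_of_le (lintegral_congr_ae ?_) h2; filter_upwards [he] with τ hτ; rw [hτ]

lemma IsWave.mono {p A A' : ℝ} {f : ℝ → ℂ} (h : IsWave p A f) (hA : A ≤ A') : IsWave p A' f := by
  obtain ⟨hA0, g, hg, hf, h1, h2⟩ := h
  have := ENNReal.ofReal_le_ofReal hA
  exact ⟨hA0.trans hA, g, hg, hf, h1.trans this, h2.trans (by gcongr)⟩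

lemma IsWave.zero (p : ℝ) : IsWave p 0 (fun _ => 0) :=
  ⟨le_rfl, 0, measurable_zero, by simp, by simp, by simp⟩

lemma IsWave.shift {p A : ℝ} {f : ℝ → ℂ} (h : IsWave p A f) (a : ℝ) :
    IsWave p A (fun t => f (t + a)) := by
  obtain ⟨hA, g, hg, hf, h1, h2⟩ := h
  refine ⟨hA, fun τ => Complex.exp (Complex.I * a * τ) * g τ, ?_, fun t => ?_, ?_, ?_⟩
  · exact (Continuous.measurable (by fun_prop)).mul hg
  · beta_reduce; rw [hf]; congr 1; ext τ; rw [← mul_assoc, ← Complex.exp_add]; push_cast; ring_nf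
  · simpa only [enorm_exp_I_mul] using h1
  · simpa only [enorm_exp_I_mul] using h2

/-- Translation of the transform in `τ` moves the reference modulation; this is the passage to the
interaction picture `e^{-ip(k)t} û(t,k)`. -/
lemma IsWave.modulate {p A : ℝ} {f : ℝ → ℂ} (h : IsWave p A f) (a : ℝ) :
    IsWave (p + a) A (fun t => Complex.exp (Complex.I * a * t) * f t) := by
  obtain ⟨hA, g, hg, hf, h1, h2⟩ := h
  refine ⟨hA, fun τ => g (τ - a), hg.comp (by fun_prop), fun t => ?_, ?_, ?_⟩
  · beta_reduce; rw [hf, ← integral_const_mul]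
    rw [← integral_sub_right_eq_self (μ := volume) _ a]
    congr 1; ext τ; rw [← mul_assoc, ← Complex.exp_add]; push_cast; ring_nf
  · rwa [lintegral_sub_right_eq_self (fun τ => ‖g τ‖ₑ) a]
  · have := lintegral_sub_right_eq_self (μ := volume)
      (fun τ => (ENNReal.ofReal (rbracket (τ - p)) * ‖g τ‖ₑ) ^ 2) a
    rw [← this] at h2
    refine le_of_eq_of_le ?_ h2
    congr 1; ext τ; congr 4; ring

lemma IsWave.const_mul {p A : ℝ} {f : ℝ → ℂ} (h : IsWave p A f) (c : ℂ) :
    IsWave p (‖c‖ * A) (fun t => c * f t) := by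
  obtain ⟨hA, g, hg, hf, h1, h2⟩ := h
  refine ⟨by positivity, fun τ => c * g τ, hg.const_mul c, fun t => ?_, ?_, ?_⟩
  · beta_reduce; rw [hf, ← integral_const_mul]; congr 1; ext τ; ring
  · simp_rw [enorm_mul]
    rw [lintegral_const_mul _ (by fun_prop), ENNReal.ofReal_mul (norm_nonneg c), ofReal_norm]
    gcongr
  · have : ∀ τ, (ENNReal.ofReal (rbracket (τ - p)) * ‖c * g τ‖ₑ) ^ 2 =
        ‖c‖ₑ ^ 2 * (ENNReal.ofReal (rbracket (τ - p)) * ‖g τ‖ₑ) ^ 2 := by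
      intro τ; rw [enorm_mul]; ring
    simp_rw [this]
    rw [lintegral_const_mul' _ _ (by finiteness), ENNReal.ofReal_mul (norm_nonneg c), ofReal_norm,
      mul_pow]
    gcongr

/-- The transform of the product is a convolution. Its `L¹` norm is at most the product of the `L¹`
norms. For the weighted `L²` norm, `⟨τ - p - p'⟩^{1/2}` is at most the sum of the weights of the two
factors, and Young's inequality puts the weighted factor in `L²` and the other one in `L¹`; the two
resulting terms cost the factor `2`. -/
lemma IsWave.mul {p p' A A' : ℝ} {f f' : ℝ → ℂ} (h : IsWave p A f) (h' : IsWave p' A' f') :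
    IsWave (p + p') (2 * A * A') (fun t => f t * f' t) := by
  obtain ⟨hA, g, hg, hf, h1, h2⟩ := h
  obtain ⟨hA', g', hg', hf', h1', h2'⟩ := h'
  have hi := integrable_of_lintegral_le hg h1
  have hi' := integrable_of_lintegral_le hg' h1'
  let L := ContinuousLinearMap.mul ℝ ℂ
  have hconv : ∀ τ, ‖(convolution g g' L volume) τ‖ₑ ≤ ∫⁻ σ, ‖g σ‖ₑ * ‖g' (τ - σ)‖ₑ := by
    intro τ
    rw [convolution_def]
    refine (enorm_integral_le_lintegral_enorm _).trans (le_of_eq ?_)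
    simp [L, enorm_mul]
  have hB : 0 ≤ 2 * A * A' := by positivity
  refine IsWave.of_ae hB (hi.integrable_convolution L hi').aestronglyMeasurable (fun t => ?_) ?_ ?_
  · have := integral_convolution (μ := volume) (ν := volume) L (integrable_exp_mul hi t)
      (integrable_exp_mul hi' t)
    rw [hf, hf']
    simp only [L, ContinuousLinearMap.mul_apply'] at this
    rw [← this]
    congr 1; ext τ
    rw [convolution_def, convolution_def, ← integral_const_mul]
    congr 1; ext σ
    simp only [ContinuousLinearMap.mul_apply']
    have : Complex.exp (Complex.I * t * τ) = Complex.exp (Complex.I * t * σ) *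
        Complex.exp (Complex.I * t * ((τ - σ : ℝ) : ℂ)) := by
      rw [← Complex.exp_add]; push_cast; ring_nf
    rw [this]; simp only [L, ContinuousLinearMap.mul_apply']; ring
  · calc _ ≤ ∫⁻ τ, ∫⁻ σ, ‖g σ‖ₑ * ‖g' (τ - σ)‖ₑ := lintegral_mono hconv
      _ = (∫⁻ σ, ‖g σ‖ₑ) * (∫⁻ σ, ‖g' σ‖ₑ) :=
        lintegral_convolution hg.enorm hg'.enorm
      _ ≤ ENNReal.ofReal A * ENNReal.ofReal A' := by gcongr
      _ = ENNReal.ofReal (A * A') := (ENNReal.ofReal_mul hA).symm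
      _ ≤ _ := ENNReal.ofReal_le_ofReal (by nlinarith [mul_nonneg hA hA'])
  · let v : ℝ → ℝ≥0∞ := fun σ => ENNReal.ofReal (rbracket (σ - p)) * ‖g σ‖ₑ
    let v' : ℝ → ℝ≥0∞ := fun σ => ENNReal.ofReal (rbracket (σ - p')) * ‖g' σ‖ₑ
    have hrb : ∀ a : ℝ, Measurable fun σ => ENNReal.ofReal (rbracket (σ - a)) := fun a =>
      (continuous_rbracket.measurable.comp (by fun_prop)).ennreal_ofReal
    have hv : Measurable v := (hrb p).mul hg.enorm
    have hv' : Measurable v' := (hrb p').mul hg'.enorm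
    have key : ∀ τ, (ENNReal.ofReal (rbracket (τ - (p + p'))) * ‖(convolution g g' L volume) τ‖ₑ) ^ 2
        ≤ 2 * (∫⁻ σ, v σ * ‖g' (τ - σ)‖ₑ) ^ 2 + 2 * (∫⁻ σ, v' σ * ‖g (τ - σ)‖ₑ) ^ 2 := by
      intro τ
      have hm : Measurable fun σ => v σ * ‖g' (τ - σ)‖ₑ :=
        hv.mul (hg'.enorm.comp (by fun_prop))
      have hsub : ∫⁻ σ, v' σ * ‖g (τ - σ)‖ₑ = ∫⁻ σ, v' (τ - σ) * ‖g σ‖ₑ := by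
        have := lintegral_sub_left_eq_self (μ := volume) (fun σ => v' σ * ‖g (τ - σ)‖ₑ) τ
        rw [← this]; simp
      have hle : ENNReal.ofReal (rbracket (τ - (p + p'))) * ‖(convolution g g' L volume) τ‖ₑ ≤
          (∫⁻ σ, v σ * ‖g' (τ - σ)‖ₑ) + ∫⁻ σ, v' σ * ‖g (τ - σ)‖ₑ := by
        rw [hsub, ← lintegral_add_left hm]
        refine (mul_le_mul_right (hconv τ) _).trans ?_
        rw [← lintegral_const_mul' _ _ ENNReal.ofReal_ne_top]
        apply lintegral_mono; intro σ
        have hr : ENNReal.ofReal (rbracket (τ - (p + p'))) ≤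
            ENNReal.ofReal (rbracket (σ - p)) + ENNReal.ofReal (rbracket (τ - σ - p')) := by
          rw [← ENNReal.ofReal_add (rbracket_pos _).le (rbracket_pos _).le]
          apply ENNReal.ofReal_le_ofReal
          convert rbracket_add_le (σ - p) (τ - σ - p') using 2; ring
        refine (mul_le_mul_left hr _).trans (le_of_eq ?_)
        simp only [v, v']; ring
      calc _ ≤ _ := pow_le_pow_left₀ (by positivity) hle 2
        _ ≤ _ := by rw [← mul_add]; exact ennreal_add_sq_le _ _
    have hY : ∀ (a b : ℝ → ℂ) (w : ℝ → ℝ≥0∞) (X Y : ℝ), Measurable b → Measurable w →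
        ∫⁻ σ, w σ ^ 2 ≤ ENNReal.ofReal X ^ 2 → ∫⁻ σ, ‖b σ‖ₑ ≤ ENNReal.ofReal Y →
        ∫⁻ τ, 2 * (∫⁻ σ, w σ * ‖b (τ - σ)‖ₑ) ^ 2 ≤
          2 * (ENNReal.ofReal X ^ 2 * ENNReal.ofReal Y ^ 2) := by
      intro a b w X Y hb hw hX hY
      rw [lintegral_const_mul' _ _ (by finiteness)]
      gcongr
      refine (lintegral_convolution_sq_le hw hb.enorm).trans ?_
      gcongr
    have hmeas : Measurable fun τ => 2 * (∫⁻ σ, v σ * ‖g' (τ - σ)‖ₑ) ^ 2 := by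
      refine Measurable.const_mul (Measurable.pow_const ?_ 2) 2
      have hm : Measurable (Function.uncurry fun τ σ => v σ * ‖g' (τ - σ)‖ₑ) :=
        (hv.comp measurable_snd).mul (hg'.comp (measurable_fst.sub measurable_snd)).enorm
      exact hm.lintegral_prod_right
    calc _ ≤ _ := lintegral_mono key
      _ = _ := lintegral_add_left hmeas _
      _ ≤ 2 * (ENNReal.ofReal A ^ 2 * ENNReal.ofReal A' ^ 2) +
          2 * (ENNReal.ofReal A' ^ 2 * ENNReal.ofReal A ^ 2) :=
        add_le_add (hY g g' v A A' hg' hv h2 h1') (hY g' g v' A' A hg hv' h2' h1)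
      _ = ENNReal.ofReal (2 * A * A') ^ 2 := by
        rw [ENNReal.ofReal_mul (by positivity), ENNReal.ofReal_mul (by norm_num)]
        rw [show ENNReal.ofReal 2 = 2 by simp]; ring

/-- The integral of a wave over a bounded interval gains the square root of its frequency. -/
lemma IsWave.norm_integral_le {p A : ℝ} {f : ℝ → ℂ} (h : IsWave p A f) {a b : ℝ}
    (hab : |b - a| ≤ 2) : ‖∫ t in a..b, f t‖ ≤ 24 * A / rbracket p := by
  obtain ⟨hA, g, hg, hf, h1, h2⟩ := h
  have hi := integrable_of_lintegral_le hg h1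
  -- The transform of the indicator of an interval of length at most `2` decays like `1 / ⟨τ⟩`: by
  -- its length for `|τ| ≤ 1`, by the explicit primitive otherwise.
  have hK : ∀ τ : ℝ, ‖∫ t in a..b, Complex.exp (Complex.I * t * τ)‖ ≤ 6 * (bracket τ)⁻¹ := by
    intro τ
    rcases le_or_gt |τ| 1 with hτ | hτ
    · have : ‖∫ t in a..b, Complex.exp (Complex.I * t * τ)‖ ≤ 1 * |b - a| :=
        intervalIntegral.norm_integral_le_of_norm_le_const fun t _ => (norm_exp_I_mul t τ).le
      have hb := bracket_le_one_add τ
      have : (1 / 2 : ℝ) ≤ (bracket τ)⁻¹ := by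
        rw [one_div]; exact inv_anti₀ (bracket_pos τ) (by linarith)
      linarith
    · have hτ0 : τ ≠ 0 := by rintro rfl; simp at hτ; linarith
      have hc : (Complex.I * τ : ℂ) ≠ 0 := by simp [hτ0]
      have he : ∫ t in a..b, Complex.exp (Complex.I * t * τ) =
          (Complex.exp (Complex.I * b * τ) - Complex.exp (Complex.I * a * τ)) / (Complex.I * τ) := by
        have := integral_exp_mul_complex (a := a) (b := b) hc
        rw [show (Complex.I * b * τ : ℂ) = Complex.I * τ * b by ring,
          show (Complex.I * a * τ : ℂ) = Complex.I * τ * a by ring, ← this]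
        congr 1; ext t; ring_nf
      rw [he, norm_div]
      have hn : ‖Complex.exp (Complex.I * b * τ) - Complex.exp (Complex.I * a * τ)‖ ≤ 2 := by
        refine (norm_sub_le _ _).trans ?_
        rw [norm_exp_I_mul, norm_exp_I_mul]; norm_num
      have hd : ‖(Complex.I * τ : ℂ)‖ = |τ| := by simp
      rw [hd, div_le_iff₀ (by linarith)]
      have hb := bracket_le_one_add τ
      have hbp := bracket_pos τ
      have h3 : bracket τ ≤ 2 * |τ| := by linarith
      have : 1 ≤ 2 * ((bracket τ)⁻¹ * |τ|) := by
        rw [← mul_inv_cancel₀ hbp.ne']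
        calc bracket τ * (bracket τ)⁻¹ ≤ (2 * |τ|) * (bracket τ)⁻¹ := by gcongr
          _ = _ := by ring
      nlinarith
  have hswap : ∫ t in a..b, f t =
      ∫ τ : ℝ, (∫ t in a..b, Complex.exp (Complex.I * t * τ)) * g τ := by
    simp_rw [hf]
    rw [intervalIntegral_integral_swap]
    · congr 1; ext τ; rw [← intervalIntegral.integral_mul_const]
    · have : Integrable (Function.uncurry fun (t τ : ℝ) => g τ)
          ((volume.restrict (Set.uIoc a b)).prod volume) := by
        have h0 : Integrable (fun _ : ℝ => (1 : ℂ)) (volume.restrict (Set.uIoc a b)) :=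
          continuous_const.integrableOn_uIoc
        have := h0.mul_prod hi
        simpa [Function.uncurry_def] using this
      refine (integrable_norm_iff ?_).1 ?_
      · exact (Continuous.aestronglyMeasurable (by fun_prop)).mul this.aestronglyMeasurable
      · simpa only [Function.uncurry_def, norm_exp_I_mul'] using this.norm
  have hP := rbracket_pos p
  rw [le_div_iff₀ hP]
  have hE : ‖∫ t in a..b, f t‖ₑ * ENNReal.ofReal (rbracket p) ≤ ENNReal.ofReal (24 * A) := by
    rw [hswap]
    let w : ℝ → ℝ≥0∞ := fun τ => ENNReal.ofReal ((bracket τ)⁻¹)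
    have hw : Measurable w :=
      (continuous_bracket.measurable.inv).ennreal_ofReal
    have hrb : Measurable fun σ => ENNReal.ofReal (rbracket (σ - p)) :=
      (continuous_rbracket.measurable.comp (by fun_prop)).ennreal_ofReal
    let v : ℝ → ℝ≥0∞ := fun σ => ENNReal.ofReal (rbracket (σ - p)) * ‖g σ‖ₑ
    have hv : Measurable v := hrb.mul hg.enorm
    -- Split `⟨p⟩^{1/2} ≤ ⟨τ⟩^{1/2} + ⟨τ - p⟩^{1/2}`. The first term is absorbed by the kernel `1 /
    -- ⟨τ⟩` and leaves the `L¹` norm of `g`; the second is the weighted `L²` function `v`, tested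
    -- against `1 / ⟨τ⟩ ∈ L²`.
    have hpt : ∀ τ : ℝ, ‖(∫ t in a..b, Complex.exp (Complex.I * t * τ)) * g τ‖ₑ *
        ENNReal.ofReal (rbracket p) ≤ 6 * ‖g τ‖ₑ + 6 * (v τ * w τ) := by
      intro τ
      have e1 : ‖(∫ t in a..b, Complex.exp (Complex.I * t * τ)) * g τ‖ₑ ≤
          ENNReal.ofReal (6 * (bracket τ)⁻¹) * ‖g τ‖ₑ := by
        rw [enorm_mul]; gcongr
        rw [← ofReal_norm]; exact ENNReal.ofReal_le_ofReal (hK τ)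
      have e2 : ENNReal.ofReal (6 * (bracket τ)⁻¹) * ENNReal.ofReal (rbracket p) ≤
          6 + 6 * (ENNReal.ofReal (rbracket (τ - p)) * w τ) := by
        have hr : rbracket p ≤ rbracket τ + rbracket (τ - p) := by
          have := rbracket_add_le τ (p - τ)
          rw [← rbracket_neg (p - τ)] at this
          simpa using this
        have hb1 : (bracket τ)⁻¹ * rbracket τ ≤ 1 := by
          rw [← sq_rbracket, inv_mul_le_iff₀ (by have := rbracket_pos τ; positivity)]
          nlinarith [one_le_rbracket τ]
        have hbi : 0 < (bracket τ)⁻¹ := inv_pos.2 (bracket_pos τ)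
        simp only [w]
        rw [← ENNReal.ofReal_mul (by positivity), ← ENNReal.ofReal_mul (rbracket_pos _).le]
        rw [show (6 : ℝ≥0∞) = ENNReal.ofReal 6 by simp, ← ENNReal.ofReal_mul (by norm_num),
          ← ENNReal.ofReal_add (by norm_num) (by have := rbracket_pos (τ - p); positivity)]
        apply ENNReal.ofReal_le_ofReal
        nlinarith [mul_le_mul_of_nonneg_left hr hbi.le]
      calc _ ≤ ENNReal.ofReal (6 * (bracket τ)⁻¹) * ‖g τ‖ₑ * ENNReal.ofReal (rbracket p) := by
            gcongr
        _ = ENNReal.ofReal (6 * (bracket τ)⁻¹) * ENNReal.ofReal (rbracket p) * ‖g τ‖ₑ := by ring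
        _ ≤ (6 + 6 * (ENNReal.ofReal (rbracket (τ - p)) * w τ)) * ‖g τ‖ₑ := by gcongr
        _ = _ := by simp only [v]; ring
    have hvw : ∫⁻ τ, v τ * w τ ≤ 2 * ENNReal.ofReal A := by
      have h3 := lintegral_mul_sq_le volume hv.aemeasurable hw.aemeasurable
      have h4 : (∫⁻ τ, v τ * w τ) ^ 2 ≤ (2 * ENNReal.ofReal A) ^ 2 := by
        refine h3.trans ?_
        rw [lintegral_inv_sq_bracket, mul_pow, mul_comm]
        gcongr
        rw [show (2 : ℝ≥0∞) ^ 2 = ENNReal.ofReal 4 by norm_num]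
        exact ENNReal.ofReal_le_ofReal Real.pi_le_four
      exact (ENNReal.pow_le_pow_left_iff two_ne_zero).1 h4
    calc _ ≤ (∫⁻ τ : ℝ, ‖(∫ t in a..b, Complex.exp (Complex.I * t * τ)) * g τ‖ₑ) *
          ENNReal.ofReal (rbracket p) := by gcongr; exact enorm_integral_le_lintegral_enorm _
      _ = ∫⁻ τ : ℝ, ‖(∫ t in a..b, Complex.exp (Complex.I * t * τ)) * g τ‖ₑ *
          ENNReal.ofReal (rbracket p) := (lintegral_mul_const' _ _ ENNReal.ofReal_ne_top).symm
      _ ≤ _ := lintegral_mono hpt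
      _ = 6 * (∫⁻ τ, ‖g τ‖ₑ) + 6 * ∫⁻ τ, v τ * w τ := by
        rw [lintegral_add_left (hg.enorm.const_mul 6), lintegral_const_mul _ hg.enorm,
          lintegral_const_mul' _ _ (by finiteness)]
      _ ≤ 6 * ENNReal.ofReal A + 6 * (2 * ENNReal.ofReal A) := by gcongr
      _ = 18 * ENNReal.ofReal A := by ring
      _ ≤ _ := by
        rw [ENNReal.ofReal_mul (by norm_num)]
        gcongr
        rw [show (18 : ℝ≥0∞) = ENNReal.ofReal 18 by simp]
        exact ENNReal.ofReal_le_ofReal (by norm_num)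
  rw [← ofReal_norm, ← ENNReal.ofReal_mul (norm_nonneg _)] at hE
  exact (ENNReal.ofReal_le_ofReal_iff (by positivity)).1 hE

/-! ### Weak time derivatives given by series of waves -/

/-- The increments of `f` over subintervals of `[α, β]` are the sums of the integrals of the waves
`F j`; the series converges absolutely thanks to the oscillation of its terms. -/
def HasWaveDeriv (α β : ℝ) {ι : Type} (f : ℝ → ℂ) (F : ι → ℝ → ℂ) : Prop :=
  (∃ p A : ι → ℝ, (∀ j, IsWave (p j) (A j) (F j)) ∧ Summable fun j => A j / rbracket (p j)) ∧
    ∀ s ∈ Set.Icc α β, ∀ t ∈ Set.Icc α β, HasSum (fun j => ∫ r in s..t, F j r) (f t - f s)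

lemma integral_unit_comp (F : ℝ → ℂ) (r ε : ℝ) (hε : ε ≠ 0) :
    ∫ θ in (0 : ℝ)..1, F (r + ε * θ) = (ε : ℂ)⁻¹ * ∫ x in r..(r + ε), F x := by
  have := intervalIntegral.integral_comp_add_mul (a := 0) (b := 1) F hε r
  rw [this]; simp

/-- The integral of `P(r + ε) - P(r)` telescopes into integrals of `P` over short intervals at `t`
and at `s`. Hence the limit is the derivative at `0` of a combination of primitives, and no
differentiability of `P` is needed. -/
lemma tendsto_average_difference {P : ℝ → ℂ} (hP : Continuous P) (s t : ℝ) :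
    Tendsto (fun ε : ℝ => (ε : ℂ)⁻¹ * ∫ r in s..(t - ε), (P (r + ε) - P r)) (𝓝[>] 0)
      (𝓝 (P t - P s)) := by
  let Φ : ℝ → ℂ := fun x => ∫ r in s..x, P r
  have hi : ∀ a b, IntervalIntegrable P volume a b := fun a b => hP.intervalIntegrable a b
  have hΦ : ∀ x, HasDerivAt Φ (P x) x := fun x =>
    intervalIntegral.integral_hasDerivAt_right (hi _ _) (hP.stronglyMeasurableAtFilter _ _)
      hP.continuousAt
  let Ψ : ℝ → ℂ := fun ε => Φ t - Φ (s + ε) - Φ (t - ε)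
  have h1 : HasDerivAt (fun ε : ℝ => Φ (s + ε)) (P s) 0 := by
    have := (hΦ (s + 0)).scomp_of_eq (h := fun ε : ℝ => s + ε) 0
      ((hasDerivAt_id (0 : ℝ)).const_add s) rfl
    simpa [Function.comp_def] using this
  have h2 : HasDerivAt (fun ε : ℝ => Φ (t - ε)) (-P t) 0 := by
    have := (hΦ (t - 0)).scomp_of_eq (h := fun ε : ℝ => t - ε) 0
      ((hasDerivAt_id (0 : ℝ)).const_sub t) rfl
    simpa [Function.comp_def] using this
  have hΨ : HasDerivAt Ψ (P t - P s) 0 := by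
    have := (h1.const_sub (Φ t)).sub h2
    exact this.congr_deriv (by ring)
  have hlim := (hasDerivAt_iff_tendsto_slope_zero.1 hΨ).mono_left
    (nhdsWithin_mono 0 fun x (hx : 0 < x) => ne_of_gt hx)
  refine hlim.congr fun ε => ?_
  have e1 : ∫ r in s..(t - ε), P (r + ε) = Φ t - Φ (s + ε) := by
    rw [intervalIntegral.integral_comp_add_right P ε, sub_add_cancel]
    exact (intervalIntegral.integral_interval_sub_left (hi _ _) (hi _ _)).symm
  rw [intervalIntegral.integral_sub
    (Continuous.intervalIntegrable (by fun_prop) _ _) (hi _ _), e1]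
  simp [Ψ, Φ]

/-- One half of the product rule. The increment of `f` over `[r, r + ε]` is the sum of the integrals
of the `F j`, but the series `∑ F j` need not converge pointwise. Integrating in `r` first makes the
`j`-th term an average over `θ` of the integrals of `F j (r + ε θ) g(r + a ε)`. Each of these is the
integral of a wave of modulation `p j + q`, bounded uniformly in `ε` by a summable sequence, so
dominated convergence applies. The parameter `a` allows `g` to be evaluated at either endpoint. -/
lemma HasWaveDeriv.tendsto_tsum_average {α β : ℝ} (hαβ : β - α ≤ 2) {ι : Type} [Countable ι]
    {f : ℝ → ℂ} {F : ι → ℝ → ℂ} (h : HasWaveDeriv α β f F) {q B : ℝ} {g : ℝ → ℂ}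
    (hg : IsWave q B g) (a : ℝ) {s t : ℝ} (hs : α ≤ s) (hst : s < t) (ht : t ≤ β) :
    Tendsto (fun ε : ℝ => (ε : ℂ)⁻¹ * ∫ r in s..(t - ε), (f (r + ε) - f r) * g (r + a * ε))
      (𝓝[>] 0) (𝓝 (∑' j, ∫ r in s..t, F j r * g r)) := by
  obtain ⟨⟨p, A, hF, hsum⟩, hfF⟩ := h
  have hFc : ∀ j, Continuous (F j) := fun j => (hF j).continuous
  have hgc := hg.continuous
  let ψ : ι → ℝ → ℂ := fun j ε =>
    ∫ θ in (0 : ℝ)..1, ∫ r in s..(t - ε), F j (r + ε * θ) * g (r + a * ε)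
  have hψc : ∀ j, Continuous (ψ j) := by
    intro j
    apply intervalIntegral.continuous_parametric_intervalIntegral_of_continuous'
    have hc := hFc j
    exact intervalIntegral.continuous_parametric_intervalIntegral_of_continuous
      (X := ℝ × ℝ) (f := fun (x : ℝ × ℝ) (r : ℝ) => F j (r + x.1 * x.2) * g (r + a * x.1))
      (s := fun x => t - x.1) (by fun_prop) (by fun_prop)
  have hψ0 : ∀ j, ψ j 0 = ∫ r in s..t, F j r * g r := by intro j; simp [ψ]
  have hbound : Summable fun j => 24 * (2 * B * (2 * (A j / rbracket (p j)) * rbracket q)) :=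
    ((((hsum.mul_left 2).mul_right _).mul_left _).mul_left _)
  have hψb : ∀ᶠ ε in 𝓝[>] (0 : ℝ), ∀ j,
      ‖ψ j ε‖ ≤ 24 * (2 * B * (2 * (A j / rbracket (p j)) * rbracket q)) := by
    filter_upwards [Ioo_mem_nhdsGT (sub_pos.2 hst)] with ε hε j
    have := intervalIntegral.norm_integral_le_of_norm_le_const (a := (0 : ℝ)) (b := 1)
      (f := fun θ => ∫ r in s..(t - ε), F j (r + ε * θ) * g (r + a * ε))
      (C := 24 * (2 * B * (2 * (A j / rbracket (p j)) * rbracket q))) ?_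
    · simpa using this
    intro θ _
    have hw := (((hF j).shift (ε * θ)).mul (hg.shift (a * ε)))
    refine (hw.norm_integral_le (a := s) (b := t - ε) ?_).trans ?_
    · rw [abs_of_nonneg] <;> linarith [hε.1, hε.2]
    · have hp := rbracket_pos (p j)
      have hq := rbracket_pos q
      have hpq := rbracket_pos (p j + q)
      have hA := (hF j).nonneg
      have hB := hg.nonneg
      have h1 : 1 / rbracket (p j + q) ≤ 2 * (1 / rbracket (p j)) * rbracket q := by
        have h2 := rbracket_add_le_mul (p j + q) (-q)
        rw [rbracket_neg, add_neg_cancel_right] at h2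
        rw [div_le_iff₀ hpq]
        have : 2 * (1 / rbracket (p j)) * rbracket q * rbracket (p j + q) =
          (2 * (rbracket (p j + q) * rbracket q)) / rbracket (p j) := by ring
        rw [this, le_div_iff₀ hp]; linarith
      calc 24 * (2 * A j * B) / rbracket (p j + q)
          = 24 * (2 * A j * B) * (1 / rbracket (p j + q)) := by ring
        _ ≤ 24 * (2 * A j * B) * (2 * (1 / rbracket (p j)) * rbracket q) := by gcongr
        _ = _ := by ring
  have hlim : Tendsto (fun ε => ∑' j, ψ j ε) (𝓝[>] 0) (𝓝 (∑' j, ∫ r in s..t, F j r * g r)) := by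
    refine tendsto_tsum_of_dominated_convergence hbound (fun j => ?_) hψb
    rw [← hψ0]
    exact (hψc j).continuousAt.tendsto.mono_left nhdsWithin_le_nhds
  refine hlim.congr' ?_
  filter_upwards [Ioo_mem_nhdsGT (sub_pos.2 hst)] with ε hε
  have hε0 : ε ≠ 0 := ne_of_gt hε.1
  have hle : s ≤ t - ε := by linarith [hε.2]
  -- For fixed `ε` the sum and the integral in `r` may be exchanged: the integral of `F j` over `[r,
  -- r + ε]` is bounded by `24 A j / rbracket (p j)`, uniformly in `r`.
  have key : HasSum (fun j => ∫ r in s..(t - ε),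
      (∫ x in r..(r + ε), F j x) * g (r + a * ε))
      (∫ r in s..(t - ε), (f (r + ε) - f r) * g (r + a * ε)) := by
    refine intervalIntegral.hasSum_integral_of_dominated_convergence
      (fun j _ => 24 * (A j / rbracket (p j)) * B) (fun j => ?_) (fun j => ?_) ?_ ?_ ?_
    · apply Continuous.aestronglyMeasurable
      have : Continuous fun r => ∫ x in r..(r + ε), F j x := by
        have h0 : ∀ r, ∫ x in r..(r + ε), F j x =
            (∫ x in (0 : ℝ)..(r + ε), F j x) - ∫ x in (0 : ℝ)..r, F j x := fun r =>
          (intervalIntegral.integral_interval_sub_left ((hFc j).intervalIntegrable _ _)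
            ((hFc j).intervalIntegrable _ _)).symm
        simp_rw [h0]
        have := intervalIntegral.continuous_primitive
          (fun a b => (hFc j).intervalIntegrable (μ := volume) a b) 0
        exact (this.comp (by fun_prop)).sub this
      fun_prop
    · refine ae_of_all _ fun r _ => ?_
      rw [norm_mul]
      have := (hF j).norm_integral_le (a := r) (b := r + ε) (by
        rw [abs_of_nonneg] <;> linarith [hε.1, hε.2])
      refine mul_le_mul (this.trans (le_of_eq (by ring))) (hg.norm_le _) (norm_nonneg _) ?_
      exact (norm_nonneg _).trans (this.trans (le_of_eq (by ring)))
    · exact ae_of_all _ fun r _ => (hsum.mul_left _).mul_right _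
    · exact intervalIntegrable_const
    · refine ae_of_all _ fun r hr => ?_
      rw [Set.uIoc_of_le hle] at hr
      exact (hfF r ⟨by linarith [hr.1], by linarith [hr.2, hε.1]⟩ (r + ε)
        ⟨by linarith [hr.1, hε.1], by linarith [hr.2]⟩).mul_right _
  rw [← key.tsum_eq, ← tsum_mul_left]
  congr 1; ext j
  have hc := hFc j
  simp only [ψ]
  rw [intervalIntegral_intervalIntegral_swap, ← intervalIntegral.integral_const_mul]
  · congr 1; ext r
    rw [← mul_assoc, ← integral_unit_comp _ _ _ hε0, ← intervalIntegral.integral_mul_const]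
  · refine (ContinuousOn.integrableOn_compact (isCompact_uIcc.prod isCompact_uIcc)
      (Continuous.continuousOn ?_)).mono_set
      (Set.prod_mono Set.uIoc_subset_uIcc Set.uIoc_subset_uIcc)
    simp only [Function.uncurry_def]
    fun_prop

/-- The discrete Leibniz rule `f(r+ε) g(r+ε) - f(r) g(r) = (f(r+ε) - f(r)) g(r+ε) + f(r) (g(r+ε) -
g(r))`, averaged over `r` and divided by `ε`. The two terms on the right are the cases `a = 1` and
`a = 0` of `tendsto_tsum_average`; the left side tends to the increment of `f g`. -/
lemma HasWaveDeriv.mul {α β : ℝ} (hαβ : β - α ≤ 2) {ι κ : Type} [Countable ι] [Countable κ]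
    {f g : ℝ → ℂ} {F : ι → ℝ → ℂ} {G : κ → ℝ → ℂ} {p q A B : ℝ} (hf : IsWave p A f)
    (hg : IsWave q B g) (hF : HasWaveDeriv α β f F) (hG : HasWaveDeriv α β g G) :
    HasWaveDeriv α β (fun t => f t * g t)
      (Sum.elim (fun j t => F j t * g t) (fun j t => f t * G j t)) := by
  have aux : ∀ {ι : Type} {F : ι → ℝ → ℂ} {f : ℝ → ℂ} (_ : HasWaveDeriv α β f F) {g : ℝ → ℂ}
      {q B : ℝ} (_ : IsWave q B g), ∃ P C : ι → ℝ, (∀ j, IsWave (P j) (C j) fun t => F j t * g t) ∧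
        Summable fun j => C j / rbracket (P j) := by
    rintro ι F f ⟨⟨p, A, h1, h2⟩, -⟩ g q B hg
    refine ⟨_, _, fun j => (h1 j).mul hg, ?_⟩
    have hB := hg.nonneg
    refine Summable.of_nonneg_of_le (fun j => ?_) (fun j => ?_)
      (((h2.mul_left 2).mul_right (rbracket q)).mul_left (2 * B))
    · have := (h1 j).nonneg; have := rbracket_pos (p j + q); positivity
    · have hA := (h1 j).nonneg
      have hp := rbracket_pos (p j)
      have hq := rbracket_pos q
      have hpq := rbracket_pos (p j + q)
      have h3 := rbracket_add_le_mul (p j + q) (-q)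
      rw [rbracket_neg, add_neg_cancel_right] at h3
      rw [div_le_iff₀ hpq]
      have : 2 * B * (2 * (A j / rbracket (p j)) * rbracket q) * rbracket (p j + q) =
        2 * A j * B * ((2 * (rbracket (p j + q) * rbracket q)) / rbracket (p j)) := by ring
      rw [this]
      have : 1 ≤ (2 * (rbracket (p j + q) * rbracket q)) / rbracket (p j) := by
        rw [le_div_iff₀ hp]; linarith
      nlinarith [mul_nonneg (mul_nonneg zero_le_two hA) hB]
  obtain ⟨P, C, hPC, hCs⟩ := aux hF hg
  obtain ⟨P', C', hPC', hCs'⟩ := aux hG hf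
  have hPC'' : ∀ j, IsWave (P' j) (C' j) fun t => f t * G j t := fun j => by
    simpa only [mul_comm] using hPC' j
  refine ⟨⟨Sum.elim P P', Sum.elim C C', ?_, ?_⟩, ?_⟩
  · rintro (j | j)
    · exact hPC j
    · exact hPC'' j
  · exact Summable.sum _ hCs hCs'
  have hfc := hf.continuous
  have hgc := hg.continuous
  have summ : ∀ {ι : Type} {F : ι → ℝ → ℂ} {P C : ι → ℝ} (_ : ∀ j, IsWave (P j) (C j) (F j))
      (_ : Summable fun j => C j / rbracket (P j)) (s t : ℝ) (_ : |t - s| ≤ 2),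
      Summable fun j => ∫ r in s..t, F j r := by
    intro ι F P C h1 h2 s t hst
    refine Summable.of_norm_bounded (h2.mul_left 24) fun j => ?_
    refine ((h1 j).norm_integral_le hst).trans (le_of_eq (by ring))
  have main : ∀ s t, α ≤ s → s < t → t ≤ β →
      HasSum (fun j => ∫ r in s..t, Sum.elim (fun j t => F j t * g t) (fun j t => f t * G j t) j r)
        (f t * g t - f s * g s) := by
    intro s t hs hst ht
    have h2 : |t - s| ≤ 2 := by rw [abs_of_pos] <;> linarith
    have s1 := (summ hPC hCs s t h2).hasSum
    have s2 := (summ hPC'' hCs' s t h2).hasSum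
    have t1 := hF.tendsto_tsum_average hαβ hg 1 hs hst ht
    have t2 := hG.tendsto_tsum_average hαβ hf 0 hs hst ht
    have t3 := tendsto_average_difference (hfc.mul hgc) s t
    have heq : f t * g t - f s * g s = (∑' j, ∫ r in s..t, F j r * g r) +
        ∑' j, ∫ r in s..t, f r * G j r := by
      have t4 := t1.add t2
      simp only [mul_comm (G _ _)] at t4
      refine tendsto_nhds_unique (t3.congr fun ε => ?_) t4
      rw [← mul_add, ← intervalIntegral.integral_add (Continuous.intervalIntegrable (by fun_prop) _ _)
        (Continuous.intervalIntegrable (by fun_prop) _ _)]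
      congr 2; ext r
      simp only [one_mul, zero_mul, add_zero, Pi.mul_apply]
      ring
    rw [heq]
    exact HasSum.sum s1 s2
  intro s hs t ht
  rcases lt_trichotomy s t with h | rfl | h
  · exact main s t hs.1 h ht.2
  · simp
  · have := (main t s ht.1 h hs.2).neg
    simp only [neg_sub] at this
    simpa only [← intervalIntegral.integral_symm] using this

lemma HasWaveDeriv.reindex {α β : ℝ} {ι κ : Type} {f : ℝ → ℂ} {F : ι → ℝ → ℂ}
    (h : HasWaveDeriv α β f F) (e : κ ≃ ι) : HasWaveDeriv α β f (fun k => F (e k)) := by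
  obtain ⟨⟨p, A, h1, h2⟩, h3⟩ := h
  exact ⟨⟨p ∘ e, A ∘ e, fun j => h1 (e j), (e.summable_iff (f := fun j => A j / rbracket (p j))).2 h2⟩,
    fun s hs t ht => (e.hasSum_iff (f := fun j => ∫ r in s..t, F j r)).2 (h3 s hs t ht)⟩

lemma IsWave.prod {l : ℕ} {f : Fin (l + 1) → ℝ → ℂ} {p A : Fin (l + 1) → ℝ}
    (h : ∀ i, IsWave (p i) (A i) (f i)) :
    IsWave (∑ i, p i) (2 ^ l * ∏ i, A i) (fun t => ∏ i, f i t) := by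
  induction l with
  | zero => simpa using h 0
  | succ l ih =>
    have := (h 0).mul (ih fun i => h i.succ)
    simp only [Fin.prod_univ_succ (n := l + 1), Fin.sum_univ_succ (n := l + 1)]
    convert this using 1
    ring

/-- The Leibniz rule for products of several factors. -/
lemma HasWaveDeriv.prod {α β : ℝ} (hαβ : β - α ≤ 2) {ι : Type} [Countable ι] {l : ℕ}
    {f : Fin (l + 1) → ℝ → ℂ} {F : Fin (l + 1) → ι → ℝ → ℂ} {p A : Fin (l + 1) → ℝ}
    (h : ∀ i, IsWave (p i) (A i) (f i)) (hF : ∀ i, HasWaveDeriv α β (f i) (F i)) :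
    HasWaveDeriv α β (fun t => ∏ i, f i t)
      (fun (x : Fin (l + 1) × ι) t => F x.1 x.2 t * ∏ i, if i = x.1 then 1 else f i t) := by
  induction l with
  | zero =>
    have := (hF 0).reindex (Equiv.uniqueProd ι (Fin 1))
    simpa [Fin.eq_zero] using this
  | succ l ih =>
    have h1 := HasWaveDeriv.mul hαβ (h 0) (IsWave.prod fun i => h i.succ) (hF 0)
      (ih (fun i => h i.succ) fun i => hF i.succ)
    -- The derivative falls either on the first factor or on one of the others.
    let e : Fin (l + 2) × ι ≃ ι ⊕ (Fin (l + 1) × ι) :=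
      { toFun := fun x => Fin.cases (Sum.inl x.2) (fun k => Sum.inr (k, x.2)) x.1
        invFun := Sum.elim (fun j => (0, j)) (fun y => (y.1.succ, y.2))
        left_inv := by
          rintro ⟨i, j⟩
          refine Fin.cases ?_ (fun k => ?_) i <;> simp
        right_inv := by rintro (j | ⟨k, j⟩) <;> simp }
    have h2 := h1.reindex e
    simp only [Fin.prod_univ_succ (n := l + 1)]
    convert h2 using 1
    ext ⟨i, j⟩ t
    refine Fin.cases ?_ (fun k => ?_) i
    · simp [e]
    · simp [e, (Fin.succ_ne_zero k).symm]; ring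

/-- The derivative of `e^{iΩt} f`. -/
lemma HasWaveDeriv.hasSum_phase {α β : ℝ} (hαβ : β - α ≤ 2) {ι : Type} [Countable ι]
    {f : ℝ → ℂ} {F : ι → ℝ → ℂ} (hfc : Continuous f) (h : HasWaveDeriv α β f F) (Ω : ℝ)
    {s t : ℝ} (hs : s ∈ Set.Icc α β) (ht : t ∈ Set.Icc α β) :
    HasSum (fun j => ∫ r in s..t, Complex.exp (Complex.I * Ω * r) * F j r)
      (Complex.exp (Complex.I * Ω * t) * f t - Complex.exp (Complex.I * Ω * s) * f s -
        Complex.I * Ω * ∫ r in s..t, Complex.exp (Complex.I * Ω * r) * f r) := by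
  obtain ⟨⟨p, A, h1, h2⟩, h3⟩ := h
  have hFc : ∀ j, Continuous (F j) := fun j => (h1 j).continuous
  let E : ℝ → ℂ := fun r => Complex.exp (Complex.I * Ω * r)
  have hEc : Continuous E := by fun_prop
  have hE : ∀ r : ℝ, HasDerivAt E (Complex.I * Ω * E r) r := by
    intro r
    have := ((hasDerivAt_id r).ofReal_comp.const_mul (Complex.I * Ω)).cexp
    simpa [E, mul_comm] using this
  have hE1 : ∀ r, ‖E r‖ = 1 := fun r => norm_exp_I_mul Ω r
  have hΦ : ∀ j r, HasDerivAt (fun r => ∫ x in s..r, F j x) (F j r) r := fun j r =>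
    intervalIntegral.integral_hasDerivAt_right ((hFc j).intervalIntegrable _ _)
      ((hFc j).stronglyMeasurableAtFilter _ _) (hFc j).continuousAt
  -- Integration by parts moves the derivative onto the phase, so that only primitives of the `F j`
  -- occur. These are summable uniformly on the interval, whereas the `F j` themselves are not.
  have hparts : ∀ j, ∫ r in s..t, E r * F j r = E t * (∫ x in s..t, F j x) -
      Complex.I * Ω * ∫ r in s..t, E r * ∫ x in s..r, F j x := by
    intro j
    rw [intervalIntegral.integral_mul_deriv_eq_deriv_mul (fun r _ => hE r) (fun r _ => hΦ j r)
      (Continuous.intervalIntegrable (by fun_prop) _ _) ((hFc j).intervalIntegrable _ _)]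
    simp only [intervalIntegral.integral_same, mul_zero, sub_zero, mul_assoc,
      intervalIntegral.integral_const_mul]
  have hsub : ∀ r ∈ Set.uIoc s t, r ∈ Set.Icc α β := fun r hr =>
    Set.uIcc_subset_Icc hs ht (Set.uIoc_subset_uIcc hr)
  have hsum : HasSum (fun j => ∫ r in s..t, E r * ∫ x in s..r, F j x)
      (∫ r in s..t, E r * (f r - f s)) := by
    refine intervalIntegral.hasSum_integral_of_dominated_convergence
      (fun j _ => 24 * (A j / rbracket (p j))) (fun j => ?_) (fun j => ?_) ?_ ?_ ?_
    · have hc : Continuous fun r => ∫ x in s..r, F j x :=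
        continuous_iff_continuousAt.2 fun r => (hΦ j r).continuousAt
      exact (hEc.mul hc).aestronglyMeasurable
    · refine ae_of_all _ fun r hr => ?_
      rw [norm_mul, hE1, one_mul]
      have hr' := hsub r hr
      refine ((h1 j).norm_integral_le ?_).trans (le_of_eq (by ring))
      rw [abs_le]; constructor <;> linarith [hr'.1, hr'.2, hs.1, hs.2]
    · exact ae_of_all _ fun r _ => h2.mul_left _
    · exact intervalIntegrable_const
    · exact ae_of_all _ fun r hr => (h3 s hs r (hsub r hr)).mul_left _
  have hfin := ((h3 s hs t ht).mul_left (E t)).sub (hsum.mul_left (Complex.I * Ω))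
  simp only [← hparts] at hfin
  have e1 : ∫ r in s..t, E r * (f r - f s) = (∫ r in s..t, E r * f r) - (∫ r in s..t, E r) * f s := by
    simp only [mul_sub]
    rw [intervalIntegral.integral_sub (Continuous.intervalIntegrable (by fun_prop) _ _)
      (Continuous.intervalIntegrable (by fun_prop) _ _), intervalIntegral.integral_mul_const]
  have e2 : Complex.I * Ω * ∫ r in s..t, E r = E t - E s := by
    rw [← intervalIntegral.integral_const_mul]
    exact intervalIntegral.integral_eq_sub_of_hasDerivAt (fun r _ => hE r)
      (Continuous.intervalIntegrable (by fun_prop) _ _)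
  have e3 : E t * (f t - f s) - Complex.I * Ω * ∫ r in s..t, E r * (f r - f s) =
      E t * f t - E s * f s - Complex.I * Ω * ∫ r in s..t, E r * f r := by
    rw [e1, mul_sub (Complex.I * Ω : ℂ), ← mul_assoc _ _ (f s), e2]
    ring
  rw [e3] at hfin
  exact hfin

/-! ### The equation for the Fourier coefficients -/

/-- The dispersion relation at the frequency of index `n`. -/
noncomputable def disp (β lam : ℝ) (n : ℤ) : ℝ := dispersion β lam (freq lam n)

/-- The normalization constant of products. -/
noncomputable def convConst (lam : ℝ) : ℝ := (Real.sqrt (2 * Real.pi) * lam)⁻¹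

/-- The terms of the derivative of `e^{-ip(k)t} û(t,k)`. -/
noncomputable def modeTerm (β lam : ℝ) (U : ℝ → PeriodicDistribution) (n j : ℤ) (t : ℝ) : ℂ :=
  -(Complex.I * freq lam n * convConst lam) *
    (Complex.exp (Complex.I * (-disp β lam n : ℝ) * t) * (U t j * U t (n - j)))

/-- The Fourier coefficients `U t n` are waves of size `b n`, and they solve the equation on the
time interval `[T, T']`, in the sense that the nonlinearity is summed absolutely after
integration in time. -/
structure IsModeFamily (β lam T T' : ℝ) (b : ℤ → ℝ) (U : ℝ → PeriodicDistribution) : Prop where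
  zero : ∀ t, U t 0 = 0
  wave : ∀ n, IsWave (disp β lam n) (b n) (fun t => U t n)
  deriv : ∀ n, HasWaveDeriv T T' (fun t => Complex.exp (Complex.I * (-disp β lam n : ℝ) * t) * U t n)
    (modeTerm β lam U n)

/-- The modulation of the interaction of `j` and `n - j` into `n` is the quadratic resonance
function. Its size is what makes the nonlinearity summable after integration in time. -/
lemma isWave_modeTerm {β lam : ℝ} {b : ℤ → ℝ} {U : ℝ → PeriodicDistribution}
    (hw : ∀ n, IsWave (disp β lam n) (b n) (fun t => U t n)) (n j : ℤ) :
    IsWave (disp β lam j + disp β lam (n - j) - disp β lam n)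
      (‖(freq lam n * convConst lam : ℝ)‖ * (2 * b j * b (n - j))) (modeTerm β lam U n j) := by
  have := (((hw j).mul (hw (n - j))).modulate (-disp β lam n)).const_mul
    (-(Complex.I * freq lam n * convConst lam))
  convert this using 2
  · ring
  · simp
  · rfl

lemma mem_truncation (n : ℤ) (M : ℕ) (j : ℤ) :
    j ∈ (Finset.Icc (-(M : ℤ)) M).filter (fun j => |n - j| ≤ (M : ℤ)) ↔
      |j| ≤ (M : ℤ) ∧ |n - j| ≤ (M : ℤ) := by
  simp [abs_le]

/-- The pairs of frequencies kept by the truncated squares exhaust all pairs, so the limit in the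
definition of a solution agrees with the unordered sum as soon as the latter converges. -/
lemma tendsto_truncation (n : ℤ) :
    Tendsto (fun M : ℕ => (Finset.Icc (-(M : ℤ)) M).filter (fun j => |n - j| ≤ (M : ℤ)))
      atTop atTop := by
  refine tendsto_atTop_finset_of_monotone (fun M M' h j hj => ?_) fun j => ?_
  · rw [mem_truncation] at hj ⊢
    constructor <;> [have := hj.1; have := hj.2] <;> omega
  · refine ⟨(|j| + |n - j|).toNat, ?_⟩
    rw [mem_truncation]
    have := abs_nonneg j
    have := abs_nonneg (n - j)
    constructor <;> omega

/-- After multiplication by `e^{-ip(k)t}` the truncated Duhamel formula is a finite partial sum of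
the integrals of the `modeTerm`s. By `hsum` and the gain of `norm_integral_le` the full series
converges absolutely, and uniqueness of limits identifies its sum with the increment from `t₀`.
General increments follow by subtraction. -/
lemma hasWaveDeriv_of_duhamel {β lam s t₀ : ℝ} {b : ℤ → ℝ} {u U : ℝ → PeriodicDistribution}
    (hu : IsSolution β lam s t₀ u)
    (hU : ∀ t ∈ Set.Icc (t₀ - 1) (t₀ + 1), ∀ n, U t n = u t n)
    (hw : ∀ n, IsWave (disp β lam n) (b n) (fun t => U t n)) (n : ℤ)
    (hsum : Summable fun j => |freq lam n| * (b j * b (n - j)) /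
      rbracket (disp β lam j + disp β lam (n - j) - disp β lam n)) :
    HasWaveDeriv (t₀ - 1) (t₀ + 1)
      (fun t => Complex.exp (Complex.I * (-disp β lam n : ℝ) * t) * U t n)
      (modeTerm β lam U n) := by
  have hW := isWave_modeTerm hw n
  have hS : Summable fun j => ‖(freq lam n * convConst lam : ℝ)‖ * (2 * b j * b (n - j)) /
      rbracket (disp β lam j + disp β lam (n - j) - disp β lam n) := by
    refine (hsum.mul_left (2 * |convConst lam|)).congr fun j => ?_
    rw [Real.norm_eq_abs, abs_mul]; ring
  have ht₀ : t₀ ∈ Set.Icc (t₀ - 1) (t₀ + 1) := by constructor <;> linarith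
  have hc : ∀ n, Continuous fun t => U t n := fun n => (hw n).continuous
  have hi : ∀ j x y, IntervalIntegrable (modeTerm β lam U n j) volume x y := fun j x y =>
    (hW j).continuous.intervalIntegrable _ _
  have hbase : ∀ t ∈ Set.Icc (t₀ - 1) (t₀ + 1), HasSum (fun j => ∫ r in t₀..t, modeTerm β lam U n j r)
      (Complex.exp (Complex.I * (-disp β lam n : ℝ) * t) * U t n -
        Complex.exp (Complex.I * (-disp β lam n : ℝ) * t₀) * U t₀ n) := by
    intro t ht
    have hsm : Summable fun j => ∫ r in t₀..t, modeTerm β lam U n j r := by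
      refine Summable.of_norm_bounded (hS.mul_left 24) fun j => ?_
      refine ((hW j).norm_integral_le ?_).trans (le_of_eq (by ring))
      rw [abs_le]; constructor <;> linarith [ht.1, ht.2]
    have h1 := hsm.hasSum.comp (tendsto_truncation n)
    have h2 := (hu.duhamel t ht n).const_mul (Complex.exp (Complex.I * (-disp β lam n : ℝ) * t))
    have h3 : ∀ M : ℕ, Complex.exp (Complex.I * (-disp β lam n : ℝ) * t) *
        (Complex.exp (Complex.I * dispersion β lam (freq lam n) * (t - t₀)) * u t₀ n -
        ∫ t' in t₀..t, Complex.exp (Complex.I * dispersion β lam (freq lam n) * (t - t')) *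
          (Complex.I * freq lam n * truncatedSquare lam M (u t') n)) =
        Complex.exp (Complex.I * (-disp β lam n : ℝ) * t₀) * U t₀ n +
        ∑ j ∈ (Finset.Icc (-(M : ℤ)) M).filter (fun j => |n - j| ≤ (M : ℤ)),
          ∫ r in t₀..t, modeTerm β lam U n j r := by
      intro M
      rw [← intervalIntegral.integral_finsetSum fun j _ => hi j _ _, mul_sub, ← mul_assoc,
        ← Complex.exp_add, ← intervalIntegral.integral_const_mul, hU t₀ ht₀, sub_eq_add_neg,
        ← intervalIntegral.integral_neg]
      congr 1
      · congr 2; simp only [disp]; push_cast; ring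
      · apply intervalIntegral.integral_congr
        intro r hr
        have hr' : r ∈ Set.Icc (t₀ - 1) (t₀ + 1) := Set.uIcc_subset_Icc ht₀ ht hr
        simp only [truncatedSquare, ← Finset.sum_filter, modeTerm, ← Finset.mul_sum, hU r hr']
        have : Complex.exp (Complex.I * (-disp β lam n : ℝ) * r) =
          Complex.exp (Complex.I * (-disp β lam n : ℝ) * t) *
            Complex.exp (Complex.I * dispersion β lam (freq lam n) * (t - r)) := by
          rw [← Complex.exp_add]; congr 1; simp only [disp]; push_cast; ring
        rw [this, convConst]; push_cast; ring
    simp only [h3] at h2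
    have h4 := tendsto_nhds_unique (h2.sub_const
      (Complex.exp (Complex.I * (-disp β lam n : ℝ) * t₀) * U t₀ n)) (h1.congr fun M => by
        simp)
    rw [hU t ht]
    rw [h4]
    exact hsm.hasSum
  refine ⟨⟨_, _, hW, hS⟩, fun x hx y hy => ?_⟩
  have := (hbase y hy).sub (hbase x hx)
  simp only [sub_sub_sub_cancel_right] at this
  refine this.congr_fun fun j => ?_
  exact (intervalIntegral.integral_interval_sub_left (hi j _ _) (hi j _ _)).symm

/-- The sum of the dispersions of a tuple of frequencies. -/
noncomputable def phase (β lam : ℝ) {l : ℕ} (n : Fin l → ℤ) : ℝ := ∑ i, disp β lam (n i)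

lemma IsModeFamily.norm_prod_le {β lam T T' : ℝ} {b : ℤ → ℝ} {U : ℝ → PeriodicDistribution}
    (h : IsModeFamily β lam T T' b U) {l : ℕ} (n : Fin l → ℤ) (t : ℝ) :
    ‖∏ i, U t (n i)‖ ≤ ∏ i, b (n i) := by
  rw [norm_prod]
  exact Finset.prod_le_prod (fun i _ => norm_nonneg _) fun i _ => (h.wave (n i)).norm_le t

lemma IsModeFamily.norm_integral_prod_le {β lam T T' : ℝ} {b : ℤ → ℝ}
    {U : ℝ → PeriodicDistribution} (h : IsModeFamily β lam T T' b U) {l : ℕ} (n : Fin (l + 1) → ℤ)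
    {s t : ℝ} (hst : |t - s| ≤ 2) :
    ‖∫ r in s..t, ∏ i, U r (n i)‖ ≤ 24 * 2 ^ l * ((∏ i, b (n i)) / rbracket (phase β lam n)) := by
  refine ((IsWave.prod fun i => h.wave (n i)).norm_integral_le hst).trans (le_of_eq ?_)
  rw [phase]; ring

/-- The derivative of a product of Fourier coefficients. -/
lemma IsModeFamily.hasSum_prod {β lam T T' : ℝ} (hT : T' - T ≤ 2) {b : ℤ → ℝ}
    {U : ℝ → PeriodicDistribution} (h : IsModeFamily β lam T T' b U) {l : ℕ} (n : Fin (l + 1) → ℤ)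
    {s t : ℝ} (hs : s ∈ Set.Icc T T') (ht : t ∈ Set.Icc T T') :
    HasSum (fun x : Fin (l + 1) × ℤ => -(Complex.I * freq lam (n x.1) * convConst lam) *
        ∫ r in s..t, U r x.2 * U r (n x.1 - x.2) * ∏ i, if i = x.1 then 1 else U r (n i))
      (∏ i, U t (n i) - ∏ i, U s (n i) -
        Complex.I * phase β lam n * ∫ r in s..t, ∏ i, U r (n i)) := by
  have hw : ∀ i, IsWave (disp β lam (n i) + -disp β lam (n i)) (b (n i))
      (fun t => Complex.exp (Complex.I * (-disp β lam (n i) : ℝ) * t) * U t (n i)) := fun i =>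
    (h.wave (n i)).modulate _
  have h1 := HasWaveDeriv.prod hT hw fun i => h.deriv (n i)
  have h2 := h1.hasSum_phase hT (IsWave.prod hw).continuous (phase β lam n) hs ht
  -- The phases of the interaction picture multiply to `e^{-iΩr}` with `Ω` the total phase. Undoing
  -- them by `hasSum_phase` restores the product of the `U r (n i)` and creates the term with `iΩ`.
  have hE : ∀ r : ℝ, Complex.exp (Complex.I * phase β lam n * r) *
      ∏ i, Complex.exp (Complex.I * (-disp β lam (n i) : ℝ) * r) = 1 := by
    intro r
    rw [← Complex.exp_sum, ← Complex.exp_add, ← Finset.sum_mul, ← Finset.mul_sum, phase]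
    rw [Complex.exp_eq_one_iff.2 ⟨0, ?_⟩]
    push_cast
    rw [Finset.sum_neg_distrib]; ring
  have hP : ∀ r : ℝ, Complex.exp (Complex.I * phase β lam n * r) *
      ∏ i, Complex.exp (Complex.I * (-disp β lam (n i) : ℝ) * r) * U r (n i) = ∏ i, U r (n i) := by
    intro r
    rw [Finset.prod_mul_distrib, ← mul_assoc, hE, one_mul]
  simp only [hP] at h2
  refine h2.congr_fun fun x => ?_
  rw [← intervalIntegral.integral_const_mul]
  congr 1; ext r
  have hsplit : ∏ i, (if i = x.1 then 1 else
      Complex.exp (Complex.I * (-disp β lam (n i) : ℝ) * r) * U r (n i)) = (∏ i, (if i = x.1 then 1 else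
      Complex.exp (Complex.I * (-disp β lam (n i) : ℝ) * r))) *
      ∏ i, if i = x.1 then 1 else U r (n i) := by
    rw [← Finset.prod_mul_distrib]
    apply Finset.prod_congr rfl; intro i _; split_ifs <;> simp
  have hrest : ∏ i, Complex.exp (Complex.I * (-disp β lam (n i) : ℝ) * r) =
      Complex.exp (Complex.I * (-disp β lam (n x.1) : ℝ) * r) *
      ∏ i, (if i = x.1 then 1 else Complex.exp (Complex.I * (-disp β lam (n i) : ℝ) * r)) := by
    rw [← Finset.mul_prod_erase _ _ (Finset.mem_univ x.1)]
    congr 1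
    rw [← Finset.mul_prod_erase _ (fun i => if i = x.1 then _ else _) (Finset.mem_univ x.1)]
    simp only [if_true, one_mul]
    apply Finset.prod_congr rfl; intro i hi; rw [if_neg (Finset.ne_of_mem_erase hi)]
  have hEr := hE r
  rw [hrest] at hEr
  rw [hsplit, modeTerm]
  linear_combination (-(-(Complex.I * freq lam (n x.1) * convConst lam)) *
    (U r x.2 * U r (n x.1 - x.2)) * ∏ i, if i = x.1 then 1 else U r (n i)) * hEr

/-! ### Sums over the hyperplanes `n_1 + ⋯ + n_l = 0` in free coordinates -/

/-- The tuple with sum zero whose first entries are given. -/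
def complete {l : ℕ} (n : Fin l → ℤ) : Fin (l + 1) → ℤ := Fin.snoc n (-∑ i, n i)

lemma sum_complete {l : ℕ} (n : Fin l → ℤ) : ∑ i, complete n i = 0 := by
  simp [complete, Fin.sum_univ_castSucc]

lemma complete_init {l : ℕ} {m : Fin (l + 1) → ℤ} (h : ∑ i, m i = 0) :
    complete (Fin.init m) = m := by
  rw [Fin.sum_univ_castSucc] at h
  have : -∑ i, (Fin.init m : Fin l → ℤ) i = m (Fin.last l) := by
    simp only [Fin.init]; omega
  rw [complete, this, Fin.snoc_init_self]

lemma init_complete {l : ℕ} (n : Fin l → ℤ) : (Fin.init (complete n) : Fin l → ℤ) = n := by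
  simp [complete]

lemma sum_comp_perm {l : ℕ} (n : Fin l → ℤ) (σ : Equiv.Perm (Fin (l + 1))) :
    ∑ i, (complete n ∘ σ) i = 0 := by
  rw [← sum_complete n]; exact Equiv.sum_comp σ _

/-- The action of a permutation on the hyperplane, in free coordinates. -/
def permFree {l : ℕ} (σ : Equiv.Perm (Fin (l + 1))) : (Fin l → ℤ) ≃ (Fin l → ℤ) where
  toFun n := Fin.init (complete n ∘ σ)
  invFun n := Fin.init (complete n ∘ σ.symm)
  left_inv n := by
    beta_reduce; rw [complete_init (sum_comp_perm n σ), Function.comp_assoc]; simp [init_complete]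
  right_inv n := by
    beta_reduce; rw [complete_init (sum_comp_perm n σ.symm), Function.comp_assoc]; simp [init_complete]

lemma complete_permFree {l : ℕ} (σ : Equiv.Perm (Fin (l + 1))) (n : Fin l → ℤ) :
    complete (permFree σ n) = complete n ∘ σ := complete_init (sum_comp_perm n σ)

/-- Adding up the last two entries. -/
def merge {l : ℕ} (m : Fin (l + 2) → ℤ) : Fin (l + 1) → ℤ :=
  Fin.snoc (fun i : Fin l => m i.castSucc.castSucc) (m (Fin.last l).castSucc + m (Fin.last (l + 1)))

/-- Splitting the last frequency into `j` and the remainder stays on the hyperplane. This is the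
change of variables by which the nonlinearity in the last factor becomes a form with one more
argument. -/
lemma merge_complete_snoc {l : ℕ} (n : Fin l → ℤ) (j : ℤ) :
    merge (complete (Fin.snoc n j : Fin (l + 1) → ℤ)) = complete n := by
  simp [merge, complete, Fin.sum_univ_castSucc]

/-- Splitting off the last entry of a tuple. -/
def snocPair (l : ℕ) : (Fin l → ℤ) × ℤ ≃ (Fin (l + 1) → ℤ) where
  toFun x := Fin.snoc x.1 x.2
  invFun m := (Fin.init m, m (Fin.last l))
  left_inv x := by simp
  right_inv m := by simp

/-- The sum of the last two frequencies. -/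
noncomputable def lastFreq (lam : ℝ) {l : ℕ} (m : Fin (l + 2) → ℤ) : ℝ :=
  freq lam (m (Fin.last l).castSucc + m (Fin.last (l + 1)))

lemma phase_comp_perm (β lam : ℝ) {l : ℕ} (n : Fin l → ℤ) (σ : Equiv.Perm (Fin l)) :
    phase β lam (n ∘ σ) = phase β lam n := by
  simp only [phase, Function.comp_apply]
  exact Equiv.sum_comp σ fun i => disp β lam (n i)

/-- The majorant of the time integral of a product of Fourier coefficients. -/
noncomputable def weight (β lam : ℝ) (b : ℤ → ℝ) {l : ℕ} (n : Fin l → ℤ) : ℝ :=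
  (∏ i, b (n i)) / rbracket (phase β lam n)

lemma weight_comp_perm (β lam : ℝ) (b : ℤ → ℝ) {l : ℕ} (n : Fin l → ℤ) (σ : Equiv.Perm (Fin l)) :
    weight β lam b (n ∘ σ) = weight β lam b n := by
  simp only [weight, phase_comp_perm, Function.comp_apply]
  rw [Equiv.prod_comp σ fun i => b (n i)]

/-- The time integral of a product of Fourier coefficients. -/
noncomputable def modeIntegral (U : ℝ → PeriodicDistribution) (s t : ℝ) {l : ℕ} (n : Fin l → ℤ) : ℂ :=
  ∫ r in s..t, ∏ i, U r (n i)

lemma modeIntegral_comp_perm (U : ℝ → PeriodicDistribution) (s t : ℝ) {l : ℕ} (n : Fin l → ℤ)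
    (σ : Equiv.Perm (Fin l)) : modeIntegral U s t (n ∘ σ) = modeIntegral U s t n := by
  simp only [modeIntegral, Function.comp_apply]
  congr 1; ext r
  exact Equiv.prod_comp σ fun i => U r (n i)

lemma IsModeFamily.norm_modeIntegral_le {β lam T T' : ℝ} {b : ℤ → ℝ}
    {U : ℝ → PeriodicDistribution} (h : IsModeFamily β lam T T' b U) {l : ℕ} (n : Fin (l + 1) → ℤ)
    {s t : ℝ} (hst : |t - s| ≤ 2) :
    ‖modeIntegral U s t n‖ ≤ 24 * 2 ^ l * weight β lam b n := h.norm_integral_prod_le n hst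

lemma IsModeFamily.summable_mul_modeIntegral {β lam T T' : ℝ} {b : ℤ → ℝ}
    {U : ℝ → PeriodicDistribution} (h : IsModeFamily β lam T T' b U) {l : ℕ} {ι : Type}
    {X : ι → ℂ} {n : ι → Fin (l + 1) → ℤ} (hX : Summable fun i => ‖X i‖ * weight β lam b (n i))
    {s t : ℝ} (hst : |t - s| ≤ 2) :
    Summable fun i => X i * modeIntegral U s t (n i) := by
  refine Summable.of_norm_bounded (hX.mul_left (24 * 2 ^ l)) fun i => ?_
  rw [norm_mul]
  have := mul_le_mul_of_nonneg_left (h.norm_modeIntegral_le (n i) hst) (norm_nonneg (X i))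
  linarith

lemma IsModeFamily.summable_mul_prod {β lam T T' : ℝ} {b : ℤ → ℝ}
    {U : ℝ → PeriodicDistribution} (h : IsModeFamily β lam T T' b U) {l : ℕ} {ι : Type}
    {X : ι → ℂ} {n : ι → Fin l → ℤ} (hX : Summable fun i => ‖X i‖ * ∏ j, b (n i j)) (t : ℝ) :
    Summable fun i => X i * ∏ j, U t (n i j) := by
  refine Summable.of_norm_bounded hX fun i => ?_
  rw [norm_mul]
  exact mul_le_mul_of_nonneg_left (h.norm_prod_le _ _) (norm_nonneg _)

/-- The evolution of a multilinear form with symmetric multiplier. -/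
lemma IsModeFamily.tsum_sub_tsum {β lam T T' : ℝ} (hT : T' - T ≤ 2) {b : ℤ → ℝ}
    {U : ℝ → PeriodicDistribution} (h : IsModeFamily β lam T T' b U) {l : ℕ}
    {X : (Fin (l + 1) → ℤ) → ℂ} (hX : ∀ (σ : Equiv.Perm (Fin (l + 1))) m, X (m ∘ σ) = X m)
    (h1 : Summable fun n : Fin l → ℤ => ‖X (complete n)‖ * ∏ i, b (complete n i))
    (h2 : Summable fun n : Fin l → ℤ => ‖Complex.I * phase β lam (complete n) * X (complete n)‖ *
      weight β lam b (complete n))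
    (h3 : Summable fun n : Fin (l + 1) → ℤ => ‖X (merge (complete n)) * lastFreq lam (complete n)‖ *
      weight β lam b (complete n)) {s t : ℝ} (hs : s ∈ Set.Icc T T') (ht : t ∈ Set.Icc T T') :
    ∑' n : Fin l → ℤ, X (complete n) * ∏ i, U t (complete n i) -
      ∑' n : Fin l → ℤ, X (complete n) * ∏ i, U s (complete n i) =
      ∑' n : Fin l → ℤ, Complex.I * phase β lam (complete n) * X (complete n) *
        modeIntegral U s t (complete n) +
      (-(Complex.I * convConst lam) * (l + 1 : ℕ)) *
        ∑' n : Fin (l + 1) → ℤ, X (merge (complete n)) * lastFreq lam (complete n) *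
          modeIntegral U s t (complete n) := by
  have hst : |t - s| ≤ 2 := by rw [abs_le]; constructor <;> linarith [hs.1, hs.2, ht.1, ht.2]
  let Φ : Fin (l + 1) → (Fin l → ℤ) × ℤ → ℂ := fun i x =>
    X (complete x.1) * (-(Complex.I * freq lam (complete x.1 i) * convConst lam) *
      ∫ r in s..t, U r x.2 * U r (complete x.1 i - x.2) *
        ∏ i', if i' = i then 1 else U r (complete x.1 i'))
  let S : ℂ := ∑' n : Fin (l + 1) → ℤ, X (merge (complete n)) * lastFreq lam (complete n) *
    modeIntegral U s t (complete n)
  -- The derivative falling on the last factor: the pairs `(n, j)` are the free coordinates of the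
  -- next hyperplane, and `h3` provides summability.
  have hlast : HasSum (Φ (Fin.last l)) (-(Complex.I * convConst lam) * S) := by
    have hS := ((h.summable_mul_modeIntegral h3 hst).hasSum).mul_left (-(Complex.I * convConst lam))
    refine ((snocPair l).hasSum_iff.2 hS).congr_fun fun x => ?_
    simp only [Function.comp_apply, snocPair, Equiv.coe_fn_mk, merge_complete_snoc, Φ]
    have e1 : lastFreq lam (complete (Fin.snoc x.1 x.2 : Fin (l + 1) → ℤ)) =
        freq lam (complete x.1 (Fin.last l)) := by
      rw [← merge_complete_snoc x.1 x.2, lastFreq, merge, Fin.snoc_last]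
    have e2 : modeIntegral U s t (complete (Fin.snoc x.1 x.2 : Fin (l + 1) → ℤ)) =
        ∫ r in s..t, U r x.2 * U r (complete x.1 (Fin.last l) - x.2) *
        ∏ i', if i' = Fin.last l then 1 else U r (complete x.1 i') := by
      rw [modeIntegral]
      congr 1; ext r
      rw [Fin.prod_univ_castSucc, Fin.prod_univ_castSucc, Fin.prod_univ_castSucc (n := l)]
      simp [complete, Fin.sum_univ_castSucc, (Fin.castSucc_lt_last _).ne]
      rw [show -x.2 + -∑ i, x.1 i = -∑ i, x.1 i - x.2 by ring]
      ring
    rw [e1, e2]; ring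
  -- By symmetry of `X`, exchanging `i` with the last index reduces every other factor to the last
  -- one. This yields the factor `l + 1`.
  have hall : ∀ i, HasSum (Φ i) (-(Complex.I * convConst lam) * S) := by
    intro i
    let σ := Equiv.swap i (Fin.last l)
    refine (((permFree σ).prodCongr (Equiv.refl ℤ)).hasSum_iff.2 hlast).congr_fun fun x => ?_
    simp only [Function.comp_apply, Equiv.prodCongr_apply, Prod.map, Φ, complete_permFree, hX]
    have e0 : σ (Fin.last l) = i := Equiv.swap_apply_right _ _
    rw [e0]
    congr 2
    congr 1; ext r
    congr 1
    rw [← Equiv.prod_comp σ]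
    apply Finset.prod_congr rfl; intro i' _
    have : σ i' = i ↔ i' = Fin.last l := by
      rw [← e0]; exact σ.injective.eq_iff
    simp only [this]
  have htot : HasSum (fun x => ∑ i, Φ i x) ((l + 1 : ℕ) * (-(Complex.I * convConst lam) * S)) := by
    have := hasSum_sum fun i (_ : i ∈ Finset.univ) => hall i
    simpa using this
  -- For fixed `n` the sum over `j` is the increment of the product at `n`. Joint summability, known
  -- from `htot`, permits summation by fibres.
  have hfib : ∀ n : Fin l → ℤ, HasSum (fun j => ∑ i, Φ i (n, j))
      (X (complete n) * (∏ i, U t (complete n i) - ∏ i, U s (complete n i) -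
        Complex.I * phase β lam (complete n) * modeIntegral U s t (complete n))) := by
    intro n
    have := (h.hasSum_prod hT (complete n) hs ht).mul_left (X (complete n))
    have h4 := (Equiv.prodComm ℤ (Fin (l + 1))).hasSum_iff.2 this
    exact h4.prod_fiberwise fun j => hasSum_fintype _
  have hD := htot.prod_fiberwise hfib
  have hA := h.summable_mul_prod h1 t
  have hB := h.summable_mul_prod h1 s
  have hC := h.summable_mul_modeIntegral h2 hst
  have hfin := (hA.hasSum.sub hB.hasSum).sub hC.hasSum
  have heq := hD.unique (hfin.congr_fun fun n => by ring)
  linear_combination -heq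

lemma summable_symmetrize {l : ℕ} (lam : ℝ) {F : (Fin (l + 1) → ℝ) → ℂ}
    {w : (Fin (l + 1) → ℤ) → ℝ} (hw : ∀ (σ : Equiv.Perm (Fin (l + 1))) m, w (m ∘ σ) = w m)
    (hw0 : ∀ m, 0 ≤ w m)
    (h : Summable fun n : Fin l → ℤ => ‖F (fun i => freq lam (complete n i))‖ * w (complete n)) :
    Summable fun n : Fin l → ℤ => ‖symmetrize F (fun i => freq lam (complete n i))‖ *
      w (complete n) := by
  have h1 : ∀ σ : Equiv.Perm (Fin (l + 1)), Summable fun n : Fin l → ℤ =>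
      ‖F (fun i => freq lam (complete n (σ i)))‖ * w (complete n) := by
    intro σ
    refine ((permFree σ).summable_iff.2 h).congr fun n => ?_
    simp only [Function.comp_apply, complete_permFree]
    rw [hw]
  refine Summable.of_nonneg_of_le (fun n => mul_nonneg (norm_nonneg _) (hw0 _)) (fun n => ?_)
    ((summable_sum fun σ (_ : σ ∈ Finset.univ) => h1 σ).mul_left (((l + 1).factorial : ℝ))⁻¹)
  rw [← Finset.sum_mul, ← mul_assoc, symmetrize, norm_mul, norm_inv]
  simp only [Complex.norm_natCast]
  gcongr
  · exact hw0 _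
  · exact norm_sum_le _ _

/-- A multiplier may be symmetrized. -/
lemma tsum_symmetrize {l : ℕ} (lam : ℝ) {F : (Fin (l + 1) → ℝ) → ℂ}
    {V : (Fin (l + 1) → ℤ) → ℂ} (hV : ∀ (σ : Equiv.Perm (Fin (l + 1))) m, V (m ∘ σ) = V m)
    (h : Summable fun n : Fin l → ℤ => F (fun i => freq lam (complete n i)) * V (complete n)) :
    ∑' n : Fin l → ℤ, symmetrize F (fun i => freq lam (complete n i)) * V (complete n) =
      ∑' n : Fin l → ℤ, F (fun i => freq lam (complete n i)) * V (complete n) := by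
  have h1 : ∀ σ : Equiv.Perm (Fin (l + 1)), HasSum (fun n : Fin l → ℤ =>
      F (fun i => freq lam (complete n (σ i))) * V (complete n))
      (∑' n : Fin l → ℤ, F (fun i => freq lam (complete n i)) * V (complete n)) := by
    intro σ
    refine ((permFree σ).hasSum_iff.2 h.hasSum).congr_fun fun n => ?_
    simp only [Function.comp_apply, complete_permFree]
    rw [hV]
  have h2 := (hasSum_sum fun σ (_ : σ ∈ Finset.univ) => h1 σ).mul_left
    (((l + 1).factorial : ℂ))⁻¹
  have h3 : HasSum (fun n : Fin l → ℤ =>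
      symmetrize F (fun i => freq lam (complete n i)) * V (complete n)) _ :=
    h2.congr_fun fun n => by rw [symmetrize, ← Finset.sum_mul, mul_assoc]
  rw [h3.tsum_eq]
  simp only [Finset.sum_const, Finset.card_univ, Fintype.card_perm, Fintype.card_fin, nsmul_eq_mul]
  rw [← mul_assoc, inv_mul_cancel₀ (by exact_mod_cast Nat.factorial_ne_zero _), one_mul]

/-! ### Estimates for the symbols -/

/-- The function `k m(k)²`. -/
noncomputable def fluxSymbol (m : ℝ → ℝ) (x : ℝ) : ℝ := x * m x ^ 2

/-- What is needed of a symbol `m` at scale `N`: it is even, bounded by `1`, equal to `1` at low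
frequencies, and `k m(k)²` has a bounded derivative which varies at the scale `|k|`. -/
structure IsNice (N D : ℝ) (m : ℝ → ℝ) : Prop where
  one_le_scale : 1 ≤ N
  one_le : 1 ≤ D
  even : ∀ x, m (-x) = m x
  low : ∀ x, |x| ≤ N → m x = 1
  bdd : ∀ x, |m x| ≤ 1
  deriv : ∃ f' : ℝ → ℝ, Continuous f' ∧ (∀ x, HasDerivAt (fluxSymbol m) (f' x) x) ∧
    (∀ x, |f' x| ≤ D) ∧ ∀ R x y, 0 < R → R ≤ x → R ≤ y → |f' x - f' y| ≤ D * |x - y| / R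

section Symbol

variable {N D : ℝ} {m : ℝ → ℝ}

local notation "𝔣" => fluxSymbol m

lemma IsNice.sq_le_one (h : IsNice N D m) (x : ℝ) : m x ^ 2 ≤ 1 := by
  rw [← sq_abs]; exact pow_le_one₀ (abs_nonneg _) (h.bdd x)

lemma IsNice.flux_neg (h : IsNice N D m) (x : ℝ) : 𝔣 (-x) = -𝔣 x := by
  simp [fluxSymbol, h.even]

lemma IsNice.flux_low (h : IsNice N D m) {x : ℝ} (hx : |x| ≤ N) : 𝔣 x = x := by
  simp [fluxSymbol, h.low x hx]

lemma IsNice.abs_flux_le (h : IsNice N D m) (x : ℝ) : |𝔣 x| ≤ |x| := by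
  rw [fluxSymbol, abs_mul, abs_of_nonneg (sq_nonneg (m x))]
  exact mul_le_of_le_one_right (abs_nonneg _) (h.sq_le_one x)

lemma IsNice.flux_lip (h : IsNice N D m) (x y : ℝ) : |𝔣 x - 𝔣 y| ≤ D * |x - y| := by
  obtain ⟨f', -, h1, h2, -⟩ := h.deriv
  have := Convex.norm_image_sub_le_of_norm_hasDerivWithin_le (s := Set.univ)
    (fun z _ => (h1 z).hasDerivWithinAt) (fun z _ => h2 z) convex_univ (Set.mem_univ y)
    (Set.mem_univ x)
  simpa [Real.norm_eq_abs] using this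

/-- The second difference of `k m(k)²`. -/
lemma IsNice.flux_second_diff (h : IsNice N D m) {n a b : ℝ} (hn : 0 < n) (ha : |a| ≤ n / 4)
    (hb : |b| ≤ n / 4) : |𝔣 n - 𝔣 (n - a) - 𝔣 (n - b) + 𝔣 (n - a - b)| ≤ 2 * D * |a| * |b| / n := by
  obtain ⟨f', -, h1, -, h3⟩ := h.deriv
  have ha' := abs_le.1 ha
  have hb' := abs_le.1 hb
  have hseg : ∀ z ∈ Set.uIcc (n - b) n, 3 * n / 4 ≤ z := by
    intro z hz
    have := hz.1
    have h5 : 3 * n / 4 ≤ min (n - b) n := le_min (by linarith) (by linarith)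
    exact h5.trans hz.1
  -- Mean value inequality for `z ↦ 𝔣 z - 𝔣 (z - a)`. On the segment both `z` and `z - a` are at
  -- least `n / 2`, the scale at which the variation of `f'` is measured.
  have key := Convex.norm_image_sub_le_of_norm_hasDerivWithin_le (s := Set.uIcc (n - b) n)
    (f := fun z => 𝔣 z - 𝔣 (z - a)) (f' := fun z => f' z - f' (z - a))
    (C := D * |a| / (n / 2)) (x := n - b) (y := n)
    (fun z _ => ?_) (fun z hz => ?_) (convex_uIcc _ _) Set.left_mem_uIcc Set.right_mem_uIcc
  · simp only [Real.norm_eq_abs, sub_sub_cancel] at key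
    rw [show 𝔣 n - 𝔣 (n - a) - 𝔣 (n - b) + 𝔣 (n - a - b) =
      𝔣 n - 𝔣 (n - a) - (𝔣 (n - b) - 𝔣 (n - b - a)) by
        rw [show n - b - a = n - a - b by ring]; ring]
    refine key.trans (le_of_eq ?_)
    field_simp
  · have := (h1 (z - a)).comp z ((hasDerivAt_id z).sub_const a)
    simp only [mul_one] at this
    exact ((h1 z).sub this).hasDerivWithinAt
  · have hz' := hseg z hz
    have := h3 (n / 2) z (z - a) (by linarith) (by linarith) (by linarith)
    simpa using this

/-- The difference quotient of `k m(k)²` at large frequencies. -/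
lemma IsNice.flux_quotient (h : IsNice N D m) {z a b : ℝ} (hz : 0 < z) (ha : |a| ≤ z / 4)
    (hb : |b| ≤ z / 4) (ha0 : a ≠ 0) (hb0 : b ≠ 0) :
    |(𝔣 z - 𝔣 (z - a)) / a - (𝔣 z - 𝔣 (z - b)) / b| ≤ 2 * D * |a - b| / z := by
  obtain ⟨f', hc, h1, -, h3⟩ := h.deriv
  -- The difference quotient is the average of `f'` over the segment, and the two averages are
  -- compared at equal `θ`.
  have hrep : ∀ a ≠ 0, (𝔣 z - 𝔣 (z - a)) / a = ∫ θ in (0 : ℝ)..1, f' (z - a * θ) := by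
    intro a ha0
    have := intervalIntegral.integral_comp_sub_mul (a := 0) (b := 1) f' ha0 z
    rw [this, intervalIntegral.integral_eq_sub_of_hasDerivAt (fun x _ => h1 x)
      (hc.intervalIntegrable _ _)]
    simp only [mul_one, mul_zero, sub_zero, smul_eq_mul]
    ring
  rw [hrep a ha0, hrep b hb0, ← intervalIntegral.integral_sub
    (Continuous.intervalIntegrable (by fun_prop) _ _)
    (Continuous.intervalIntegrable (by fun_prop) _ _)]
  have := intervalIntegral.norm_integral_le_of_norm_le_const (a := (0 : ℝ)) (b := 1)
    (f := fun θ => f' (z - a * θ) - f' (z - b * θ)) (C := 2 * D * |a - b| / z) ?_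
  · simpa using this
  intro θ hθ
  rw [Set.uIoc_of_le zero_le_one] at hθ
  have hθ1 : |θ| ≤ 1 := by rw [abs_of_pos hθ.1]; exact hθ.2
  have e1 : ∀ a, |a| ≤ z / 4 → z / 2 ≤ z - a * θ := by
    intro a ha
    have : |a * θ| ≤ z / 4 := by
      rw [abs_mul]; nlinarith [abs_nonneg a, abs_nonneg θ]
    linarith [le_abs_self (a * θ)]
  have := h3 (z / 2) _ _ (by linarith) (e1 a ha) (e1 b hb)
  rw [Real.norm_eq_abs]
  refine this.trans ?_
  have e2 : |z - a * θ - (z - b * θ)| ≤ |a - b| := by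
    rw [show z - a * θ - (z - b * θ) = (b - a) * θ by ring, abs_mul, abs_sub_comm]
    exact mul_le_of_le_one_right (abs_nonneg _) hθ1
  have hD := h.one_le
  calc D * |z - a * θ - (z - b * θ)| / (z / 2) ≤ D * |a - b| / (z / 2) := by gcongr
    _ = _ := by field_simp

/-- Regularity of `m²` is recovered from that of `𝔣` by `x (m(x)² - m(y)²) = (𝔣 x - 𝔣 y) - (x - y)
m(y)²`. -/
lemma IsNice.sq_lip (h : IsNice N D m) {R x y : ℝ} (hR : 0 < R) (hx : R ≤ x) (_ : R ≤ y) :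
    |m x ^ 2 - m y ^ 2| ≤ (D + 1) * |x - y| / R := by
  have hx0 : 0 < x := hR.trans_le hx
  have h1 := h.flux_lip x y
  have h2 : x * (m x ^ 2 - m y ^ 2) = (𝔣 x - 𝔣 y) - (x - y) * m y ^ 2 := by
    simp only [fluxSymbol]; ring
  have h3 : x * |m x ^ 2 - m y ^ 2| ≤ (D + 1) * |x - y| := by
    rw [← abs_of_pos hx0, ← abs_mul, abs_of_pos hx0, h2]
    refine (abs_sub _ _).trans ?_
    rw [abs_mul, abs_of_nonneg (sq_nonneg (m y))]
    nlinarith [h.sq_le_one y, abs_nonneg (x - y)]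
  rw [le_div_iff₀ hR]
  nlinarith [abs_nonneg (m x ^ 2 - m y ^ 2)]

/-- `m²` at two nearly opposite frequencies. -/
lemma IsNice.sq_sub_sq_le (h : IsNice N D m) {x y : ℝ} (hxy : |y| ≤ |x|) :
    |m x ^ 2 - m y ^ 2| ≤ 2 * (D + 1) * |x + y| / max N |x| := by
  have hN := h.one_le_scale
  have hD := h.one_le
  rcases le_or_gt |x| N with hx | hx
  · rw [h.low x hx, h.low y (hxy.trans hx)]
    simp only [sub_self, abs_zero]; positivity
  rw [max_eq_right hx.le]
  have hx0 : 0 < |x| := by linarith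
  have habs : ∀ x, m x = m |x| := by
    intro x; rcases abs_cases x with ⟨h1, -⟩ | ⟨h1, -⟩ <;> rw [h1]; rw [h.even]
  have htri : |x| - |y| ≤ |x + y| := by
    have := abs_sub_abs_le_abs_sub x (-y); rwa [abs_neg, sub_neg_eq_add] at this
  -- For comparable `|x|`, `|y|` the Lipschitz bound at scale `|x| / 2` applies; otherwise `|x + y|
  -- ≥ |x| / 2` and the trivial bound `1` suffices.
  rcases le_or_gt (|x| / 2) |y| with hy | _
  · rw [habs x, habs y]
    refine (h.sq_lip (R := |x| / 2) (by linarith) (by linarith) hy).trans ?_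
    rw [abs_of_nonneg (sub_nonneg.2 hxy)]
    calc (D + 1) * (|x| - |y|) / (|x| / 2) ≤ (D + 1) * |x + y| / (|x| / 2) := by gcongr
      _ = _ := by field_simp
  · rw [le_div_iff₀ hx0]
    have : |m x ^ 2 - m y ^ 2| ≤ 1 := by
      rw [abs_le]; constructor <;> nlinarith [h.sq_le_one x, h.sq_le_one y, sq_nonneg (m x), sq_nonneg (m y)]
    nlinarith [abs_nonneg (x + y)]

/-! ### Pair contributions and their cancellations -/

/-- The quadratic factor of the resonance function. -/
noncomputable def quadFactor (c a b : ℝ) : ℝ := 5 * (a ^ 2 + a * b + b ^ 2) + c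

/-- The pair contributions to `M_4`. -/
noncomputable def pairSymbol (c : ℝ) (m : ℝ → ℝ) (a b : ℝ) : ℝ :=
  (fluxSymbol m a + fluxSymbol m b - fluxSymbol m (a + b)) / (a * b * quadFactor c a b)

/-- With `c = 3 β lam⁻²` and `δ = lam⁻¹`, the lower order term is absorbed by the leading one
because nonzero frequencies have size at least `lam⁻¹`. -/
lemma quadFactor_ge {c δ a b : ℝ} (hc : |c| ≤ 3 * δ ^ 2) (hδ : 0 < δ) (ha : δ ≤ |a|)
    (hb : δ ≤ |b|) : a ^ 2 + b ^ 2 ≤ quadFactor c a b := by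
  have h1 : δ ^ 2 ≤ a ^ 2 := by rw [← sq_abs a]; gcongr
  have h2 : δ ^ 2 ≤ b ^ 2 := by rw [← sq_abs b]; gcongr
  have := (abs_le.1 hc).1
  rw [quadFactor]; nlinarith [sq_nonneg (a + b)]

/-- The numerator vanishes at `b = 0`, and `𝔣` is Lipschitz. -/
lemma IsNice.pair_num_le (h : IsNice N D m) (a b : ℝ) :
    |𝔣 a + 𝔣 b - 𝔣 (a + b)| ≤ (D + 1) * |b| := by
  have h1 := h.flux_lip a (a + b)
  have h2 := h.abs_flux_le b
  rw [show 𝔣 a + 𝔣 b - 𝔣 (a + b) = (𝔣 a - 𝔣 (a + b)) + 𝔣 b by ring]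
  refine (abs_add_le _ _).trans ?_
  rw [show a - (a + b) = -b by ring, abs_neg] at h1
  linarith

/-- By oddness of `𝔣` the numerator also vanishes at `a + b = 0`; this is the useful form when the
two frequencies nearly cancel. -/
lemma IsNice.pair_num_le_sum (h : IsNice N D m) (a b : ℝ) :
    |𝔣 a + 𝔣 b - 𝔣 (a + b)| ≤ (D + 1) * |a + b| := by
  have h1 := h.flux_lip a (-b)
  have h2 := h.abs_flux_le (a + b)
  rw [h.flux_neg, sub_neg_eq_add, sub_neg_eq_add] at h1
  refine (abs_sub _ _).trans ?_
  linarith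

lemma pairSymbol_comm (c : ℝ) (m : ℝ → ℝ) (a b : ℝ) : pairSymbol c m a b = pairSymbol c m b a := by
  simp only [pairSymbol, quadFactor, add_comm a b]; ring_nf

lemma IsNice.pairSymbol_neg (h : IsNice N D m) (c a b : ℝ) :
    pairSymbol c m (-a) (-b) = -pairSymbol c m a b := by
  have : -a + -b = -(a + b) := by ring
  simp only [pairSymbol, quadFactor, this, h.flux_neg]
  rw [neg_div']
  congr 1 <;> ring

/-- `𝔣` is the identity below `N`, hence additive there. This is why every later bound involves `max
N |k|` rather than `|k|`. -/
lemma IsNice.pairSymbol_low (h : IsNice N D m) (c : ℝ) {a b : ℝ} (ha : |a| ≤ N / 2)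
    (hb : |b| ≤ N / 2) : pairSymbol c m a b = 0 := by
  have hN := h.one_le_scale
  rw [pairSymbol, h.flux_low (by linarith), h.flux_low (by linarith), h.flux_low]
  · simp
  · linarith [abs_add_le a b]

variable {c δ : ℝ}

lemma abs_pairSymbol_le (hc : |c| ≤ 3 * δ ^ 2) (hδ : 0 < δ) {a b X : ℝ} (ha : δ ≤ |a|)
    (hb : δ ≤ |b|) (hX : |𝔣 a + 𝔣 b - 𝔣 (a + b)| ≤ X) :
    |pairSymbol c m a b| ≤ X / (|a| * |b| * (a ^ 2 + b ^ 2)) := by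
  have hQ := quadFactor_ge hc hδ ha hb
  have ha0 : 0 < |a| := hδ.trans_le ha
  have hb0 : 0 < |b| := hδ.trans_le hb
  have : 0 < a ^ 2 + b ^ 2 := by rw [← sq_abs a]; positivity
  rw [pairSymbol, abs_div, abs_mul, abs_mul, abs_of_pos (this.trans_le hQ)]
  have hX0 : 0 ≤ X := (abs_nonneg _).trans hX
  gcongr

lemma IsNice.abs_pairSymbol_le_cube (h : IsNice N D m) (hc : |c| ≤ 3 * δ ^ 2) (hδ : 0 < δ)
    {a b r : ℝ} (ha : δ ≤ |a|) (hb : δ ≤ |b|) (hr : 0 < r) (hra : r ≤ |a|) :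
    |pairSymbol c m a b| ≤ (D + 1) / r ^ 3 := by
  refine (abs_pairSymbol_le hc hδ ha hb (h.pair_num_le a b)).trans ?_
  have hb0 : 0 < |b| := hδ.trans_le hb
  have hD := h.one_le
  rw [div_le_div_iff₀ (by rw [← sq_abs a]; have := hr.trans_le hra; positivity) (by positivity)]
  have h1 : r ^ 2 ≤ a ^ 2 + b ^ 2 := by rw [← sq_abs a]; nlinarith [sq_nonneg b]
  have h2 : r ^ 3 ≤ |a| * (a ^ 2 + b ^ 2) := by
    calc r ^ 3 = r * r ^ 2 := by ring
      _ ≤ _ := by gcongr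
  calc (D + 1) * |b| * r ^ 3 ≤ (D + 1) * |b| * (|a| * (a ^ 2 + b ^ 2)) := by gcongr
    _ = _ := by ring

/-- The polynomial is the quotient by `x + y` of the difference of the two denominators in
`abs_pairSymbol_add_le`, after `n + x` has been singled out as a variable. -/
lemma abs_cubic_le {n x y c : ℝ} (hn : 0 < n) (hx : |x| ≤ n / 8) (hy : |y| ≤ n / 8)
    (hc : |c| ≤ 3 * n ^ 2 / 64) :
    |5 * (2 * (n + x) ^ 2 - 2 * (n + x) * (x - y) + (x ^ 2 - x * y + y ^ 2)) + c| ≤ 20 * n ^ 2 := by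
  have hcc := abs_le.1 hc
  have hx' := abs_le.1 hx
  have hy' := abs_le.1 hy
  have hx2 : x ^ 2 ≤ (n / 8) ^ 2 := sq_le_sq' hx'.1 hx'.2
  have hy2 : y ^ 2 ≤ (n / 8) ^ 2 := sq_le_sq' hy'.1 hy'.2
  have hz0 : 0 < n + x := by linarith
  have hz2 : (n + x) ^ 2 ≤ (9 * n / 8) ^ 2 := by gcongr; linarith
  have hxy : |(n + x) * (x - y)| ≤ 9 * n / 8 * (n / 4) := by
    rw [abs_mul, abs_of_pos hz0]
    gcongr
    · linarith
    · exact (abs_sub _ _).trans (by linarith)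
  have hxy' := abs_le.1 hxy
  have hq1 : x ^ 2 - x * y + y ^ 2 ≤ 3 / 2 * (x ^ 2 + y ^ 2) := by nlinarith only [sq_nonneg (x + y)]
  have hq2 : 0 ≤ x ^ 2 - x * y + y ^ 2 := by nlinarith only [sq_nonneg (x - y), sq_nonneg (x + y)]
  have hz3 := sq_nonneg (n + x)
  have hn2 := sq_nonneg n
  generalize x ^ 2 - x * y + y ^ 2 = q at *
  rw [show 2 * (n + x) * (x - y) = 2 * ((n + x) * (x - y)) by ring]
  generalize (n + x) * (x - y) = v at *
  generalize (n + x) ^ 2 = w at *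
  rw [abs_le]
  constructor <;> linarith only [hcc.1, hcc.2, hxy'.1, hxy'.2, hq1, hq2, hz3, hn2, hx2, hy2, hz2]

set_option maxHeartbeats 1000000 in
/-- The cancellation between the pairs `(n, x)` and `(n', y)`, where `n + x + n' + y = 0` and `x`,
`y` are small. -/
lemma IsNice.abs_pairSymbol_add_le (h : IsNice N D m) (hc : |c| ≤ 3 * δ ^ 2) (hδ : 0 < δ)
    {n x y Y : ℝ} (hn : 0 < n) (hx : δ ≤ |x|) (hy : δ ≤ |y|) (hxn : |x| ≤ n / 8) (hyn : |y| ≤ n / 8)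
    (hY : |m x ^ 2 - m y ^ 2| ≤ Y) :
    |pairSymbol c m n x + pairSymbol c m (-(n + x + y)) y| ≤
      (Y + 60 * (D + 1) * |x + y| / n) / n ^ 3 := by
  have hD := h.one_le
  have hx' := abs_le.1 hxn
  have hy' := abs_le.1 hyn
  have hx0 : x ≠ 0 := by rintro rfl; simp at hx; linarith
  have hy0 : y ≠ 0 := by rintro rfl; simp at hy; linarith
  set z := n + x with hz
  have hzn : 7 * n / 8 ≤ z := by linarith
  have hzn' : z ≤ 9 * n / 8 := by linarith
  have hz0 : 0 < z := by linarith
  set u' := z + y with hu'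
  have hu'n : 3 * n / 4 ≤ u' := by linarith
  have hu'0 : 0 < u' := by linarith
  have hQ1 := quadFactor_ge (a := n) hc hδ (by rw [abs_of_pos hn]; linarith) hx
  have hQ2 := quadFactor_ge (a := u') (b := -y) hc hδ (by rw [abs_of_pos hu'0]; linarith)
    (by rwa [abs_neg])
  set Q1 := quadFactor c n x
  set Q2 := quadFactor c u' (-y)
  have hQ1n : n ^ 2 ≤ Q1 := by nlinarith [sq_nonneg x]
  have hQ2n : n ^ 2 / 2 ≤ Q2 := by nlinarith [sq_nonneg y]
  have hQ1p : 0 < Q1 := by nlinarith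
  have hQ2p : 0 < Q2 := by nlinarith
  -- Both pairs are expressed by difference quotients of `𝔣` at the common point `z = n + x`, with
  -- increments `x` and `-y`. Thus `g - g'` consists of a difference of values of `m²` and a
  -- difference of such quotients, both small when `x + y` is.
  let g := m x ^ 2 - (𝔣 z - 𝔣 (z - x)) / x
  let g' := m y ^ 2 - (𝔣 z - 𝔣 (z - -y)) / (-y)
  have e1 : pairSymbol c m n x = g / (n * Q1) := by
    have : 𝔣 x = x * m x ^ 2 := rfl
    have h1 : pairSymbol c m n x = (𝔣 n + 𝔣 x - 𝔣 z) / (n * x * Q1) := rfl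
    rw [h1, this]
    simp only [g]
    rw [show z - x = n by rw [hz]; ring]
    rw [div_eq_div_iff (by positivity) (by positivity)]
    field_simp
    ring
  have e2 : pairSymbol c m (-(z + y)) y = -(g' / (u' * Q2)) := by
    have h0 := h.pairSymbol_neg c u' (-y)
    rw [neg_neg] at h0
    rw [h0]
    have : 𝔣 (-y) = -(y * m y ^ 2) := by rw [h.flux_neg]; rfl
    have h1 : pairSymbol c m u' (-y) = (𝔣 u' + 𝔣 (-y) - 𝔣 (u' + -y)) / (u' * -y * Q2) := rfl
    rw [h1, this]
    simp only [g']
    rw [show u' + -y = z by rw [hu']; ring, show z - -y = u' by rw [hu']; ring]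
    congr 1
    rw [div_eq_div_iff (mul_ne_zero (mul_ne_zero hu'0.ne' (neg_ne_zero.2 hy0)) hQ2p.ne')
      (mul_pos hu'0 hQ2p).ne']
    field_simp
    ring
  have hg' : |g'| ≤ D + 1 := by
    have h1 := h.flux_lip z (z - -y)
    refine (abs_sub _ _).trans ?_
    rw [abs_div, abs_of_nonneg (sq_nonneg (m y))]
    have : |𝔣 z - 𝔣 (z - -y)| / |-y| ≤ D := by
      rw [div_le_iff₀ (by simpa using hy0)]; simpa using h1
    linarith [h.sq_le_one y]
  have hgg : |g - g'| ≤ Y + 2 * D * |x + y| / z := by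
    have h1 := h.flux_quotient hz0 (a := x) (b := -y) (by linarith) (by rw [abs_neg]; linarith)
      hx0 (by simpa using hy0)
    rw [sub_neg_eq_add x y] at h1
    rw [show g - g' = (m x ^ 2 - m y ^ 2) -
      ((𝔣 z - 𝔣 (z - x)) / x - (𝔣 z - 𝔣 (z - -y)) / (-y)) by simp only [g, g']; ring]
    exact (abs_sub _ _).trans (add_le_add hY h1)
  have hY0 : 0 ≤ Y := (abs_nonneg _).trans hY
  have hc' : |c| ≤ 3 * n ^ 2 / 64 := by
    refine hc.trans ?_
    have : δ ≤ n / 8 := hx.trans hxn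
    nlinarith
  have hdiff : |u' * Q2 - n * Q1| ≤ 20 * |x + y| * n ^ 2 := by
    have : u' * Q2 - n * Q1 = (x + y) * (5 * (2 * z ^ 2 - 2 * z * (x - y) + (x ^ 2 - x * y + y ^ 2)) + c) := by
      simp only [Q1, Q2, quadFactor, hu', hz]; ring
    rw [this, abs_mul]
    have h1 := mul_le_mul_of_nonneg_left (abs_cubic_le hn hxn hyn hc') (abs_nonneg (x + y))
    rw [hz]
    linarith
  rw [e1, e2]
  -- The first summand carries the difference of the numerators, the second that of the
  -- denominators; each is proportional to `x + y` up to `Y`.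
  have e3 : g / (n * Q1) + -(g' / (u' * Q2)) = (g - g') / (n * Q1) +
      g' * (u' * Q2 - n * Q1) / (n * Q1 * (u' * Q2)) := by
    field_simp; ring
  rw [e3]
  have hn3 : n ^ 3 ≤ n * Q1 := by nlinarith
  have hn3' : n ^ 3 * (3 / 8) ≤ u' * Q2 := by
    calc n ^ 3 * (3 / 8) = (3 * n / 4) * (n ^ 2 / 2) := by ring
      _ ≤ _ := by gcongr
  have t1 : |(g - g') / (n * Q1)| ≤ (Y + 2 * D * |x + y| / (7 * n / 8)) / n ^ 3 := by
    rw [abs_div, abs_of_pos (by positivity : 0 < n * Q1)]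
    have : Y + 2 * D * |x + y| / z ≤ Y + 2 * D * |x + y| / (7 * n / 8) := by gcongr
    gcongr
    exact hgg.trans this
  have t2 : |g' * (u' * Q2 - n * Q1) / (n * Q1 * (u' * Q2))| ≤
      (D + 1) * (20 * |x + y| * n ^ 2) / (n ^ 3 * (n ^ 3 * (3 / 8))) := by
    rw [abs_div, abs_mul, abs_of_pos (by positivity : 0 < n * Q1 * (u' * Q2))]
    gcongr
  refine (abs_add_le _ _).trans ((add_le_add t1 t2).trans ?_)
  have : (D + 1) * (20 * |x + y| * n ^ 2) / (n ^ 3 * (n ^ 3 * (3 / 8))) =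
      (160 / 3 * (D + 1) * |x + y| / n) / n ^ 3 := by field_simp; ring
  rw [this, ← add_div]
  refine div_le_div_of_nonneg_right ?_ (by positivity)
  rw [show 2 * D * |x + y| / (7 * n / 8) = 16 / 7 * D * |x + y| / n by field_simp; ring, add_assoc,
    ← add_div]
  refine add_le_add le_rfl (div_le_div_of_nonneg_right ?_ hn.le)
  nlinarith [abs_nonneg (x + y)]

end Symbol

/-! ### Pointwise bounds for the quartic and cubic multipliers -/

section Symbol

variable {N D c δ : ℝ} {m : ℝ → ℝ}

local notation "𝔣" => fluxSymbol m

/-- The frequencies are `n`, `p - n`, `q - n`, `r - n`, and `p`, `q`, `r` are the three pair sums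
with `n`. If `q ≤ n / 4`, then `n - r = -(n - p - q)` exhibits a second difference with increments
`p` and `q`, while `r` is comparable to `n`. Otherwise `q` and `r` are both comparable to `n`, and
the Lipschitz bound for two increments `p` is enough. -/
lemma IsNice.flux_four_le_aux (h : IsNice N D m) {n p q r : ℝ} (hn : 0 < n) (hp : 0 ≤ p)
    (hpq : p ≤ q) (hqr : q ≤ r) (hs : p + q + r = 2 * n) :
    |𝔣 n - 𝔣 (n - p) - 𝔣 (n - q) - 𝔣 (n - r)| ≤ 12 * D * (p * q * r) / n ^ 2 := by
  have hD := h.one_le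
  have e : 𝔣 (n - r) = -𝔣 (n - p - q) := by rw [← h.flux_neg]; congr 1; linarith
  have hr : 2 * n / 3 ≤ r := by linarith
  rcases le_or_gt q (n / 4) with hq | hq
  · have h1 := h.flux_second_diff hn (a := p) (b := q) (by rw [abs_of_nonneg hp]; linarith)
      (by rw [abs_of_nonneg (hp.trans hpq)]; linarith)
    rw [e, sub_neg_eq_add]
    refine h1.trans ?_
    rw [abs_of_nonneg hp, abs_of_nonneg (hp.trans hpq), div_le_div_iff₀ hn (by positivity)]
    have : 0 ≤ D * p * q := by have := hp.trans hpq; positivity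
    calc 2 * D * p * q * n ^ 2 = D * p * q * n * (2 * n) := by ring
      _ ≤ D * p * q * n * (12 * r) :=
        mul_le_mul_of_nonneg_left (by linarith) (mul_nonneg this hn.le)
      _ = _ := by ring
  · have h1 := h.flux_lip n (n - p)
    have h2 := h.flux_lip (n - q) (n - p - q)
    rw [show n - (n - p) = p by ring, abs_of_nonneg hp] at h1
    rw [show n - q - (n - p - q) = p by ring, abs_of_nonneg hp] at h2
    rw [e, show 𝔣 n - 𝔣 (n - p) - 𝔣 (n - q) - -𝔣 (n - p - q) =
      (𝔣 n - 𝔣 (n - p)) - (𝔣 (n - q) - 𝔣 (n - p - q)) by ring]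
    refine (abs_sub _ _).trans ((add_le_add h1 h2).trans ?_)
    rw [le_div_iff₀ (by positivity)]
    have : n ^ 2 ≤ 6 * (q * r) := by nlinarith
    calc (D * p + D * p) * n ^ 2 = 2 * (D * p) * n ^ 2 := by ring
      _ ≤ 2 * (D * p) * (6 * (q * r)) := by gcongr
      _ = _ := by ring

/-- The sum of `k m(k)²` over four frequencies with sum zero. -/
lemma IsNice.flux_four_le (h : IsNice N D m) {n p q r : ℝ} (hn : 0 < n) (hp : 0 ≤ p)
    (hq : 0 ≤ q) (hr : 0 ≤ r) (hs : p + q + r = 2 * n) :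
    |𝔣 n - 𝔣 (n - p) - 𝔣 (n - q) - 𝔣 (n - r)| ≤ 12 * D * (p * q * r) / n ^ 2 := by
  wlog hpq : p ≤ q generalizing p q
  · rw [show 𝔣 n - 𝔣 (n - p) - 𝔣 (n - q) - 𝔣 (n - r) =
      𝔣 n - 𝔣 (n - q) - 𝔣 (n - p) - 𝔣 (n - r) by ring, mul_comm p q]
    exact this hq hp (by linarith) (le_of_not_ge hpq)
  rcases le_total q r with h1 | h1
  · exact h.flux_four_le_aux hn hp hpq h1 hs
  rw [show 𝔣 n - 𝔣 (n - p) - 𝔣 (n - q) - 𝔣 (n - r) =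
      𝔣 n - 𝔣 (n - p) - 𝔣 (n - r) - 𝔣 (n - q) by ring]
  rcases le_total p r with h2 | h2
  · rw [show p * q * r = p * r * q by ring]
    exact h.flux_four_le_aux hn hp h2 h1 (by linarith)
  · rw [show 𝔣 n - 𝔣 (n - p) - 𝔣 (n - r) - 𝔣 (n - q) =
      𝔣 n - 𝔣 (n - r) - 𝔣 (n - p) - 𝔣 (n - q) by ring, show p * q * r = r * p * q by ring]
    exact h.flux_four_le_aux hn hr h2 hpq (by linarith)

/-- The sum of two opposite pair contributions at comparable frequencies. -/
lemma IsNice.abs_pairSymbol_add_le_of_comparable (h : IsNice N D m) (hc : |c| ≤ 3 * δ ^ 2)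
    (hδ : 0 < δ) {n a b x y : ℝ} (hs : a + b + x + y = 0) (hδn : δ ≤ n)
    (ha : n / 16 ≤ |a|) (hb : n / 16 ≤ |b|) (hx : n / 16 ≤ |x|) (hy : n / 16 ≤ |y|)
    (hδa : δ ≤ |a|) (hδb : δ ≤ |b|) (hδx : δ ≤ |x|) (hδy : δ ≤ |y|)
    (ha' : |a| ≤ n) (hb' : |b| ≤ n) (hx' : |x| ≤ n) (hy' : |y| ≤ n)
    (hF : |𝔣 a + 𝔣 b + 𝔣 x + 𝔣 y| ≤ 12 * D * |(a + b) * (a + x) * (a + y)| / n ^ 2) :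
    |pairSymbol c m a x + pairSymbol c m b y| ≤
      2 ^ 36 * (D + 1) * |(a + b) * (a + x) * (a + y)| / n ^ 6 := by
  have hD := h.one_le
  have hn : 0 < n := hδ.trans_le hδn
  set V := |(a + b) * (a + x) * (a + y)| with hV
  have hV0 : 0 ≤ V := abs_nonneg _
  set QA := quadFactor c a x with hQA
  set QB := quadFactor c b y with hQB
  have hA : n ^ 2 / 256 ≤ |a * x| := by
    rw [abs_mul]
    calc n ^ 2 / 256 = n / 16 * (n / 16) := by ring
      _ ≤ _ := by gcongr
  have hB : n ^ 2 / 256 ≤ |b * y| := by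
    rw [abs_mul]
    calc n ^ 2 / 256 = n / 16 * (n / 16) := by ring
      _ ≤ _ := by gcongr
  have hsq : ∀ z : ℝ, n / 16 ≤ |z| → n ^ 2 / 256 ≤ z ^ 2 := by
    intro z hz
    rw [← sq_abs z]
    calc n ^ 2 / 256 = (n / 16) ^ 2 := by ring
      _ ≤ _ := by gcongr
  have hQA1 : n ^ 2 / 128 ≤ QA := by
    have := quadFactor_ge (a := a) (b := x) hc hδ hδa hδx
    linarith [hsq a ha, hsq x hx]
  have hQB1 : n ^ 2 / 128 ≤ QB := by
    have := quadFactor_ge (a := b) (b := y) hc hδ hδb hδy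
    linarith [hsq b hb, hsq y hy]
  have hQA0 : 0 < QA := lt_of_lt_of_le (by positivity) hQA1
  have hQB0 : 0 < QB := lt_of_lt_of_le (by positivity) hQB1
  have hAQ : n ^ 4 / 2 ^ 15 ≤ |a * x * QA| := by
    rw [abs_mul, abs_of_pos hQA0]
    calc n ^ 4 / 2 ^ 15 = n ^ 2 / 256 * (n ^ 2 / 128) := by ring
      _ ≤ _ := by gcongr
  have hBQ : n ^ 4 / 2 ^ 15 ≤ |b * y * QB| := by
    rw [abs_mul, abs_of_pos hQB0]
    calc n ^ 4 / 2 ^ 15 = n ^ 2 / 256 * (n ^ 2 / 128) := by ring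
      _ ≤ _ := by gcongr
  have hA0 : a * x * QA ≠ 0 := abs_pos.1 (lt_of_lt_of_le (by positivity) hAQ)
  have hB0 : b * y * QB ≠ 0 := abs_pos.1 (lt_of_lt_of_le (by positivity) hBQ)
  have hfby : 𝔣 (b + y) = -𝔣 (a + x) := by rw [← h.flux_neg]; congr 1; linarith
  set NA := 𝔣 a + 𝔣 x - 𝔣 (a + x) with hNA
  have hNA1 : |NA| ≤ (D + 1) * |a + x| := h.pair_num_le_sum a x
  set F := 𝔣 a + 𝔣 b + 𝔣 x + 𝔣 y with hFdef
  set L := 5 * (a + x) ^ 2 + c - 5 * (a * x + b * y) with hL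
  -- The difference of the denominators contains two of the three resonant factors; the third, `a +
  -- x`, comes from the bound on `NA`.
  have hdiff : b * y * QB - a * x * QA = (a + b) * (a + y) * L := by
    have : y = -(a + b + x) := by linarith
    simp only [hL, hQA, hQB, quadFactor, this]; ring
  have hLn : |L| ≤ 33 * n ^ 2 := by
    have h0 : |a * x| ≤ n * n := by rw [abs_mul]; gcongr
    have h1 : |b * y| ≤ n * n := by rw [abs_mul]; gcongr
    have h2 : (a + x) ^ 2 ≤ (2 * n) ^ 2 := by
      rw [← sq_abs]; gcongr; exact (abs_add_le _ _).trans (by linarith)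
    have h3 : δ ^ 2 ≤ n ^ 2 := by gcongr
    have h4 := abs_le.1 hc
    have h0' := abs_le.1 h0
    have h1' := abs_le.1 h1
    rw [hL, abs_le]
    constructor <;> nlinarith only [h0'.1, h0'.2, h1'.1, h1'.2, h2, h3, h4.1, h4.2, sq_nonneg (a + x)]
  -- The two pair sums are opposite, so the numerators of the pairs add up to `F`. The first term on
  -- the right is the change of denominator, and the second contains all three resonant factors by
  -- `hF`.
  have hrep : pairSymbol c m a x + pairSymbol c m b y =
      NA * ((a + b) * (a + y) * L) / ((a * x * QA) * (b * y * QB)) + F / (b * y * QB) := by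
    rw [← hdiff]
    have e1 : pairSymbol c m a x = NA / (a * x * QA) := rfl
    have e2 : pairSymbol c m b y = (F - NA) / (b * y * QB) := by
      simp only [pairSymbol, hfby, hNA, hFdef, hQB]; congr 1; ring
    rw [e1, e2]
    generalize a * x * QA = α at *
    generalize b * y * QB = γ at *
    field_simp
    ring
  rw [hrep]
  have t1 : |NA * ((a + b) * (a + y) * L) / ((a * x * QA) * (b * y * QB))| ≤
      (D + 1) * V * (33 * n ^ 2) / (n ^ 4 / 2 ^ 15 * (n ^ 4 / 2 ^ 15)) := by
    rw [abs_div, abs_mul (a * x * QA)]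
    have : |NA * ((a + b) * (a + y) * L)| ≤ (D + 1) * V * (33 * n ^ 2) := by
      rw [hV, abs_mul, abs_mul _ L, abs_mul, abs_mul, abs_mul]
      calc |NA| * (|a + b| * |a + y| * |L|) ≤
          (D + 1) * |a + x| * (|a + b| * |a + y| * (33 * n ^ 2)) := by gcongr
        _ = _ := by ring
    gcongr
  have t2 : |F / (b * y * QB)| ≤ 12 * D * V / n ^ 2 / (n ^ 4 / 2 ^ 15) := by
    rw [abs_div]
    gcongr
  refine (abs_add_le _ _).trans ((add_le_add t1 t2).trans ?_)
  have e3 : (D + 1) * V * (33 * n ^ 2) / (n ^ 4 / 2 ^ 15 * (n ^ 4 / 2 ^ 15)) +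
      12 * D * V / n ^ 2 / (n ^ 4 / 2 ^ 15) =
      ((D + 1) * V * (33 * 2 ^ 30) + 12 * D * V * 2 ^ 15) / n ^ 6 := by field_simp
  rw [e3]
  refine div_le_div_of_nonneg_right ?_ (by positivity)
  have : 0 ≤ D * V := by positivity
  nlinarith only [this, hV0]

/-- The factor of the quartic resonance function complementary to the pair sums. -/
noncomputable def quartFactor (c a b x y : ℝ) : ℝ :=
  5 / 2 * (a ^ 2 + b ^ 2 + x ^ 2 + y ^ 2) + c

/-- The numerator of `σ_4`. -/
noncomputable def quartNum (c : ℝ) (m : ℝ → ℝ) (a b x y : ℝ) : ℝ :=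
  pairSymbol c m a b + pairSymbol c m x y + (pairSymbol c m a x + pairSymbol c m b y) +
    (pairSymbol c m a y + pairSymbol c m b x)

/-- The absolute value of `σ_4`. -/
noncomputable def quartSymbol (c : ℝ) (m : ℝ → ℝ) (a b x y : ℝ) : ℝ :=
  |quartNum c m a b x y| / (|(a + b) * (a + x) * (a + y)| * quartFactor c a b x y)

/-- The three adjacent transpositions generate all permutations of the arguments, so the frequencies
may be sorted in the estimates below. -/
lemma quartNum_swap_left (c : ℝ) (m : ℝ → ℝ) (a b x y : ℝ) :
    quartNum c m a b x y = quartNum c m b a x y := by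
  simp only [quartNum]; rw [pairSymbol_comm c m a b]; ring

lemma quartNum_swap_mid (c : ℝ) (m : ℝ → ℝ) (a b x y : ℝ) :
    quartNum c m a b x y = quartNum c m a x b y := by
  simp only [quartNum]; rw [pairSymbol_comm c m b x]; ring

lemma quartNum_swap_right (c : ℝ) (m : ℝ → ℝ) (a b x y : ℝ) :
    quartNum c m a b x y = quartNum c m a b y x := by
  simp only [quartNum]; rw [pairSymbol_comm c m x y]; ring

lemma quartSymbol_swap_left (c : ℝ) (m : ℝ → ℝ) {a b x y : ℝ} (hs : a + b + x + y = 0) :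
    quartSymbol c m a b x y = quartSymbol c m b a x y := by
  simp only [quartSymbol, quartFactor]
  rw [quartNum_swap_left, show (a + b) * (a + x) * (a + y) = (b + a) * (b + x) * (b + y) by
    have : y = -(a + b + x) := by linarith
    rw [this]; ring, add_comm (a ^ 2)]

lemma quartSymbol_swap_mid (c : ℝ) (m : ℝ → ℝ) (a b x y : ℝ) :
    quartSymbol c m a b x y = quartSymbol c m a x b y := by
  simp only [quartSymbol, quartFactor]
  rw [quartNum_swap_mid, show (a + b) * (a + x) * (a + y) = (a + x) * (a + b) * (a + y) by ring,
    add_right_comm (a ^ 2)]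

lemma quartSymbol_swap_right (c : ℝ) (m : ℝ → ℝ) (a b x y : ℝ) :
    quartSymbol c m a b x y = quartSymbol c m a b y x := by
  simp only [quartSymbol, quartFactor]
  rw [quartNum_swap_right, show (a + b) * (a + x) * (a + y) = (a + b) * (a + y) * (a + x) by ring,
    add_right_comm (a ^ 2 + b ^ 2)]

lemma IsNice.quartSymbol_neg (h : IsNice N D m) (c a b x y : ℝ) :
    quartSymbol c m (-a) (-b) (-x) (-y) = quartSymbol c m a b x y := by
  simp only [quartSymbol, quartNum, quartFactor, h.pairSymbol_neg, neg_sq]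
  congr 1
  · rw [← abs_neg]; congr 1; ring
  · congr 1
    rw [← abs_neg]; congr 1; ring

lemma quartFactor_ge (hc : |c| ≤ 3 * δ ^ 2) (hδ : 0 < δ) {a b x y : ℝ} (hb : δ ≤ |b|)
    (hx : δ ≤ |x|) : a ^ 2 ≤ quartFactor c a b x y := by
  have h1 : δ ^ 2 ≤ b ^ 2 := by rw [← sq_abs b]; gcongr
  have h2 : δ ^ 2 ≤ x ^ 2 := by rw [← sq_abs x]; gcongr
  have := (abs_le.1 hc).1
  rw [quartFactor]; nlinarith [sq_nonneg a, sq_nonneg y]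

/-- If `|y| ≤ |x| / 2`, then `|x + y|` is comparable to `|x|` and nothing needs to cancel. Otherwise
the numerator supplies the factor `|x + y|` and the denominator is comparable to `|x|⁴`. -/
lemma IsNice.abs_pairSymbol_small_le (h : IsNice N D m) (hc : |c| ≤ 3 * δ ^ 2) (hδ : 0 < δ)
    {x y : ℝ} (hx : δ ≤ |x|) (hy : δ ≤ |y|) (hyx : |y| ≤ |x|) :
    |pairSymbol c m x y| ≤ 32 * (D + 1) * |x + y| / max N |x| ^ 4 := by
  have hN := h.one_le_scale
  have hD := h.one_le
  rcases le_or_gt |x| (N / 2) with hxN | hxN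
  · rw [h.pairSymbol_low c hxN (hyx.trans hxN), abs_zero]; positivity
  have hx0 : 0 < |x| := by linarith
  have hy0 : 0 < |y| := by linarith
  have hM : max N |x| ≤ 2 * |x| := max_le (by linarith) (by linarith)
  have key : |pairSymbol c m x y| ≤ 2 * (D + 1) * |x + y| / |x| ^ 4 := by
    rcases le_or_gt |y| (|x| / 2) with h1 | h1
    · refine (h.abs_pairSymbol_le_cube hc hδ hx hy hx0 le_rfl).trans ?_
      have : |x| / 2 ≤ |x + y| := by
        have := abs_sub_abs_le_abs_sub x (-y); rw [abs_neg, sub_neg_eq_add] at this; linarith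
      rw [div_le_div_iff₀ (by positivity) (by positivity)]
      calc (D + 1) * |x| ^ 4 = 2 * (D + 1) * (|x| / 2) * |x| ^ 3 := by ring
        _ ≤ _ := by gcongr
    · refine (abs_pairSymbol_le hc hδ hx hy (h.pair_num_le_sum x y)).trans ?_
      rw [div_le_div_iff₀ (by rw [← sq_abs x]; positivity) (by positivity)]
      have : |x| ^ 4 ≤ 2 * (|x| * |y| * (x ^ 2 + y ^ 2)) := by
        rw [← sq_abs x]
        calc |x| ^ 4 = 2 * (|x| * (|x| / 2) * |x| ^ 2) := by ring
          _ ≤ _ := by gcongr; linarith [sq_nonneg y]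
      calc (D + 1) * |x + y| * |x| ^ 4 ≤
          (D + 1) * |x + y| * (2 * (|x| * |y| * (x ^ 2 + y ^ 2))) := by gcongr
        _ = _ := by ring
  refine key.trans ?_
  rw [div_le_div_iff₀ (by positivity) (by positivity)]
  calc 2 * (D + 1) * |x + y| * max N |x| ^ 4 ≤ 2 * (D + 1) * |x + y| * (2 * |x|) ^ 4 := by gcongr
    _ = _ := by ring

set_option maxHeartbeats 800000 in
/-- `σ_4` at two large and two much smaller frequencies. -/
lemma IsNice.quartSymbol_le_of_separated (h : IsNice N D m) (hc : |c| ≤ 3 * δ ^ 2) (hδ : 0 < δ)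
    {n b x y : ℝ} (hs : n + b + x + y = 0) (hb : δ ≤ |b|)
    (hx : δ ≤ |x|) (hy : δ ≤ |y|) (hnN : N / 2 ≤ n) (hyx : |y| ≤ |x|) (hxn : |x| ≤ n / 8) :
    quartSymbol c m n b x y ≤ 2 ^ 16 * (D + 1) / (max N |n| ^ 4 * max N |x| ^ 4) := by
  have hN := h.one_le_scale
  have hD := h.one_le
  have hn0 : 0 < n := by linarith
  have hx1 := abs_le.1 hxn
  have hyn : |y| ≤ n / 8 := hyx.trans hxn
  have hy1 := abs_le.1 hyn
  set e := |x + y| with he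
  have he0 : 0 ≤ e := abs_nonneg _
  set M := max N |x| with hM
  have hM0 : 0 < M := by rw [hM]; positivity
  have hMn : M ≤ 2 * n := max_le (by linarith) (by linarith)
  have hbe : b = -(n + x + y) := by linarith
  have hbn : 3 * n / 4 ≤ |b| := by rw [hbe, abs_neg]; exact (by linarith : _ ≤ n + x + y).trans (le_abs_self _)
  -- Here `n + b = -(x + y)`, so this pair has the factor `e` on its own.
  have t1 : |pairSymbol c m n b| ≤ 16 * (D + 1) * e / M ^ 4 := by
    refine (abs_pairSymbol_le hc hδ (by rw [abs_of_pos hn0]; linarith) hb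
      (h.pair_num_le_sum n b)).trans ?_
    have e1 : |n + b| = e := by rw [hbe, he, ← abs_neg]; congr 1; ring
    rw [e1, abs_of_pos hn0]
    have hb2 : (3 * n / 4) ^ 2 ≤ b ^ 2 := by rw [← sq_abs b]; gcongr
    have h2 : n ^ 4 ≤ n * |b| * (n ^ 2 + b ^ 2) := by
      calc n ^ 4 ≤ n * (3 * n / 4) * (n ^ 2 + (3 * n / 4) ^ 2) := by
            nlinarith only [pow_pos hn0 4]
        _ ≤ _ := by gcongr
    have hb0 : 0 < |b| := by linarith
    rw [div_le_div_iff₀ (by positivity) (by positivity)]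
    calc (D + 1) * e * M ^ 4 ≤ (D + 1) * e * (2 * n) ^ 4 := by gcongr
      _ = 16 * (D + 1) * e * n ^ 4 := by ring
      _ ≤ _ := by gcongr
  have t2 := h.abs_pairSymbol_small_le hc hδ hx hy hyx
  have hY := h.sq_sub_sq_le hyx
  -- The mixed pairs have no factor `e` individually; it appears only in the sums of `(n, x)` with
  -- `(b, y)` and of `(n, y)` with `(b, x)`.
  have t3 := h.abs_pairSymbol_add_le hc hδ hn0 hx hy hxn hyn hY
  rw [abs_sub_comm] at hY
  have t4 := h.abs_pairSymbol_add_le hc hδ hn0 hy hx hyn hxn hY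
  rw [← hbe] at t3
  rw [show -(n + y + x) = b by rw [hbe]; ring, add_comm y x] at t4
  have t5 : (2 * (D + 1) * e / M + 60 * (D + 1) * e / n) / n ^ 3 ≤ 976 * (D + 1) * e / M ^ 4 := by
    have a1 : 2 * (D + 1) * e / M + 60 * (D + 1) * e / n ≤ 122 * (D + 1) * e / M := by
      have : 60 * (D + 1) * e / n ≤ 120 * (D + 1) * e / M := by
        rw [div_le_div_iff₀ hn0 hM0]
        calc 60 * (D + 1) * e * M ≤ 60 * (D + 1) * e * (2 * n) := by gcongr
          _ = _ := by ring
      calc _ ≤ 2 * (D + 1) * e / M + 120 * (D + 1) * e / M := by gcongr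
        _ = _ := by ring
    calc _ ≤ (122 * (D + 1) * e / M) / (M / 2) ^ 3 := by gcongr; linarith
      _ = _ := by field_simp; ring
  have hT : |quartNum c m n b x y| ≤ 2000 * (D + 1) * e / M ^ 4 := by
    rw [quartNum]
    refine (abs_add_le _ _).trans ((add_le_add ((abs_add_le _ _).trans (add_le_add
      ((abs_add_le _ _).trans (add_le_add t1 t2)) (t3.trans t5))) (t4.trans t5)).trans ?_)
    exact le_of_eq (by ring)
  -- On the resonant plane `n + b = 0` the quotient is `0` by the convention for division by zero.
  -- Off it the factor `e` of the numerator cancels `|n + b|`.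
  rcases eq_or_lt_of_le he0 with h0 | h0
  · have : n + b = 0 := by
      have := abs_eq_zero.1 (he.symm.trans h0.symm); linarith
    rw [quartSymbol, this]; simp; positivity
  have hQ := quartFactor_ge (a := n) (y := y) hc hδ hb hx
  have hnx : 7 * n / 8 ≤ n + x := by linarith
  have hny : 7 * n / 8 ≤ n + y := by linarith
  have hnx0 : 0 < n + x := by linarith
  have hny0 : 0 < n + y := by linarith
  have hden : e * n ^ 4 / 2 ≤ |(n + b) * (n + x) * (n + y)| * quartFactor c n b x y := by
    have e1 : |n + b| = e := by rw [hbe, he, ← abs_neg]; congr 1; ring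
    rw [abs_mul, abs_mul, e1, abs_of_pos (by linarith : 0 < n + x),
      abs_of_pos (by linarith : 0 < n + y)]
    calc e * n ^ 4 / 2 ≤ e * (7 * n / 8) * (7 * n / 8) * n ^ 2 := by
          nlinarith only [mul_nonneg he0 (pow_nonneg hn0.le 4)]
      _ ≤ _ := by gcongr
  have hMn' : max N |n| ≤ 2 * n := max_le (by linarith) (by rw [abs_of_pos hn0]; linarith)
  rw [quartSymbol]
  calc _ ≤ 2000 * (D + 1) * e / M ^ 4 / (e * n ^ 4 / 2) := by gcongr
    _ = 4000 * (D + 1) / (n ^ 4 * M ^ 4) := by field_simp; ring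
    _ ≤ 4000 * (D + 1) / ((max N |n| / 2) ^ 4 * M ^ 4) := by gcongr; linarith
    _ = 64000 * (D + 1) / (max N |n| ^ 4 * M ^ 4) := by field_simp; ring
    _ ≤ _ := by gcongr; norm_num

set_option maxHeartbeats 800000 in
/-- `σ_4` at three comparable frequencies. -/
lemma IsNice.quartSymbol_le_of_comparable (h : IsNice N D m) (hc : |c| ≤ 3 * δ ^ 2) (hδ : 0 < δ)
    {n b x y : ℝ} (hs : n + b + x + y = 0) (hb : δ ≤ |b|) (hx : δ ≤ |x|) (hy : δ ≤ |y|)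
    (hn : 0 < n) (hbn : |b| ≤ n) (hxb : |x| ≤ |b|) (hyx : |y| ≤ |x|) (hxn : n / 8 ≤ |x|) :
    quartSymbol c m n b x y ≤ 2 ^ 38 * (D + 1) / n ^ 8 := by
  have hD := h.one_le
  have hxn' : |x| ≤ n := hxb.trans hbn
  have hyn' : |y| ≤ n := hyx.trans hxn'
  have hn' : |n| = n := abs_of_pos hn
  have hQ := quartFactor_ge (a := n) (y := y) hc hδ hb hx
  have hQ0 : 0 < quartFactor c n b x y := lt_of_lt_of_le (by positivity) hQ
  have hδn : δ ≤ n := hb.trans hbn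
  set V := |(n + b) * (n + x) * (n + y)| with hV
  have hb1 := abs_le.1 hbn
  have hx1 := abs_le.1 hxn'
  have hy1 := abs_le.1 hyn'
  -- With a much smaller fourth frequency no pair sum is small, and the pairs can be bounded one by
  -- one.
  rcases le_or_gt |y| (n / 16) with hy16 | hy16
  · have hH : ∀ a z : ℝ, δ ≤ |a| → δ ≤ |z| → n / 8 ≤ |a| →
        |pairSymbol c m a z| ≤ 512 * (D + 1) / n ^ 3 := by
      intro a z ha hz han
      refine (h.abs_pairSymbol_le_cube hc hδ ha hz (by positivity : 0 < n / 8) han).trans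
        (le_of_eq ?_)
      field_simp; ring
    have hT : |quartNum c m n b x y| ≤ 3072 * (D + 1) / n ^ 3 := by
      rw [quartNum]
      have hnn : n / 8 ≤ |n| := by rw [hn']; linarith
      have hδn' : δ ≤ |n| := by rwa [hn']
      refine (abs_add_le _ _).trans ((add_le_add ((abs_add_le _ _).trans (add_le_add
        ((abs_add_le _ _).trans (add_le_add (hH n b hδn' hb hnn) (hH x y hx hy hxn)))
        ((abs_add_le _ _).trans (add_le_add (hH n x hδn' hx hnn) (hH b y hb hy (hxn.trans hxb))))))
        ((abs_add_le _ _).trans (add_le_add (hH n y hδn' hy hnn)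
          (hH b x hb hx (hxn.trans hxb))))).trans (le_of_eq ?_))
      ring
    have htri : ∀ z : ℝ, n / 8 ≤ |z| → n / 16 ≤ |z + y| := by
      intro z hz
      have := abs_sub_abs_le_abs_sub z (-y)
      rw [abs_neg, sub_neg_eq_add] at this
      linarith
    have h1 : n / 16 ≤ |n + b| := by
      rw [show n + b = -(x + y) by linarith, abs_neg]; exact htri x hxn
    have h2 : n / 16 ≤ |n + x| := by
      rw [show n + x = -(b + y) by linarith, abs_neg]; exact htri b (hxn.trans hxb)
    have h3 : n / 2 ≤ |n + y| := by
      have := neg_abs_le y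
      exact (by linarith : n / 2 ≤ n + y).trans (le_abs_self _)
    have hden : n ^ 5 / 512 ≤ V * quartFactor c n b x y := by
      rw [hV, abs_mul, abs_mul]
      calc n ^ 5 / 512 = n / 16 * (n / 16) * (n / 2) * n ^ 2 := by ring
        _ ≤ _ := by gcongr
    rw [quartSymbol]
    calc _ ≤ 3072 * (D + 1) / n ^ 3 / (n ^ 5 / 512) := by gcongr
      _ = 1572864 * (D + 1) / n ^ 8 := by field_simp; ring
      _ ≤ _ := by gcongr; norm_num
  have hy16' := hy16.le
  have hx16 : n / 16 ≤ |x| := hy16'.trans hyx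
  have hb16 : n / 16 ≤ |b| := hx16.trans hxb
  have hn16 : n / 16 ≤ |n| := by rw [hn']; linarith
  -- All four frequencies are comparable, and each of the three sums of opposite pairs contains the
  -- full product of resonant factors, which then cancels against the denominator.
  have hF : |𝔣 n + 𝔣 b + 𝔣 x + 𝔣 y| ≤ 12 * D * V / n ^ 2 := by
    have := h.flux_four_le hn (p := n + b) (q := n + x) (r := n + y) (by linarith) (by linarith)
      (by linarith) (by linarith)
    rw [show n - (n + b) = -b by ring, show n - (n + x) = -x by ring,
      show n - (n + y) = -y by ring, h.flux_neg, h.flux_neg, h.flux_neg, sub_neg_eq_add,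
      sub_neg_eq_add, sub_neg_eq_add] at this
    have e0 : 0 ≤ (n + b) * (n + x) * (n + y) :=
      mul_nonneg (mul_nonneg (by linarith only [hb1.1]) (by linarith only [hx1.1]))
        (by linarith only [hy1.1])
    rwa [hV, abs_of_nonneg e0]
  have p1 := h.abs_pairSymbol_add_le_of_comparable hc hδ (a := n) (b := x) (x := b) (y := y)
    (by linarith) hδn hn16 hx16 hb16 hy16' (by rwa [hn']) hx hb hy hn'.le hxn' hbn hyn'
    (by rw [show (n + x) * (n + b) * (n + y) = (n + b) * (n + x) * (n + y) by ring,
          show 𝔣 n + 𝔣 x + 𝔣 b + 𝔣 y = 𝔣 n + 𝔣 b + 𝔣 x + 𝔣 y by ring]; exact hF)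
  have p2 := h.abs_pairSymbol_add_le_of_comparable hc hδ (a := n) (b := b) (x := x) (y := y)
    (by linarith) hδn hn16 hb16 hx16 hy16' (by rwa [hn']) hb hx hy hn'.le hbn hxn' hyn' hF
  have p3 := h.abs_pairSymbol_add_le_of_comparable hc hδ (a := n) (b := b) (x := y) (y := x)
    (by linarith) hδn hn16 hb16 hy16' hx16 (by rwa [hn']) hb hy hx hn'.le hbn hyn' hxn'
    (by rw [show (n + b) * (n + y) * (n + x) = (n + b) * (n + x) * (n + y) by ring,
          show 𝔣 n + 𝔣 b + 𝔣 y + 𝔣 x = 𝔣 n + 𝔣 b + 𝔣 x + 𝔣 y by ring]; exact hF)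
  rw [show (n + x) * (n + b) * (n + y) = (n + b) * (n + x) * (n + y) by ring] at p1
  rw [show (n + b) * (n + y) * (n + x) = (n + b) * (n + x) * (n + y) by ring] at p3
  rw [← hV] at p1 p2 p3
  have hT : |quartNum c m n b x y| ≤ 3 * 2 ^ 36 * (D + 1) * V / n ^ 6 := by
    rw [quartNum]
    refine (abs_add_le _ _).trans ((add_le_add ((abs_add_le _ _).trans (add_le_add p1 p2)) p3).trans
      (le_of_eq ?_))
    ring
  rw [quartSymbol, ← hV]
  rcases eq_or_lt_of_le (abs_nonneg ((n + b) * (n + x) * (n + y))) with h0 | h0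
  · rw [hV, ← h0]; simp; positivity
  rw [← hV] at h0
  calc _ ≤ 3 * 2 ^ 36 * (D + 1) * V / n ^ 6 / (V * n ^ 2) := by gcongr
    _ = 3 * 2 ^ 36 * (D + 1) / n ^ 8 := by field_simp
    _ ≤ _ := by gcongr; norm_num

lemma quartSymbol_le_aux (h : IsNice N D m) (hc : |c| ≤ 3 * δ ^ 2) (hδ : 0 < δ)
    {a b x y : ℝ} (hs : a + b + x + y = 0) (ha : 0 < a) (hb : δ ≤ |b|) (hx : δ ≤ |x|)
    (hy : δ ≤ |y|) (hba : |b| ≤ |a|) (hxb : |x| ≤ |b|) (hyx : |y| ≤ |x|) :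
    quartSymbol c m a b x y ≤ 2 ^ 46 * (D + 1) / (max N |a| ^ 4 * max N |x| ^ 4) := by
  have hN := h.one_le_scale
  have hD := h.one_le
  have hal : |a| = a := abs_of_pos ha
  rcases le_or_gt |a| (N / 2) with haN | haN
  · have hb' := hba.trans haN
    have hx' := hxb.trans hb'
    have hy' := hyx.trans hx'
    rw [quartSymbol, quartNum, h.pairSymbol_low c haN hb', h.pairSymbol_low c hx' hy',
      h.pairSymbol_low c haN hx', h.pairSymbol_low c haN hy', h.pairSymbol_low c hb' hx',
      h.pairSymbol_low c hb' hy']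
    simp; positivity
  rcases le_or_gt |x| (a / 8) with hxa | hxa
  · refine (h.quartSymbol_le_of_separated hc hδ hs hb hx hy (by linarith) hyx hxa).trans ?_
    gcongr <;> norm_num
  · refine (h.quartSymbol_le_of_comparable hc hδ hs hb hx hy ha (by linarith) hxb hyx
      hxa.le).trans ?_
    have h1 : max N |a| ≤ 2 * a := max_le (by linarith) (by linarith)
    have h2 : max N |x| ≤ 2 * a := max_le (by linarith) (by linarith)
    have hM : 0 < max N |x| := by positivity
    have hM' : 0 < max N |a| := by positivity
    calc 2 ^ 38 * (D + 1) / a ^ 8 = 2 ^ 46 * (D + 1) / ((2 * a) ^ 4 * (2 * a) ^ 4) := by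
          field_simp
      _ ≤ _ := by gcongr

lemma IsNice.quartSymbol_le_sorted (h : IsNice N D m) (hc : |c| ≤ 3 * δ ^ 2) (hδ : 0 < δ)
    {a b x y : ℝ} (hs : a + b + x + y = 0) (ha : δ ≤ |a|) (hb : δ ≤ |b|) (hx : δ ≤ |x|)
    (hy : δ ≤ |y|) (hba : |b| ≤ |a|) (hxb : |x| ≤ |b|) (hyx : |y| ≤ |x|) :
    quartSymbol c m a b x y ≤ 2 ^ 46 * (D + 1) / (max N |a| ^ 4 * max N |x| ^ 4) := by
  rcases lt_or_ge 0 a with h0 | h0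
  · exact quartSymbol_le_aux h hc hδ hs h0 hb hx hy hba hxb hyx
  · have h1 : a ≠ 0 := by rintro rfl; simp at ha; linarith
    have := quartSymbol_le_aux h hc hδ (a := -a) (b := -b) (x := -x) (y := -y) (by linarith)
      (by have := lt_of_le_of_ne h0 h1; linarith) (by rwa [abs_neg]) (by rwa [abs_neg])
      (by rwa [abs_neg]) (by rwa [abs_neg, abs_neg]) (by rwa [abs_neg, abs_neg])
      (by rwa [abs_neg, abs_neg])
    rwa [h.quartSymbol_neg, abs_neg, abs_neg] at this

/-- **Bound for `σ_4`**: if `|x| ≤ |a|` and `|x| ≤ |b|`, then `|x|` is at most the third largest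
of the four frequencies. -/
theorem IsNice.quartSymbol_le (h : IsNice N D m) (hc : |c| ≤ 3 * δ ^ 2) (hδ : 0 < δ)
    {a b x y : ℝ} (hs : a + b + x + y = 0) (ha : δ ≤ |a|) (hb : δ ≤ |b|) (hx : δ ≤ |x|)
    (hy : δ ≤ |y|) (hxa : |x| ≤ |a|) (hxb : |x| ≤ |b|) :
    quartSymbol c m a b x y ≤ 2 ^ 46 * (D + 1) / (max N |a| ^ 4 * max N |x| ^ 4) := by
  have hN := h.one_le_scale
  have hD := h.one_le
  have hM : ∀ z, 0 < max N |z| := fun z => lt_of_lt_of_le (by linarith) (le_max_left _ _)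
  wlog hba : |b| ≤ |a| generalizing a b
  · rw [quartSymbol_swap_left c m hs]
    have hab := le_of_not_ge hba
    refine (this (by linarith) hb ha hxb hxa hab).trans ?_
    have := hM a; have := hM x
    gcongr
  rcases le_or_gt |y| |x| with h1 | h1
  · exact h.quartSymbol_le_sorted hc hδ hs ha hb hx hy hba hxb h1
  have mono : ∀ a' x' : ℝ, |a| ≤ |a'| → |x| ≤ |x'| →
      2 ^ 46 * (D + 1) / (max N |a'| ^ 4 * max N |x'| ^ 4) ≤
      2 ^ 46 * (D + 1) / (max N |a| ^ 4 * max N |x| ^ 4) := by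
    intro a' x' h1 h2
    have := hM a; have := hM x
    gcongr
  rcases le_or_gt |y| |b| with h2 | h2
  · rw [quartSymbol_swap_right]
    exact (h.quartSymbol_le_sorted hc hδ (by linarith) ha hb hy hx hba h2 h1.le).trans
      (mono _ _ le_rfl h1.le)
  rw [quartSymbol_swap_right, quartSymbol_swap_mid]
  rcases le_or_gt |y| |a| with h3 | h3
  · exact (h.quartSymbol_le_sorted hc hδ (by linarith) ha hy hb hx h3 h2.le hxb).trans
      (mono _ _ le_rfl hxb)
  · rw [quartSymbol_swap_left c m (by linarith)]
    exact (h.quartSymbol_le_sorted hc hδ (by linarith) hy ha hb hx h3.le hba hxb).trans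
      (mono _ _ h3.le hxb)

/-- The absolute value of `σ_3`, up to a constant factor. -/
noncomputable def cubicSymbol (c : ℝ) (m : ℝ → ℝ) (a b x : ℝ) : ℝ :=
  |fluxSymbol m a + fluxSymbol m b + fluxSymbol m x| / (|a * b * x| * quadFactor c a b)

lemma cubicSymbol_swap_left (c : ℝ) (m : ℝ → ℝ) (a b x : ℝ) :
    cubicSymbol c m a b x = cubicSymbol c m b a x := by
  simp only [cubicSymbol, quadFactor]
  rw [add_comm (fluxSymbol m a), mul_comm a b, show a ^ 2 + b * a + b ^ 2 = b ^ 2 + b * a + a ^ 2 by ring]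

lemma cubicSymbol_swap_right (c : ℝ) (m : ℝ → ℝ) {a b x : ℝ} (hs : a + b + x = 0) :
    cubicSymbol c m a b x = cubicSymbol c m a x b := by
  simp only [cubicSymbol, quadFactor]
  rw [add_right_comm (fluxSymbol m a), mul_right_comm a b, show a ^ 2 + a * b + b ^ 2 = a ^ 2 + a * x + x ^ 2 by
    have : x = -(a + b) := by linarith
    rw [this]; ring]

/-- The two largest frequencies are comparable. The numerator vanishes linearly in the smallest one,
which cancels that factor of the denominator and leaves `|a| |b|` times a quadratic factor, of size
`|a|⁴`. -/
lemma IsNice.cubicSymbol_le_sorted (h : IsNice N D m) (hc : |c| ≤ 3 * δ ^ 2) (hδ : 0 < δ)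
    {a b x : ℝ} (hs : a + b + x = 0) (ha : δ ≤ |a|) (hb : δ ≤ |b|) (hx : δ ≤ |x|)
    (hba : |b| ≤ |a|) (hxb : |x| ≤ |b|) :
    cubicSymbol c m a b x ≤ 32 * (D + 1) / max N |a| ^ 4 := by
  have hN := h.one_le_scale
  have hD := h.one_le
  have hM : 0 < max N |a| := by positivity
  rcases le_or_gt |a| (N / 2) with haN | haN
  · rw [cubicSymbol, h.flux_low (by linarith), h.flux_low (by linarith), h.flux_low (by linarith),
      hs]
    simp; positivity
  have hM2 : max N |a| ≤ 2 * |a| := max_le (by linarith) (by linarith)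
  have hQ := quadFactor_ge hc hδ ha hb
  have ha0 : 0 < |a| := by linarith
  have hx0 : 0 < |x| := by linarith
  have hxe : x = -(a + b) := by linarith
  have hbe : |a| / 2 ≤ |b| := by
    have : |a| ≤ |b| + |x| := by
      rw [show a = -(b + x) by linarith, abs_neg]; exact abs_add_le b x
    linarith
  have hnum : |𝔣 a + 𝔣 b + 𝔣 x| ≤ (D + 1) * |x| := by
    have := h.pair_num_le_sum a b
    rwa [← abs_neg (a + b), ← hxe, sub_eq_add_neg, ← h.flux_neg, ← hxe] at this
  have hden : |a| ^ 4 * |x| / 2 ≤ |a * b * x| * quadFactor c a b := by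
    rw [abs_mul, abs_mul]
    have : |a| ^ 2 ≤ quadFactor c a b := by rw [sq_abs]; linarith [sq_nonneg b]
    calc |a| ^ 4 * |x| / 2 = |a| * (|a| / 2) * |x| * |a| ^ 2 := by ring
      _ ≤ _ := by gcongr
  rw [cubicSymbol]
  calc _ ≤ (D + 1) * |x| / (|a| ^ 4 * |x| / 2) := by gcongr
    _ = 32 * (D + 1) / (2 * |a|) ^ 4 := by field_simp; ring
    _ ≤ _ := by gcongr

/-- **Bound for `σ_3`.** -/
theorem IsNice.cubicSymbol_le (h : IsNice N D m) (hc : |c| ≤ 3 * δ ^ 2) (hδ : 0 < δ)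
    {a b x : ℝ} (hs : a + b + x = 0) (ha : δ ≤ |a|) (hb : δ ≤ |b|) (hx : δ ≤ |x|) :
    cubicSymbol c m a b x ≤ 32 * (D + 1) / max N |a| ^ 4 := by
  have hN := h.one_le_scale
  have hD := h.one_le
  have hM : ∀ z, 0 < max N |z| := fun z => lt_of_lt_of_le (by linarith) (le_max_left _ _)
  wlog hxb : |x| ≤ |b| generalizing b x
  · rw [cubicSymbol_swap_right c m hs]
    exact this (by linarith) hx hb (le_of_not_ge hxb)
  rcases le_or_gt |b| |a| with h1 | h1
  · exact h.cubicSymbol_le_sorted hc hδ hs ha hb hx h1 hxb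
  have mono : 32 * (D + 1) / max N |b| ^ 4 ≤ 32 * (D + 1) / max N |a| ^ 4 := by
    have := hM a; gcongr
  rw [cubicSymbol_swap_left]
  refine le_trans ?_ mono
  rcases le_or_gt |x| |a| with h2 | h2
  · exact h.cubicSymbol_le_sorted hc hδ (by linarith) hb ha hx h1.le h2
  · rw [cubicSymbol_swap_right c m (by linarith)]
    exact h.cubicSymbol_le_sorted hc hδ (by linarith) hb hx ha hxb h2.le

end Symbol

/-! ### The multipliers `σ_3` and `σ_4` -/

lemma symmetrize_comp_perm {l : ℕ} (F : (Fin l → ℝ) → ℂ) (k : Fin l → ℝ)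
    (σ : Equiv.Perm (Fin l)) : symmetrize F (k ∘ σ) = symmetrize F k := by
  simp only [symmetrize, Function.comp_apply]
  congr 1
  exact Equiv.sum_comp (Equiv.mulLeft σ) fun τ => F fun i => k (τ i)

lemma resonance_comp_perm {l : ℕ} (β lam : ℝ) (k : Fin l → ℝ) (σ : Equiv.Perm (Fin l)) :
    resonance β lam (k ∘ σ) = resonance β lam k := by
  simp only [resonance, Function.comp_apply]
  rw [Equiv.sum_comp σ fun i => k i ^ 5, Equiv.sum_comp σ fun i => k i ^ 3]

lemma sigma3_comp_perm (β lam : ℝ) (m : ℝ → ℝ) (k : Fin 3 → ℝ) (σ : Equiv.Perm (Fin 3)) :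
    sigma3 β lam m (k ∘ σ) = sigma3 β lam m k := by
  simp only [sigma3, M3, symmetrize_comp_perm, resonance_comp_perm]

lemma sigma4_comp_perm (β lam : ℝ) (m : ℝ → ℝ) (k : Fin 4 → ℝ) (σ : Equiv.Perm (Fin 4)) :
    sigma4 β lam m (k ∘ σ) = sigma4 β lam m k := by
  simp only [sigma4, M4, symmetrize_comp_perm, resonance_comp_perm]

/-- The denominator of the multipliers is the total phase produced by the linear evolution: this is
the mechanism of the correction terms. -/
lemma resonance_freq (β lam : ℝ) {l : ℕ} (n : Fin l → ℤ) :
    resonance β lam (fun i => freq lam (n i)) = Complex.I * phase β lam n := by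
  simp only [resonance, phase, disp, dispersion, Finset.sum_add_distrib, ← Finset.mul_sum]
  push_cast; ring

lemma sum_perm_apply_zero {l : ℕ} (g : Fin (l + 1) → ℂ) :
    ∑ σ : Equiv.Perm (Fin (l + 1)), g (σ 0) = l.factorial * ∑ i, g i := by
  rw [← Equiv.Perm.decomposeFin.symm.sum_comp, Fintype.sum_prod_type]
  simp [Equiv.Perm.decomposeFin_symm_apply_zero, Fintype.card_perm, Finset.mul_sum]

/-- A permutation is determined by the image of `0` and a permutation of the remaining indices; each
ordered pair of distinct images of `0` and `1` is hit `l!` times. -/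
lemma sum_perm_apply_zero_one {l : ℕ} (g : Fin (l + 2) → Fin (l + 2) → ℂ) :
    ∑ σ : Equiv.Perm (Fin (l + 2)), g (σ 0) (σ 1) =
      l.factorial * ∑ p, ∑ q : Fin (l + 1), g p (Equiv.swap 0 p q.succ) := by
  rw [← Equiv.Perm.decomposeFin.symm.sum_comp, Fintype.sum_prod_type, Finset.mul_sum]
  refine Finset.sum_congr rfl fun p _ => ?_
  rw [← sum_perm_apply_zero]
  refine Finset.sum_congr rfl fun e _ => ?_
  rw [Equiv.Perm.decomposeFin_symm_apply_zero]
  congr 1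
  exact Equiv.Perm.decomposeFin_symm_apply_one e p

/-- The constant in the quadratic factors of the resonance functions. -/
noncomputable def lowOrder (β lam : ℝ) : ℝ := 3 * β * (lam ^ 2)⁻¹

lemma abs_lowOrder_le {β lam : ℝ} (hβ : β = -1 ∨ β = 0 ∨ β = 1) :
    |lowOrder β lam| ≤ 3 * lam⁻¹ ^ 2 := by
  have : |β| ≤ 1 := by rcases hβ with h | h | h <;> simp [h]
  have h2 : (0 : ℝ) ≤ (lam ^ 2)⁻¹ := by positivity
  rw [lowOrder, abs_mul, abs_mul, abs_of_nonneg h2, abs_of_pos (by norm_num : (0 : ℝ) < 3), inv_pow]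
  gcongr
  linarith

lemma le_abs_freq {lam : ℝ} (hlam : 0 < lam) {n : ℤ} (hn : n ≠ 0) : lam⁻¹ ≤ |freq lam n| := by
  rw [freq, abs_div, abs_of_pos hlam, inv_eq_one_div]
  have : (1 : ℝ) ≤ |(n : ℝ)| := by exact_mod_cast Int.one_le_abs hn
  gcongr

lemma freq_add (lam : ℝ) (a b : ℤ) : freq lam (a + b) = freq lam a + freq lam b := by
  simp [freq, add_div]

lemma freq_neg (lam : ℝ) (a : ℤ) : freq lam (-a) = -freq lam a := by
  simp [freq, neg_div]

variable {β lam : ℝ} {m : ℝ → ℝ}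

/-- On the hyperplane `k_2 + k_3 = -k_1`, and evenness of `m` turns each term of the symmetrization
into a value of `-k m(k)²`. -/
lemma M3_eq (hm : ∀ x, m (-x) = m x) {k : Fin 3 → ℝ} (hk : k 0 + k 1 + k 2 = 0) :
    M3 m k = 2 * Complex.I / 3 *
      ((fluxSymbol m (k 0) + fluxSymbol m (k 1) + fluxSymbol m (k 2) : ℝ) : ℂ) := by
  have h : ∀ σ : Equiv.Perm (Fin 3), ((m (k (σ 0)) * m (k (σ 1) + k (σ 2)) *
      (k (σ 1) + k (σ 2)) : ℝ) : ℂ) = ((-fluxSymbol m (k (σ 0)) : ℝ) : ℂ) := by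
    intro σ
    have h1 : k (σ 1) + k (σ 2) = -k (σ 0) := by
      have := Equiv.sum_comp σ k
      simp only [Fin.sum_univ_three] at this
      linarith
    rw [h1, hm, fluxSymbol]; push_cast; ring
  simp only [M3, symmetrize, h]
  rw [sum_perm_apply_zero fun i => ((-fluxSymbol m (k i) : ℝ) : ℂ)]
  simp [Fin.sum_univ_three, Nat.factorial]
  ring

lemma resonance_three {k : Fin 3 → ℝ} (hk : k 0 + k 1 + k 2 = 0) :
    resonance β lam k =
      Complex.I * ((k 0 * k 1 * k 2 * quadFactor (lowOrder β lam) (k 0) (k 1) : ℝ) : ℂ) := by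
  have h2 : k 2 = -(k 0 + k 1) := by linarith
  simp only [resonance, Fin.sum_univ_three, h2, quadFactor, lowOrder]
  push_cast; ring

lemma sigma3_eq (hm : ∀ x, m (-x) = m x) {k : Fin 3 → ℝ} (hk : k 0 + k 1 + k 2 = 0) :
    sigma3 β lam m k = ((-(2 / 3) * ((fluxSymbol m (k 0) + fluxSymbol m (k 1) + fluxSymbol m (k 2)) /
      (k 0 * k 1 * k 2 * quadFactor (lowOrder β lam) (k 0) (k 1))) : ℝ) : ℂ) := by
  rw [sigma3, M3_eq hm hk, resonance_three hk]
  push_cast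
  generalize (fluxSymbol m (k 0) + fluxSymbol m (k 1) + fluxSymbol m (k 2) : ℂ) = F
  generalize (k 0 * k 1 * k 2 * quadFactor (lowOrder β lam) (k 0) (k 1) : ℂ) = Q
  rcases eq_or_ne Q 0 with h | h
  · simp [h]
  · field_simp

lemma norm_sigma3 (hm : ∀ x, m (-x) = m x) {k : Fin 3 → ℝ} (hk : k 0 + k 1 + k 2 = 0)
    (hQ : 0 ≤ quadFactor (lowOrder β lam) (k 0) (k 1)) :
    ‖sigma3 β lam m k‖ = 2 / 3 * cubicSymbol (lowOrder β lam) m (k 0) (k 1) (k 2) := by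
  rw [sigma3_eq hm hk, Complex.norm_real, Real.norm_eq_abs, abs_mul, abs_div, cubicSymbol,
    abs_mul _ (quadFactor _ _ _), abs_of_nonneg hQ]
  norm_num

/-- The outer factor cancels one factor of the denominator of `σ_3`. At `x = 0` both sides vanish,
the right one because `𝔣` is odd, so the value assigned to `σ_3` there does not matter. -/
lemma sigma3_mul_add (hm : ∀ x, m (-x) = m x) {a b x : ℝ} (hk : a + b + x = 0) :
    sigma3 β lam m ![a, b, x] * (x : ℂ) =
      ((-(2 / 3) * pairSymbol (lowOrder β lam) m a b : ℝ) : ℂ) := by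
  have hf : fluxSymbol m x = -fluxSymbol m (a + b) := by
    rw [show x = -(a + b) by linarith]; simp only [fluxSymbol, hm]; ring
  rw [sigma3_eq hm (by simpa using hk)]
  simp only [Matrix.cons_val_zero, Matrix.cons_val_one, Matrix.cons_val]
  rw [← Complex.ofReal_mul]
  congr 1
  rw [pairSymbol]
  rcases eq_or_ne x 0 with h0 | h0
  · have : a + b = 0 := by linarith
    have hb : b = -a := by linarith
    subst hb
    simp [h0, fluxSymbol, hm]
  · rw [hf, ← sub_eq_add_neg]
    generalize fluxSymbol m a + fluxSymbol m b - fluxSymbol m (a + b) = F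
    rw [show a * b * x * quadFactor (lowOrder β lam) a b =
      (a * b * quadFactor (lowOrder β lam) a b) * x by ring]
    generalize a * b * quadFactor (lowOrder β lam) a b = Q
    rw [mul_assoc, div_mul_eq_mul_div, mul_div_mul_right _ _ h0]

lemma M4_eq (hm : ∀ x, m (-x) = m x) {k : Fin 4 → ℝ} (hk : k 0 + k 1 + k 2 + k 3 = 0) :
    M4 β lam m k = Complex.I / 3 *
      ((quartNum (lowOrder β lam) m (k 0) (k 1) (k 2) (k 3) : ℝ) : ℂ) := by
  have h : ∀ σ : Equiv.Perm (Fin 4), sigma3 β lam m ![k (σ 0), k (σ 1), k (σ 2) + k (σ 3)] *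
      ((k (σ 2) + k (σ 3) : ℝ) : ℂ) =
      ((-(2 / 3) * pairSymbol (lowOrder β lam) m (k (σ 0)) (k (σ 1)) : ℝ) : ℂ) := by
    intro σ
    refine sigma3_mul_add hm ?_
    have := Equiv.sum_comp σ k
    simp only [Fin.sum_univ_four] at this
    linarith
  simp only [M4, symmetrize, h]
  rw [sum_perm_apply_zero_one fun i j =>
    ((-(2 / 3) * pairSymbol (lowOrder β lam) m (k i) (k j) : ℝ) : ℂ)]
  have e1 : Equiv.swap (0 : Fin 4) 1 1 = 0 := by decide
  have e2 : Equiv.swap (0 : Fin 4) 1 2 = 2 := by decide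
  have e3 : Equiv.swap (0 : Fin 4) 1 3 = 3 := by decide
  have e4 : Equiv.swap (0 : Fin 4) 2 1 = 1 := by decide
  have e5 : Equiv.swap (0 : Fin 4) 2 2 = 0 := by decide
  have e6 : Equiv.swap (0 : Fin 4) 2 3 = 3 := by decide
  have e7 : Equiv.swap (0 : Fin 4) 3 1 = 1 := by decide
  have e8 : Equiv.swap (0 : Fin 4) 3 2 = 2 := by decide
  have e9 : Equiv.swap (0 : Fin 4) 3 3 = 0 := by decide
  have s0 : (0 : Fin 3).succ = 1 := rfl
  have s1 : (1 : Fin 3).succ = 2 := rfl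
  have s2 : (2 : Fin 3).succ = 3 := rfl
  simp only [Fin.sum_univ_four, Fin.sum_univ_three, Equiv.swap_self, Equiv.refl_apply, s0, s1, s2,
    Nat.reduceAdd,
    e1, e2, e3, e4, e5, e6, e7, e8, e9]
  rw [pairSymbol_comm _ m (k 1) (k 0), pairSymbol_comm _ m (k 2) (k 0),
    pairSymbol_comm _ m (k 3) (k 0), pairSymbol_comm _ m (k 2) (k 1),
    pairSymbol_comm _ m (k 3) (k 1), pairSymbol_comm _ m (k 3) (k 2)]
  simp only [quartNum, Nat.factorial]
  push_cast
  ring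

lemma resonance_four {k : Fin 4 → ℝ} (hk : k 0 + k 1 + k 2 + k 3 = 0) :
    resonance β lam k = Complex.I * (((k 0 + k 1) * (k 0 + k 2) * (k 0 + k 3) *
      quartFactor (lowOrder β lam) (k 0) (k 1) (k 2) (k 3) : ℝ) : ℂ) := by
  have h2 : k 3 = -(k 0 + k 1 + k 2) := by linarith
  simp only [resonance, Fin.sum_univ_four, h2, quartFactor, lowOrder]
  push_cast; ring

lemma norm_sigma4 (hm : ∀ x, m (-x) = m x) {k : Fin 4 → ℝ} (hk : k 0 + k 1 + k 2 + k 3 = 0)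
    (hQ : 0 ≤ quartFactor (lowOrder β lam) (k 0) (k 1) (k 2) (k 3)) :
    ‖sigma4 β lam m k‖ = 1 / 3 * quartSymbol (lowOrder β lam) m (k 0) (k 1) (k 2) (k 3) := by
  rw [sigma4, M4_eq hm hk, resonance_four hk, quartSymbol, norm_div, norm_neg, norm_mul, norm_mul,
    norm_div, Complex.norm_I, Complex.norm_real, Complex.norm_real, Real.norm_eq_abs,
    Real.norm_eq_abs, abs_mul _ (quartFactor _ _ _ _ _), abs_of_nonneg hQ]
  norm_num
  ring

/-- On the resonant set the frequencies are `a, -a, b, -b`. The pairs with sum zero contribute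
nothing, and the others cancel two by two by oddness. -/
lemma quartNum_eq_zero (hm : ∀ x, m (-x) = m x) (c a b : ℝ) :
    quartNum c m a (-a) b (-b) = 0 := by
  have h0 : ∀ a, pairSymbol c m a (-a) = 0 := by
    intro a; simp [pairSymbol, fluxSymbol, hm]
  have h1 : ∀ a b, pairSymbol c m (-a) (-b) = -pairSymbol c m a b := by
    intro a b
    have : -a + -b = -(a + b) := by ring
    simp only [pairSymbol, quadFactor, this, fluxSymbol, hm]
    rw [neg_div']
    congr 1 <;> ring
  have h2 : pairSymbol c m (-a) b = -pairSymbol c m a (-b) := by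
    have := h1 a (-b); rwa [neg_neg] at this
  rw [quartNum, h0, h0, h1, h2]; ring

lemma resonance_mul_sigma3 (hlam : 0 < lam)
    (hβ : β = -1 ∨ β = 0 ∨ β = 1) {n : Fin 3 → ℤ} (hn : ∑ i, n i = 0) (h0 : ∀ i, n i ≠ 0) :
    Complex.I * phase β lam n * sigma3 β lam m (fun i => freq lam (n i)) =
      -M3 m (fun i => freq lam (n i)) := by
  have hk : freq lam (n 0) + freq lam (n 1) + freq lam (n 2) = 0 := by
    rw [← freq_add, ← freq_add, ← Fin.sum_univ_three, hn]; simp [freq]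
  rw [← resonance_freq, sigma3]
  refine mul_div_cancel₀ _ ?_
  rw [resonance_three (k := fun i => freq lam (n i)) hk]
  have hδ : 0 < lam⁻¹ := inv_pos.2 hlam
  have hf : ∀ i, 0 < |freq lam (n i)| := fun i => hδ.trans_le (le_abs_freq hlam (h0 i))
  have hQ := quadFactor_ge (abs_lowOrder_le (lam := lam) hβ) hδ (le_abs_freq hlam (h0 0))
    (le_abs_freq hlam (h0 1))
  have := abs_pos.1 (hf 0); have := abs_pos.1 (hf 1); have := abs_pos.1 (hf 2)
  have hQ0 : quadFactor (lowOrder β lam) (freq lam (n 0)) (freq lam (n 1)) ≠ 0 :=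
    (lt_of_lt_of_le (by positivity) hQ).ne'
  exact mul_ne_zero Complex.I_ne_zero (Complex.ofReal_ne_zero.2
    (by simp only [ne_eq, mul_eq_zero, not_or]; tauto))

/-- Where the resonance function vanishes the quotient gives no information, but there `M_4`
vanishes too: the quartic factor is positive, so two frequencies cancel and `quartNum_eq_zero`
applies. -/
lemma resonance_mul_sigma4 (hm : ∀ x, m (-x) = m x) (hlam : 0 < lam)
    (hβ : β = -1 ∨ β = 0 ∨ β = 1) {n : Fin 4 → ℤ} (hn : ∑ i, n i = 0) (h0 : ∀ i, n i ≠ 0) :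
    Complex.I * phase β lam n * sigma4 β lam m (fun i => freq lam (n i)) =
      -M4 β lam m (fun i => freq lam (n i)) := by
  have hk : freq lam (n 0) + freq lam (n 1) + freq lam (n 2) + freq lam (n 3) = 0 := by
    rw [← freq_add, ← freq_add, ← freq_add, ← Fin.sum_univ_four, hn]; simp [freq]
  rw [← resonance_freq, sigma4]
  rcases eq_or_ne (resonance β lam fun i => freq lam (n i)) 0 with hr | hr
  · rw [hr, zero_mul, M4_eq hm (k := fun i => freq lam (n i)) hk]
    rw [resonance_four (k := fun i => freq lam (n i)) hk] at hr
    have hδ : 0 < lam⁻¹ := inv_pos.2 hlam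
    have hf : 0 < freq lam (n 0) ^ 2 := by
      have := abs_pos.1 (hδ.trans_le (le_abs_freq hlam (h0 0))); positivity
    have hQ := quartFactor_ge (a := freq lam (n 0)) (y := freq lam (n 3))
      (abs_lowOrder_le (lam := lam) hβ) hδ (le_abs_freq hlam (h0 1)) (le_abs_freq hlam (h0 2))
    have hQ0 := (hf.trans_le hQ).ne'
    generalize freq lam (n 0) = a at *
    generalize freq lam (n 1) = b at *
    generalize freq lam (n 2) = x at *
    generalize freq lam (n 3) = y at *
    have h1 : (a + b) * (a + x) * (a + y) = 0 := by
      have := (mul_eq_zero.1 hr).resolve_left Complex.I_ne_zero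
      exact (mul_eq_zero.1 (Complex.ofReal_eq_zero.1 this)).resolve_right hQ0
    have h2 : quartNum (lowOrder β lam) m a b x y = 0 := by
      rcases mul_eq_zero.1 h1 with h3 | h3
      · rcases mul_eq_zero.1 h3 with h4 | h4
        · rw [show b = -a by linarith, show y = -x by linarith]; exact quartNum_eq_zero hm _ _ _
        · rw [quartNum_swap_mid, show x = -a by linarith, show y = -b by linarith]
          exact quartNum_eq_zero hm _ _ _
      · rw [quartNum_swap_right, quartNum_swap_mid, show y = -a by linarith,
          show x = -b by linarith]
        exact quartNum_eq_zero hm _ _ _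
    rw [h2]; simp
  · exact mul_div_cancel₀ _ hr

/-! ### The weight of the quintic term -/

/-- The dispersion relation in terms of the constant `c = 3 β lam⁻²`. -/
noncomputable def quinticPoly (c k : ℝ) : ℝ := k ^ 5 + c / 3 * k ^ 3

lemma dispersion_eq (β lam k : ℝ) : dispersion β lam k = quinticPoly (lowOrder β lam) k := by
  simp only [dispersion, quinticPoly, lowOrder]; ring

lemma quinticPoly_pair (c a b : ℝ) : quinticPoly c a + quinticPoly c b - quinticPoly c (a + b) =
    -(a * b * (a + b) * quadFactor c a b) := by
  simp only [quinticPoly, quadFactor]; ring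

lemma quinticPoly_four (c : ℝ) {a b x y : ℝ} (hs : a + b + x + y = 0) :
    quinticPoly c a + quinticPoly c b + quinticPoly c x + quinticPoly c y =
      (a + b) * (a + x) * (a + y) * quartFactor c a b x y := by
  have h2 : y = -(a + b + x) := by linarith
  simp only [quinticPoly, quartFactor, h2]; ring

lemma quinticPoly_neg (c k : ℝ) : quinticPoly c (-k) = -quinticPoly c k := by
  simp only [quinticPoly]; ring

lemma le_abs_quinticPoly_pair {c δ a b : ℝ} (hc : |c| ≤ 3 * δ ^ 2) (hδ : 0 < δ) (ha : δ ≤ |a|)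
    (hb : δ ≤ |b|) : |a| * |b| * |a + b| * (a ^ 2 + b ^ 2) ≤
      |quinticPoly c a + quinticPoly c b - quinticPoly c (a + b)| := by
  have hQ := quadFactor_ge hc hδ ha hb
  have : 0 ≤ a ^ 2 + b ^ 2 := by positivity
  rw [quinticPoly_pair, abs_neg, abs_mul, abs_mul, abs_mul, abs_of_nonneg (this.trans hQ)]
  gcongr

lemma one_le_rbracket_sq (x : ℝ) : |x| ≤ rbracket x ^ 2 := by
  rw [sq_rbracket]; exact abs_le_bracket x

/-- Gains of `⟨Ω⟩^{1/2}` are proved after squaring, where `Ω` enters as a polynomial. -/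
lemma le_mul_rbracket {y A x : ℝ} (hA : 0 ≤ A) (h : y ^ 2 ≤ A ^ 2 * |x|) :
    y ≤ A * rbracket x := by
  refine abs_le_of_sq_le_sq' ?_ (mul_nonneg hA (rbracket_pos x).le) |>.2
  rw [mul_pow]
  exact h.trans (mul_le_mul_of_nonneg_left (one_le_rbracket_sq x) (sq_nonneg A))

/-- The square summable weight `max(1, |k|)^{-2/3}`. -/
noncomputable def decay (k : ℝ) : ℝ := (max 1 |k|) ^ (-(2 / 3) : ℝ)

lemma decay_pos (k : ℝ) : 0 < decay k := Real.rpow_pos_of_pos (by positivity) _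

lemma le_decay {T k : ℝ} (hT : 1 ≤ T) (hk : |k| ≤ T) : T ^ (-(2 / 3) : ℝ) ≤ decay k :=
  Real.rpow_le_rpow_of_nonpos (by positivity) (max_le hT hk) (by norm_num)

/-- The exponent `2/3` is forced from one side by `3 · 2/3 = 2`, so that two spare powers of the
frequency pay for three weights; it is admissible since `2 · 2/3 > 1` gives square summability. -/
lemma inv_sq_le_decay {T x y z : ℝ} (hT : 1 ≤ T) (hx : |x| ≤ T) (hy : |y| ≤ T) (hz : |z| ≤ T) :
    1 / T ^ 2 ≤ decay x * decay y * decay z := by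
  have hT0 : 0 < T := by linarith
  have : 1 / T ^ 2 = T ^ (-(2 / 3) : ℝ) * T ^ (-(2 / 3) : ℝ) * T ^ (-(2 / 3) : ℝ) := by
    rw [← Real.rpow_add hT0, ← Real.rpow_add hT0, one_div, ← Real.rpow_natCast, ← Real.rpow_neg hT0.le]
    norm_num
  rw [this]
  have h0 : 0 ≤ T ^ (-(2 / 3) : ℝ) := Real.rpow_nonneg hT0.le _
  have hx' := le_decay hT hx
  have hy' := le_decay hT hy
  have hz' := le_decay hT hz
  have := (decay_pos x).le
  have := (mul_pos (decay_pos x) (decay_pos y)).le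
  gcongr

section

variable {N D c δ : ℝ} {m : ℝ → ℝ}

/-- The resonance functions compared, when the two last frequencies nearly cancel. -/
lemma mul_le_of_resonance {N c δ k1 k2 k3 k4 k5 X M1 : ℝ} (hc : |c| ≤ 3 * δ ^ 2) (hδ : 0 < δ)
    (hs : k1 + k2 + k3 + (k4 + k5) = 0) (h1 : δ ≤ |k1|) (h4 : δ ≤ |k4|) (h5 : δ ≤ |k5|)
    (h21 : |k2| ≤ |k1|) (h32 : |k3| ≤ |k2|) (hκ : |k4 + k5| ≤ |k2|) (hN : 1 ≤ N)
    (hNX : N ≤ X) (h3X : |k3| ≤ X) (hκX : |k4 + k5| ≤ X) (hNM : N ≤ M1) (h1M : |k1| ≤ M1) :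
    |k4 + k5| * (max N |k4| * max N |k5|) ≤ 17 * M1 ^ 2 * X *
      rbracket (quinticPoly c k1 + quinticPoly c k2 + quinticPoly c k3 + quinticPoly c k4 +
        quinticPoly c k5) := by
  wlog h54 : |k5| ≤ |k4| generalizing k4 k5
  · rw [add_comm k4 k5, mul_comm (max N |k4|), add_right_comm _ (quinticPoly c k4)]
    exact this (by linarith) h5 h4 (by rwa [add_comm]) (by rwa [add_comm]) (le_of_not_ge h54)
  set Ω := quinticPoly c k1 + quinticPoly c k2 + quinticPoly c k3 + quinticPoly c k4 +
        quinticPoly c k5 with hΩ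
  have hrb := one_le_rbracket Ω
  have hκ0 := abs_nonneg (k4 + k5)
  have hM1 : 0 < M1 := by linarith
  have hX0 : 0 < X := by linarith
  -- If `|k4|` does not exceed the other frequencies substantially, no gain from the resonance is
  -- needed.
  rcases le_or_gt |k4| (4 * M1) with hb | hb
  · have e4 : max N |k4| ≤ 4 * M1 := max_le (by linarith) hb
    have e5 : max N |k5| ≤ 4 * M1 := max_le (by linarith) (h54.trans hb)
    calc |k4 + k5| * (max N |k4| * max N |k5|) ≤ X * ((4 * M1) * (4 * M1)) := by gcongr
      _ ≤ 17 * M1 ^ 2 * X * 1 := by nlinarith only [mul_nonneg (sq_nonneg M1) hX0.le]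
      _ ≤ _ := by gcongr
  set l := |k4| with hl
  have hl0 : 0 < l := by linarith
  have e4 : max N |k4| ≤ l := max_le (by linarith) le_rfl
  have e5 : max N |k5| ≤ l := max_le (by linarith) h54
  have hk5 : 3 * l / 4 ≤ |k5| := by
    have := abs_sub_abs_le_abs_sub k4 (k4 + k5)
    rw [show k4 - (k4 + k5) = -k5 by ring, abs_neg] at this
    linarith
  refine (mul_le_mul_of_nonneg_left (mul_le_mul e4 e5 (by positivity) hl0.le) hκ0).trans ?_
  have hp3 := le_abs_quinticPoly_pair hc hδ h4 h5
  set P3 := quinticPoly c k4 + quinticPoly c k5 - quinticPoly c (k4 + k5) with hP3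
  have hp3' : 3 / 4 * l ^ 4 * |k4 + k5| ≤ |P3| := by
    refine le_trans ?_ hp3
    rw [← sq_abs k4, ← hl]
    calc 3 / 4 * l ^ 4 * |k4 + k5| ≤ l * (3 * l / 4) * |k4 + k5| * (l ^ 2 + (3 * l / 4) ^ 2) := by
          nlinarith only [mul_nonneg (pow_nonneg hl0.le 4) hκ0]
      _ ≤ _ := by rw [← sq_abs k5]; gcongr
  set P4 := quinticPoly c k1 + quinticPoly c k2 + quinticPoly c k3 + quinticPoly c (k4 + k5) with hP4
  have hsum : Ω = P4 + P3 := by rw [hΩ, hP3, hP4]; ring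
  have hκ1 : |k4 + k5| ≤ |k1| := hκ.trans h21
  have h31 : |k3| ≤ |k1| := h32.trans h21
  have hsqk : ∀ z : ℝ, |z| ≤ |k1| → z ^ 2 ≤ |k1| ^ 2 := fun z hz => by
    rw [← sq_abs z]; gcongr
  have hp4 : |P4| ≤ 104 * |k1| ^ 4 * X := by
    rw [hP4, quinticPoly_four c hs, abs_mul, abs_mul, abs_mul]
    have a1 : |k1 + k2| ≤ 2 * X := by
      rw [show k1 + k2 = -(k3 + (k4 + k5)) by linarith, abs_neg]
      exact (abs_add_le _ _).trans (by linarith)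
    have a2 : |k1 + k3| ≤ 2 * |k1| := (abs_add_le _ _).trans (by linarith)
    have a3 : |k1 + (k4 + k5)| ≤ 2 * |k1| := (abs_add_le _ _).trans (by linarith)
    have a4 : |quartFactor c k1 k2 k3 (k4 + k5)| ≤ 13 * |k1| ^ 2 := by
      have hδ2 : δ ^ 2 ≤ |k1| ^ 2 := by gcongr
      rw [quartFactor]
      refine (abs_add_le _ _).trans ?_
      rw [abs_of_nonneg (by positivity)]
      linarith [hsqk _ h21, hsqk _ h31, hsqk _ hκ1, hsqk k1 le_rfl]
    calc _ ≤ 2 * X * (2 * |k1|) * (2 * |k1|) * (13 * |k1| ^ 2) := by gcongr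
      _ = _ := by ring
  -- `P3` is the resonance of splitting off `k4, k5`, and `P4` is that of the four merged
  -- frequencies. If `P3` dominates, `Ω` inherits its size `l⁴ |k4 + k5|`. If not, this size is
  -- already bounded by that of `P4`, and the claim holds without `Ω`.
  rcases le_or_gt (2 * |P4|) |P3| with h | h
  · have hΩ' : 3 / 8 * l ^ 4 * |k4 + k5| ≤ |Ω| := by
      have := abs_sub_abs_le_abs_sub P3 (-P4)
      rw [abs_neg, sub_neg_eq_add, add_comm P3, ← hsum] at this
      linarith
    have : |k4 + k5| * (l * l) ≤ (2 * M1 ^ 2 * X) * rbracket Ω := by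
      refine le_mul_rbracket (by positivity) ?_
      have h1 : (|k4 + k5| * (l * l)) ^ 2 = |k4 + k5| * (8 / 3) * (3 / 8 * l ^ 4 * |k4 + k5|) := by
        ring
      have hX1 : 1 ≤ X := hN.trans hNX
      have hM11 : 1 ≤ M1 := hN.trans hNM
      rw [h1]
      calc _ ≤ X * (8 / 3) * |Ω| := by gcongr
        _ ≤ _ := by
          gcongr
          have : 1 ≤ M1 ^ 4 := one_le_pow₀ hM11
          nlinarith only [mul_le_mul_of_nonneg_left hX1 hX0.le, this, sq_nonneg X,
            mul_le_mul_of_nonneg_left this (sq_nonneg X)]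
    refine this.trans ?_
    gcongr; norm_num
  · have h1 : 3 / 4 * l ^ 4 * |k4 + k5| ≤ 208 * |k1| ^ 4 * X := by linarith
    have h2 : |k4 + k5| * (l * l) ≤ 17 * M1 ^ 2 * X := by
      refine abs_le_of_sq_le_sq' ?_ (by positivity) |>.2
      calc (|k4 + k5| * (l * l)) ^ 2 = |k4 + k5| * (4 / 3) * (3 / 4 * l ^ 4 * |k4 + k5|) := by ring
        _ ≤ X * (4 / 3) * (208 * |k1| ^ 4 * X) := by gcongr
        _ ≤ X * (4 / 3) * (208 * M1 ^ 4 * X) := by gcongr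
        _ ≤ _ := by nlinarith only [mul_nonneg (sq_nonneg X) (sq_nonneg (M1 ^ 2))]
    refine h2.trans (le_mul_of_one_le_right (by positivity) hrb)

/-- The weight of the quintic term, when the two last frequencies nearly cancel. -/
lemma IsNice.quintic_weight_le_of_small (h : IsNice N D m) (hc : |c| ≤ 3 * δ ^ 2) (hδ : 0 < δ)
    {k1 k2 k3 k4 k5 : ℝ} (hs : k1 + k2 + k3 + (k4 + k5) = 0) (h1 : δ ≤ |k1|) (h2 : δ ≤ |k2|)
    (h3 : δ ≤ |k3|) (h4 : δ ≤ |k4|) (h5 : δ ≤ |k5|) (hκ0 : δ ≤ |k4 + k5|) (h21 : |k2| ≤ |k1|)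
    (h32 : |k3| ≤ |k2|) (hκ : |k4 + k5| ≤ |k2|) :
    quartSymbol c m k1 k2 k3 (k4 + k5) * |k4 + k5| *
      (max N |k1| * max N |k2| * max N |k3| * (max N |k4| * max N |k5|)) ≤
      2 ^ 51 * (D + 1) * rbracket (quinticPoly c k1 + quinticPoly c k2 + quinticPoly c k3 +
        quinticPoly c k4 + quinticPoly c k5) * (decay k3 * decay (k4 + k5) * decay (k4 + k5)) := by
  have hN := h.one_le_scale
  have hD := h.one_le
  set X := max (max N |k3|) |k4 + k5| with hX
  have hNX : N ≤ X := (le_max_left _ _).trans (le_max_left _ _)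
  have h3X : |k3| ≤ X := (le_max_right _ _).trans (le_max_left _ _)
  have hM3X : max N |k3| ≤ X := le_max_left _ _
  have hκX : |k4 + k5| ≤ X := le_max_right _ _
  have hX0 : 0 < X := by linarith
  set M1 := max N |k1| with hM1
  have hM10 : 0 < M1 := lt_of_lt_of_le (by linarith) (le_max_left _ _)
  have hS : quartSymbol c m k1 k2 k3 (k4 + k5) ≤ 2 ^ 46 * (D + 1) / (M1 ^ 4 * X ^ 4) := by
    -- `X` is the third largest argument of `σ_4`, cut off at `N`; it may be `k3` or the sum `k4 +
    -- k5`.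
    have hX' : X = max N |k3| ∨ X = max N |k4 + k5| := by
      rcases le_total |k3| |k4 + k5| with hh | hh
      · right; rw [hX, max_assoc, max_eq_right hh]
      · left; rw [hX, max_assoc, max_eq_left hh]
    rcases hX' with e | e <;> rw [e]
    · exact h.quartSymbol_le hc hδ hs h1 h2 h3 hκ0 (h32.trans h21) h32
    · rw [quartSymbol_swap_right]
      exact h.quartSymbol_le hc hδ (by linarith) h1 h2 hκ0 h3 (hκ.trans h21) hκ
  have key := mul_le_of_resonance (N := N) (X := X) (M1 := M1) hc hδ hs h1 h4 h5 h21 h32 hκ hN hNX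
    h3X hκX (le_max_left _ _) (le_max_right _ _)
  set R := rbracket (quinticPoly c k1 + quinticPoly c k2 + quinticPoly c k3 + quinticPoly c k4 +
        quinticPoly c k5) with hR
  have hR0 : 0 < R := rbracket_pos _
  have hM2 : max N |k2| ≤ M1 := max_le_max le_rfl h21
  have hM20 : 0 ≤ max N |k2| := by positivity
  have hM30 : 0 ≤ max N |k3| := by positivity
  have hM45 : 0 ≤ |k4 + k5| * (max N |k4| * max N |k5|) := by positivity
  -- The powers of `M1` balance exactly, and of the four powers of `1 / X` in the bound for `σ_4`
  -- two are left over.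
  have hdec := inv_sq_le_decay (hN.trans hNX) h3X hκX hκX
  calc _ = quartSymbol c m k1 k2 k3 (k4 + k5) * (M1 * max N |k2| * max N |k3| *
        (|k4 + k5| * (max N |k4| * max N |k5|))) := by ring
    _ ≤ 2 ^ 46 * (D + 1) / (M1 ^ 4 * X ^ 4) * (M1 * M1 * X * (17 * M1 ^ 2 * X * R)) := by
        gcongr
    _ = 17 * 2 ^ 46 * (D + 1) * R * (1 / X ^ 2) := by field_simp
    _ ≤ 2 ^ 51 * (D + 1) * R * (decay k3 * decay (k4 + k5) * decay (k4 + k5)) := by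
        gcongr; norm_num

set_option maxHeartbeats 1000000 in
/-- The weight of the quintic term, when the two last frequencies do not cancel. -/
lemma IsNice.quintic_weight_le_of_large (h : IsNice N D m) (hc : |c| ≤ 3 * δ ^ 2) (hδ : 0 < δ)
    {k1 k2 k3 k4 k5 : ℝ} (hs : k1 + k2 + k3 + (k4 + k5) = 0) (h1 : δ ≤ |k1|) (h2 : δ ≤ |k2|)
    (h3 : δ ≤ |k3|) (h4 : δ ≤ |k4|) (h5 : δ ≤ |k5|) (hκ0 : δ ≤ |k4 + k5|) (h21 : |k2| ≤ |k1|)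
    (h32 : |k3| ≤ |k2|) (hκ : |k2| ≤ |k4 + k5|) (h54 : |k5| ≤ |k4|) :
    quartSymbol c m k1 k2 k3 (k4 + k5) * |k4 + k5| *
      (max N |k1| * max N |k2| * max N |k3| * (max N |k4| * max N |k5|)) ≤
      2 ^ 88 * (D + 1) * rbracket (quinticPoly c k1 + quinticPoly c k2 + quinticPoly c k3 +
        quinticPoly c k4 + quinticPoly c k5) *
        (decay k2 * decay k3 * decay k5 + decay k1 * decay k2 * decay k3) := by
  have hN := h.one_le_scale
  have hD := h.one_le
  have hS : quartSymbol c m k1 k2 k3 (k4 + k5) ≤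
      2 ^ 46 * (D + 1) / (max N |k1| ^ 4 * max N |k2| ^ 4) := by
    rw [quartSymbol_swap_right, quartSymbol_swap_mid]
    exact h.quartSymbol_le hc hδ (by linarith) h1 hκ0 h2 h3 h21 hκ
  have hrb := one_le_rbracket (quinticPoly c k1 + quinticPoly c k2 + quinticPoly c k3 +
        quinticPoly c k4 + quinticPoly c k5)
  set Ω := quinticPoly c k1 + quinticPoly c k2 + quinticPoly c k3 + quinticPoly c k4 +
        quinticPoly c k5 with hΩ
  have hd1 := decay_pos k1; have hd2 := decay_pos k2; have hd3 := decay_pos k3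
  have hd5 := decay_pos k5
  set M1 := max N |k1| with hM1
  set M2 := max N |k2| with hM2
  set M3 := max N |k3| with hM3
  set M4 := max N |k4| with hM4
  set M5 := max N |k5| with hM5
  have hNM1 : N ≤ M1 := le_max_left _ _
  have hn1 : |k1| ≤ M1 := le_max_right _ _
  have hn2 : |k2| ≤ M2 := le_max_right _ _
  have hn3 : |k3| ≤ M3 := le_max_right _ _
  have hn5 : |k5| ≤ M5 := le_max_right _ _
  have hM21 : M2 ≤ M1 := max_le_max le_rfl h21
  have hM32 : M3 ≤ M2 := max_le_max le_rfl h32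
  have hM11 : 1 ≤ M1 := hN.trans hNM1
  have hM22 : 1 ≤ M2 := hN.trans (le_max_left _ _)
  have hM33 : 1 ≤ M3 := hN.trans (le_max_left _ _)
  have hM44 : 1 ≤ M4 := hN.trans (le_max_left _ _)
  have hM55 : 1 ≤ M5 := hN.trans (le_max_left _ _)
  have hκ1 : |k4 + k5| ≤ 3 * |k1| := by
    rw [show k4 + k5 = -(k1 + k2 + k3) by linarith, abs_neg]
    have := abs_add_le (k1 + k2) k3; have := abs_add_le k1 k2; linarith
  have h1κ : |k1| ≤ 3 * |k4 + k5| := by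
    rw [show k1 = -(k2 + k3 + (k4 + k5)) by linarith, abs_neg]
    have := abs_add_le (k2 + k3) (k4 + k5); have := abs_add_le k2 k3; linarith
  have h4κ : |k4 + k5| ≤ 2 * |k4| := (abs_add_le _ _).trans (by linarith)
  -- With the bound for `σ_4` inserted, each case below has to find a scale `T` dominating three
  -- frequencies. The constant `2 ^ 42` is what remains of `2 ^ 88` after the `2 ^ 46` of `σ_4`.
  have red : ∀ T A d : ℝ, 1 ≤ T → 0 ≤ A → A ≤ 2 ^ 42 → 1 / T ^ 2 ≤ d → |k4 + k5| * M3 * (M4 * M5) ≤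
      A * rbracket Ω * (M1 ^ 3 * M2 ^ 3 * (1 / T ^ 2)) →
      quartSymbol c m k1 k2 k3 (k4 + k5) * |k4 + k5| * (M1 * M2 * M3 * (M4 * M5)) ≤
        2 ^ 88 * (D + 1) * rbracket Ω * d := by
    intro T A d hT hA0 hA hd hle
    have hd0 : 0 ≤ d := le_trans (by positivity) hd
    calc _ = quartSymbol c m k1 k2 k3 (k4 + k5) * (M1 * M2 * (|k4 + k5| * M3 * (M4 * M5))) := by ring
      _ ≤ 2 ^ 46 * (D + 1) / (M1 ^ 4 * M2 ^ 4) *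
          (M1 * M2 * (A * rbracket Ω * (M1 ^ 3 * M2 ^ 3 * (1 / T ^ 2)))) := by gcongr
      _ = 2 ^ 46 * (D + 1) * A * rbracket Ω * (1 / T ^ 2) := by field_simp
      _ ≤ 2 ^ 46 * (D + 1) * 2 ^ 42 * rbracket Ω * d := by gcongr
      _ = _ := by ring
  rw [mul_add]
  have hR0 : 0 ≤ 2 ^ 88 * (D + 1) * rbracket Ω := by positivity
  have hA0 : 0 ≤ decay k2 * decay k3 * decay k5 := by positivity
  have hB0 : 0 ≤ decay k1 * decay k2 * decay k3 := by positivity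
  have hA0' := mul_nonneg hR0 hA0
  have hB0' := mul_nonneg hR0 hB0
  rcases le_or_gt |k4| (16 * M1) with hb | hb
  · have hM4 : M4 ≤ 16 * M1 := max_le (by linarith) hb
    have hM5 : M5 ≤ 16 * M1 := max_le (by linarith) (h54.trans hb)
    refine le_add_of_le_of_nonneg ?_ hB0'
    -- If `k5` is not much larger than `k2`, the multiplier alone suffices, with `T` a multiple of
    -- `M2`.
    rcases le_or_gt M5 (2 ^ 12 * M2) with hc5 | hc5
    · refine red (2 ^ 12 * M2) (48 * 2 ^ 36) _ (by linarith) (by norm_num) (by norm_num)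
        (inv_sq_le_decay (by linarith) (by linarith) (by linarith) (by linarith)) ?_
      calc |k4 + k5| * M3 * (M4 * M5) ≤ 3 * M1 * M2 * ((16 * M1) * (2 ^ 12 * M2)) := by
            gcongr; linarith
        _ = 48 * 2 ^ 36 * 1 * (M1 ^ 2 * M2 ^ 2 * M2 * (1 / (2 ^ 24 * M2))) := by field_simp; ring
        _ ≤ 48 * 2 ^ 36 * rbracket Ω * (M1 ^ 2 * M2 ^ 2 * M1 * (1 / (2 ^ 24 * M2))) := by gcongr
        _ = _ := by field_simp
    · have hk5 : M5 = |k5| := max_eq_right (le_of_lt (by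
        by_contra hcon
        have : M5 = N := max_eq_left (not_lt.1 hcon)
        have : N ≤ M2 := le_max_left _ _
        linarith))
      have hk1 : M1 = |k1| := max_eq_right (le_of_lt (by
        by_contra hcon
        have : M1 = N := max_eq_left (not_lt.1 hcon)
        have : N ≤ M2 := le_max_left _ _
        linarith))
      -- Merge `k2, k3` instead: the four frequencies `k1, k4, k5, k2 + k3` have resonance at least
      -- `|k5| |k1|⁴ / 72`. The correction for the merging is at most `36 |k2| |k1|⁴`, and the
      -- threshold `2 ^ 12` makes it smaller while leaving room for `|Ω| ≥ |k1|⁴`.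
      have hR : |k1| ^ 2 ≤ 1 * rbracket Ω := by
        refine le_mul_rbracket zero_le_one ?_
        have hn25 : 2 ^ 12 * |k2| ≤ |k5| := by rw [← hk5]; linarith
        have h15 : (2 ^ 12 : ℝ) ≤ |k5| := by rw [← hk5]; linarith
        have hn10 := abs_nonneg k1; have hn20 := abs_nonneg k2; have hn50 := abs_nonneg k5
        have hz : |k2 + k3| ≤ 2 * |k2| := (abs_add_le _ _).trans (by linarith)
        have e1 := quinticPoly_four c (a := k1) (b := k4) (x := k5) (y := k2 + k3) (by linarith)
        have e2 := quinticPoly_pair c k2 k3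
        set PA := quinticPoly c k1 + quinticPoly c k4 + quinticPoly c k5 + quinticPoly c (k2 + k3)
          with hPA
        set PB := quinticPoly c k2 + quinticPoly c k3 - quinticPoly c (k2 + k3) with hPB
        have hsum : Ω = PA + PB := by rw [hΩ, hPA, hPB]; ring
        have hlow : |k5| * |k1| ^ 4 / 72 ≤ |PA| := by
          have a1 : |k5| / 2 ≤ |k1 + k4| := by
            have := abs_sub_abs_le_abs_sub k5 (-(k2 + k3))
            rw [abs_neg, sub_neg_eq_add] at this
            rw [show k1 + k4 = -(k5 + (k2 + k3)) by linarith, abs_neg]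
            linarith
          have a2 : |k1| / 12 ≤ |k1 + k5| := by
            have := abs_sub_abs_le_abs_sub k4 (-(k2 + k3))
            rw [abs_neg, sub_neg_eq_add] at this
            rw [show k1 + k5 = -(k4 + (k2 + k3)) by linarith, abs_neg]
            linarith
          have a3 : |k1| / 3 ≤ |k1 + (k2 + k3)| := by
            rw [show k1 + (k2 + k3) = -(k4 + k5) by linarith, abs_neg]; linarith
          have a4 : |k1| ^ 2 ≤ |quartFactor c k1 k4 k5 (k2 + k3)| := by
            rw [sq_abs]
            exact (quartFactor_ge hc hδ h4 h5).trans (le_abs_self _)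
          rw [e1, abs_mul, abs_mul, abs_mul]
          calc |k5| * |k1| ^ 4 / 72 = |k5| / 2 * (|k1| / 12) * (|k1| / 3) * |k1| ^ 2 := by ring
            _ ≤ _ := by gcongr
        have hup : |PB| ≤ 36 * |k1| ^ 4 * |k2| := by
          rw [e2, abs_neg, abs_mul, abs_mul, abs_mul]
          have hq : |quadFactor c k2 k3| ≤ 18 * |k2| ^ 2 := by
            have hδ2 : δ ^ 2 ≤ |k2| ^ 2 := by gcongr
            have h33 : |k3| ^ 2 ≤ |k2| ^ 2 := by gcongr
            have h23 : |k2 * k3| ≤ |k2| ^ 2 := by rw [abs_mul, sq]; gcongr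
            have h23' := abs_le.1 h23
            have hcc := abs_le.1 hc
            rw [sq_abs k3] at h33
            rw [quadFactor, abs_le]
            constructor <;> nlinarith only [h23'.1, h23'.2, hcc.1, hcc.2, h33, hδ2, sq_nonneg k3,
              sq_nonneg k2, sq_abs k2]
          calc _ ≤ |k2| * |k2| * (2 * |k2|) * (18 * |k2| ^ 2) := by gcongr
            _ = 36 * |k2| ^ 4 * |k2| := by ring
            _ ≤ _ := by gcongr
        have hup' : |PB| ≤ 36 / 2 ^ 12 * (|k5| * |k1| ^ 4) := by
          calc _ ≤ 36 * |k1| ^ 4 * |k2| := hup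
            _ = 36 / 2 ^ 12 * (2 ^ 12 * |k2| * |k1| ^ 4) := by ring
            _ ≤ _ := by gcongr
        have htri := abs_sub_abs_le_abs_sub PA (-PB)
        rw [abs_neg, sub_neg_eq_add, ← hsum] at htri
        have h16 : 2 ^ 12 * |k1| ^ 4 ≤ |k5| * |k1| ^ 4 := by gcongr
        have h17 : 0 ≤ |k1| ^ 4 := by positivity
        rw [show (|k1| ^ 2) ^ 2 = |k1| ^ 4 by ring]
        linarith
      rw [one_mul, ← hk1] at hR
      refine red (16 * M1) (768 * 256) _ (by linarith) (by norm_num) (by norm_num)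
        (inv_sq_le_decay (by linarith) (by linarith) (by linarith) (by linarith)) ?_
      calc |k4 + k5| * M3 * (M4 * M5) ≤ 3 * M1 * M2 * ((16 * M1) * (16 * M1)) := by
            gcongr; linarith
        _ = 768 * M1 ^ 2 * (M1 * M2 * 1) := by ring
        _ ≤ 768 * rbracket Ω * (M1 * M2 * M2 ^ 2) := by
            gcongr; exact one_le_pow₀ hM22
        _ = _ := by field_simp; ring
  · refine le_add_of_nonneg_of_le hA0' ?_
    have hn10 := abs_nonneg k1; have hn20 := abs_nonneg k2; have hκ00 := abs_nonneg (k4 + k5)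
    set l := |k4| with hl
    have hl0 : 0 < l := by linarith
    have hM4 : M4 ≤ l := max_le (by linarith) le_rfl
    have hM5 : M5 ≤ l := max_le (by linarith) h54
    have hk5 : 13 / 16 * l ≤ |k5| := by
      have := abs_sub_abs_le_abs_sub k4 (k4 + k5)
      rw [show k4 - (k4 + k5) = -k5 by ring, abs_neg] at this
      linarith
    -- Here `k4` and `k5` are far larger than `k1`, and the resonance `P3` of their interaction
    -- dominates that of the four merged frequencies.
    have hR : |k4 + k5| * l ^ 2 ≤ (3 * M1) * rbracket Ω := by
      refine le_mul_rbracket (by positivity) ?_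
      have hp3 := le_abs_quinticPoly_pair hc hδ h4 h5
      set P3 := quinticPoly c k4 + quinticPoly c k5 - quinticPoly c (k4 + k5) with hP3
      have hp3' : 13 / 16 * (|k4 + k5| * l ^ 4) ≤ |P3| := by
        refine le_trans ?_ hp3
        rw [← sq_abs k4, ← hl]
        calc 13 / 16 * (|k4 + k5| * l ^ 4) = l * (13 / 16 * l) * |k4 + k5| * (l ^ 2 + 0) := by ring
          _ ≤ _ := by gcongr; positivity
      have e4 := quinticPoly_four c hs
      set P4 := quinticPoly c k1 + quinticPoly c k2 + quinticPoly c k3 + quinticPoly c (k4 + k5)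
        with hP4
      have hsum : Ω = P3 + P4 := by rw [hΩ, hP3, hP4]; ring
      have hp4 : |P4| ≤ 264 * |k4 + k5| * |k1| ^ 4 := by
        rw [e4, abs_mul, abs_mul, abs_mul]
        have a1 : |k1 + k2| ≤ 2 * |k1| := (abs_add_le _ _).trans (by linarith)
        have a2 : |k1 + k3| ≤ 2 * |k1| := (abs_add_le _ _).trans (by linarith)
        have a3 : |k1 + (k4 + k5)| ≤ 2 * |k4 + k5| := by
          rw [show k1 + (k4 + k5) = -(k2 + k3) by linarith, abs_neg]
          exact (abs_add_le _ _).trans (by linarith)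
        have a4 : |quartFactor c k1 k2 k3 (k4 + k5)| ≤ 33 * |k1| ^ 2 := by
          have hδ2 : δ ^ 2 ≤ |k1| ^ 2 := by gcongr
          have b2 : k2 ^ 2 ≤ |k1| ^ 2 := by rw [← sq_abs k2]; gcongr
          have b3 : k3 ^ 2 ≤ |k1| ^ 2 := by
            rw [← sq_abs k3]; have := h32.trans h21; gcongr
          have b4 : (k4 + k5) ^ 2 ≤ 9 * |k1| ^ 2 := by
            rw [← sq_abs (k4 + k5)]
            calc |k4 + k5| ^ 2 ≤ (3 * |k1|) ^ 2 := by gcongr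
              _ = _ := by ring
          rw [quartFactor]
          refine (abs_add_le _ _).trans ?_
          rw [abs_of_nonneg (by positivity)]
          linarith [sq_abs k1]
        calc _ ≤ 2 * |k1| * (2 * |k1|) * (2 * |k4 + k5|) * (33 * |k1| ^ 2) := by gcongr
          _ = _ := by ring
      have hp4' : |P4| ≤ 1 / 4 * (|k4 + k5| * l ^ 4) := by
        have : |k1| ≤ l / 16 := by linarith
        calc |P4| ≤ 264 * |k4 + k5| * |k1| ^ 4 := hp4
          _ ≤ 264 * |k4 + k5| * (l / 16) ^ 4 := by gcongr
          _ ≤ _ := by nlinarith only [mul_nonneg hκ00 (pow_nonneg hl0.le 4)]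
      have htri := abs_sub_abs_le_abs_sub P3 (-P4)
      rw [abs_neg, sub_neg_eq_add, ← hsum] at htri
      have hX0 : 0 ≤ |k4 + k5| * l ^ 4 := by positivity
      have hΩl : |k4 + k5| * l ^ 4 ≤ 2 * |Ω| := by linarith
      calc (|k4 + k5| * l ^ 2) ^ 2 = |k4 + k5| * (|k4 + k5| * l ^ 4) := by ring
        _ ≤ 3 * M1 * (2 * |Ω|) := by gcongr; linarith
        _ ≤ _ := by nlinarith only [mul_le_mul_of_nonneg_right hM11
                      (mul_nonneg (zero_le_one.trans hM11) (abs_nonneg Ω)),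
                      mul_nonneg (zero_le_one.trans hM11) (abs_nonneg Ω)]
    refine red M1 3 _ (by linarith) (by norm_num) (by norm_num)
        (inv_sq_le_decay (by linarith) (by linarith) (by linarith) (by linarith)) ?_
    calc |k4 + k5| * M3 * (M4 * M5) ≤ |k4 + k5| * M2 * (l * l) := by gcongr
      _ = |k4 + k5| * l ^ 2 * (M2 * 1) := by ring
      _ ≤ 3 * M1 * rbracket Ω * (M2 * M2 ^ 2) := by
          gcongr; exact one_le_pow₀ hM22
      _ = _ := by field_simp

/-- The majorant of the weight of the quintic term. -/
noncomputable def quinticMajorant (k1 k2 k3 k4 k5 : ℝ) : ℝ :=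
  (decay k1 + decay k2 + decay k3) * (decay (k4 + k5) * decay (k4 + k5)) +
    (decay k1 * decay k2 * decay k3 +
      (decay k1 * decay k2 + decay k1 * decay k3 + decay k2 * decay k3) * (decay k4 + decay k5))

/-- The weight of the quintic term, where the first three frequencies are ordered. -/
lemma IsNice.quintic_weight_le_sorted (h : IsNice N D m) (hc : |c| ≤ 3 * δ ^ 2) (hδ : 0 < δ)
    {k1 k2 k3 k4 k5 : ℝ} (hs : k1 + k2 + k3 + (k4 + k5) = 0) (h1 : δ ≤ |k1|) (h2 : δ ≤ |k2|)
    (h3 : δ ≤ |k3|) (h4 : δ ≤ |k4|) (h5 : δ ≤ |k5|) (hκ0 : δ ≤ |k4 + k5|) (h21 : |k2| ≤ |k1|)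
    (h32 : |k3| ≤ |k2|) :
    quartSymbol c m k1 k2 k3 (k4 + k5) * |k4 + k5| *
      (max N |k1| * max N |k2| * max N |k3| * (max N |k4| * max N |k5|)) ≤
      2 ^ 88 * (D + 1) * rbracket (quinticPoly c k1 + quinticPoly c k2 + quinticPoly c k3 +
        quinticPoly c k4 + quinticPoly c k5) * quinticMajorant k1 k2 k3 k4 k5 := by
  have hD := h.one_le
  have hd1 := decay_pos k1; have hd2 := decay_pos k2; have hd3 := decay_pos k3
  have hd4 := decay_pos k4; have hd5 := decay_pos k5; have hdκ := decay_pos (k4 + k5)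
  have hrb := rbracket_pos (quinticPoly c k1 + quinticPoly c k2 + quinticPoly c k3 +
        quinticPoly c k4 + quinticPoly c k5)
  -- The cases differ in the third largest argument of `σ_4`: the larger of `k3` and `k4 + k5` in
  -- the first, `k2` in the second.
  rcases le_total |k4 + k5| |k2| with hκ | hκ
  · refine (h.quintic_weight_le_of_small hc hδ hs h1 h2 h3 h4 h5 hκ0 h21 h32 hκ).trans ?_
    have hle : decay k3 * decay (k4 + k5) * decay (k4 + k5) ≤ quinticMajorant k1 k2 k3 k4 k5 := by
      rw [quinticMajorant, ← sub_nonneg]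
      ring_nf
      positivity
    refine mul_le_mul ?_ hle (by positivity) (by positivity)
    refine mul_le_mul_of_nonneg_right ?_ hrb.le
    exact mul_le_mul_of_nonneg_right (by norm_num) (by linarith)
  rcases le_total |k5| |k4| with h54 | h54
  · refine (h.quintic_weight_le_of_large hc hδ hs h1 h2 h3 h4 h5 hκ0 h21 h32 hκ h54).trans ?_
    gcongr
    rw [quinticMajorant, ← sub_nonneg]
    ring_nf
    positivity
  · have := h.quintic_weight_le_of_large hc hδ (k4 := k5) (k5 := k4) (by linarith) h1 h2 h3 h5 h4
      (by rwa [add_comm]) h21 h32 (by rwa [add_comm]) h54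
    rw [add_comm k5 k4, mul_comm (max N |k5|), add_right_comm _ (quinticPoly c k5)] at this
    refine this.trans ?_
    gcongr
    rw [quinticMajorant, ← sub_nonneg]
    ring_nf
    positivity

/-- **The weight of the quintic term.** -/
theorem IsNice.quintic_weight_le (h : IsNice N D m) (hc : |c| ≤ 3 * δ ^ 2) (hδ : 0 < δ)
    {k1 k2 k3 k4 k5 : ℝ} (hs : k1 + k2 + k3 + (k4 + k5) = 0) (h1 : δ ≤ |k1|) (h2 : δ ≤ |k2|)
    (h3 : δ ≤ |k3|) (h4 : δ ≤ |k4|) (h5 : δ ≤ |k5|) (hκ0 : δ ≤ |k4 + k5|) :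
    quartSymbol c m k1 k2 k3 (k4 + k5) * |k4 + k5| *
      (max N |k1| * max N |k2| * max N |k3| * (max N |k4| * max N |k5|)) ≤
      2 ^ 88 * (D + 1) * rbracket (quinticPoly c k1 + quinticPoly c k2 + quinticPoly c k3 +
        quinticPoly c k4 + quinticPoly c k5) * quinticMajorant k1 k2 k3 k4 k5 := by
  have hswapR : ∀ k1 k2 k3 : ℝ, quinticMajorant k1 k2 k3 k4 k5 = quinticMajorant k1 k3 k2 k4 k5 := by
    intro k1 k2 k3; simp only [quinticMajorant]; ring
  have hswapL : ∀ k1 k2 k3 : ℝ, quinticMajorant k1 k2 k3 k4 k5 = quinticMajorant k2 k1 k3 k4 k5 := by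
    intro k1 k2 k3; simp only [quinticMajorant]; ring
  wlog h21 : |k2| ≤ |k1| generalizing k1 k2
  · have := this (by linarith) h2 h1 (le_of_not_ge h21)
    rwa [hswapL, quartSymbol_swap_left c m (by linarith), mul_comm (max N |k2|),
      add_comm (quinticPoly c k2)] at this
  rcases le_total |k3| |k2| with h32 | h32
  · exact h.quintic_weight_le_sorted hc hδ hs h1 h2 h3 h4 h5 hκ0 h21 h32
  rcases le_total |k3| |k1| with h31 | h31
  · have := h.quintic_weight_le_sorted hc hδ (k2 := k3) (k3 := k2) (by linarith) h1 h3 h2 h4 h5 hκ0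
      h31 h32
    rwa [hswapR, quartSymbol_swap_mid, mul_right_comm (max N |k1|),
      add_right_comm (quinticPoly c k1)] at this
  · have := h.quintic_weight_le_sorted hc hδ (k1 := k3) (k2 := k1) (k3 := k2) (by linarith) h3 h1 h2
      h4 h5 hκ0 h31 h21
    rwa [hswapL, hswapR, quartSymbol_swap_left c m (by linarith), quartSymbol_swap_mid,
      mul_comm (max N |k3|), mul_right_comm (max N |k1|), add_comm (quinticPoly c k3),
      add_right_comm (quinticPoly c k1)] at this

end

/-! ### Convolution sums -/

lemma tsum_snoc {l : ℕ} (F : (Fin (l + 1) → ℤ) → ℝ≥0∞) :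
    ∑' n, F n = ∑' n : Fin l → ℤ, ∑' j : ℤ, F (Fin.snoc n j) := by
  rw [← (snocPair l).tsum_eq]
  exact ENNReal.tsum_prod (f := fun n j => F (Fin.snoc n j))

lemma tsum_prod_pi (f : ℤ → ℝ≥0∞) (l : ℕ) :
    ∑' n : Fin l → ℤ, ∏ i, f (n i) = (∑' j, f j) ^ l := by
  induction l with
  | zero => rw [tsum_fintype]; simp
  | succ l ih =>
    rw [tsum_snoc]
    simp only [Fin.prod_univ_castSucc, Fin.snoc_castSucc, Fin.snoc_last, ENNReal.tsum_mul_left,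
      ENNReal.tsum_mul_right, ih, pow_succ]

lemma tsum_complete_comp_perm {l : ℕ} (σ : Equiv.Perm (Fin (l + 1)))
    (F : (Fin (l + 1) → ℤ) → ℝ≥0∞) :
    ∑' n : Fin l → ℤ, F (complete n ∘ σ) = ∑' n : Fin l → ℤ, F (complete n) := by
  rw [← (permFree σ).tsum_eq fun n => F (complete n)]
  simp only [complete_permFree]

lemma complete_snoc_castSucc {l : ℕ} (n : Fin l → ℤ) (j : ℤ) (i : Fin l) :
    complete (Fin.snoc n j : Fin (l + 1) → ℤ) i.castSucc.castSucc = n i := by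
  simp [complete]

lemma complete_snoc_last {l : ℕ} (n : Fin l → ℤ) (j : ℤ) :
    complete (Fin.snoc n j : Fin (l + 1) → ℤ) (Fin.last l).castSucc = j := by
  simp [complete]

lemma complete_snoc_last' {l : ℕ} (n : Fin l → ℤ) (j : ℤ) :
    complete (Fin.snoc n j : Fin (l + 1) → ℤ) (Fin.last (l + 1)) = -∑ i, n i - j := by
  simp [complete, Fin.sum_univ_castSucc]; ring

section

variable {a w : ℤ → ℝ≥0∞} {B Q W : ℝ≥0∞}

lemma tsum_mul_reflect_le (hB : ∑' n, a n ^ 2 ≤ B) (c : ℤ) : ∑' n, a n * a (c - n) ≤ 2 * B := by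
  have h1 : ∑' n, a (c - n) ^ 2 ≤ B := by
    rw [← (Equiv.subLeft c).tsum_eq] at hB; exact hB
  calc ∑' n, a n * a (c - n) ≤ ∑' n, (a n ^ 2 + a (c - n) ^ 2) := by
        refine ENNReal.tsum_le_tsum fun n => ?_
        rcases le_total (a n) (a (c - n)) with h | h
        · exact (mul_le_mul_left h _).trans (by rw [← sq]; exact le_add_self)
        · exact (mul_le_mul_right h _).trans (by rw [← sq]; exact le_self_add)
    _ = _ := ENNReal.tsum_add
    _ ≤ _ := by rw [two_mul]; exact add_le_add hB h1

/-- Cauchy–Schwarz for sequences. The bound is stated through `W * B ≤ Q ^ 2`, so that no square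
roots are taken in `ℝ≥0∞`. -/
lemma tsum_mul_le (hB : ∑' n, a n ^ 2 ≤ B) (hW : ∑' n, w n ^ 2 ≤ W) (hQ : W * B ≤ Q ^ 2) :
    ∑' n, w n * a n ≤ Q := by
  have := lintegral_mul_sq_le (μ := Measure.count) (f := w) (g := a)
    (measurable_of_countable _).aemeasurable (measurable_of_countable _).aemeasurable
  simp only [lintegral_count] at this
  have h2 := (this.trans (mul_le_mul' hW hB)).trans hQ
  exact (ENNReal.pow_le_pow_left_iff two_ne_zero).1 h2

/-- When the other frequencies are fixed, the last two run over `j` and `c - j` and are summed by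
square summability alone. Hence a form with `l + 2` arguments needs weights for only `l`
frequencies, three in the quintic case. -/
lemma tsum_complete_last_two_le (hB : ∑' n, a n ^ 2 ≤ B) {l : ℕ} (F : (Fin l → ℤ) → ℝ≥0∞) :
    ∑' n : Fin (l + 1) → ℤ, F (fun i => complete n i.castSucc.castSucc) *
      (a (complete n (Fin.last l).castSucc) * a (complete n (Fin.last (l + 1)))) ≤
      (∑' n, F n) * (2 * B) := by
  rw [tsum_snoc]
  simp only [complete_snoc_castSucc, complete_snoc_last, complete_snoc_last', ENNReal.tsum_mul_left]
  rw [← ENNReal.tsum_mul_right]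
  exact ENNReal.tsum_le_tsum fun n => mul_le_mul_right (tsum_mul_reflect_le hB _) _

lemma tsum_cubic_le (hB : ∑' n, a n ^ 2 ≤ B) (hW : ∑' n, w n ^ 2 ≤ W) (hQ : W * B ≤ Q ^ 2) :
    ∑' n : Fin 2 → ℤ, w (complete n 0) * ∏ i, a (complete n i) ≤ Q * (2 * B) := by
  have h := tsum_complete_last_two_le hB (l := 1) fun n => ∏ i, (w (n i) * a (n i))
  rw [tsum_prod_pi fun j => w j * a j, pow_one] at h
  refine le_trans (le_of_eq ?_) (h.trans (mul_le_mul_left (tsum_mul_le hB hW hQ) _))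
  refine tsum_congr fun n => ?_
  simp [Fin.prod_univ_three]
  ring

lemma tsum_quartic_le (hB : ∑' n, a n ^ 2 ≤ B) (hW : ∑' n, w n ^ 2 ≤ W) (hQ : W * B ≤ Q ^ 2) :
    ∑' n : Fin 3 → ℤ, w (complete n 0) * w (complete n 1) * ∏ i, a (complete n i) ≤
      Q ^ 2 * (2 * B) := by
  have h := tsum_complete_last_two_le hB (l := 2) fun n => ∏ i, (w (n i) * a (n i))
  rw [tsum_prod_pi fun j => w j * a j] at h
  have := tsum_mul_le hB hW hQ
  refine le_trans (le_of_eq ?_) (h.trans (mul_le_mul_left (pow_le_pow_left' this 2) _))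
  refine tsum_congr fun n => ?_
  simp [Fin.prod_univ_four, Fin.prod_univ_two]
  ring

/-- The weight at the sum of the last two frequencies equals a weight at `-(n 0 + n 1)` and is
paired with the coefficient at `n 1`. -/
lemma tsum_quartic_pair_le (hB : ∑' n, a n ^ 2 ≤ B) (hW : ∑' n, w n ^ 2 ≤ W)
    (hQ : W * B ≤ Q ^ 2) :
    ∑' n : Fin 3 → ℤ, w (complete n 0) * w (complete n 2 + complete n 3) *
      ∏ i, a (complete n i) ≤ Q ^ 2 * (2 * B) := by
  have h := tsum_complete_last_two_le hB (l := 2)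
    fun n => w (n 0) * a (n 0) * (a (n 1) * w (-(n 0 + n 1)))
  have h2 : ∑' n : Fin 2 → ℤ, w (n 0) * a (n 0) * (a (n 1) * w (-(n 0 + n 1))) ≤ Q ^ 2 := by
    rw [tsum_snoc]
    have h3 : ∀ n : Fin 1 → ℤ, ∑' j, a j * w (-(n 0 + j)) ≤ Q := by
      intro n
      have e : ∑' j, a (-(n 0 + j)) ^ 2 ≤ B := by
        rw [← ((Equiv.addLeft (n 0)).trans (Equiv.neg ℤ)).tsum_eq] at hB; exact hB
      rw [← ((Equiv.addLeft (n 0)).trans (Equiv.neg ℤ)).tsum_eq]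
      refine le_trans (le_of_eq (tsum_congr fun j => ?_)) (tsum_mul_le e hW hQ)
      simp [mul_comm]
    have h4 := tsum_prod_pi (fun j => w j * a j) 1
    simp only [Fin.prod_univ_one, pow_one] at h4
    calc _ ≤ ∑' n : Fin 1 → ℤ, w (n 0) * a (n 0) * Q := by
          refine ENNReal.tsum_le_tsum fun n => ?_
          have e0 : ∀ j, (Fin.snoc n j : Fin 2 → ℤ) 0 = n 0 := fun j => rfl
          have e1 : ∀ j, (Fin.snoc n j : Fin 2 → ℤ) 1 = j := fun j => rfl
          simp only [e0, e1, ENNReal.tsum_mul_left]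
          exact mul_le_mul_right (h3 n) _
      _ ≤ _ := by
          rw [ENNReal.tsum_mul_right, h4, sq]
          exact mul_le_mul_left (tsum_mul_le hB hW hQ) _
  refine le_trans (le_of_eq ?_) (h.trans (mul_le_mul_left h2 _))
  refine tsum_congr fun n => ?_
  have hs := sum_complete n
  rw [Fin.sum_univ_four] at hs
  have e : complete n 2 + complete n 3 = -(complete n 0 + complete n 1) := by omega
  simp [Fin.prod_univ_four, e]
  ring

/-- On the diagonal the four frequencies form two opposite pairs. Only two of them are free, and no
weight is needed. -/
lemma tsum_quartic_diag_le (hB : ∑' n, a n ^ 2 ≤ B) :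
    ∑' n : Fin 3 → ℤ, (if complete n 2 = -complete n 0 ∨ complete n 2 = -complete n 1 then
      ∏ i, a (complete n i) else 0) ≤ 2 * (2 * B) ^ 2 := by
  have hr : ∑' j, a j * a (-j) ≤ 2 * B := by simpa using tsum_mul_reflect_le hB 0
  rw [tsum_snoc]
  have h1 : ∀ n : Fin 2 → ℤ, ∑' j, (if complete (Fin.snoc n j : Fin 3 → ℤ) 2 =
      -complete (Fin.snoc n j : Fin 3 → ℤ) 0 ∨ complete (Fin.snoc n j : Fin 3 → ℤ) 2 =
      -complete (Fin.snoc n j : Fin 3 → ℤ) 1 then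
      ∏ i, a (complete (Fin.snoc n j : Fin 3 → ℤ) i) else 0) ≤
      2 * ∏ i, (a (n i) * a (-n i)) := by
    intro n
    have e0 : ∀ j, complete (Fin.snoc n j : Fin 3 → ℤ) 0 = n 0 := fun j => complete_snoc_castSucc n j 0
    have e1 : ∀ j, complete (Fin.snoc n j : Fin 3 → ℤ) 1 = n 1 := fun j => complete_snoc_castSucc n j 1
    have e2 : ∀ j, complete (Fin.snoc n j : Fin 3 → ℤ) 2 = j := fun j => complete_snoc_last n j
    have e3 : ∀ j, complete (Fin.snoc n j : Fin 3 → ℤ) 3 = -(n 0 + n 1) - j := fun j => by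
      have := complete_snoc_last' n j
      rwa [Fin.sum_univ_two] at this
    have eP : ∀ j, ∏ i, a (complete (Fin.snoc n j : Fin 3 → ℤ) i) =
        a (n 0) * a (n 1) * a j * a (-(n 0 + n 1) - j) := fun j => by
      rw [← e3 j]
      refine (Fin.prod_univ_four _).trans ?_
      rw [e2, e0, e1]
    simp only [e0, e1, e2, eP, Fin.prod_univ_two]
    calc _ ≤ ∑' j, ((if j = -n 0 then a (n 0) * a (n 1) * a j * a (-(n 0 + n 1) - j) else 0) +
          (if j = -n 1 then a (n 0) * a (n 1) * a j * a (-(n 0 + n 1) - j) else 0)) := by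
          refine ENNReal.tsum_le_tsum fun j => ?_
          by_cases h0 : j = -n 0
          · simp [h0]
          · simp [h0]
      _ = _ := by
          rw [ENNReal.tsum_add, tsum_ite_eq, tsum_ite_eq]
          rw [show -(n 0 + n 1) - -n 0 = -n 1 by ring, show -(n 0 + n 1) - -n 1 = -n 0 by ring]
          ring
  refine (ENNReal.tsum_le_tsum h1).trans ?_
  rw [ENNReal.tsum_mul_left, tsum_prod_pi fun j => a j * a (-j)]
  gcongr

lemma tsum_quintic_le (hB : ∑' n, a n ^ 2 ≤ B) (hW : ∑' n, w n ^ 2 ≤ W) (hQ : W * B ≤ Q ^ 2) :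
    ∑' n : Fin 4 → ℤ, w (complete n 0) * w (complete n 1) * w (complete n 2) *
      ∏ i, a (complete n i) ≤ Q ^ 3 * (2 * B) := by
  have h := tsum_complete_last_two_le hB (l := 3) fun n => ∏ i, (w (n i) * a (n i))
  rw [tsum_prod_pi fun j => w j * a j] at h
  have := tsum_mul_le hB hW hQ
  refine le_trans (le_of_eq ?_) (h.trans (mul_le_mul_left (pow_le_pow_left' this 3) _))
  refine tsum_congr fun n => ?_
  simp [Fin.prod_univ_five, Fin.prod_univ_three]
  ring

lemma tsum_quintic_perm_le (hB : ∑' n, a n ^ 2 ≤ B) (hW : ∑' n, w n ^ 2 ≤ W) (hQ : W * B ≤ Q ^ 2)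
    (σ : Equiv.Perm (Fin 5)) :
    ∑' n : Fin 4 → ℤ, w (complete n (σ 0)) * w (complete n (σ 1)) * w (complete n (σ 2)) *
      ∏ i, a (complete n i) ≤ Q ^ 3 * (2 * B) := by
  refine le_trans (le_of_eq ?_) (tsum_quintic_le hB hW hQ)
  rw [← tsum_complete_comp_perm σ fun c => w (c 0) * w (c 1) * w (c 2) * ∏ i, a (c i)]
  refine tsum_congr fun n => ?_
  simp only [Function.comp_apply]
  rw [Equiv.prod_comp σ fun i => a (complete n i)]

lemma tsum_quintic_pair_le (hB : ∑' n, a n ^ 2 ≤ B) (hW : ∑' n, w n ^ 2 ≤ W)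
    (hQ : W * B ≤ Q ^ 2) :
    ∑' n : Fin 4 → ℤ, w (complete n 0) * w (complete n 3 + complete n 4) ^ 2 *
      ∏ i, a (complete n i) ≤ Q * W * (2 * B) ^ 2 := by
  have h := tsum_complete_last_two_le hB (l := 3)
    fun n => w (n 0) * a (n 0) * a (n 1) * a (n 2) * w (-(n 0 + n 1 + n 2)) ^ 2
  have h2 : ∑' n : Fin 3 → ℤ, w (n 0) * a (n 0) * a (n 1) * a (n 2) *
      w (-(n 0 + n 1 + n 2)) ^ 2 ≤ Q * W * (2 * B) := by
    have e1 : ∑' n : Fin 3 → ℤ, w (n 0) * a (n 0) * a (n 1) * a (n 2) *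
      w (-(n 0 + n 1 + n 2)) ^ 2 = ∑' n : Fin 3 → ℤ, w (complete n 0) * a (complete n 0) *
        a (complete n 1) * a (complete n 2) * w (complete n 3) ^ 2 := by
      refine tsum_congr fun n => ?_
      have e0 : complete n 0 = n 0 := rfl
      have e1 : complete n 1 = n 1 := rfl
      have e2 : complete n 2 = n 2 := rfl
      have e3 := sum_complete n
      rw [Fin.sum_univ_four] at e3
      have e4 : complete n 3 = -(n 0 + n 1 + n 2) := by rw [← e0, ← e1, ← e2]; omega
      rw [e0, e1, e2, e4]
    -- The sum of the last two frequencies is, up to sign, a fourth frequency completing the first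
    -- three to zero. Exchanging it with index `1` makes it free, so the squared weight sums to `W`,
    -- and the two coefficients without weight become the last two.
    rw [e1, ← tsum_complete_comp_perm (Equiv.swap 1 3) fun c => w (c 0) * a (c 0) *
        a (c 1) * a (c 2) * w (c 3) ^ 2]
    have h3 := tsum_complete_last_two_le hB (l := 2) fun n => w (n 0) * a (n 0) * w (n 1) ^ 2
    have h4 : ∑' n : Fin 2 → ℤ, w (n 0) * a (n 0) * w (n 1) ^ 2 ≤ Q * W := by
      rw [tsum_snoc]
      have e0 : ∀ (n : Fin 1 → ℤ) j, (Fin.snoc n j : Fin 2 → ℤ) 0 = n 0 := fun _ _ => rfl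
      have e1 : ∀ (n : Fin 1 → ℤ) j, (Fin.snoc n j : Fin 2 → ℤ) 1 = j := fun _ _ => rfl
      have h5 := tsum_prod_pi (fun j => w j * a j) 1
      simp only [Fin.prod_univ_one, pow_one] at h5
      simp only [e0, e1, ENNReal.tsum_mul_left, ENNReal.tsum_mul_right, h5]
      exact mul_le_mul' (tsum_mul_le hB hW hQ) hW
    refine le_trans (le_of_eq ?_) (h3.trans (mul_le_mul_left h4 _))
    refine tsum_congr fun n => ?_
    have s0 : Equiv.swap (1 : Fin 4) 3 0 = 0 := by decide
    have s2 : Equiv.swap (1 : Fin 4) 3 2 = 2 := by decide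
    simp [s0, s2]
    ring
  refine le_trans (le_of_eq ?_) ((h.trans (mul_le_mul_left h2 _)).trans (le_of_eq (by ring)))
  refine tsum_congr fun n => ?_
  have hs := sum_complete n
  rw [Fin.sum_univ_five] at hs
  have e : complete n 3 + complete n 4 = -(complete n 0 + complete n 1 + complete n 2) := by omega
  simp [Fin.prod_univ_five, e]
  ring

end

/-! ### Square summability of the weight -/

/-- The substitution `y = (1 + k)^{1/3}` replaces the fractional power by `y⁻⁴`. -/
lemma decay_sq_le {k y : ℝ} (hk : 0 ≤ k) (hy : 0 < y) (h : y ^ 3 = 1 + k) :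
    decay k ^ 2 ≤ 16 / y ^ 4 := by
  have h1 : (y / 2) ^ 3 ≤ max 1 |k| := by
    rw [abs_of_nonneg hk, div_pow, h]
    rcases le_total 1 k with h2 | h2
    · rw [max_eq_right h2]; linarith
    · rw [max_eq_left h2]; linarith
  have h2 : decay k ≤ 4 / y ^ 2 := by
    rw [decay]
    refine (Real.rpow_le_rpow_of_nonpos (by positivity) h1 (by norm_num)).trans (le_of_eq ?_)
    rw [← Real.rpow_natCast, ← Real.rpow_mul (by positivity)]
    norm_num
    field_simp
    norm_num
  calc decay k ^ 2 ≤ (4 / y ^ 2) ^ 2 := by have := (decay_pos k).le; gcongr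
    _ = _ := by ring

/-- Telescoping in place of an integral comparison: the increments of `1 / y n`, `y n = (1 + n /
lam)^{1/3}`, are bounded below by a multiple of `1 / (lam y⁴)`. Linear growth in `lam` is what the
final scaling requires. -/
lemma tsum_decay_nat_le {lam : ℝ} (hlam : 1 ≤ lam) :
    ∑' n : ℕ, ENNReal.ofReal (decay ((n + 1 : ℕ) / lam)) ^ 2 ≤ ENNReal.ofReal (48 * lam) := by
  have hl0 : 0 < lam := by linarith
  let y : ℕ → ℝ := fun n => (1 + n / lam) ^ (1 / 3 : ℝ)
  have hpos : ∀ n : ℕ, 0 < 1 + (n : ℝ) / lam := fun n => by positivity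
  have hy0 : ∀ n, 0 < y n := fun n => Real.rpow_pos_of_pos (hpos n) _
  have hy3 : ∀ n : ℕ, y n ^ 3 = 1 + n / lam := fun n => by
    simp only [y]
    rw [← Real.rpow_natCast, ← Real.rpow_mul (hpos n).le]
    norm_num
  have hstep : ∀ n : ℕ, decay ((n + 1 : ℕ) / lam) ^ 2 ≤ 48 * lam * ((y n)⁻¹ - (y (n + 1))⁻¹) := by
    intro n
    refine (decay_sq_le (by positivity) (hy0 (n + 1)) (hy3 (n + 1))).trans ?_
    have h1 := hy0 n
    have h2 := hy0 (n + 1)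
    have h3 : y (n + 1) ^ 3 - y n ^ 3 = 1 / lam := by
      rw [hy3, hy3]; push_cast; field_simp; ring
    have h4 : y n ≤ y (n + 1) := by
      by_contra hcon
      have : y (n + 1) ^ 3 < y n ^ 3 := by
        have := not_le.1 hcon; gcongr
      have : 0 < 1 / lam := by positivity
      linarith
    generalize y n = u at *
    generalize y (n + 1) = v at *
    have h5 : 1 ≤ lam * ((v - u) * (3 * v ^ 2)) := by
      have : v ^ 3 - u ^ 3 ≤ (v - u) * (3 * v ^ 2) := by
        rw [show v ^ 3 - u ^ 3 = (v - u) * (v ^ 2 + v * u + u ^ 2) by ring]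
        refine mul_le_mul_of_nonneg_left ?_ (by linarith)
        nlinarith
      calc (1 : ℝ) = lam * (v ^ 3 - u ^ 3) := by rw [h3]; field_simp
        _ ≤ _ := by gcongr
    have h6 : u⁻¹ - v⁻¹ = (v - u) / (u * v) := by field_simp
    rw [h6, mul_div_assoc', div_le_div_iff₀ (by positivity) (by positivity)]
    have h7 : u * v ≤ v ^ 2 := by nlinarith
    have h8 : 0 ≤ v - u := by linarith
    calc 16 * (u * v) ≤ 16 * v ^ 2 := by linarith
      _ = 16 * v ^ 2 * 1 := by ring
      _ ≤ 16 * v ^ 2 * (lam * ((v - u) * (3 * v ^ 2))) := by gcongr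
      _ = _ := by ring
  refine ENNReal.tsum_le_of_sum_range_le fun M => ?_
  have h1 : ∀ n : ℕ, ENNReal.ofReal (decay ((n + 1 : ℕ) / lam)) ^ 2 =
      ENNReal.ofReal (decay ((n + 1 : ℕ) / lam) ^ 2) := fun n =>
    (ENNReal.ofReal_pow (decay_pos _).le 2).symm
  simp only [h1]
  rw [← ENNReal.ofReal_sum_of_nonneg fun _ _ => sq_nonneg _]
  refine ENNReal.ofReal_le_ofReal ((Finset.sum_le_sum fun n _ => hstep n).trans ?_)
  rw [← Finset.mul_sum, Finset.sum_range_sub' fun n => (y n)⁻¹]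
  have : y 0 = 1 := by simp [y]
  rw [this]
  have := inv_pos.2 (hy0 M)
  nlinarith

lemma tsum_decay_le {lam : ℝ} (hlam : 1 ≤ lam) :
    ∑' n : ℤ, ENNReal.ofReal (decay (freq lam n)) ^ 2 ≤ ENNReal.ofReal (100 * lam) := by
  rw [tsum_of_nat_of_neg_add_one ENNReal.summable ENNReal.summable,
    tsum_eq_zero_add' ENNReal.summable]
  have h0 : decay (freq lam ((0 : ℕ) : ℤ)) = 1 := by simp [decay, freq]
  have h1 : ∀ n : ℕ, decay (freq lam ((n + 1 : ℕ) : ℤ)) = decay ((n + 1 : ℕ) / lam) := fun n => by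
    simp [freq]
  have h2 : ∀ n : ℕ, decay (freq lam (-((n : ℤ) + 1))) = decay ((n + 1 : ℕ) / lam) := fun n => by
    rw [freq_neg]; simp [decay, freq]
  simp only [h0, h1, h2]
  have := tsum_decay_nat_le hlam
  calc _ ≤ ENNReal.ofReal 1 ^ 2 + ENNReal.ofReal (48 * lam) + ENNReal.ofReal (48 * lam) := by gcongr
    _ = ENNReal.ofReal (1 + 48 * lam + 48 * lam) := by
      rw [ENNReal.ofReal_add (by positivity) (by positivity),
        ENNReal.ofReal_add (by positivity) (by positivity)]; simp
    _ ≤ _ := ENNReal.ofReal_le_ofReal (by linarith)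

/-! ### Bounds for the multipliers at the frequencies of the torus -/

section

variable {N D c δ : ℝ} {m : ℝ → ℝ}

/-- An arithmetic–geometric mean inequality: if each fourth power is controlled, so is any product
of degree four. -/
lemma mul_le_of_mul_pow_le {S K x y z : ℝ} (hS : 0 ≤ S) (hx : S * x ^ 4 ≤ K) (hy : S * y ^ 4 ≤ K)
    (hz : S * z ^ 4 ≤ K) : S * (x * y * z) * x ≤ K := by
  have h1 : x * y * z * x ≤ (2 * x ^ 4 + y ^ 4 + z ^ 4) / 4 := by
    nlinarith only [sq_nonneg (y - z), sq_nonneg (x ^ 2 - y ^ 2), sq_nonneg (x ^ 2 - z ^ 2),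
      mul_nonneg (sq_nonneg x) (sq_nonneg (y - z))]
  have := mul_le_mul_of_nonneg_left h1 hS
  linarith

/-- A form of the bound for `σ_4` that does not refer to the order of the frequencies: two
prescribed frequencies get an additional power. In each order the six powers are dominated by the
fourth powers of the largest and the third largest frequency. -/
lemma IsNice.quartSymbol_mul_le (h : IsNice N D m) (hc : |c| ≤ 3 * δ ^ 2) (hδ : 0 < δ)
    {a b x y : ℝ} (hs : a + b + x + y = 0) (ha : δ ≤ |a|) (hb : δ ≤ |b|) (hx : δ ≤ |x|)
    (hy : δ ≤ |y|) :
    quartSymbol c m a b x y * (max N |a| ^ 2 * max N |b| ^ 2 * (max N |x| * max N |y|)) ≤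
      2 ^ 46 * (D + 1) := by
  have hN := h.one_le_scale
  have hD := h.one_le
  have hM : ∀ z, 1 ≤ max N |z| := fun z => hN.trans (le_max_left _ _)
  have mono : ∀ {z z' : ℝ}, |z| ≤ |z'| → max N |z| ≤ max N |z'| := fun h => max_le_max le_rfl h
  wlog hba : |b| ≤ |a| generalizing a b
  · rw [quartSymbol_swap_left c m hs, mul_comm (max N |a| ^ 2)]
    exact this (by linarith) hb ha (le_of_not_ge hba)
  wlog hyx : |y| ≤ |x| generalizing x y
  · rw [quartSymbol_swap_right, mul_comm (max N |x|)]
    exact this (x := y) (y := x) hy hx (by linarith) (le_of_not_ge hyx)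
  have hMa := hM a; have hMb := hM b; have hMx := hM x; have hMy := hM y
  have fin : ∀ {p q : ℝ}, 1 ≤ p → 1 ≤ q →
      quartSymbol c m a b x y ≤ 2 ^ 46 * (D + 1) / (p ^ 4 * q ^ 4) →
      max N |a| ^ 2 * max N |b| ^ 2 * (max N |x| * max N |y|) ≤ p ^ 4 * q ^ 4 →
      quartSymbol c m a b x y * (max N |a| ^ 2 * max N |b| ^ 2 * (max N |x| * max N |y|)) ≤
      2 ^ 46 * (D + 1) := by
    intro p q hp hq h1 h2
    calc _ ≤ 2 ^ 46 * (D + 1) / (p ^ 4 * q ^ 4) * (p ^ 4 * q ^ 4) := by gcongr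
      _ = _ := by field_simp
  have e2 : ∀ {p : ℝ}, 1 ≤ p → p ^ 2 ≤ p ^ 4 := fun hp => pow_le_pow_right₀ hp (by norm_num)
  have e3 : ∀ {p : ℝ}, 1 ≤ p → p ^ 3 ≤ p ^ 4 := fun hp => pow_le_pow_right₀ hp (by norm_num)
  rcases le_total |x| |b| with h1 | h1
  · refine fin hMa hMx (h.quartSymbol_le hc hδ hs ha hb hx hy (h1.trans hba) h1) ?_
    have := mono hba; have := mono hyx; have := e2 hMx
    calc _ ≤ max N |a| ^ 2 * max N |a| ^ 2 * (max N |x| * max N |x|) := by gcongr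
      _ = max N |a| ^ 4 * max N |x| ^ 2 := by ring
      _ ≤ _ := by gcongr
  rcases le_total |x| |a| with h2 | h2
  · rcases le_total |y| |b| with h3 | h3
    · refine fin hMa hMb ?_ ?_
      · rw [quartSymbol_swap_mid]
        exact h.quartSymbol_le hc hδ (by linarith) ha hx hb hy hba h1
      · have := mono h2; have := mono h3; have := e3 hMa; have := e3 hMb
        calc _ ≤ max N |a| ^ 2 * max N |b| ^ 2 * (max N |a| * max N |b|) := by gcongr
          _ = max N |a| ^ 3 * max N |b| ^ 3 := by ring
          _ ≤ _ := by gcongr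
    · refine fin hMa hMy ?_ ?_
      · rw [quartSymbol_swap_mid, quartSymbol_swap_right]
        exact h.quartSymbol_le hc hδ (by linarith) ha hx hy hb (hyx.trans h2) hyx
      · have := mono h2; have := mono h3; have := e3 hMa; have := e3 hMy
        calc _ ≤ max N |a| ^ 2 * max N |y| ^ 2 * (max N |a| * max N |y|) := by gcongr
          _ = max N |a| ^ 3 * max N |y| ^ 3 := by ring
          _ ≤ _ := by gcongr
  · have hxa : quartSymbol c m a b x y = quartSymbol c m x a b y := by
      rw [quartSymbol_swap_mid, quartSymbol_swap_left c m (by linarith)]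
    rcases le_total |y| |b| with h3 | h3
    · refine fin hMx hMb ?_ ?_
      · rw [hxa]
        exact h.quartSymbol_le hc hδ (by linarith) hx ha hb hy (hba.trans h2) hba
      · have := mono h2; have := mono h3; have := e3 hMx; have := e3 hMb
        calc _ ≤ max N |x| ^ 2 * max N |b| ^ 2 * (max N |x| * max N |b|) := by gcongr
          _ = max N |x| ^ 3 * max N |b| ^ 3 := by ring
          _ ≤ _ := by gcongr
    rcases le_total |y| |a| with h4 | h4
    · refine fin hMx hMy ?_ ?_
      · rw [hxa, quartSymbol_swap_right]
        exact h.quartSymbol_le hc hδ (by linarith) hx ha hy hb hyx h4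
      · have := mono h2; have := mono h3; have := e3 hMx; have := e3 hMy
        calc _ ≤ max N |x| ^ 2 * max N |y| ^ 2 * (max N |x| * max N |y|) := by gcongr
          _ = max N |x| ^ 3 * max N |y| ^ 3 := by ring
          _ ≤ _ := by gcongr
    · refine fin hMx hMa ?_ ?_
      · rw [hxa, quartSymbol_swap_right, quartSymbol_swap_mid]
        exact h.quartSymbol_le hc hδ (by linarith) hx hy ha hb h2 h4
      · have := mono hyx; have := mono hba; have := e2 hMx
        calc _ ≤ max N |a| ^ 2 * max N |a| ^ 2 * (max N |x| * max N |x|) := by gcongr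
          _ = max N |x| ^ 2 * max N |a| ^ 4 := by ring
          _ ≤ _ := by gcongr

/-- The resonance function of a quadratic interaction gains two derivatives. -/
lemma mul_le_rbracket_three {N lam k0 k1 k2 : ℝ} (hlam : 1 ≤ lam) (hN : 1 ≤ N)
    (hc : |c| ≤ 3 * lam⁻¹ ^ 2) (hs : k0 + k1 + k2 = 0) (h0 : lam⁻¹ ≤ |k0|) (h1 : lam⁻¹ ≤ |k1|)
    (h2 : lam⁻¹ ≤ |k2|) : max N |k1| * max N |k2| ≤ N ^ 2 * lam ^ 3 *
      rbracket (quinticPoly c k0 + quinticPoly c k1 + quinticPoly c k2) := by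
  have hl0 : 0 < lam := by linarith
  have hM : ∀ k : ℝ, lam⁻¹ ≤ |k| → max N |k| ≤ N * lam * |k| := fun k hk => by
    have h3 : 1 ≤ lam * |k| := by
      calc 1 = lam * lam⁻¹ := by field_simp
        _ ≤ _ := by gcongr
    have h4 := abs_nonneg k
    refine max_le (by nlinarith) ?_
    calc |k| = 1 * 1 * |k| := by ring
      _ ≤ _ := by gcongr
  have hp := le_abs_quinticPoly_pair hc (inv_pos.2 hl0) h1 h2
  have e : quinticPoly c k0 = -quinticPoly c (k1 + k2) := by
    rw [← quinticPoly_neg]; congr 1; linarith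
  have e' : quinticPoly c k0 + quinticPoly c k1 + quinticPoly c k2 =
      quinticPoly c k1 + quinticPoly c k2 - quinticPoly c (k1 + k2) := by rw [e]; ring
  rw [e']
  set Ω := quinticPoly c k1 + quinticPoly c k2 - quinticPoly c (k1 + k2)
  rw [show k1 + k2 = -k0 by linarith, abs_neg] at hp
  refine le_mul_rbracket (by positivity) ?_
  have h5 : |k1| ^ 2 * |k2| ^ 2 ≤ lam * |Ω| := by
    have h6 : |k1| * |k2| ≤ k1 ^ 2 + k2 ^ 2 := by
      rw [← sq_abs k1, ← sq_abs k2]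
      nlinarith [sq_nonneg (|k1| - |k2|), abs_nonneg k1, abs_nonneg k2]
    calc |k1| ^ 2 * |k2| ^ 2 = lam * (|k1| * |k2| * lam⁻¹ * (|k1| * |k2|)) := by field_simp
      _ ≤ lam * (|k1| * |k2| * |k0| * (k1 ^ 2 + k2 ^ 2)) := by gcongr
      _ ≤ _ := by gcongr
  calc (max N |k1| * max N |k2|) ^ 2 ≤ ((N * lam * |k1|) * (N * lam * |k2|)) ^ 2 := by
        have := hM k1 h1; have := hM k2 h2; gcongr
    _ = N ^ 4 * lam ^ 4 * (|k1| ^ 2 * |k2| ^ 2) := by ring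
    _ ≤ N ^ 4 * lam ^ 4 * (lam * |Ω|) := by gcongr
    _ = N ^ 4 * lam ^ 5 * |Ω| := by ring
    _ ≤ N ^ 4 * lam ^ 6 * |Ω| := by gcongr; norm_num
    _ = _ := by ring

/-- The resonance function of a cubic interaction. -/
lemma mul_le_rbracket_four {N lam k0 k1 k2 k3 T : ℝ} (hlam : 1 ≤ lam) (hN : 1 ≤ N)
    (hc : |c| ≤ 3 * lam⁻¹ ^ 2) (hs : k0 + k1 + k2 + k3 = 0) (h0 : lam⁻¹ ≤ |k0|)
    (h2 : lam⁻¹ ≤ |k2|) (h3 : lam⁻¹ ≤ |k3|) (h23 : lam⁻¹ ≤ |k2 + k3|)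
    (h02 : lam⁻¹ ≤ |k0 + k2|) (h03 : lam⁻¹ ≤ |k0 + k3|) (hNT : N ≤ T) (h0T : |k0| ≤ T)
    (h23T : |k2 + k3| ≤ T) :
    max N |k2| * max N |k3| ≤ 4 * N * lam ^ 3 * T *
      rbracket (quinticPoly c k0 + quinticPoly c k1 + quinticPoly c k2 + quinticPoly c k3) := by
  have hl0 : 0 < lam := by linarith
  wlog h32 : |k3| ≤ |k2| generalizing k2 k3
  · rw [mul_comm (max N |k2|), add_right_comm _ (quinticPoly c k2)]
    exact this (by linarith) h3 h2 (by rwa [add_comm]) h03 h02 (by rwa [add_comm])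
      (le_of_not_ge h32)
  have e := quinticPoly_four c (a := k0) (b := k2) (x := k3) (y := k1) (by linarith)
  set Ω := quinticPoly c k0 + quinticPoly c k1 + quinticPoly c k2 + quinticPoly c k3 with hΩ
  have eΩ : |Ω| = |k0 + k2| * |k0 + k3| * |k2 + k3| * |quartFactor c k0 k2 k3 k1| := by
    have e1 : k0 + k1 = -(k2 + k3) := by linarith
    rw [show Ω = (k0 + k2) * (k0 + k3) * (k0 + k1) * quartFactor c k0 k2 k3 k1 by
      rw [← e, hΩ]; ring, abs_mul, abs_mul, abs_mul, e1, abs_neg]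
  have hδ : 0 < lam⁻¹ := inv_pos.2 hl0
  have hq : |k2| ^ 2 ≤ |quartFactor c k0 k2 k3 k1| := by
    have := quartFactor_ge (a := k2) (b := k0) (x := k3) (y := k1) hc hδ h0 h3
    rw [sq_abs]
    refine (this.trans (le_of_eq ?_)).trans (le_abs_self _)
    simp only [quartFactor]; ring
  have hk2 := abs_nonneg k2
  -- If `|k2| ≤ 4T`, the three pair sums are only known to be at least `lam⁻¹`, but the quartic
  -- factor still gives `|k2|` while `k3` is paid by `T`. Otherwise `k3`, `k0 + k2` and `k0 + k3`
  -- are comparable to `k2`, and `Ω` controls its fourth power.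
  rcases le_or_gt |k2| (4 * T) with hb | hb
  · have a1 : |k2| ≤ lam ^ 2 * rbracket Ω := by
      refine le_mul_rbracket (by positivity) ?_
      rw [eΩ]
      calc |k2| ^ 2 = lam ^ 3 * (lam⁻¹ * lam⁻¹ * lam⁻¹ * |k2| ^ 2) := by field_simp
        _ ≤ (lam ^ 2) ^ 2 * (|k0 + k2| * |k0 + k3| * |k2 + k3| * |quartFactor c k0 k2 k3 k1|) := by
          have : lam ^ 3 ≤ (lam ^ 2) ^ 2 := by
            rw [← pow_mul]; exact pow_le_pow_right₀ hlam (by norm_num)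
          gcongr
    have a2 : max N |k2| ≤ N * lam * |k2| := by
      have h3 : 1 ≤ lam * |k2| := by
        calc 1 = lam * lam⁻¹ := by field_simp
          _ ≤ _ := by gcongr
      refine max_le (by nlinarith) ?_
      calc |k2| = 1 * 1 * |k2| := by ring
        _ ≤ _ := by gcongr
    have a3 : max N |k3| ≤ 4 * T := max_le (by linarith) (h32.trans hb)
    have : 0 ≤ max N |k3| := by positivity
    calc _ ≤ N * lam * |k2| * (4 * T) := by gcongr
      _ ≤ N * lam * (lam ^ 2 * rbracket Ω) * (4 * T) := by
          have : 0 ≤ T := by linarith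
          gcongr
      _ = _ := by ring
  · have b1 : max N |k2| ≤ |k2| := max_le (by linarith) le_rfl
    have b2 : max N |k3| ≤ |k2| := max_le (by linarith) h32
    have b3 : 3 / 4 * |k2| ≤ |k3| := by
      have := abs_sub_abs_le_abs_sub k2 (k2 + k3)
      rw [show k2 - (k2 + k3) = -k3 by ring, abs_neg] at this
      linarith
    have b4 : 3 / 4 * |k2| ≤ |k0 + k2| := by
      have := abs_sub_abs_le_abs_sub k2 (-k0)
      rw [abs_neg, sub_neg_eq_add, add_comm] at this
      linarith
    have b5 : 1 / 2 * |k2| ≤ |k0 + k3| := by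
      have := abs_sub_abs_le_abs_sub k3 (-k0)
      rw [abs_neg, sub_neg_eq_add, add_comm] at this
      linarith
    have b6 : |k2| * |k2| ≤ 2 * lam * rbracket Ω := by
      refine le_mul_rbracket (by positivity) ?_
      rw [eΩ]
      calc (|k2| * |k2|) ^ 2 = 8 / 3 * lam * (3 / 4 * |k2| * (1 / 2 * |k2|) * lam⁻¹ * |k2| ^ 2) := by
            field_simp; ring
        _ ≤ (2 * lam) ^ 2 * (|k0 + k2| * |k0 + k3| * |k2 + k3| * |quartFactor c k0 k2 k3 k1|) := by
            have : 8 / 3 * lam ≤ (2 * lam) ^ 2 := by nlinarith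
            gcongr
    have : 0 ≤ max N |k3| := by positivity
    calc _ ≤ |k2| * |k2| := by gcongr
      _ ≤ 2 * lam * rbracket Ω := b6
      _ ≤ _ := by
        have hT1 : 1 ≤ T := hN.trans hNT
        have hlam2 : 1 ≤ lam ^ 2 := one_le_pow₀ hlam
        have := rbracket_pos Ω
        calc 2 * lam * rbracket Ω ≤ 4 * 1 * (lam * 1) * 1 * rbracket Ω := by nlinarith
          _ ≤ 4 * N * (lam * lam ^ 2) * T * rbracket Ω := by gcongr
          _ = _ := by ring

end

/-! ### Majorants for the multilinear sums -/

/-- The Fourier coefficients are bounded by `b`, and `b` is controlled by a square summable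
sequence `A` with a loss of one derivative at high frequencies. -/
structure IsControlled (lam N κ : ℝ) (A b : ℤ → ℝ) : Prop where
  one_le : 1 ≤ lam
  one_le_scale : 1 ≤ N
  const_nonneg : 0 ≤ κ
  majorant_nonneg : ∀ n, 0 ≤ A n
  finite : ∑' n, ENNReal.ofReal (A n) ^ 2 ≠ ⊤
  nonneg : ∀ n, 0 ≤ b n
  zero : b 0 = 0
  le : ∀ n, b n ≤ κ * (A n * max N |freq lam n|)

lemma inv_le_decay {N k : ℝ} (hN : 1 ≤ N) : (max N |k|)⁻¹ ≤ decay k := by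
  have h1 : 1 ≤ max N |k| := hN.trans (le_max_left _ _)
  refine le_trans ?_ (le_decay h1 (le_max_right N |k|))
  rw [← Real.rpow_neg_one]
  exact Real.rpow_le_rpow_of_exponent_le h1 (by norm_num)

lemma summable_of_tsum_ne_top {ι : Type} {f g : ι → ℝ} {C : ℝ} (hf : ∀ i, 0 ≤ f i)
    (hfg : ∀ i, f i ≤ C * g i) (hg0 : ∀ i, 0 ≤ g i) (hg : ∑' i, ENNReal.ofReal (g i) ≠ ⊤) :
    Summable f := by
  have h1 : Summable g := by
    have := ENNReal.summable_toReal hg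
    simpa only [ENNReal.toReal_ofReal (hg0 _)] using this
  exact Summable.of_nonneg_of_le hf hfg (h1.mul_left C)

lemma phase_three (β lam : ℝ) (c : Fin 3 → ℤ) : phase β lam c =
    quinticPoly (lowOrder β lam) (freq lam (c 0)) + quinticPoly (lowOrder β lam) (freq lam (c 1)) +
      quinticPoly (lowOrder β lam) (freq lam (c 2)) := by
  simp only [phase, disp, dispersion_eq, Fin.sum_univ_three]

lemma phase_four (β lam : ℝ) (c : Fin 4 → ℤ) : phase β lam c =
    quinticPoly (lowOrder β lam) (freq lam (c 0)) + quinticPoly (lowOrder β lam) (freq lam (c 1)) +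
      quinticPoly (lowOrder β lam) (freq lam (c 2)) +
      quinticPoly (lowOrder β lam) (freq lam (c 3)) := by
  simp only [phase, disp, dispersion_eq, Fin.sum_univ_four]

lemma phase_five (β lam : ℝ) (c : Fin 5 → ℤ) : phase β lam c =
    quinticPoly (lowOrder β lam) (freq lam (c 0)) + quinticPoly (lowOrder β lam) (freq lam (c 1)) +
      quinticPoly (lowOrder β lam) (freq lam (c 2)) +
      quinticPoly (lowOrder β lam) (freq lam (c 3)) +
      quinticPoly (lowOrder β lam) (freq lam (c 4)) := by
  simp only [phase, disp, dispersion_eq, Fin.sum_univ_five]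

section

variable {β lam N D κ R : ℝ} {m : ℝ → ℝ} {A b : ℤ → ℝ}

lemma IsControlled.prod_le (hA : IsControlled lam N κ A b) {l : ℕ} (c : Fin l → ℤ) :
    ∏ i, b (c i) ≤ κ ^ l * ((∏ i, A (c i)) * ∏ i, max N |freq lam (c i)|) := by
  refine (Finset.prod_le_prod (fun i _ => hA.nonneg (c i)) fun i _ => hA.le (c i)).trans
    (le_of_eq ?_)
  rw [Finset.prod_mul_distrib, Finset.prod_mul_distrib]
  simp

lemma IsControlled.prod_eq_zero (hA : IsControlled lam N κ A b) {l : ℕ} {c : Fin l → ℤ}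
    (h : ¬∀ i, c i ≠ 0) : ∏ i, b (c i) = 0 := by
  obtain ⟨i, hi⟩ := not_forall.1 h
  exact Finset.prod_eq_zero (Finset.mem_univ i) (by rw [not_not.1 hi, hA.zero])

lemma IsControlled.prod_nonneg (hA : IsControlled lam N κ A b) {l : ℕ} (c : Fin l → ℤ) :
    0 ≤ ∏ i, A (c i) := Finset.prod_nonneg fun _ _ => hA.majorant_nonneg _

lemma IsControlled.mul_prod_le (hA : IsControlled lam N κ A b) {l : ℕ} {c : Fin l → ℤ} {S X : ℝ}
    (hS : 0 ≤ S) (h : S * ∏ i, max N |freq lam (c i)| ≤ X) :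
    S * ∏ i, b (c i) ≤ κ ^ l * (X * ∏ i, A (c i)) := by
  have hκ := hA.const_nonneg
  have hP := hA.prod_nonneg c
  calc _ ≤ S * (κ ^ l * ((∏ i, A (c i)) * ∏ i, max N |freq lam (c i)|)) := by
        gcongr; exact hA.prod_le c
    _ = κ ^ l * ((S * ∏ i, max N |freq lam (c i)|) * ∏ i, A (c i)) := by ring
    _ ≤ _ := by gcongr

lemma cubicSymbol_nonneg {c δ a b x : ℝ} (hc : |c| ≤ 3 * δ ^ 2) (hδ : 0 < δ) (ha : δ ≤ |a|)
    (hb : δ ≤ |b|) : 0 ≤ cubicSymbol c m a b x := by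
  have := quadFactor_ge hc hδ ha hb
  have : 0 ≤ quadFactor c a b := le_trans (by positivity) this
  rw [cubicSymbol]; positivity

lemma quartSymbol_nonneg {c δ a b x y : ℝ} (hc : |c| ≤ 3 * δ ^ 2) (hδ : 0 < δ) (hb : δ ≤ |b|)
    (hx : δ ≤ |x|) : 0 ≤ quartSymbol c m a b x y := by
  have := quartFactor_ge (a := a) (y := y) hc hδ hb hx
  have : 0 ≤ quartFactor c a b x y := le_trans (by positivity) this
  rw [quartSymbol]; positivity

/-- Of the four powers in the bound for `σ_3` three compensate the growth of the coefficients; the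
fourth is the weight on the first frequency. -/
lemma IsControlled.norm_sigma3_mul_prod_le (hA : IsControlled lam N κ A b) (h : IsNice N D m)
    (hβ : β = -1 ∨ β = 0 ∨ β = 1) {c : Fin 3 → ℤ} (hc : ∑ i, c i = 0) :
    ‖sigma3 β lam m (fun i => freq lam (c i))‖ * ∏ i, b (c i) ≤
      32 * (D + 1) * κ ^ 3 * (decay (freq lam (c 0)) * ∏ i, A (c i)) := by
  have hD := h.one_le
  have hκ := hA.const_nonneg
  have hl0 : 0 < lam := by linarith [hA.one_le]
  by_cases h0 : ∀ i, c i ≠ 0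
  swap
  · rw [hA.prod_eq_zero h0, mul_zero]
    have := hA.prod_nonneg c; have := decay_pos (freq lam (c 0)); positivity
  have hk : freq lam (c 0) + freq lam (c 1) + freq lam (c 2) = 0 := by
    rw [← freq_add, ← freq_add, ← Fin.sum_univ_three, hc]; simp [freq]
  have hδ : 0 < lam⁻¹ := inv_pos.2 hl0
  have hlo := abs_lowOrder_le (lam := lam) hβ
  have hf := fun i => le_abs_freq hl0 (h0 i)
  have hQ : 0 ≤ quadFactor (lowOrder β lam) (freq lam (c 0)) (freq lam (c 1)) :=
    le_trans (by positivity) (quadFactor_ge hlo hδ (hf 0) (hf 1))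
  have hM : ∀ k, 0 < max N |k| := fun k => lt_of_lt_of_le (by linarith [hA.one_le_scale])
    (le_max_left _ _)
  have e := norm_sigma3 (m := m) (k := fun i => freq lam (c i)) h.even hk hQ
  set S := cubicSymbol (lowOrder β lam) m (freq lam (c 0)) (freq lam (c 1)) (freq lam (c 2)) with hS
  have hS0 : 0 ≤ S := cubicSymbol_nonneg hlo hδ (hf 0) (hf 1)
  have hb0 : S * max N |freq lam (c 0)| ^ 4 ≤ 32 * (D + 1) := by
    rw [← le_div_iff₀ (pow_pos (hM _) 4)]
    exact h.cubicSymbol_le hlo hδ hk (hf 0) (hf 1) (hf 2)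
  have hb1 : S * max N |freq lam (c 1)| ^ 4 ≤ 32 * (D + 1) := by
    rw [← le_div_iff₀ (pow_pos (hM _) 4), hS, cubicSymbol_swap_left]
    exact h.cubicSymbol_le hlo hδ (by linarith) (hf 1) (hf 0) (hf 2)
  have hb2 : S * max N |freq lam (c 2)| ^ 4 ≤ 32 * (D + 1) := by
    rw [← le_div_iff₀ (pow_pos (hM _) 4), hS, cubicSymbol_swap_right _ _ hk, cubicSymbol_swap_left]
    rw [cubicSymbol_swap_left, cubicSymbol_swap_left]
    exact h.cubicSymbol_le hlo hδ (by linarith) (hf 2) (hf 0) (hf 1)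
  have hprod := mul_le_of_mul_pow_le hS0 hb0 hb1 hb2
  have hle : ‖sigma3 β lam m (fun i => freq lam (c i))‖ * ∏ i, max N |freq lam (c i)| ≤
      32 * (D + 1) * decay (freq lam (c 0)) := by
    rw [e, Fin.prod_univ_three]
    have h3 := inv_le_decay (k := freq lam (c 0)) hA.one_le_scale
    have := hM (freq lam (c 0)); have := hM (freq lam (c 1)); have := hM (freq lam (c 2))
    calc _ ≤ 1 * S * (max N |freq lam (c 0)| * max N |freq lam (c 1)| * max N |freq lam (c 2)|) := by
          gcongr; norm_num
      _ = S * (max N |freq lam (c 0)| * max N |freq lam (c 1)| * max N |freq lam (c 2)|) *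
          max N |freq lam (c 0)| * (max N |freq lam (c 0)|)⁻¹ := by field_simp
      _ ≤ _ := by gcongr
  exact (hA.mul_prod_le (norm_nonneg _) hle).trans (le_of_eq (by ring))

lemma IsControlled.norm_sigma4_mul_prod_le (hA : IsControlled lam N κ A b) (h : IsNice N D m)
    (hβ : β = -1 ∨ β = 0 ∨ β = 1) {c : Fin 4 → ℤ} (hc : ∑ i, c i = 0) :
    ‖sigma4 β lam m (fun i => freq lam (c i))‖ * ∏ i, b (c i) ≤
      2 ^ 46 * (D + 1) * κ ^ 4 *
        (decay (freq lam (c 0)) * decay (freq lam (c 1)) * ∏ i, A (c i)) := by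
  have hD := h.one_le
  have hκ := hA.const_nonneg
  have hl0 : 0 < lam := by linarith [hA.one_le]
  have hd0 := decay_pos (freq lam (c 0)); have hd1 := decay_pos (freq lam (c 1))
  by_cases h0 : ∀ i, c i ≠ 0
  swap
  · rw [hA.prod_eq_zero h0, mul_zero]
    have := hA.prod_nonneg c; positivity
  have hk : freq lam (c 0) + freq lam (c 1) + freq lam (c 2) + freq lam (c 3) = 0 := by
    rw [← freq_add, ← freq_add, ← freq_add, ← Fin.sum_univ_four, hc]; simp [freq]
  have hδ : 0 < lam⁻¹ := inv_pos.2 hl0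
  have hlo := abs_lowOrder_le (lam := lam) hβ
  have hf := fun i => le_abs_freq hl0 (h0 i)
  have hQ : 0 ≤ quartFactor (lowOrder β lam) (freq lam (c 0)) (freq lam (c 1)) (freq lam (c 2))
      (freq lam (c 3)) := le_trans (by positivity) (quartFactor_ge hlo hδ (hf 1) (hf 2))
  have hM : ∀ k, 0 < max N |k| := fun k => lt_of_lt_of_le (by linarith [hA.one_le_scale])
    (le_max_left _ _)
  have e := norm_sigma4 (m := m) (k := fun i => freq lam (c i)) h.even hk hQ
  have hS0 := quartSymbol_nonneg (m := m) (a := freq lam (c 0)) (y := freq lam (c 3)) hlo hδ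
    (hf 1) (hf 2)
  have hb := h.quartSymbol_mul_le hlo hδ hk (hf 0) (hf 1) (hf 2) (hf 3)
  set S := quartSymbol (lowOrder β lam) m (freq lam (c 0)) (freq lam (c 1)) (freq lam (c 2))
    (freq lam (c 3)) with hS
  have hle : ‖sigma4 β lam m (fun i => freq lam (c i))‖ * ∏ i, max N |freq lam (c i)| ≤
      2 ^ 46 * (D + 1) * (decay (freq lam (c 0)) * decay (freq lam (c 1))) := by
    rw [e, Fin.prod_univ_four]
    have h3 := inv_le_decay (k := freq lam (c 0)) hA.one_le_scale
    have h4 := inv_le_decay (k := freq lam (c 1)) hA.one_le_scale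
    have := hM (freq lam (c 0)); have := hM (freq lam (c 1)); have := hM (freq lam (c 2))
    have := hM (freq lam (c 3))
    calc _ ≤ 1 * S * (max N |freq lam (c 0)| * max N |freq lam (c 1)| * max N |freq lam (c 2)| *
          max N |freq lam (c 3)|) := by
          gcongr; norm_num
      _ = S * (max N |freq lam (c 0)| ^ 2 * max N |freq lam (c 1)| ^ 2 *
          (max N |freq lam (c 2)| * max N |freq lam (c 3)|)) *
          ((max N |freq lam (c 0)|)⁻¹ * (max N |freq lam (c 1)|)⁻¹) := by field_simp
      _ ≤ _ := by gcongr
  exact (hA.mul_prod_le (norm_nonneg _) hle).trans (le_of_eq (by ring))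

/-- The factor `⟨Ω⟩^{1/2}` in `quintic_weight_le` is cancelled by the denominator of `weight`, the
gain from integration in time. -/
lemma IsControlled.norm_quintic_mul_weight_le (hA : IsControlled lam N κ A b) (h : IsNice N D m)
    (hβ : β = -1 ∨ β = 0 ∨ β = 1) {c : Fin 5 → ℤ} (hc : ∑ i, c i = 0) :
    ‖sigma4 β lam m (fun i => freq lam (merge c i)) * lastFreq lam c‖ * weight β lam b c ≤
      2 ^ 88 * (D + 1) * κ ^ 5 * (quinticMajorant (freq lam (c 0)) (freq lam (c 1)) (freq lam (c 2))
        (freq lam (c 3)) (freq lam (c 4)) * ∏ i, A (c i)) := by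
  have hD := h.one_le
  have hκ := hA.const_nonneg
  have hl0 : 0 < lam := by linarith [hA.one_le]
  have hmaj : 0 ≤ quinticMajorant (freq lam (c 0)) (freq lam (c 1)) (freq lam (c 2))
        (freq lam (c 3)) (freq lam (c 4)) := by
    have := fun k => (decay_pos k).le
    rw [quinticMajorant]
    have h1 := this (freq lam (c 0)); have h2 := this (freq lam (c 1))
    have h3 := this (freq lam (c 2)); have h4 := this (freq lam (c 3))
    have h5 := this (freq lam (c 4)); have h6 := this (freq lam (c 3) + freq lam (c 4))
    positivity
  have hr0 : 0 ≤ 2 ^ 88 * (D + 1) * κ ^ 5 * (quinticMajorant (freq lam (c 0)) (freq lam (c 1))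
      (freq lam (c 2)) (freq lam (c 3)) (freq lam (c 4)) * ∏ i, A (c i)) := by
    have := hA.prod_nonneg c; positivity
  by_cases h0 : ∀ i, c i ≠ 0
  swap
  · rw [weight, hA.prod_eq_zero h0, zero_div, mul_zero]; exact hr0
  have hlast : lastFreq lam c = freq lam (c 3) + freq lam (c 4) := by
    rw [lastFreq, freq_add]; rfl
  have hm3 : freq lam (merge c 3) = freq lam (c 3) + freq lam (c 4) := by
    rw [← freq_add]; rfl
  have hm0 : merge c 0 = c 0 := rfl
  have hm1 : merge c 1 = c 1 := rfl
  have hm2 : merge c 2 = c 2 := rfl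
  by_cases hz : c 3 + c 4 = 0
  · have : lastFreq lam c = 0 := by rw [hlast, ← freq_add, hz]; simp [freq]
    rw [this]; simpa using hr0
  have hk : freq lam (c 0) + freq lam (c 1) + freq lam (c 2) + (freq lam (c 3) + freq lam (c 4)) = 0 := by
    rw [← add_assoc, ← freq_add, ← freq_add, ← freq_add, ← freq_add, ← Fin.sum_univ_five, hc]
    simp [freq]
  have hδ : 0 < lam⁻¹ := inv_pos.2 hl0
  have hlo := abs_lowOrder_le (lam := lam) hβ
  have hf := fun i => le_abs_freq hl0 (h0 i)
  have hfκ : lam⁻¹ ≤ |freq lam (c 3) + freq lam (c 4)| := by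
    rw [← freq_add]; exact le_abs_freq hl0 hz
  have hQ : 0 ≤ quartFactor (lowOrder β lam) (freq lam (c 0)) (freq lam (c 1)) (freq lam (c 2))
      (freq lam (c 3) + freq lam (c 4)) :=
    le_trans (by positivity) (quartFactor_ge hlo hδ (hf 1) (hf 2))
  have e := norm_sigma4 (β := β) (lam := lam) (m := m) (k := fun i => freq lam (merge c i)) h.even
    (by simp only [hm0, hm1, hm2, hm3]; exact hk) (by simp only [hm0, hm1, hm2, hm3]; exact hQ)
  simp only [hm0, hm1, hm2, hm3] at e
  have key := h.quintic_weight_le hlo hδ hk (hf 0) (hf 1) (hf 2) (hf 3) (hf 4) hfκ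
  rw [← phase_five] at key
  have hS0 := quartSymbol_nonneg (m := m) (a := freq lam (c 0))
    (y := freq lam (c 3) + freq lam (c 4)) hlo hδ (hf 1) (hf 2)
  have hrb := rbracket_pos (phase β lam c)
  rw [norm_mul, e, hlast, weight, Complex.norm_real, Real.norm_eq_abs, mul_div_assoc', div_le_iff₀ hrb]
  have hle : 1 / 3 * quartSymbol (lowOrder β lam) m (freq lam (c 0)) (freq lam (c 1))
      (freq lam (c 2)) (freq lam (c 3) + freq lam (c 4)) * |freq lam (c 3) + freq lam (c 4)| *
      ∏ i, max N |freq lam (c i)| ≤ 2 ^ 88 * (D + 1) * rbracket (phase β lam c) *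
        quinticMajorant (freq lam (c 0)) (freq lam (c 1)) (freq lam (c 2))
        (freq lam (c 3)) (freq lam (c 4)) := by
    refine le_trans (le_of_eq ?_) ((mul_le_mul_of_nonneg_left key (by norm_num : (0:ℝ) ≤ 1 / 3)).trans ?_)
    · rw [Fin.prod_univ_five]; ring
    · rw [one_div_mul_eq_div]
      exact div_le_self (by positivity) (by norm_num)
  exact (hA.mul_prod_le (by positivity) hle).trans (le_of_eq (by ring))

end

/-! ### Symbols of compact support -/

section

variable {β lam N D κ R : ℝ} {m : ℝ → ℝ} {A b : ℤ → ℝ}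

lemma one_le_mul_decay {k : ℝ} (hN : 1 ≤ N) (hk : max N |k| ≤ R) : 1 ≤ R * decay k := by
  have h0 : 0 < max N |k| := lt_of_lt_of_le (by linarith) (le_max_left _ _)
  have h1 := inv_le_decay (k := k) hN
  have hR : 0 ≤ R := h0.le.trans hk
  calc 1 = max N |k| * (max N |k|)⁻¹ := by field_simp
    _ ≤ _ := by gcongr

/-- The product of the majorants of the quadratic nonlinearity. -/
lemma IsControlled.bilinear_le (hA : IsControlled lam N κ A b) (hβ : β = -1 ∨ β = 0 ∨ β = 1)
    (n j : ℤ) :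
    |freq lam n| * (b j * b (n - j)) / rbracket (disp β lam j + disp β lam (n - j) - disp β lam n) ≤
      |freq lam n| * κ ^ 2 * (N ^ 2 * lam ^ 3) * (A j * A (n - j)) := by
  have hκ := hA.const_nonneg
  have hN := hA.one_le_scale
  have hl0 : 0 < lam := by linarith [hA.one_le]
  have hAj := hA.majorant_nonneg j
  have hAn := hA.majorant_nonneg (n - j)
  have hrb := rbracket_pos (disp β lam j + disp β lam (n - j) - disp β lam n)
  rcases eq_or_ne n 0 with rfl | hn
  · simp [freq]
  rcases eq_or_ne j 0 with rfl | hj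
  · rw [hA.zero, zero_mul, mul_zero, zero_div]; positivity
  rcases eq_or_ne (n - j) 0 with hnj | hnj
  · rw [hnj, hA.zero, mul_zero, mul_zero, zero_div]; rw [hnj] at hAn; positivity
  have key := mul_le_rbracket_three (k0 := freq lam (-n)) (k1 := freq lam j) (k2 := freq lam (n - j))
    hA.one_le hN (abs_lowOrder_le (lam := lam) hβ)
    (by rw [← freq_add, ← freq_add, show -n + j + (n - j) = 0 by ring]; simp [freq])
    (le_abs_freq hl0 (neg_ne_zero.2 hn)) (le_abs_freq hl0 hj) (le_abs_freq hl0 hnj)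
  have e : quinticPoly (lowOrder β lam) (freq lam (-n)) + quinticPoly (lowOrder β lam) (freq lam j) +
      quinticPoly (lowOrder β lam) (freq lam (n - j)) =
      disp β lam j + disp β lam (n - j) - disp β lam n := by
    simp only [disp, dispersion_eq, freq_neg, quinticPoly]; ring
  rw [e] at key
  rw [div_le_iff₀ hrb]
  have h1 : b j * b (n - j) ≤ κ * (A j * max N |freq lam j|) *
      (κ * (A (n - j) * max N |freq lam (n - j)|)) :=
    mul_le_mul (hA.le _) (hA.le _) (hA.nonneg _) ((hA.nonneg _).trans (hA.le _))
  calc |freq lam n| * (b j * b (n - j)) ≤ |freq lam n| * (κ * (A j * max N |freq lam j|) *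
      (κ * (A (n - j) * max N |freq lam (n - j)|))) := by gcongr
    _ = |freq lam n| * κ ^ 2 * (A j * A (n - j)) * (max N |freq lam j| * max N |freq lam (n - j)|) := by
      ring
    _ ≤ |freq lam n| * κ ^ 2 * (A j * A (n - j)) * (N ^ 2 * lam ^ 3 *
      rbracket (disp β lam j + disp β lam (n - j) - disp β lam n)) := by gcongr
    _ = _ := by ring

/-- The multiplier of the first energy. -/
noncomputable def quadSymbol (lam : ℝ) (m : ℝ → ℝ) (c : Fin 2 → ℤ) : ℂ :=
  ((m (freq lam (c 0)) * m (freq lam (c 1)) : ℝ) : ℂ)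

/-- Compact support of `m` bounds the first frequency and with it the sum of the others, whose
growth is absorbed by the quadratic resonance function. The dependence of the constant on `R`, `N`
and `lam` is harmless: only summability is drawn from it. -/
lemma IsControlled.norm_quad_mul_weight_le (hA : IsControlled lam N κ A b) (h : IsNice N D m)
    (hβ : β = -1 ∨ β = 0 ∨ β = 1) (hNR : N ≤ R) (hR : ∀ k, R ≤ |k| → m k = 0) {c : Fin 3 → ℤ}
    (hc : ∑ i, c i = 0) :
    ‖quadSymbol lam m (merge c) * lastFreq lam c‖ * weight β lam b c ≤
      κ ^ 3 * (R ^ 3 * (N ^ 2 * lam ^ 3)) * (decay (freq lam (c 0)) * ∏ i, A (c i)) := by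
  have hκ := hA.const_nonneg
  have hN := hA.one_le_scale
  have hl0 : 0 < lam := by linarith [hA.one_le]
  have hR0 : 0 < R := by linarith
  have hd0 := decay_pos (freq lam (c 0))
  have hr0 : 0 ≤ κ ^ 3 * (R ^ 3 * (N ^ 2 * lam ^ 3)) * (decay (freq lam (c 0)) * ∏ i, A (c i)) := by
    have := hA.prod_nonneg c; positivity
  by_cases h0 : ∀ i, c i ≠ 0
  swap
  · rw [weight, hA.prod_eq_zero h0, zero_div, mul_zero]; exact hr0
  by_cases hk0 : R ≤ |freq lam (c 0)|
  · have : quadSymbol lam m (merge c) = 0 := by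
      rw [quadSymbol, show merge c 0 = c 0 from rfl, hR _ hk0]; simp
    rw [this]; simpa using hr0
  have hk : freq lam (c 0) + freq lam (c 1) + freq lam (c 2) = 0 := by
    rw [← freq_add, ← freq_add, ← Fin.sum_univ_three, hc]; simp [freq]
  have hf := fun i => le_abs_freq hl0 (h0 i)
  have hM0 : max N |freq lam (c 0)| ≤ R := max_le hNR (not_le.1 hk0).le
  have hlast : ‖(lastFreq lam c : ℂ)‖ ≤ R := by
    have : lastFreq lam c = -freq lam (c 0) := by
      rw [lastFreq, freq_add]
      show freq lam (c 1) + freq lam (c 2) = _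
      linarith
    rw [this, Complex.norm_real, Real.norm_eq_abs, abs_neg]; exact (not_le.1 hk0).le
  have hq : ‖quadSymbol lam m (merge c)‖ ≤ 1 := by
    rw [quadSymbol, Complex.norm_real, Real.norm_eq_abs, abs_mul]
    exact mul_le_one₀ (h.bdd _) (abs_nonneg _) (h.bdd _)
  have key := mul_le_rbracket_three hA.one_le hN (abs_lowOrder_le (lam := lam) hβ) hk
    (hf 0) (hf 1) (hf 2)
  rw [← phase_three] at key
  have hrb := rbracket_pos (phase β lam c)
  rw [weight, mul_div_assoc', div_le_iff₀ hrb, norm_mul]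
  have h1 := one_le_mul_decay hN hM0
  have hle : ‖quadSymbol lam m (merge c)‖ * ‖(lastFreq lam c : ℂ)‖ *
      ∏ i, max N |freq lam (c i)| ≤ R ^ 3 * (N ^ 2 * lam ^ 3) * decay (freq lam (c 0)) *
        rbracket (phase β lam c) := by
    rw [Fin.prod_univ_three]
    calc _ = ‖quadSymbol lam m (merge c)‖ * ‖(lastFreq lam c : ℂ)‖ * max N |freq lam (c 0)| *
        (max N |freq lam (c 1)| * max N |freq lam (c 2)|) * 1 := by ring
      _ ≤ 1 * R * R * (N ^ 2 * lam ^ 3 * rbracket (phase β lam c)) *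
          (R * decay (freq lam (c 0))) := by gcongr
      _ = _ := by ring
  exact (hA.mul_prod_le (by positivity) hle).trans (le_of_eq (by ring))

lemma cubicSymbol_mul_pow_le (h : IsNice N D m) {c a b x : ℝ} {δ : ℝ} (hc : |c| ≤ 3 * δ ^ 2)
    (hδ : 0 < δ) (hk : a + b + x = 0) (ha : δ ≤ |a|) (hb : δ ≤ |b|) (hx : δ ≤ |x|) :
    cubicSymbol c m a b x * max (max N |a|) (max (max N |b|) (max N |x|)) ^ 4 ≤ 32 * (D + 1) := by
  have hM : ∀ k, 0 < max N |k| := fun k => lt_of_lt_of_le (by linarith [h.one_le_scale])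
    (le_max_left _ _)
  rcases max_choice (max N |a|) (max (max N |b|) (max N |x|)) with e | e
  · rw [e, ← le_div_iff₀ (pow_pos (hM _) 4)]
    exact h.cubicSymbol_le hc hδ hk ha hb hx
  rw [e]
  rcases max_choice (max N |b|) (max N |x|) with e | e
  · rw [e, ← le_div_iff₀ (pow_pos (hM _) 4), cubicSymbol_swap_left]
    exact h.cubicSymbol_le hc hδ (by linarith) hb ha hx
  · rw [e, ← le_div_iff₀ (pow_pos (hM _) 4), cubicSymbol_swap_right _ _ hk, cubicSymbol_swap_left]
    exact h.cubicSymbol_le hc hδ (by linarith) hx ha hb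

/-- The majorant of the quartic terms in the derivative of the third energy. -/
noncomputable def quarticMajorant (lam : ℝ) (A : ℤ → ℝ) (c : Fin 4 → ℤ) : ℝ :=
  decay (freq lam (c 0)) * decay (freq lam (c 1)) * ∏ i, A (c i) +
    (decay (freq lam (c 0)) * decay (freq lam (c 2 + c 3)) * ∏ i, A (c i) +
      if c 2 = -c 0 ∨ c 2 = -c 1 then ∏ i, A (c i) else 0)

lemma IsControlled.quarticMajorant_nonneg (hA : IsControlled lam N κ A b) (c : Fin 4 → ℤ) :
    0 ≤ quarticMajorant lam A c := by
  have h1 := hA.prod_nonneg c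
  have h2 := decay_pos (freq lam (c 0)); have h3 := decay_pos (freq lam (c 1))
  have h4 := decay_pos (freq lam (c 2 + c 3))
  rw [quarticMajorant]
  split_ifs <;> positivity

lemma mul_mul_le_of_max {x y z T R : ℝ} (hx : 0 ≤ x) (hy : 0 ≤ y) (hz : 0 ≤ z) (hxT : x ≤ T)
    (hyT : y ≤ T) (hzT : z ≤ T) (h : x ≤ R ∨ y ≤ R ∨ z ≤ R) : x * y * z ≤ R * T ^ 2 := by
  have hT : 0 ≤ T := hx.trans hxT
  rcases h with h | h | h
  · have hR : 0 ≤ R := hx.trans h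
    calc x * y * z ≤ R * T * T := by gcongr
      _ = _ := by ring
  · have hR : 0 ≤ R := hy.trans h
    calc x * y * z ≤ T * R * T := by gcongr
      _ = _ := by ring
  · have hR : 0 ≤ R := hz.trans h
    calc x * y * z ≤ T * T * R := by gcongr
      _ = _ := by ring

lemma one_le_mul_of_max {k0 k1 κ T : ℝ} (hN : 1 ≤ N) (h0T : max N |k0| ≤ T) (h1T : max N |k1| ≤ T)
    (h : max N |k0| ≤ R ∨ max N |k1| ≤ R ∨ max N |κ| ≤ R) :
    1 ≤ R * T * (decay k0 * decay k1 + decay k0 * decay κ) := by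
  have hM : ∀ k, 0 < max N |k| := fun k => lt_of_lt_of_le (by linarith) (le_max_left _ _)
  have hd := decay_pos
  have hdm : ∀ k S, max N |k| ≤ S → 1 ≤ S * decay k := fun k S hS => one_le_mul_decay hN hS
  have hT : 0 < T := (hM k0).trans_le h0T
  have d0 := hd k0; have d1 := hd k1; have dκ := hd κ
  rcases h with h | h | h
  · have hR : 0 < R := (hM _).trans_le h
    have := one_le_mul_of_one_le_of_one_le (hdm k0 R h) (hdm k1 T h1T)
    have h2 : 0 ≤ R * T * (decay k0 * decay κ) := by positivity
    linarith
  · have hR : 0 < R := (hM _).trans_le h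
    have := one_le_mul_of_one_le_of_one_le (hdm k0 T h0T) (hdm k1 R h)
    have h2 : 0 ≤ R * T * (decay k0 * decay κ) := by positivity
    linarith
  · have hR : 0 < R := (hM _).trans_le h
    have := one_le_mul_of_one_le_of_one_le (hdm k0 T h0T) (hdm κ R h)
    have h2 : 0 ≤ R * T * (decay k0 * decay k1) := by positivity
    linarith

-- As in the cubic case the bound serves summability only. Compact support forces one argument of
-- `σ_3` to be at most `R`. Off the diagonal the resonance function absorbs the growth in `c 2, c 3`
-- (`mul_le_rbracket_four`).
set_option maxHeartbeats 1000000 in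
lemma IsControlled.norm_cubic_mul_weight_le (hA : IsControlled lam N κ A b) (h : IsNice N D m)
    (hβ : β = -1 ∨ β = 0 ∨ β = 1) (hNR : N ≤ R) (hR : ∀ k, R ≤ |k| → m k = 0) {c : Fin 4 → ℤ}
    (hc : ∑ i, c i = 0) :
    ‖sigma3 β lam m (fun i => freq lam (merge c i)) * lastFreq lam c‖ * weight β lam b c ≤
      κ ^ 4 * (128 * (D + 1) * R ^ 2 * (N * lam ^ 3)) * quarticMajorant lam A c := by
  have hD := h.one_le
  have hκ := hA.const_nonneg
  have hN := hA.one_le_scale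
  have hl0 : 0 < lam := by linarith [hA.one_le]
  have hR0 : 0 < R := by linarith
  have hmaj := hA.quarticMajorant_nonneg c
  have hr0 : 0 ≤ κ ^ 4 * (128 * (D + 1) * R ^ 2 * (N * lam ^ 3)) * quarticMajorant lam A c := by
    positivity
  by_cases h0 : ∀ i, c i ≠ 0
  swap
  · rw [weight, hA.prod_eq_zero h0, zero_div, mul_zero]; exact hr0
  have hlast : lastFreq lam c = freq lam (c 2 + c 3) := rfl
  have hm2 : merge c 2 = c 2 + c 3 := rfl
  have hm0 : merge c 0 = c 0 := rfl
  have hm1 : merge c 1 = c 1 := rfl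
  by_cases hz : c 2 + c 3 = 0
  · have : lastFreq lam c = 0 := by rw [hlast, hz]; simp [freq]
    rw [this]; simpa using hr0
  have hk : freq lam (c 0) + freq lam (c 1) + freq lam (c 2 + c 3) = 0 := by
    rw [← freq_add, ← freq_add, ← add_assoc, ← Fin.sum_univ_four, hc]; simp [freq]
  have hδ : 0 < lam⁻¹ := inv_pos.2 hl0
  have hlo := abs_lowOrder_le (lam := lam) hβ
  have hf := fun i => le_abs_freq hl0 (h0 i)
  have hfκ : lam⁻¹ ≤ |freq lam (c 2 + c 3)| := le_abs_freq hl0 hz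
  have hQ : 0 ≤ quadFactor (lowOrder β lam) (freq lam (c 0)) (freq lam (c 1)) :=
    le_trans (by positivity) (quadFactor_ge hlo hδ (hf 0) (hf 1))
  have e := norm_sigma3 (β := β) (lam := lam) (m := m) (k := fun i => freq lam (merge c i)) h.even
    (by simp only [hm0, hm1, hm2]; exact hk) (by simp only [hm0, hm1]; exact hQ)
  simp only [hm0, hm1, hm2] at e
  have hM : ∀ k, 0 < max N |k| := fun k => lt_of_lt_of_le (by linarith) (le_max_left _ _)
  have hST := cubicSymbol_mul_pow_le h hlo hδ hk (hf 0) (hf 1) hfκ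
  have hS0 : 0 ≤ cubicSymbol (lowOrder β lam) m (freq lam (c 0)) (freq lam (c 1))
    (freq lam (c 2 + c 3)) := cubicSymbol_nonneg hlo hδ (hf 0) (hf 1)
  by_cases hall : R ≤ |freq lam (c 0)| ∧ R ≤ |freq lam (c 1)| ∧ R ≤ |freq lam (c 2 + c 3)|
  · have : cubicSymbol (lowOrder β lam) m (freq lam (c 0)) (freq lam (c 1))
      (freq lam (c 2 + c 3)) = 0 := by
      simp [cubicSymbol, fluxSymbol, hR _ hall.1, hR _ hall.2.1, hR _ hall.2.2]
    rw [norm_mul, e, this]; simpa using hr0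
  have hsmall : max N |freq lam (c 0)| ≤ R ∨ max N |freq lam (c 1)| ≤ R ∨
      max N |freq lam (c 2 + c 3)| ≤ R := by
    by_contra! hcon
    refine hall ⟨?_, ?_, ?_⟩
    · exact ((lt_max_iff.1 hcon.1).resolve_left (not_lt.2 hNR)).le
    · exact ((lt_max_iff.1 hcon.2.1).resolve_left (not_lt.2 hNR)).le
    · exact ((lt_max_iff.1 hcon.2.2).resolve_left (not_lt.2 hNR)).le
  set T := max (max N |freq lam (c 0)|) (max (max N |freq lam (c 1)|)
    (max N |freq lam (c 2 + c 3)|)) with hT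
  set S := cubicSymbol (lowOrder β lam) m (freq lam (c 0)) (freq lam (c 1)) (freq lam (c 2 + c 3))
  have h0T : max N |freq lam (c 0)| ≤ T := le_max_left _ _
  have h1T : max N |freq lam (c 1)| ≤ T := (le_max_left _ _).trans (le_max_right _ _)
  have hκT : max N |freq lam (c 2 + c 3)| ≤ T := (le_max_right _ _).trans (le_max_right _ _)
  have hT0 : 0 < T := (hM _).trans_le h0T
  have hthree : max N |freq lam (c 0)| * max N |freq lam (c 1)| * |freq lam (c 2 + c 3)| ≤
      R * T ^ 2 :=
    (mul_le_mul_of_nonneg_left (le_max_right _ _) (mul_pos (hM _) (hM _)).le).trans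
      (mul_mul_le_of_max (hM _).le (hM _).le (hM _).le h0T h1T hκT hsmall)
  have hrb := rbracket_pos (phase β lam c)
  have hrb1 := one_le_rbracket (phase β lam c)
  have hnorm : ‖sigma3 β lam m (fun i => freq lam (merge c i)) * lastFreq lam c‖ ≤
      S * |freq lam (c 2 + c 3)| := by
    rw [norm_mul, e, hlast, Complex.norm_real, Real.norm_eq_abs]
    gcongr; linarith
  have hP := hA.prod_nonneg c
  have hd0 := decay_pos (freq lam (c 0)); have hd1 := decay_pos (freq lam (c 1))
  have hdκ := decay_pos (freq lam (c 2 + c 3))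
  have hlam3 : 1 ≤ N * lam ^ 3 := one_le_mul_of_one_le_of_one_le hN (one_le_pow₀ hA.one_le)
  rw [weight, mul_div_assoc', div_le_iff₀ hrb]
  -- On the diagonal the resonance function vanishes and gives nothing, but the last two frequencies
  -- are then the negatives of the first two, and `σ_3` controls all of them.
  by_cases hdiag : c 2 = -c 0 ∨ c 2 = -c 1
  · have h23 : max N |freq lam (c 2)| * max N |freq lam (c 3)| =
        max N |freq lam (c 0)| * max N |freq lam (c 1)| := by
      rw [Fin.sum_univ_four] at hc
      rcases hdiag with hd | hd
      · rw [hd, show c 3 = -c 1 by omega, freq_neg, freq_neg, abs_neg, abs_neg]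
      · rw [hd, show c 3 = -c 0 by omega, freq_neg, freq_neg, abs_neg, abs_neg, mul_comm]
    have hle : ‖sigma3 β lam m (fun i => freq lam (merge c i)) * lastFreq lam c‖ *
        ∏ i, max N |freq lam (c i)| ≤ 128 * (D + 1) * R ^ 2 * (N * lam ^ 3) *
          rbracket (phase β lam c) := by
      rw [Fin.prod_univ_four, mul_assoc (_ * _), h23]
      have h4 := (hM (freq lam (c 0))).le; have h5 := (hM (freq lam (c 1))).le
      have hR1 : 1 ≤ R := hN.trans hNR
      calc _ ≤ S * |freq lam (c 2 + c 3)| * (max N |freq lam (c 0)| * max N |freq lam (c 1)| *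
            (max N |freq lam (c 0)| * max N |freq lam (c 1)|)) := by gcongr
        _ = S * (max N |freq lam (c 0)| * max N |freq lam (c 1)| * |freq lam (c 2 + c 3)|) *
            (max N |freq lam (c 0)| * max N |freq lam (c 1)|) := by ring
        _ ≤ S * (R * T ^ 2) * (T * T) := by gcongr
        _ = (S * T ^ 4) * R := by ring
        _ ≤ 32 * (D + 1) * R := by gcongr
        _ ≤ 128 * (D + 1) * R * R * 1 * 1 := by
            have : 0 < (D + 1) * R := by positivity
            nlinarith [mul_le_mul_of_nonneg_left hR1 this.le]
        _ ≤ 128 * (D + 1) * R * R * (N * lam ^ 3) * rbracket (phase β lam c) := by gcongr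
        _ = _ := by ring
    refine (hA.mul_prod_le (norm_nonneg _) hle).trans ?_
    have : ∏ i, A (c i) ≤ quarticMajorant lam A c := by
      rw [quarticMajorant, if_pos hdiag]
      have : 0 ≤ decay (freq lam (c 0)) * decay (freq lam (c 1)) * ∏ i, A (c i) := by positivity
      have : 0 ≤ decay (freq lam (c 0)) * decay (freq lam (c 2 + c 3)) * ∏ i, A (c i) := by
        positivity
      linarith
    calc _ = κ ^ 4 * (128 * (D + 1) * R ^ 2 * (N * lam ^ 3)) * (∏ i, A (c i)) *
          rbracket (phase β lam c) := by ring
      _ ≤ _ := by gcongr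
  · rw [not_or] at hdiag
    have h02 : lam⁻¹ ≤ |freq lam (c 0) + freq lam (c 2)| := by
      rw [← freq_add]; exact le_abs_freq hl0 fun h' => hdiag.1 (by omega)
    have h03 : lam⁻¹ ≤ |freq lam (c 0) + freq lam (c 3)| := by
      rw [Fin.sum_univ_four] at hc
      rw [← freq_add]; exact le_abs_freq hl0 fun h' => hdiag.2 (by omega)
    have hfκ' := hfκ
    rw [freq_add] at hfκ'
    have key := mul_le_rbracket_four (k0 := freq lam (c 0)) (k1 := freq lam (c 1)) (T := T)
      hA.one_le hN hlo (by rw [freq_add] at hk; linarith)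
      (hf 0) (hf 2) (hf 3) hfκ' h02 h03 ((le_max_left _ _).trans h0T) ((le_max_right _ _).trans h0T)
      (by rw [← freq_add]; exact (le_max_right _ _).trans hκT)
    rw [← phase_four] at key
    have hone := one_le_mul_of_max hN h0T h1T hsmall
    set G := decay (freq lam (c 0)) * decay (freq lam (c 1)) +
      decay (freq lam (c 0)) * decay (freq lam (c 2 + c 3)) with hG
    have hG0 : 0 ≤ G := by positivity
    have hle : ‖sigma3 β lam m (fun i => freq lam (merge c i)) * lastFreq lam c‖ *
        ∏ i, max N |freq lam (c i)| ≤ 128 * (D + 1) * R ^ 2 * (N * lam ^ 3) * G *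
          rbracket (phase β lam c) := by
      rw [Fin.prod_univ_four, mul_assoc (_ * _)]
      have h4 := (hM (freq lam (c 0))).le; have h5 := (hM (freq lam (c 1))).le
      have h6 := (hM (freq lam (c 2))).le; have h7 := (hM (freq lam (c 3))).le
      calc _ ≤ S * |freq lam (c 2 + c 3)| * (max N |freq lam (c 0)| * max N |freq lam (c 1)| *
            (max N |freq lam (c 2)| * max N |freq lam (c 3)|)) := by gcongr
        _ = S * (max N |freq lam (c 0)| * max N |freq lam (c 1)| * |freq lam (c 2 + c 3)|) *
            (max N |freq lam (c 2)| * max N |freq lam (c 3)|) * 1 := by ring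
        _ ≤ S * (R * T ^ 2) * (4 * N * lam ^ 3 * T * rbracket (phase β lam c)) * (R * T * G) := by
            gcongr
        _ = (S * T ^ 4) * (4 * R ^ 2 * (N * lam ^ 3) * G * rbracket (phase β lam c)) := by ring
        _ ≤ (32 * (D + 1)) * (4 * R ^ 2 * (N * lam ^ 3) * G * rbracket (phase β lam c)) := by gcongr
        _ = _ := by ring
    refine (hA.mul_prod_le (norm_nonneg _) hle).trans (le_of_eq ?_)
    rw [quarticMajorant, if_neg (by rw [not_or]; exact hdiag), hG]
    ring

end

/-! ### Summability of the multilinear forms -/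

section

variable {β lam N D κ R : ℝ} {m : ℝ → ℝ} {A b : ℤ → ℝ}

/-- A crude admissible choice of `Q` in the convolution sums, for use where only finiteness matters.
-/
lemma ofReal_decay_mul_sq {lam B : ℝ≥0∞} : lam * B ≤ (lam * B + 1) ^ 2 := by
  rw [sq]
  calc lam * B ≤ (lam * B + 1) * 1 := by rw [mul_one]; exact le_self_add
    _ ≤ _ := by gcongr; exact le_add_self

lemma IsControlled.ofReal_prod (hA : IsControlled lam N κ A b) {l : ℕ} (c : Fin l → ℤ) :
    ENNReal.ofReal (∏ i, A (c i)) = ∏ i, ENNReal.ofReal (A (c i)) :=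
  ENNReal.ofReal_prod_of_nonneg fun _ _ => hA.majorant_nonneg _

lemma IsControlled.tsum_pair_ne_top (hA : IsControlled lam N κ A b) :
    ∑' n : Fin 1 → ℤ, ENNReal.ofReal (∏ i, A (complete n i)) ≠ ⊤ := by
  have h := tsum_complete_last_two_le (a := fun n => ENNReal.ofReal (A n)) le_rfl (l := 0)
    fun _ => 1
  refine ne_top_of_le_ne_top ?_ (le_trans (le_of_eq (tsum_congr fun n => ?_)) h)
  · rw [tsum_fintype]
    simpa using ENNReal.mul_ne_top ENNReal.ofNat_ne_top hA.finite
  · rw [hA.ofReal_prod, Fin.prod_univ_two, one_mul]; rfl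

lemma IsControlled.tsum_cubic_ne_top (hA : IsControlled lam N κ A b) :
    ∑' n : Fin 2 → ℤ, ENNReal.ofReal (decay (freq lam (complete n 0)) * ∏ i, A (complete n i)) ≠
      ⊤ := by
  have h := tsum_cubic_le (a := fun n => ENNReal.ofReal (A n)) le_rfl
    (tsum_decay_le hA.one_le) ofReal_decay_mul_sq
  refine ne_top_of_le_ne_top ?_ (le_trans (le_of_eq (tsum_congr fun n => ?_)) h)
  · have := hA.finite; finiteness
  · rw [ENNReal.ofReal_mul (decay_pos _).le, hA.ofReal_prod]

lemma IsControlled.tsum_quartic_ne_top (hA : IsControlled lam N κ A b) :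
    ∑' n : Fin 3 → ℤ, ENNReal.ofReal (decay (freq lam (complete n 0)) *
      decay (freq lam (complete n 1)) * ∏ i, A (complete n i)) ≠ ⊤ := by
  have h := tsum_quartic_le (a := fun n => ENNReal.ofReal (A n)) le_rfl
    (tsum_decay_le hA.one_le) ofReal_decay_mul_sq
  refine ne_top_of_le_ne_top ?_ (le_trans (le_of_eq (tsum_congr fun n => ?_)) h)
  · have := hA.finite; finiteness
  · rw [ENNReal.ofReal_mul (mul_pos (decay_pos _) (decay_pos _)).le,
      ENNReal.ofReal_mul (decay_pos _).le, hA.ofReal_prod]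

lemma IsControlled.tsum_quarticMajorant_ne_top (hA : IsControlled lam N κ A b) :
    ∑' n : Fin 3 → ℤ, ENNReal.ofReal (quarticMajorant lam A (complete n)) ≠ ⊤ := by
  have h := tsum_quartic_pair_le (a := fun n => ENNReal.ofReal (A n)) le_rfl
    (tsum_decay_le hA.one_le) ofReal_decay_mul_sq
  have h' := tsum_quartic_diag_le (a := fun n => ENNReal.ofReal (A n)) le_rfl
  have hp : ∀ c : Fin 4 → ℤ, ENNReal.ofReal (quarticMajorant lam A c) ≤
      ENNReal.ofReal (decay (freq lam (c 0)) * decay (freq lam (c 1)) * ∏ i, A (c i)) +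
      (ENNReal.ofReal (decay (freq lam (c 0))) * ENNReal.ofReal (decay (freq lam (c 2 + c 3))) *
        ∏ i, ENNReal.ofReal (A (c i)) +
      (if c 2 = -c 0 ∨ c 2 = -c 1 then ∏ i, ENNReal.ofReal (A (c i)) else 0)) := by
    intro c
    rw [quarticMajorant]
    refine ENNReal.ofReal_add_le.trans (add_le_add le_rfl (ENNReal.ofReal_add_le.trans
      (add_le_add (le_of_eq ?_) (le_of_eq ?_))))
    · rw [ENNReal.ofReal_mul (mul_pos (decay_pos _) (decay_pos _)).le,
        ENNReal.ofReal_mul (decay_pos _).le, hA.ofReal_prod]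
    · split_ifs
      · exact hA.ofReal_prod c
      · exact ENNReal.ofReal_zero
  refine ne_top_of_le_ne_top ?_ (ENNReal.tsum_le_tsum fun n => hp (complete n))
  rw [ENNReal.tsum_add, ENNReal.tsum_add]
  refine ENNReal.add_ne_top.2 ⟨hA.tsum_quartic_ne_top, ENNReal.add_ne_top.2
    ⟨ne_top_of_le_ne_top ?_ h, ne_top_of_le_ne_top ?_ h'⟩⟩
  · have := hA.finite; finiteness
  · have := hA.finite; finiteness

/-- The quintic majorant on the hyperplane. -/
noncomputable def quinticSum (lam : ℝ) (A : ℤ → ℝ) (c : Fin 5 → ℤ) : ℝ :=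
  quinticMajorant (freq lam (c 0)) (freq lam (c 1)) (freq lam (c 2)) (freq lam (c 3))
    (freq lam (c 4)) * ∏ i, A (c i)

lemma IsControlled.quinticSum_nonneg (hA : IsControlled lam N κ A b) (c : Fin 5 → ℤ) :
    0 ≤ quinticSum lam A c := by
  have hd := fun k => (decay_pos k).le
  refine mul_nonneg ?_ (hA.prod_nonneg c)
  rw [quinticMajorant]
  have h1 := hd (freq lam (c 0)); have h2 := hd (freq lam (c 1))
  have h3 := hd (freq lam (c 2)); have h4 := hd (freq lam (c 3))
  have h5 := hd (freq lam (c 4)); have h6 := hd (freq lam (c 3) + freq lam (c 4))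
  positivity

/-- Expanded, the majorant has three terms with a squared weight at `k4 + k5` and seven with weights
at three distinct frequencies. Each is a permutation of one of the two model sums. -/
lemma IsControlled.tsum_quinticSum_le (hA : IsControlled lam N κ A b) {B Q : ℝ≥0∞}
    (hB : ∑' n, ENNReal.ofReal (A n) ^ 2 ≤ B) (hQ : ENNReal.ofReal (100 * lam) * B ≤ Q ^ 2) :
    ∑' n : Fin 4 → ℤ, ENNReal.ofReal (quinticSum lam A (complete n)) ≤
      3 * (Q * ENNReal.ofReal (100 * lam) * (2 * B) ^ 2) + 7 * (Q ^ 3 * (2 * B)) := by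
  have hW := tsum_decay_le hA.one_le
  set w : ℤ → ℝ≥0∞ := fun n => ENNReal.ofReal (decay (freq lam n)) with hw
  set a : ℤ → ℝ≥0∞ := fun n => ENNReal.ofReal (A n) with ha
  have htri : ∀ (i j k : Fin 5) (σ : Equiv.Perm (Fin 5)), σ 0 = i ∧ σ 1 = j ∧ σ 2 = k → ∑' n : Fin 4 → ℤ, w (complete n i) *
      w (complete n j) * w (complete n k) * ∏ i, a (complete n i) ≤ Q ^ 3 * (2 * B) := by
    rintro i j k σ ⟨h0, h1, h2⟩
    have := tsum_quintic_perm_le hB hW hQ σ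
    rwa [h0, h1, h2] at this
  have hpair : ∀ i : Fin 5, i = 0 ∨ i = 1 ∨ i = 2 → ∑' n : Fin 4 → ℤ, w (complete n i) *
      w (complete n 3 + complete n 4) ^ 2 * ∏ i, a (complete n i) ≤
      Q * ENNReal.ofReal (100 * lam) * (2 * B) ^ 2 := by
    intro i hi
    have h3 : (Equiv.swap 0 i) 3 = 3 := by
      rcases hi with rfl | rfl | rfl <;> decide
    have h4 : (Equiv.swap 0 i) 4 = 4 := by
      rcases hi with rfl | rfl | rfl <;> decide
    refine le_trans (le_of_eq ?_) (tsum_quintic_pair_le hB hW hQ)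
    rw [← tsum_complete_comp_perm (Equiv.swap 0 i) fun c => w (c 0) * w (c 3 + c 4) ^ 2 *
      ∏ i, a (c i)]
    refine tsum_congr fun n => ?_
    simp only [Function.comp_apply, h3, h4, Equiv.swap_apply_left]
    rw [Equiv.prod_comp (Equiv.swap 0 i) fun j => a (complete n j)]
  have hp : ∀ c : Fin 5 → ℤ, ENNReal.ofReal (quinticSum lam A c) =
      (w (c 0) * w (c 3 + c 4) ^ 2 * ∏ i, a (c i) + w (c 1) * w (c 3 + c 4) ^ 2 * ∏ i, a (c i) +
        w (c 2) * w (c 3 + c 4) ^ 2 * ∏ i, a (c i)) +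
      (w (c 0) * w (c 1) * w (c 2) * ∏ i, a (c i) + w (c 0) * w (c 1) * w (c 3) * ∏ i, a (c i) +
        w (c 0) * w (c 1) * w (c 4) * ∏ i, a (c i) + w (c 0) * w (c 2) * w (c 3) * ∏ i, a (c i) +
        w (c 0) * w (c 2) * w (c 4) * ∏ i, a (c i) + w (c 1) * w (c 2) * w (c 3) * ∏ i, a (c i) +
        w (c 1) * w (c 2) * w (c 4) * ∏ i, a (c i)) := by
    intro c
    have hd := fun k => (decay_pos k).le
    simp only [hw, ha, ← hA.ofReal_prod]
    rw [freq_add, quinticSum, quinticMajorant]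
    have h1 := hd (freq lam (c 0)); have h2 := hd (freq lam (c 1))
    have h3 := hd (freq lam (c 2)); have h4 := hd (freq lam (c 3))
    have h5 := hd (freq lam (c 4)); have h6 := hd (freq lam (c 3) + freq lam (c 4))
    have hP := hA.prod_nonneg c
    generalize decay (freq lam (c 0)) = d0 at *
    generalize decay (freq lam (c 1)) = d1 at *
    generalize decay (freq lam (c 2)) = d2 at *
    generalize decay (freq lam (c 3)) = d3 at *
    generalize decay (freq lam (c 4)) = d4 at *
    generalize decay (freq lam (c 3) + freq lam (c 4)) = d5 at *
    generalize ∏ i, A (c i) = P at *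
    lift d0 to NNReal using h1
    lift d1 to NNReal using h2
    lift d2 to NNReal using h3
    lift d3 to NNReal using h4
    lift d4 to NNReal using h5
    lift d5 to NNReal using h6
    lift P to NNReal using hP
    simp only [← NNReal.coe_add, ← NNReal.coe_mul, ENNReal.ofReal_coe_nnreal, ← ENNReal.coe_mul,
      ← ENNReal.coe_add, ← ENNReal.coe_pow]
    congr 1
    ring
  simp only [hp]
  simp only [ENNReal.tsum_add]
  refine add_le_add ?_ ?_
  · refine (add_le_add (add_le_add (hpair 0 (by decide)) (hpair 1 (by decide)))
      (hpair 2 (by decide))).trans (le_of_eq (by ring))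
  · refine (add_le_add (add_le_add (add_le_add (add_le_add (add_le_add (add_le_add

      (htri 0 1 2 1 (by decide))
      (htri 0 1 3 (Equiv.swap 2 3) (by decide)))
      (htri 0 1 4 (Equiv.swap 2 4) (by decide)))

      (htri 0 2 3 (Equiv.swap 1 2 * Equiv.swap 2 3) (by decide)))
      (htri 0 2 4 (Equiv.swap 1 2 * Equiv.swap 2 4) (by decide)))
      (htri 1 2 3 (Equiv.swap 0 1 * Equiv.swap 1 2 * Equiv.swap 2 3) (by decide)))

      (htri 1 2 4 (Equiv.swap 0 1 * Equiv.swap 1 2 * Equiv.swap 2 4) (by decide))).trans (le_of_eq (by ring))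

lemma IsControlled.tsum_quinticSum_ne_top (hA : IsControlled lam N κ A b) :
    ∑' n : Fin 4 → ℤ, ENNReal.ofReal (quinticSum lam A (complete n)) ≠ ⊤ := by
  refine ne_top_of_le_ne_top ?_ (hA.tsum_quinticSum_le le_rfl ofReal_decay_mul_sq)
  have := hA.finite; finiteness

lemma IsControlled.summable_bilinear (hA : IsControlled lam N κ A b)
    (hβ : β = -1 ∨ β = 0 ∨ β = 1) (n : ℤ) :
    Summable fun j => |freq lam n| * (b j * b (n - j)) /
      rbracket (disp β lam j + disp β lam (n - j) - disp β lam n) := by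
  refine summable_of_tsum_ne_top (fun j => ?_) (hA.bilinear_le hβ n)
    (fun j => mul_nonneg (hA.majorant_nonneg _) (hA.majorant_nonneg _)) ?_
  · exact div_nonneg (mul_nonneg (abs_nonneg _) (mul_nonneg (hA.nonneg _) (hA.nonneg _)))
      (rbracket_pos _).le
  · simp only [ENNReal.ofReal_mul (hA.majorant_nonneg _)]
    refine ne_top_of_le_ne_top ?_ (tsum_mul_reflect_le (a := fun n => ENNReal.ofReal (A n)) le_rfl n)
    have := hA.finite; finiteness

lemma IsControlled.weight_nonneg (hA : IsControlled lam N κ A b) {l : ℕ} (c : Fin l → ℤ) :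
    0 ≤ weight β lam b c :=
  div_nonneg (Finset.prod_nonneg fun _ _ => hA.nonneg _) (rbracket_pos _).le

lemma IsControlled.weight_eq_zero (hA : IsControlled lam N κ A b) {l : ℕ} {c : Fin l → ℤ}
    (h : ¬∀ i, c i ≠ 0) : weight β lam b c = 0 := by
  rw [weight, hA.prod_eq_zero h, zero_div]

lemma IsControlled.summable_sigma3 (hA : IsControlled lam N κ A b) (h : IsNice N D m)
    (hβ : β = -1 ∨ β = 0 ∨ β = 1) :
    Summable fun n : Fin 2 → ℤ => ‖sigma3 β lam m (fun i => freq lam (complete n i))‖ *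
      ∏ i, b (complete n i) :=
  summable_of_tsum_ne_top
    (fun _ => mul_nonneg (norm_nonneg _) (Finset.prod_nonneg fun _ _ => hA.nonneg _))
    (fun n => hA.norm_sigma3_mul_prod_le h hβ (sum_complete n))
    (fun _ => mul_nonneg (decay_pos _).le (hA.prod_nonneg _)) hA.tsum_cubic_ne_top

lemma IsControlled.summable_sigma4 (hA : IsControlled lam N κ A b) (h : IsNice N D m)
    (hβ : β = -1 ∨ β = 0 ∨ β = 1) :
    Summable fun n : Fin 3 → ℤ => ‖sigma4 β lam m (fun i => freq lam (complete n i))‖ *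
      ∏ i, b (complete n i) :=
  summable_of_tsum_ne_top
    (fun _ => mul_nonneg (norm_nonneg _) (Finset.prod_nonneg fun _ _ => hA.nonneg _))
    (fun n => hA.norm_sigma4_mul_prod_le h hβ (sum_complete n))
    (fun _ => mul_nonneg (mul_pos (decay_pos _) (decay_pos _)).le (hA.prod_nonneg _))
    hA.tsum_quartic_ne_top

lemma IsControlled.summable_quintic (hA : IsControlled lam N κ A b) (h : IsNice N D m)
    (hβ : β = -1 ∨ β = 0 ∨ β = 1) :
    Summable fun n : Fin 4 → ℤ =>
      ‖sigma4 β lam m (fun i => freq lam (merge (complete n) i)) * lastFreq lam (complete n)‖ *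
        weight β lam b (complete n) :=
  summable_of_tsum_ne_top (fun _ => mul_nonneg (norm_nonneg _) (hA.weight_nonneg _))
    (fun n => hA.norm_quintic_mul_weight_le h hβ (sum_complete n))
    (fun n => hA.quinticSum_nonneg (complete n)) hA.tsum_quinticSum_ne_top

lemma IsControlled.summable_quartic (hA : IsControlled lam N κ A b) (h : IsNice N D m)
    (hβ : β = -1 ∨ β = 0 ∨ β = 1) (hNR : N ≤ R) (hR : ∀ k, R ≤ |k| → m k = 0) :
    Summable fun n : Fin 3 → ℤ =>
      ‖sigma3 β lam m (fun i => freq lam (merge (complete n) i)) * lastFreq lam (complete n)‖ *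
        weight β lam b (complete n) :=
  summable_of_tsum_ne_top (fun _ => mul_nonneg (norm_nonneg _) (hA.weight_nonneg _))
    (fun n => hA.norm_cubic_mul_weight_le h hβ hNR hR (sum_complete n))
    (fun n => hA.quarticMajorant_nonneg (complete n)) hA.tsum_quarticMajorant_ne_top

lemma IsControlled.summable_cubic (hA : IsControlled lam N κ A b) (h : IsNice N D m)
    (hβ : β = -1 ∨ β = 0 ∨ β = 1) (hNR : N ≤ R) (hR : ∀ k, R ≤ |k| → m k = 0) :
    Summable fun n : Fin 2 → ℤ =>
      ‖quadSymbol lam m (merge (complete n)) * lastFreq lam (complete n)‖ *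
        weight β lam b (complete n) :=
  summable_of_tsum_ne_top (fun _ => mul_nonneg (norm_nonneg _) (hA.weight_nonneg _))
    (fun n => hA.norm_quad_mul_weight_le h hβ hNR hR (sum_complete n))
    (fun _ => mul_nonneg (decay_pos _).le (hA.prod_nonneg _)) hA.tsum_cubic_ne_top

lemma IsControlled.summable_quad (hA : IsControlled lam N κ A b)
    (hmb : ∀ n, |m (freq lam n)| * b n ≤ A n) :
    Summable fun n : Fin 1 → ℤ => ‖quadSymbol lam m (complete n)‖ * ∏ i, b (complete n i) := by
  refine summable_of_tsum_ne_top (C := 1)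
    (fun _ => mul_nonneg (norm_nonneg _) (Finset.prod_nonneg fun _ _ => hA.nonneg _))
    (fun n => ?_) (fun n => hA.prod_nonneg (complete n)) hA.tsum_pair_ne_top
  rw [quadSymbol, Complex.norm_real, Real.norm_eq_abs, abs_mul, Fin.prod_univ_two,
    Fin.prod_univ_two]
  have h0 := hmb (complete n 0)
  have h1 := hmb (complete n 1)
  have hb := hA.nonneg
  calc _ = (|m (freq lam (complete n 0))| * b (complete n 0)) *
        (|m (freq lam (complete n 1))| * b (complete n 1)) := by ring
    _ ≤ A (complete n 0) * A (complete n 1) :=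
        mul_le_mul h0 h1 (mul_nonneg (abs_nonneg _) (hb _))
          ((mul_nonneg (abs_nonneg _) (hb _)).trans h0)
    _ = _ := by ring

end

/-! ### The evolution of the modified energy -/

/-- The normalization of the form with `l` arguments. -/
noncomputable def formConst (lam : ℝ) (l : ℕ) : ℝ := 2 * Real.pi * lam * convConst lam ^ l

/-- The modified energy as a sum of multilinear forms in free coordinates. -/
noncomputable def modeEnergy (β lam : ℝ) (m : ℝ → ℝ) (f : PeriodicDistribution) : ℂ :=
  formConst lam 2 * ∑' n : Fin 1 → ℤ, quadSymbol lam m (complete n) * ∏ i, f (complete n i) +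
    formConst lam 3 * ∑' n : Fin 2 → ℤ, sigma3 β lam m (fun i => freq lam (complete n i)) *
      ∏ i, f (complete n i) +
    formConst lam 4 * ∑' n : Fin 3 → ℤ, sigma4 β lam m (fun i => freq lam (complete n i)) *
      ∏ i, f (complete n i)

section

variable {β lam N D κ R T T' : ℝ} {m : ℝ → ℝ} {A b : ℤ → ℝ} {U : ℝ → PeriodicDistribution}

lemma quadSymbol_comp_perm (σ : Equiv.Perm (Fin 2)) (c : Fin 2 → ℤ) :
    quadSymbol lam m (c ∘ σ) = quadSymbol lam m c := by
  have : ∀ c : Fin 2 → ℤ, quadSymbol lam m c = ∏ i, (m (freq lam (c i)) : ℂ) := fun c => by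
    rw [Fin.prod_univ_two, quadSymbol]; push_cast; rfl
  rw [this, this]
  exact Equiv.prod_comp σ fun i => (m (freq lam (c i)) : ℂ)

/-- The cubic multiplier before symmetrization. -/
noncomputable def cubicFlux (m : ℝ → ℝ) (k : Fin 3 → ℝ) : ℂ :=
  ((m (k 0) * m (k 1 + k 2) * (k 1 + k 2) : ℝ) : ℂ)

/-- The quartic multiplier before symmetrization. -/
noncomputable def quarticFlux (β lam : ℝ) (m : ℝ → ℝ) (k : Fin 4 → ℝ) : ℂ :=
  sigma3 β lam m ![k 0, k 1, k 2 + k 3] * ((k 2 + k 3 : ℝ) : ℂ)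

lemma cubicFlux_freq (c : Fin 3 → ℤ) : cubicFlux m (fun i => freq lam (c i)) =
    quadSymbol lam m (merge c) * lastFreq lam c := by
  rw [cubicFlux, quadSymbol, ← freq_add, ← Complex.ofReal_mul]; rfl

lemma quarticFlux_freq (c : Fin 4 → ℤ) : quarticFlux β lam m (fun i => freq lam (c i)) =
    sigma3 β lam m (fun i => freq lam (merge c i)) * lastFreq lam c := by
  rw [quarticFlux, ← freq_add]
  congr 2
  ext i; fin_cases i <;> rfl

lemma M3_eq_symmetrize (k : Fin 3 → ℝ) : M3 m k = -2 * Complex.I * symmetrize (cubicFlux m) k := rfl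

lemma M4_eq_symmetrize (k : Fin 4 → ℝ) :
    M4 β lam m k = -3 * Complex.I * symmetrize (quarticFlux β lam m) k := rfl

lemma IsModeFamily.modeIntegral_eq_zero (hU : IsModeFamily β lam T T' b U) {l : ℕ}
    {c : Fin l → ℤ} (h : ¬∀ i, c i ≠ 0) (s t : ℝ) : modeIntegral U s t c = 0 := by
  obtain ⟨i, hi⟩ := not_forall.1 h
  have : ∀ r, ∏ i, U r (c i) = 0 := fun r =>
    Finset.prod_eq_zero (Finset.mem_univ i) (by rw [not_not.1 hi, hU.zero])
  simp [modeIntegral, this]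

lemma phase_complete_two (n : Fin 1 → ℤ) : phase β lam (complete n) = 0 := by
  have h := sum_complete n
  rw [Fin.sum_univ_two] at h
  rw [phase, Fin.sum_univ_two, show complete n 1 = -complete n 0 by omega, disp, disp,
    freq_neg, dispersion, dispersion]
  ring

lemma IsControlled.norm_resonance_sigma3_mul (hA : IsControlled lam N κ A b)
    (hβ : β = -1 ∨ β = 0 ∨ β = 1) {c : Fin 3 → ℤ} (hc : ∑ i, c i = 0) :
    ‖Complex.I * phase β lam c * sigma3 β lam m (fun i => freq lam (c i))‖ * weight β lam b c =
      2 * (‖symmetrize (cubicFlux m) (fun i => freq lam (c i))‖ * weight β lam b c) := by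
  have hl0 : 0 < lam := by linarith [hA.one_le]
  by_cases h0 : ∀ i, c i ≠ 0
  · rw [resonance_mul_sigma3 hl0 hβ hc h0, M3_eq_symmetrize]
    simp; ring
  · rw [hA.weight_eq_zero h0]; simp

lemma IsControlled.norm_resonance_sigma4_mul (hA : IsControlled lam N κ A b)
    (hm : ∀ x, m (-x) = m x) (hβ : β = -1 ∨ β = 0 ∨ β = 1) {c : Fin 4 → ℤ} (hc : ∑ i, c i = 0) :
    ‖Complex.I * phase β lam c * sigma4 β lam m (fun i => freq lam (c i))‖ * weight β lam b c =
      3 * (‖symmetrize (quarticFlux β lam m) (fun i => freq lam (c i))‖ * weight β lam b c) := by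
  have hl0 : 0 < lam := by linarith [hA.one_le]
  by_cases h0 : ∀ i, c i ≠ 0
  · rw [resonance_mul_sigma4 hm hl0 hβ hc h0, M4_eq_symmetrize]
    simp; ring
  · rw [hA.weight_eq_zero h0]; simp

lemma formConst_succ (lam : ℝ) (l : ℕ) : formConst lam (l + 1) = formConst lam l * convConst lam := by
  rw [formConst, formConst, pow_succ, ← mul_assoc]

lemma tsum_resonance_sigma3 (hA : IsControlled lam N κ A b) (hU : IsModeFamily β lam T T' b U)
    (hβ : β = -1 ∨ β = 0 ∨ β = 1) {s t : ℝ}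
    (h : Summable fun n : Fin 2 → ℤ => cubicFlux m (fun i => freq lam (complete n i)) *
      modeIntegral U s t (complete n)) :
    ∑' n : Fin 2 → ℤ, Complex.I * phase β lam (complete n) *
      sigma3 β lam m (fun i => freq lam (complete n i)) * modeIntegral U s t (complete n) =
    2 * Complex.I * ∑' n : Fin 2 → ℤ, cubicFlux m (fun i => freq lam (complete n i)) *
      modeIntegral U s t (complete n) := by
  have hl0 : 0 < lam := by linarith [hA.one_le]
  rw [← tsum_symmetrize lam (fun σ c => modeIntegral_comp_perm U s t c σ) h, ← tsum_mul_left]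
  refine tsum_congr fun n => ?_
  by_cases h0 : ∀ i, complete n i ≠ 0
  · rw [resonance_mul_sigma3 hl0 hβ (sum_complete n) h0, M3_eq_symmetrize]
    ring
  · rw [hU.modeIntegral_eq_zero h0]; simp

lemma tsum_resonance_sigma4 (hA : IsControlled lam N κ A b) (hU : IsModeFamily β lam T T' b U)
    (hm : ∀ x, m (-x) = m x) (hβ : β = -1 ∨ β = 0 ∨ β = 1) {s t : ℝ}
    (h : Summable fun n : Fin 3 → ℤ => quarticFlux β lam m (fun i => freq lam (complete n i)) *
      modeIntegral U s t (complete n)) :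
    ∑' n : Fin 3 → ℤ, Complex.I * phase β lam (complete n) *
      sigma4 β lam m (fun i => freq lam (complete n i)) * modeIntegral U s t (complete n) =
    3 * Complex.I * ∑' n : Fin 3 → ℤ, quarticFlux β lam m (fun i => freq lam (complete n i)) *
      modeIntegral U s t (complete n) := by
  have hl0 : 0 < lam := by linarith [hA.one_le]
  rw [← tsum_symmetrize lam (fun σ c => modeIntegral_comp_perm U s t c σ) h, ← tsum_mul_left]
  refine tsum_congr fun n => ?_
  by_cases h0 : ∀ i, complete n i ≠ 0
  · rw [resonance_mul_sigma4 hm hl0 hβ (sum_complete n) h0, M4_eq_symmetrize]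
    ring
  · rw [hU.modeIntegral_eq_zero h0]; simp

set_option maxHeartbeats 1000000 in
/-- The energy identity for symbols of compact support. -/
lemma modeEnergy_sub (hA : IsControlled lam N κ A b) (hU : IsModeFamily β lam T T' b U)
    (hT : T' - T ≤ 2) (h : IsNice N D m) (hβ : β = -1 ∨ β = 0 ∨ β = 1) (hNR : N ≤ R)
    (hR : ∀ k, R ≤ |k| → m k = 0) (hmb : ∀ n, |m (freq lam n)| * b n ≤ A n) {s t : ℝ}
    (hs : s ∈ Set.Icc T T') (ht : t ∈ Set.Icc T T') :
    modeEnergy β lam m (U t) - modeEnergy β lam m (U s) =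
      formConst lam 4 * ((-(Complex.I * convConst lam) * 4) * ∑' n : Fin 4 → ℤ,
        sigma4 β lam m (fun i => freq lam (merge (complete n) i)) * lastFreq lam (complete n) *
          modeIntegral U s t (complete n)) := by
  have hst : |t - s| ≤ 2 := by rw [abs_le]; constructor <;> linarith [hs.1, hs.2, ht.1, ht.2]
  have hw0 : ∀ {l : ℕ} (c : Fin l → ℤ), 0 ≤ weight β lam b c := hA.weight_nonneg
  have hc3 := hA.summable_cubic h hβ hNR hR
  have hc4 := hA.summable_quartic h hβ hNR hR
  have hc5 := hA.summable_quintic h hβ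
  have hF3 : Summable fun n : Fin 2 → ℤ => ‖cubicFlux m (fun i => freq lam (complete n i))‖ *
      weight β lam b (complete n) := hc3.congr fun n => by rw [cubicFlux_freq]
  have hF4 : Summable fun n : Fin 3 → ℤ => ‖quarticFlux β lam m (fun i => freq lam (complete n i))‖ *
      weight β lam b (complete n) := hc4.congr fun n => by rw [quarticFlux_freq]
  have hS3 := summable_symmetrize lam (fun σ c => weight_comp_perm β lam b c σ) hw0 hF3
  have hS4 := summable_symmetrize lam (fun σ c => weight_comp_perm β lam b c σ) hw0 hF4
  have d2 := hU.tsum_sub_tsum hT (X := quadSymbol lam m) quadSymbol_comp_perm (hA.summable_quad hmb)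
    (by simp only [phase_complete_two]; simp) hc3 hs ht
  have d3 := hU.tsum_sub_tsum hT (X := fun c => sigma3 β lam m fun i => freq lam (c i))
    (fun σ c => sigma3_comp_perm β lam m (fun i => freq lam (c i)) σ) (hA.summable_sigma3 h hβ)
    ((hS3.mul_left 2).congr fun n => (hA.norm_resonance_sigma3_mul hβ (sum_complete n)).symm)
    hc4 hs ht
  have d4 := hU.tsum_sub_tsum hT (X := fun c => sigma4 β lam m fun i => freq lam (c i))
    (fun σ c => sigma4_comp_perm β lam m (fun i => freq lam (c i)) σ) (hA.summable_sigma4 h hβ)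
    ((hS4.mul_left 3).congr fun n =>
      (hA.norm_resonance_sigma4_mul h.even hβ (sum_complete n)).symm)
    hc5 hs ht
  rw [tsum_resonance_sigma3 hA hU hβ (hU.summable_mul_modeIntegral hF3 hst)] at d3
  rw [tsum_resonance_sigma4 hA hU h.even hβ (hU.summable_mul_modeIntegral hF4 hst)] at d4
  simp only [phase_complete_two, Complex.ofReal_zero, mul_zero, zero_mul, tsum_zero, zero_add] at d2
  simp only [cubicFlux_freq] at d3
  simp only [quarticFlux_freq] at d4
  -- The quadratic nonlinearity contributes exactly the factor by which the normalizations of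
  -- consecutive forms differ. Hence the term `-2i` from `d2` cancels the `2i` from `d3`, and the
  -- `-3i` from `d3` cancels the `3i` from `d4`.
  have e4 : (formConst lam 4 : ℂ) = formConst lam 3 * convConst lam := by
    rw [formConst_succ]; push_cast; rfl
  have e3 : (formConst lam 3 : ℂ) = formConst lam 2 * convConst lam := by
    rw [formConst_succ]; push_cast; rfl
  calc _ = formConst lam 2 * (∑' n : Fin 1 → ℤ, quadSymbol lam m (complete n) *
          ∏ i, U t (complete n i) - ∑' n : Fin 1 → ℤ, quadSymbol lam m (complete n) *
          ∏ i, U s (complete n i)) +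
        formConst lam 3 * (∑' n : Fin 2 → ℤ, sigma3 β lam m (fun i => freq lam (complete n i)) *
          ∏ i, U t (complete n i) -
          ∑' n : Fin 2 → ℤ, sigma3 β lam m (fun i => freq lam (complete n i)) *
          ∏ i, U s (complete n i)) +
        formConst lam 4 * (∑' n : Fin 3 → ℤ, sigma4 β lam m (fun i => freq lam (complete n i)) *
          ∏ i, U t (complete n i) -
          ∑' n : Fin 3 → ℤ, sigma4 β lam m (fun i => freq lam (complete n i)) *
          ∏ i, U s (complete n i)) := by
        simp only [modeEnergy]; ring
    _ = _ := by
        rw [d2, d3, d4, e4, e3]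
        push_cast
        ring

lemma ofReal_norm_modeEnergy_sub_le (hA : IsControlled lam N κ A b)
    (hU : IsModeFamily β lam T T' b U)
    (hT : T' - T ≤ 2) (h : IsNice N D m) (hβ : β = -1 ∨ β = 0 ∨ β = 1) (hNR : N ≤ R)
    (hR : ∀ k, R ≤ |k| → m k = 0) (hmb : ∀ n, |m (freq lam n)| * b n ≤ A n) {s t : ℝ}
    (hs : s ∈ Set.Icc T T') (ht : t ∈ Set.Icc T T') :
    ENNReal.ofReal ‖modeEnergy β lam m (U t) - modeEnergy β lam m (U s)‖ ≤
      ENNReal.ofReal (2 ^ 99 * formConst lam 5 * (D + 1) * κ ^ 5) *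
        ∑' n : Fin 4 → ℤ, ENNReal.ofReal (quinticSum lam A (complete n)) := by
  have hst : |t - s| ≤ 2 := by rw [abs_le]; constructor <;> linarith [hs.1, hs.2, ht.1, ht.2]
  have hD := h.one_le
  have hκ := hA.const_nonneg
  have hl0 : 0 < lam := by linarith [hA.one_le]
  have hcc : 0 ≤ convConst lam := by rw [convConst]; positivity
  have hfc : ∀ l, 0 ≤ formConst lam l := fun l => by
    rw [formConst]; positivity
  have hq0 := fun n : Fin 4 → ℤ => hA.quinticSum_nonneg (complete n)
  have hqs : Summable fun n : Fin 4 → ℤ => quinticSum lam A (complete n) := by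
    have := ENNReal.summable_toReal hA.tsum_quinticSum_ne_top
    simpa only [ENNReal.toReal_ofReal (hq0 _)] using this
  rw [← ENNReal.ofReal_tsum_of_nonneg hq0 hqs, ← ENNReal.ofReal_mul (by have := hfc 5; positivity)]
  refine ENNReal.ofReal_le_ofReal ?_
  rw [modeEnergy_sub hA hU hT h hβ hNR hR hmb hs ht]
  -- The constant is `24 · 2⁴ = 384 ≤ 2⁹` times `2 ^ 88`; the factor `4` of the quintic term
  -- accounts for `2 ^ 99`.
  have hle : ∀ n : Fin 4 → ℤ, ‖sigma4 β lam m (fun i => freq lam (merge (complete n) i)) *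
      lastFreq lam (complete n) * modeIntegral U s t (complete n)‖ ≤
      2 ^ 97 * (D + 1) * κ ^ 5 * quinticSum lam A (complete n) := by
    intro n
    rw [norm_mul]
    have h1 := hU.norm_modeIntegral_le (complete n) hst
    have h2 := hA.norm_quintic_mul_weight_le h hβ (sum_complete n)
    have h3 := hA.weight_nonneg (β := β) (complete n)
    set X := ‖sigma4 β lam m (fun i => freq lam (merge (complete n) i)) *
      lastFreq lam (complete n)‖
    have hX : 0 ≤ X := norm_nonneg _
    calc _ ≤ X * (24 * 2 ^ 4 * weight β lam b (complete n)) := by gcongr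
      _ = (384 : ℝ) * (X * weight β lam b (complete n)) := by ring
      _ ≤ 384 * (2 ^ 88 * (D + 1) * κ ^ 5 * quinticSum lam A (complete n)) := by
          exact mul_le_mul_of_nonneg_left h2 (by norm_num)
      _ ≤ _ := by
          have : 0 ≤ (D + 1) * κ ^ 5 * quinticSum lam A (complete n) := by
            have := hq0 n; positivity
          nlinarith
  have hnorm := tsum_of_norm_bounded (hqs.mul_left (2 ^ 97 * (D + 1) * κ ^ 5)).hasSum hle
  rw [tsum_mul_left] at hnorm
  rw [norm_mul, norm_mul, Complex.norm_real, Real.norm_eq_abs, abs_of_nonneg (hfc 4)]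
  have : ‖-(Complex.I * (convConst lam : ℂ)) * 4‖ = convConst lam * 4 := by
    rw [norm_mul, norm_neg, norm_mul, Complex.norm_I, one_mul, Complex.norm_real, Real.norm_eq_abs,
      abs_of_nonneg hcc]
    norm_num
  rw [this, formConst_succ lam 4]
  have h4 := hfc 4
  calc _ ≤ formConst lam 4 * (convConst lam * 4 * (2 ^ 97 * (D + 1) * κ ^ 5 *
        ∑' n : Fin 4 → ℤ, quinticSum lam A (complete n))) := by gcongr
    _ = _ := by ring

end

/-! ### Removing the compact support of the symbol -/

section

variable {β lam : ℝ} {m : ℝ → ℝ} {mK : ℕ → ℝ → ℝ}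

lemma tendsto_symmetrize {l : ℕ} {F : (Fin l → ℝ) → ℂ} {FK : ℕ → (Fin l → ℝ) → ℂ}
    (h : ∀ k, Tendsto (fun K => FK K k) atTop (𝓝 (F k))) (k : Fin l → ℝ) :
    Tendsto (fun K => symmetrize (FK K) k) atTop (𝓝 (symmetrize F k)) :=
  (tendsto_finsetSum _ fun _ _ => h _).const_mul _

lemma tendsto_sigma3 (h : ∀ k, Tendsto (fun K => mK K k) atTop (𝓝 (m k))) (k : Fin 3 → ℝ) :
    Tendsto (fun K => sigma3 β lam (mK K) k) atTop (𝓝 (sigma3 β lam m k)) := by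
  refine Tendsto.div_const (Tendsto.neg (Tendsto.const_mul _ (tendsto_symmetrize (fun k => ?_) k))) _
  exact (Complex.continuous_ofReal.tendsto _).comp (((h _).mul (h _)).mul_const _)

lemma tendsto_sigma4 (h : ∀ k, Tendsto (fun K => mK K k) atTop (𝓝 (m k))) (k : Fin 4 → ℝ) :
    Tendsto (fun K => sigma4 β lam (mK K) k) atTop (𝓝 (sigma4 β lam m k)) := by
  refine Tendsto.div_const (Tendsto.neg (Tendsto.const_mul _ (tendsto_symmetrize (fun k => ?_) k))) _
  exact (tendsto_sigma3 h _).mul_const _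

end

section

variable {β lam N D κ T T' : ℝ} {m : ℝ → ℝ} {mK : ℕ → ℝ → ℝ} {A b : ℤ → ℝ}
  {U : ℝ → PeriodicDistribution}

lemma tendsto_tsum_of_multiplier {l : ℕ} {X : (Fin l → ℤ) → ℂ} {XK : ℕ → (Fin l → ℤ) → ℂ}
    {Z : (Fin l → ℤ) → ℂ} {g : (Fin l → ℤ) → ℝ} {C : ℝ} (hX : ∀ n, Tendsto (fun K => XK K n) atTop (𝓝 (X n)))
    {p : (Fin l → ℤ) → ℝ} (hZ : ∀ n, ‖Z n‖ ≤ p n) (hg0 : ∀ n, 0 ≤ g n)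
    (hg : ∑' n, ENNReal.ofReal (g n) ≠ ⊤) (hle : ∀ K n, ‖XK K n‖ * p n ≤ C * g n) :
    Tendsto (fun K => ∑' n, XK K n * Z n) atTop (𝓝 (∑' n, X n * Z n)) := by
  have h1 : Summable g := by
    have := ENNReal.summable_toReal hg
    simpa only [ENNReal.toReal_ofReal (hg0 _)] using this
  refine tendsto_tsum_of_dominated_convergence (h1.mul_left C) (fun n => (hX n).mul_const _)
    (Eventually.of_forall fun K n => ?_)
  rw [norm_mul]
  exact (mul_le_mul_of_nonneg_left (hZ n) (norm_nonneg _)).trans (hle K n)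

/-- Dominated convergence for each of the three forms. The majorants depend on `N`, `D`, `κ` and `A`
but not on the supports of the `mK K`, so compact support is needed for the energy identity alone.
-/
lemma tendsto_modeEnergy (hA : IsControlled lam N κ A b) (hU : IsModeFamily β lam T T' b U)
    (hβ : β = -1 ∨ β = 0 ∨ β = 1) (hmb : ∀ n, |m (freq lam n)| * b n ≤ A n)
    (hmK : ∀ K, IsNice N D (mK K)) (hle : ∀ K k, |mK K k| ≤ |m k|)
    (hlim : ∀ k, Tendsto (fun K => mK K k) atTop (𝓝 (m k))) (t : ℝ) :
    Tendsto (fun K => modeEnergy β lam (mK K) (U t)) atTop (𝓝 (modeEnergy β lam m (U t))) := by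
  refine ((Tendsto.const_mul _ ?_).add (Tendsto.const_mul _ ?_)).add (Tendsto.const_mul _ ?_)
  · refine tendsto_tsum_of_multiplier (C := 1) (g := fun n => ∏ i, A (complete n i)) (fun n => ?_)
      (fun n => hU.norm_prod_le (complete n) t) (fun n => hA.prod_nonneg (complete n))
      hA.tsum_pair_ne_top fun K n => ?_
    · exact (Complex.continuous_ofReal.tendsto _).comp ((hlim _).mul (hlim _))
    · rw [quadSymbol, Complex.norm_real, Real.norm_eq_abs, abs_mul, Fin.prod_univ_two,
        Fin.prod_univ_two]
      have hb := hA.nonneg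
      have hmb' : ∀ n, |mK K (freq lam n)| * b n ≤ A n := fun n =>
        (mul_le_mul_of_nonneg_right (hle K _) (hb n)).trans (hmb n)
      have h0 := hmb' (complete n 0)
      have h1 := hmb' (complete n 1)
      calc _ = (|mK K (freq lam (complete n 0))| * b (complete n 0)) *
            (|mK K (freq lam (complete n 1))| * b (complete n 1)) := by ring
        _ ≤ A (complete n 0) * A (complete n 1) :=
            mul_le_mul h0 h1 (mul_nonneg (abs_nonneg _) (hb _))
              ((mul_nonneg (abs_nonneg _) (hb _)).trans h0)
        _ = _ := by ring
  · exact tendsto_tsum_of_multiplier (fun n => tendsto_sigma3 hlim _)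
      (fun n => hU.norm_prod_le (complete n) t)
      (fun n => mul_nonneg (decay_pos _).le (hA.prod_nonneg (complete n)))
      hA.tsum_cubic_ne_top fun K n => hA.norm_sigma3_mul_prod_le (hmK K) hβ (sum_complete n)
  · exact tendsto_tsum_of_multiplier (fun n => tendsto_sigma4 hlim _)
      (fun n => hU.norm_prod_le (complete n) t)
      (fun n => mul_nonneg (mul_pos (decay_pos _) (decay_pos _)).le (hA.prod_nonneg (complete n)))
      hA.tsum_quartic_ne_top fun K n => hA.norm_sigma4_mul_prod_le (hmK K) hβ (sum_complete n)

/-- The almost conservation law for the modified energy in free coordinates. -/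
theorem modeEnergy_almost_conserved (hA : IsControlled lam N κ A b)
    (hU : IsModeFamily β lam T T' b U) (hT : T' - T ≤ 2) (hβ : β = -1 ∨ β = 0 ∨ β = 1)
    (hmb : ∀ n, |m (freq lam n)| * b n ≤ A n) (hmK : ∀ K, IsNice N D (mK K))
    (hsupp : ∀ K, ∃ R, ∀ k, R ≤ |k| → mK K k = 0) (hle : ∀ K k, |mK K k| ≤ |m k|)
    (hlim : ∀ k, Tendsto (fun K => mK K k) atTop (𝓝 (m k))) {s t : ℝ}
    (hs : s ∈ Set.Icc T T') (ht : t ∈ Set.Icc T T') :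
    ENNReal.ofReal ‖modeEnergy β lam m (U t) - modeEnergy β lam m (U s)‖ ≤
      ENNReal.ofReal (2 ^ 99 * formConst lam 5 * (D + 1) * κ ^ 5) *
        ∑' n : Fin 4 → ℤ, ENNReal.ofReal (quinticSum lam A (complete n)) := by
  have hl := ENNReal.tendsto_ofReal (((tendsto_modeEnergy hA hU hβ hmb hmK hle hlim t).sub
    (tendsto_modeEnergy hA hU hβ hmb hmK hle hlim s)).norm)
  refine le_of_tendsto' hl fun K => ?_
  obtain ⟨R, hR⟩ := hsupp K
  exact ofReal_norm_modeEnergy_sub_le hA hU hT (hmK K) hβ (R := max N R) (le_max_left _ _)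
    (fun k hk => hR k ((le_max_right _ _).trans hk))
    (fun n => (mul_le_mul_of_nonneg_right (hle K _) (hA.nonneg n)).trans (hmb n)) hs ht

end

/-! ### Admissible symbols and their truncations -/

section

variable {s N D : ℝ} {B : ℕ → ℝ} {m : ℝ → ℝ}

/-- The derivative of `k m(k)²` is `m² + 2m (k m')`, and `k` times its second derivative is a
polynomial in `m`, `k m'` and `k² m''`. So scale invariant bounds on two derivatives of `m` suffice;
the constant is `4 + 2 + 2 = 8`. -/
lemma isNice_of_deriv_le {m' m'' : ℝ → ℝ} (hN : 1 ≤ N) (hD : 1 ≤ D) (even : ∀ x, m (-x) = m x)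
    (low : ∀ x, |x| ≤ N → m x = 1) (bdd : ∀ x, |m x| ≤ 1) (h1 : ∀ x, HasDerivAt m (m' x) x)
    (h2 : ∀ x, HasDerivAt m' (m'' x) x) (hb1 : ∀ x, |x * m' x| ≤ D)
    (hb2 : ∀ x, |x ^ 2 * m'' x| ≤ D) : IsNice N (8 * D ^ 2) m := by
  have hf : ∀ x, HasDerivAt (fluxSymbol m) (m x ^ 2 + 2 * m x * (x * m' x)) x := fun x => by
    refine HasDerivAt.congr_deriv ((hasDerivAt_id x).mul ((h1 x).pow 2)) ?_
    simp only [id]; push_cast; ring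
  have hf2 : ∀ x, HasDerivAt (fun x => m x ^ 2 + 2 * m x * (x * m' x))
      (4 * m x * m' x + 2 * x * m' x ^ 2 + 2 * m x * x * m'' x) x := fun x => by
    refine HasDerivAt.congr_deriv
      (((h1 x).pow 2).add (((h1 x).const_mul 2).mul ((hasDerivAt_id x).mul (h2 x)))) ?_
    simp only [id]; push_cast; ring
  have hm2 : ∀ x, m x ^ 2 ≤ 1 := fun x => by
    rw [← sq_abs]; exact pow_le_one₀ (abs_nonneg _) (bdd x)
  have hD2 : D ≤ D ^ 2 := by nlinarith
  refine ⟨hN, by nlinarith, even, low, bdd, _, ?_, hf, fun x => ?_, fun R x y hR hx hy => ?_⟩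
  · exact continuous_iff_continuousAt.2 fun x => (hf2 x).continuousAt
  · calc |m x ^ 2 + 2 * m x * (x * m' x)| ≤ |m x ^ 2| + |2 * m x * (x * m' x)| := abs_add_le _ _
      _ = m x ^ 2 + 2 * |m x| * |x * m' x| := by
        rw [abs_mul, abs_mul, abs_of_pos (zero_lt_two' ℝ), abs_of_nonneg (sq_nonneg (m x))]
      _ ≤ 1 + 2 * 1 * D := by gcongr; exacts [hm2 x, bdd x, hb1 x]
      _ ≤ _ := by nlinarith
  · have key := Convex.norm_image_sub_le_of_norm_hasDerivWithin_le (s := Set.Ici R)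
      (fun z _ => (hf2 z).hasDerivWithinAt) (C := 8 * D ^ 2 / R) (fun z hz => ?_) (convex_Ici R)
      (Set.mem_Ici.2 hy) (Set.mem_Ici.2 hx)
    · simp only [Real.norm_eq_abs] at key
      rw [mul_div_right_comm]; exact key
    · have hz' : R ≤ z := hz
      have hz0 : 0 < z := hR.trans_le hz'
      rw [Real.norm_eq_abs, le_div_iff₀ hR]
      have e : (4 * m z * m' z + 2 * z * m' z ^ 2 + 2 * m z * z * m'' z) * z =
          4 * m z * (z * m' z) + 2 * (z * m' z) ^ 2 + 2 * m z * (z ^ 2 * m'' z) := by ring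
      have hp := hb1 z
      have hq := hb2 z
      have hmz := bdd z
      have h0 : |z * m' z| ^ 2 ≤ D ^ 2 := pow_le_pow_left₀ (abs_nonneg _) hp 2
      calc _ ≤ |4 * m z * m' z + 2 * z * m' z ^ 2 + 2 * m z * z * m'' z| * z := by gcongr
        _ = |4 * m z * (z * m' z) + 2 * (z * m' z) ^ 2 + 2 * m z * (z ^ 2 * m'' z)| := by
          rw [← e, abs_mul, abs_of_pos hz0]
        _ ≤ |4 * m z * (z * m' z)| + |2 * (z * m' z) ^ 2| + |2 * m z * (z ^ 2 * m'' z)| :=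
          (abs_add_le _ _).trans (add_le_add (abs_add_le _ _) le_rfl)
        _ = 4 * |m z| * |z * m' z| + 2 * |z * m' z| ^ 2 + 2 * |m z| * |z ^ 2 * m'' z| := by
          simp only [abs_mul, abs_pow]; norm_num
        _ ≤ 4 * 1 * D + 2 * D ^ 2 + 2 * 1 * D := by gcongr
        _ ≤ _ := by nlinarith

lemma IsSymbol.abs_arg (h : IsSymbol s N B m) (x : ℝ) : m |x| = m x := by
  rcases abs_choice x with e | e <;> rw [e]
  exact h.even x

lemma IsSymbol.rpow_le (h : IsSymbol s N B m) {x y : ℝ} (hxy : |x| ≤ y)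
    (hy : 2 * N ≤ y) : y ^ s * N ^ (-s) ≤ m x := by
  have hy0 : 0 ≤ y := (abs_nonneg x).trans hxy
  have := h.monotone (Set.mem_Ici.2 (abs_nonneg x)) (Set.mem_Ici.2 hy0) hxy
  rwa [h.abs_arg, h.high y (by rwa [abs_of_nonneg hy0]), abs_of_nonneg hy0] at this

lemma IsSymbol.pos (h : IsSymbol s N B m) (hN : 1 ≤ N) (x : ℝ) : 0 < m x := by
  have hy : 0 < max |x| (2 * N) := lt_of_lt_of_le (by linarith) (le_max_right _ _)
  exact (mul_pos (Real.rpow_pos_of_pos hy s) (Real.rpow_pos_of_pos (by linarith) _)).trans_le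
    (h.rpow_le (le_max_left |x| (2 * N)) (le_max_right _ _))

lemma IsSymbol.le_one (h : IsSymbol s N B m) (hN : 1 ≤ N) (x : ℝ) : m x ≤ 1 := by
  have := h.monotone (Set.mem_Ici.2 le_rfl) (Set.mem_Ici.2 (abs_nonneg x)) (abs_nonneg x)
  rwa [h.abs_arg, h.low 0 (by simp; linarith)] at this

/-- By monotonicity `m(x)` is at least its explicit value at `2 max(N, |x|)`. As `s ≥ -1`, the power
`-s` of `max(N, |x|)` is at most the first. The factor `N ^ s` is the source of the decay in the
theorem. -/
lemma IsSymbol.one_le_mul (h : IsSymbol s N B m) (hs : -1 ≤ s) (hN : 1 ≤ N) (x : ℝ) :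
    1 ≤ 2 * N ^ s * max N |x| * m x := by
  have hN0 : 0 < N := by linarith
  have hmax : 0 < max N |x| := lt_max_of_lt_left hN0
  have hmax1 : 1 ≤ max N |x| := hN.trans (le_max_left _ _)
  have hlow := h.rpow_le (x := x) (y := 2 * max N |x|)
    (by linarith [le_max_right N |x|]) (by linarith [le_max_left N |x|])
  calc (1 : ℝ) ≤ 2 * 2 ^ s * (max N |x| * max N |x| ^ s) * (N ^ s * N ^ (-s)) := by
        rw [← Real.rpow_add hN0, add_neg_cancel, Real.rpow_zero, mul_one]
        have h1 : (1 : ℝ) ≤ 2 * 2 ^ s := by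
          have e : (2 : ℝ) ^ (1 + s) = 2 * 2 ^ s := by rw [Real.rpow_add two_pos, Real.rpow_one]
          rw [← e]
          exact Real.one_le_rpow (by norm_num) (by linarith)
        have h2 : 1 ≤ max N |x| * max N |x| ^ s := by
          have e : max N |x| ^ (1 + s) = max N |x| * max N |x| ^ s := by
            rw [Real.rpow_add hmax, Real.rpow_one]
          rw [← e]
          exact Real.one_le_rpow hmax1 (by linarith)
        exact one_le_mul_of_one_le_of_one_le h1 h2
    _ = 2 * N ^ s * max N |x| * ((2 * max N |x|) ^ s * N ^ (-s)) := by
        rw [Real.mul_rpow two_pos.le hmax.le]; ring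
    _ ≤ _ := by gcongr

/-- Used only to see that `Iu` has finite norm; the dependence of the constant on `N` does not enter
the estimate. -/
lemma IsSymbol.le_bracket_rpow (h : IsSymbol s N B m) (hs0 : s < 0) (hN : 1 ≤ N) (x : ℝ) :
    m x ≤ 2 ^ (-s) * (bracket (2 * N) ^ (-s) * N ^ (-s)) * bracket x ^ s := by
  have hN0 : 0 < N := by linarith
  have hNs : 1 ≤ N ^ (-s) := Real.one_le_rpow hN (by linarith)
  have h2s : (1 : ℝ) ≤ 2 ^ (-s) := Real.one_le_rpow (by norm_num) (by linarith)
  have hbs : 1 ≤ bracket (2 * N) ^ (-s) := Real.one_le_rpow (one_le_bracket _) (by linarith)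
  have hb0 := bracket_pos x
  have hbx : 0 < bracket x ^ s := Real.rpow_pos_of_pos hb0 s
  rcases le_total |x| (2 * N) with hx | hx
  · refine (h.le_one hN x).trans ?_
    have h1 : bracket x ≤ bracket (2 * N) := by
      rw [bracket, bracket]
      refine Real.sqrt_le_sqrt ?_
      have := sq_le_sq' (by linarith [abs_nonneg x]) hx
      rw [sq_abs] at this; linarith
    have h3 : 1 ≤ bracket (2 * N) ^ (-s) * bracket x ^ s := by
      have : bracket x ^ (-s) ≤ bracket (2 * N) ^ (-s) :=
        Real.rpow_le_rpow hb0.le h1 (by linarith)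
      calc 1 = bracket x ^ (-s) * bracket x ^ s := by
            rw [← Real.rpow_add hb0]; simp
        _ ≤ _ := by gcongr
    calc 1 ≤ (2 ^ (-s) * N ^ (-s)) * (bracket (2 * N) ^ (-s) * bracket x ^ s) :=
          one_le_mul_of_one_le_of_one_le (one_le_mul_of_one_le_of_one_le h2s hNs) h3
      _ = _ := by ring
  · rw [h.high x hx]
    have hx0 : 0 < |x| := by linarith
    have h1 : bracket x ≤ 2 * |x| := by
      rw [bracket, Real.sqrt_le_left (by positivity), mul_pow, sq_abs]
      nlinarith [sq_abs x]
    have h3 : |x| ^ s ≤ 2 ^ (-s) * bracket x ^ s := by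
      have := Real.rpow_le_rpow_of_nonpos hb0 h1 hs0.le
      rw [Real.mul_rpow two_pos.le hx0.le] at this
      calc |x| ^ s = 2 ^ (-s) * (2 ^ s * |x| ^ s) := by
            rw [← mul_assoc, ← Real.rpow_add two_pos]; simp
        _ ≤ _ := by gcongr
    calc |x| ^ s * N ^ (-s) ≤ 2 ^ (-s) * bracket x ^ s * N ^ (-s) * 1 := by rw [mul_one]; gcongr
      _ ≤ 2 ^ (-s) * bracket x ^ s * N ^ (-s) * bracket (2 * N) ^ (-s) := by gcongr
      _ = _ := by ring

lemma deriv_neg_of_even {f : ℝ → ℝ} (hf : ∀ x, f (-x) = f x) (x : ℝ) :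
    deriv f (-x) = -deriv f x := by
  have := deriv_comp_neg f x
  simp only [hf] at this
  linarith

lemma deriv_neg_of_odd {f : ℝ → ℝ} (hf : ∀ x, f (-x) = -f x) (x : ℝ) :
    deriv f (-x) = deriv f x := by
  have := deriv_comp_neg f x
  simp only [hf] at this
  rw [deriv.fun_neg] at this
  linarith

lemma IsSymbol.deriv_high (h : IsSymbol s N B m) (hN : 1 ≤ N) {x : ℝ} (hx : 2 * N < x) :
    deriv m x = s * x ^ (s - 1) * N ^ (-s) := by
  have hx0 : 0 < x := by linarith
  have e : m =ᶠ[𝓝 x] fun y => y ^ s * N ^ (-s) := by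
    filter_upwards [lt_mem_nhds hx] with y hy
    have hy0 : 0 < y := by linarith
    rw [h.high y (by rw [abs_of_pos hy0]; exact hy.le), abs_of_pos hy0]
  rw [e.deriv_eq]
  exact ((Real.hasDerivAt_rpow_const (Or.inl hx0.ne')).mul_const _).deriv

lemma IsSymbol.deriv_deriv_high (h : IsSymbol s N B m) (hN : 1 ≤ N) {x : ℝ} (hx : 2 * N < x) :
    deriv (deriv m) x = s * ((s - 1) * x ^ (s - 2)) * N ^ (-s) := by
  have hx0 : 0 < x := by linarith
  have e : deriv m =ᶠ[𝓝 x] fun y => s * y ^ (s - 1) * N ^ (-s) := by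
    filter_upwards [lt_mem_nhds hx] with y hy
    exact h.deriv_high hN hy
  rw [e.deriv_eq]
  have := (((Real.hasDerivAt_rpow_const (p := s - 1) (Or.inl hx0.ne')).const_mul s).mul_const
    (N ^ (-s))).deriv
  rw [this, show s - 1 - 1 = s - 2 by ring]

/-- Up to `2N` the assumed derivative bound at scale `N` applies. Beyond it the explicit power gives
`x m' = s m`. -/
lemma IsSymbol.deriv_le (h : IsSymbol s N B m) (hs : -1 ≤ s) (hs0 : s < 0) (hN : 1 ≤ N) (x : ℝ) :
    |x * deriv m x| ≤ max 2 (2 * |B 1|) := by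
  wlog hx : 0 ≤ x generalizing x
  · have := this (-x) (by linarith)
    rwa [deriv_neg_of_even h.even, neg_mul_neg] at this
  have hN0 : 0 < N := by linarith
  rcases le_or_gt x (2 * N) with hx2 | hx2
  · refine le_trans ?_ (le_max_right _ _)
    have hB := h.deriv_bound 1 x
    rw [iteratedDeriv_one, pow_one] at hB
    rw [abs_mul, abs_of_nonneg hx]
    calc x * |deriv m x| ≤ (2 * N) * (|B 1| / N) := by
          gcongr; exact hB.trans (by gcongr; exact le_abs_self _)
      _ = 2 * |B 1| := by field_simp
  · refine le_trans ?_ (le_max_left _ _)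
    have hx0 : 0 < x := by linarith
    have hm := h.le_one hN x
    rw [h.high x (by rw [abs_of_pos hx0]; exact hx2.le), abs_of_pos hx0] at hm
    rw [h.deriv_high hN hx2, show x * (s * x ^ (s - 1) * N ^ (-s)) = s * (x ^ s * N ^ (-s)) by
      rw [Real.rpow_sub_one hx0.ne']; field_simp, abs_mul]
    have hp : 0 ≤ x ^ s * N ^ (-s) := by positivity
    rw [abs_of_nonneg hp]
    have : |s| ≤ 1 := abs_le.2 ⟨hs, by linarith⟩
    nlinarith [abs_nonneg s]

lemma IsSymbol.deriv_deriv_le (h : IsSymbol s N B m) (hs : -1 ≤ s) (hs0 : s < 0) (hN : 1 ≤ N)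
    (x : ℝ) : |x ^ 2 * deriv (deriv m) x| ≤ max 2 (4 * |B 2|) := by
  wlog hx : 0 ≤ x generalizing x
  · have := this (-x) (by linarith)
    rwa [deriv_neg_of_odd (deriv_neg_of_even h.even), neg_sq] at this
  have hN0 : 0 < N := by linarith
  rcases le_or_gt x (2 * N) with hx2 | hx2
  · refine le_trans ?_ (le_max_right _ _)
    have hB := h.deriv_bound 2 x
    rw [iteratedDeriv_succ, iteratedDeriv_one] at hB
    rw [abs_mul, abs_pow, abs_of_nonneg hx]
    calc x ^ 2 * |deriv (deriv m) x| ≤ (2 * N) ^ 2 * (|B 2| / N ^ 2) := by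
          gcongr; exact hB.trans (by gcongr; exact le_abs_self _)
      _ = 4 * |B 2| := by field_simp; ring
  · refine le_trans ?_ (le_max_left _ _)
    have hx0 : 0 < x := by linarith
    have hm := h.le_one hN x
    rw [h.high x (by rw [abs_of_pos hx0]; exact hx2.le), abs_of_pos hx0] at hm
    rw [h.deriv_deriv_high hN hx2, show x ^ 2 * (s * ((s - 1) * x ^ (s - 2)) * N ^ (-s)) =
      s * (s - 1) * (x ^ s * N ^ (-s)) by
        rw [Real.rpow_sub hx0, Real.rpow_two]; field_simp, abs_mul]
    have hp : 0 ≤ x ^ s * N ^ (-s) := by positivity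
    rw [abs_of_nonneg hp]
    have : |s * (s - 1)| ≤ 2 := abs_le.2 ⟨by nlinarith, by nlinarith⟩
    nlinarith [abs_nonneg (s * (s - 1))]

/-- A smooth even cutoff function. -/
noncomputable def cutoff (x : ℝ) : ℝ := Real.smoothTransition (2 - x ^ 2)

lemma contDiff_cutoff : ContDiff ℝ ∞ cutoff :=
  Real.smoothTransition.contDiff.comp (contDiff_const.sub (contDiff_id.pow 2))

lemma cutoff_eq_one {x : ℝ} (hx : |x| ≤ 1) : cutoff x = 1 := by
  refine Real.smoothTransition.one_of_one_le ?_
  have := pow_le_one₀ (n := 2) (abs_nonneg x) hx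
  rw [sq_abs] at this; linarith

lemma cutoff_eq_zero {x : ℝ} (hx : 2 ≤ |x|) : cutoff x = 0 := by
  refine Real.smoothTransition.zero_of_nonpos ?_
  have := pow_le_pow_left₀ zero_le_two hx 2
  rw [sq_abs] at this; linarith

lemma abs_cutoff_le (x : ℝ) : |cutoff x| ≤ 1 := by
  rw [cutoff, abs_of_nonneg (Real.smoothTransition.nonneg _)]
  exact Real.smoothTransition.le_one _

lemma hasCompactSupport_cutoff : HasCompactSupport cutoff := by
  refine HasCompactSupport.intro (isCompact_Icc (a := (-2 : ℝ)) (b := 2)) fun x hx => cutoff_eq_zero ?_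
  by_contra! h
  exact hx ⟨by linarith [(abs_lt.1 h).1], by linarith [(abs_lt.1 h).2]⟩

lemma exists_deriv_bound {χ : ℝ → ℝ} (hχ : ContDiff ℝ ∞ χ) (hc : HasCompactSupport χ) :
    ∃ E : ℝ, 1 ≤ E ∧ (∀ x, |x * deriv χ x| ≤ E) ∧ ∀ x, |x ^ 2 * deriv (deriv χ) x| ≤ E := by
  have h1 : ContDiff ℝ ∞ (deriv χ) := (contDiff_infty_iff_deriv.1 hχ).2
  have h2 : ContDiff ℝ ∞ (deriv (deriv χ)) := (contDiff_infty_iff_deriv.1 h1).2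
  have g1 : Continuous fun x => x * deriv χ x := continuous_id.mul h1.continuous
  have g2 : Continuous fun x => x ^ 2 * deriv (deriv χ) x := (continuous_id.pow 2).mul h2.continuous
  obtain ⟨E1, hE1⟩ := g1.bounded_above_of_compact_support
    (HasCompactSupport.mul_left (f := fun x => x) hc.deriv)
  obtain ⟨E2, hE2⟩ := g2.bounded_above_of_compact_support
    (HasCompactSupport.mul_left (f := fun x => x ^ 2) hc.deriv.deriv)
  exact ⟨max 1 (max E1 E2), le_max_left _ _,
    fun x => (hE1 x).trans ((le_max_left _ _).trans (le_max_right _ _)),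
    fun x => (hE2 x).trans ((le_max_right _ _).trans (le_max_right _ _))⟩

lemma hasDerivAt_comp_div {g g' : ℝ → ℝ} (h : ∀ x, HasDerivAt g (g' x) x) (L x : ℝ) :
    HasDerivAt (fun x => g (x / L)) (g' (x / L) / L) x := by
  have := (h (x / L)).comp x ((hasDerivAt_id x).div_const L)
  rw [mul_one_div] at this
  exact this

/-- The truncation of a symbol at the scale `L`. -/
noncomputable def truncateSymbol (L : ℝ) (m : ℝ → ℝ) (x : ℝ) : ℝ := m x * cutoff (x / L)

/-- The bounds on `x χ'(x)` and `x² χ''(x)` are invariant under dilation, so the constant does not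
depend on the scale `L`; the assumption `N ≤ L` keeps the symbol equal to `1` up to `N`. -/
lemma isNice_truncateSymbol {m' m'' : ℝ → ℝ} {E L : ℝ} (hN : 1 ≤ N) (hNL : N ≤ L) (hD : 1 ≤ D)
    (hE : 1 ≤ E) (hE1 : ∀ x, |x * deriv cutoff x| ≤ E)
    (hE2 : ∀ x, |x ^ 2 * deriv (deriv cutoff) x| ≤ E) (even : ∀ x, m (-x) = m x)
    (low : ∀ x, |x| ≤ N → m x = 1) (bdd : ∀ x, |m x| ≤ 1) (h1 : ∀ x, HasDerivAt m (m' x) x)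
    (h2 : ∀ x, HasDerivAt m' (m'' x) x) (hb1 : ∀ x, |x * m' x| ≤ D)
    (hb2 : ∀ x, |x ^ 2 * m'' x| ≤ D) :
    IsNice N (8 * (4 * D * E) ^ 2) (truncateSymbol L m) := by
  have hL : 0 < L := by linarith
  have hDE : 1 ≤ D * E := one_le_mul_of_one_le_of_one_le hD hE
  have hDDE : D ≤ D * E := le_mul_of_one_le_right (by linarith) hE
  have hEDE : E ≤ D * E := le_mul_of_one_le_left (by linarith) hD
  have hd : ContDiff ℝ ∞ (deriv cutoff) := (contDiff_infty_iff_deriv.1 contDiff_cutoff).2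
  have c1 : ∀ x, HasDerivAt (fun x => cutoff (x / L)) (deriv cutoff (x / L) / L) x :=
    hasDerivAt_comp_div (fun x => ((contDiff_cutoff.differentiable (by simp)) x).hasDerivAt) L
  have c2 : ∀ x, HasDerivAt (fun x => deriv cutoff (x / L) / L)
      (deriv (deriv cutoff) (x / L) / L / L) x := fun x =>
    (hasDerivAt_comp_div (fun x => ((hd.differentiable (by simp)) x).hasDerivAt) L x).div_const L
  have hc := abs_cutoff_le
  refine isNice_of_deriv_le (m' := fun x => m' x * cutoff (x / L) + m x * (deriv cutoff (x / L) / L))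
    (m'' := fun x => m'' x * cutoff (x / L) + m' x * (deriv cutoff (x / L) / L) +
      (m' x * (deriv cutoff (x / L) / L) + m x * (deriv (deriv cutoff) (x / L) / L / L)))
    hN (by linarith) (fun x => ?_) (fun x hx => ?_) (fun x => ?_) (fun x => (h1 x).mul (c1 x))
    (fun x => ((h2 x).mul (c1 x)).add ((h1 x).mul (c2 x))) (fun x => ?_) (fun x => ?_)
  · rw [truncateSymbol, truncateSymbol, even, cutoff, cutoff, neg_div, neg_sq]
  · rw [truncateSymbol, low x hx, cutoff_eq_one, one_mul]
    rw [abs_div, abs_of_pos hL, div_le_one hL]; exact hx.trans hNL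
  · rw [truncateSymbol, abs_mul]
    exact mul_le_one₀ (bdd x) (abs_nonneg _) (hc _)
  · have e : x * (m' x * cutoff (x / L) + m x * (deriv cutoff (x / L) / L)) =
        (x * m' x) * cutoff (x / L) + m x * (x / L * deriv cutoff (x / L)) := by ring
    rw [e]
    calc _ ≤ |x * m' x| * |cutoff (x / L)| + |m x| * |x / L * deriv cutoff (x / L)| := by
          rw [← abs_mul, ← abs_mul]; exact abs_add_le _ _
      _ ≤ D * 1 + 1 * E := by gcongr; exacts [hb1 x, hc _, bdd x, hE1 _]
      _ ≤ _ := by linarith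
  · have e : x ^ 2 * (m'' x * cutoff (x / L) + m' x * (deriv cutoff (x / L) / L) +
        (m' x * (deriv cutoff (x / L) / L) + m x * (deriv (deriv cutoff) (x / L) / L / L))) =
        (x ^ 2 * m'' x) * cutoff (x / L) + 2 * (x * m' x) * (x / L * deriv cutoff (x / L)) +
          m x * ((x / L) ^ 2 * deriv (deriv cutoff) (x / L)) := by ring
    rw [e]
    calc _ ≤ |x ^ 2 * m'' x| * |cutoff (x / L)| + 2 * |x * m' x| * |x / L * deriv cutoff (x / L)| +
          |m x| * |(x / L) ^ 2 * deriv (deriv cutoff) (x / L)| := by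
          refine (abs_add_le _ _).trans (add_le_add ((abs_add_le _ _).trans (le_of_eq ?_)) ?_)
          · simp only [abs_mul]; norm_num
          · rw [abs_mul]
      _ ≤ D * 1 + 2 * D * E + 1 * E := by
          gcongr; exacts [hb2 x, hc _, hb1 x, hE1 _, bdd x, hE2 _]
      _ ≤ _ := by linarith

/-- Admissible symbols are approximated by symbols of compact support, uniformly in the class of
symbols. -/
lemma exists_isNice (hs : -1 ≤ s) (hs0 : s < 0) (B : ℕ → ℝ) : ∃ D : ℝ, 1 ≤ D ∧
    ∀ (N : ℝ) (m : ℝ → ℝ), 1 ≤ N → IsSymbol s N B m → IsNice N D m ∧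
      ∃ mK : ℕ → ℝ → ℝ, (∀ K, IsNice N D (mK K)) ∧ (∀ K, ∃ R, ∀ k, R ≤ |k| → mK K k = 0) ∧
        (∀ K k, |mK K k| ≤ |m k|) ∧ ∀ k, Tendsto (fun K => mK K k) atTop (𝓝 (m k)) := by
  obtain ⟨E, hE, hE1, hE2⟩ := exists_deriv_bound contDiff_cutoff hasCompactSupport_cutoff
  set D := max 2 (max (2 * |B 1|) (4 * |B 2|)) with hDdef
  have hD : 1 ≤ D := le_trans (by norm_num) (le_max_left _ _)
  refine ⟨8 * (4 * D * E) ^ 2, ?_, fun N m hN h => ?_⟩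
  · have : 1 ≤ D * E := one_le_mul_of_one_le_of_one_le hD hE
    nlinarith
  have hm1 : ∀ x, HasDerivAt m (deriv m x) x := fun x =>
    ((h.smooth.differentiable (by simp)) x).hasDerivAt
  have hm2 : ∀ x, HasDerivAt (deriv m) (deriv (deriv m) x) x := fun x => by
    have hd : ContDiff ℝ ∞ (deriv m) := (contDiff_infty_iff_deriv.1 h.smooth).2
    exact ((hd.differentiable (by simp)) x).hasDerivAt
  have hb1 : ∀ x, |x * deriv m x| ≤ D := fun x => (h.deriv_le hs hs0 hN x).trans
    (max_le_max le_rfl (le_max_left _ _))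
  have hb2 : ∀ x, |x ^ 2 * deriv (deriv m) x| ≤ D := fun x =>
    (h.deriv_deriv_le hs hs0 hN x).trans (max_le_max le_rfl (le_max_right _ _))
  have hbdd : ∀ x, |m x| ≤ 1 := fun x => by
    rw [abs_of_pos (h.pos hN x)]; exact h.le_one hN x
  have hlim : ∀ k, Tendsto (fun K : ℕ => truncateSymbol (N + K) m k) atTop (𝓝 (m k)) := by
    intro k
    refine tendsto_const_nhds.congr' ?_
    obtain ⟨K0, hK0⟩ := exists_nat_ge |k|
    filter_upwards [eventually_ge_atTop K0] with K hK
    have hL : 0 < N + K := by positivity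
    rw [truncateSymbol, cutoff_eq_one, mul_one]
    rw [abs_div, abs_of_pos hL, div_le_one hL]
    have : (K0 : ℝ) ≤ K := by exact_mod_cast hK
    linarith
  have hnice : ∀ K : ℕ, IsNice N (8 * (4 * D * E) ^ 2) (truncateSymbol (N + K) m) := fun K =>
    isNice_truncateSymbol hN (le_add_of_nonneg_right (Nat.cast_nonneg K)) hD hE hE1 hE2 h.even
      h.low hbdd hm1 hm2 hb1 hb2
  refine ⟨?_, fun K => truncateSymbol (N + K) m, hnice, fun K => ⟨2 * (N + K), fun k hk => ?_⟩,
    fun K k => ?_, hlim⟩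
  · have h8 := isNice_of_deriv_le hN hD h.even h.low hbdd hm1 hm2 hb1 hb2
    obtain ⟨a1, a2, a3, a4, a5, f', a6, a7, a8, a9⟩ := h8
    have hle : 8 * D ^ 2 ≤ 8 * (4 * D * E) ^ 2 := by
      have : D ≤ 4 * D * E := by nlinarith
      have := pow_le_pow_left₀ (by linarith) this 2
      linarith
    exact ⟨a1, a2.trans hle, a3, a4, a5, f', a6, a7, fun x => (a8 x).trans hle,
      fun R x y hR hx hy => (a9 R x y hR hx hy).trans (by gcongr)⟩
  · have hL : 0 < N + K := by positivity
    show m k * cutoff (k / (N + K)) = 0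
    rw [cutoff_eq_zero, mul_zero]
    rw [abs_div, abs_of_pos hL, le_div_iff₀ hL]; exact hk
  · show |m k * cutoff (k / (N + K))| ≤ |m k|
    rw [abs_mul]
    exact mul_le_of_le_one_right (abs_nonneg _) (abs_cutoff_le _)

end

/-! ### The Fourier coefficients of a solution -/

/-- The size of the Fourier coefficient at `n / lam` of a function in `W⁰`. -/
noncomputable def modeNorm (β lam : ℝ) (G : ℤ → ℝ → ℂ) (n : ℤ) : ℝ≥0∞ :=
  if n = 0 then 0 else
    (∫⁻ τ, (ENNReal.ofReal (rbracket (τ - disp β lam n)) * ‖G n τ‖ₑ) ^ 2) ^ (1 / 2 : ℝ) +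
      ∫⁻ τ, ‖G n τ‖ₑ

lemma rpow_half_sq (x : ℝ≥0∞) : (x ^ (1 / 2 : ℝ)) ^ 2 = x := by
  rw [← ENNReal.rpow_natCast, ← ENNReal.rpow_mul]; norm_num

section

variable {β lam s N t₀ : ℝ} {m : ℝ → ℝ} {B : ℕ → ℝ} {G : ℤ → ℝ → ℂ}
  {u : ℝ → PeriodicDistribution}

lemma tsum_ne_zero_eq (f : ℤ → ℝ≥0∞) (h : f 0 = 0) : ∑' n : {n : ℤ // n ≠ 0}, f n = ∑' n, f n :=
  tsum_subtype_eq_of_support_subset (s := {n : ℤ | n ≠ 0}) fun n hn h0 => hn (by rw [h0, h])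

lemma xNorm_zero_sq (β lam : ℝ) (G : ℤ → ℝ → ℂ) : xNorm β lam 0 (1 / 2) G ^ 2 =
    ENNReal.ofReal lam⁻¹ * ∑' n : {n : ℤ // n ≠ 0},
      ∫⁻ τ, (ENNReal.ofReal (rbracket (τ - disp β lam n)) * ‖G n τ‖ₑ) ^ 2 := by
  rw [xNorm, rpow_half_sq]
  simp only [Real.rpow_zero, one_mul, ← Real.sqrt_eq_rpow, rbracket, disp]

lemma yNorm_zero_sq (lam : ℝ) (G : ℤ → ℝ → ℂ) : yNorm lam 0 G ^ 2 =
    ENNReal.ofReal lam⁻¹ * ∑' n : {n : ℤ // n ≠ 0}, (∫⁻ τ, ‖G n τ‖ₑ) ^ 2 := by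
  rw [yNorm, rpow_half_sq]
  simp only [Real.rpow_zero, ENNReal.ofReal_one, one_mul]

/-- The factor `lam` undoes the normalization `1 / lam` of the sums in the norms. -/
lemma tsum_modeNorm_sq_le (hlam : 1 ≤ lam) (β : ℝ) (G : ℤ → ℝ → ℂ) :
    ∑' n, modeNorm β lam G n ^ 2 ≤ ENNReal.ofReal (2 * lam) * wNorm β lam 0 G ^ 2 := by
  have hl0 : 0 < lam := by linarith
  rw [← tsum_ne_zero_eq _ (by simp [modeNorm])]
  have h1 : ∀ n : {n : ℤ // n ≠ 0}, modeNorm β lam G n ^ 2 ≤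
      2 * ((∫⁻ τ, (ENNReal.ofReal (rbracket (τ - disp β lam n)) * ‖G n τ‖ₑ) ^ 2) +
        (∫⁻ τ, ‖G n τ‖ₑ) ^ 2) := fun n => by
    rw [modeNorm, if_neg n.2]
    refine (ennreal_add_sq_le _ _).trans (le_of_eq ?_)
    rw [rpow_half_sq]
  refine (ENNReal.tsum_le_tsum h1).trans ?_
  rw [ENNReal.tsum_mul_left, ENNReal.tsum_add]
  have hone : ENNReal.ofReal lam * ENNReal.ofReal lam⁻¹ = 1 := by
    rw [← ENNReal.ofReal_mul hl0.le, mul_inv_cancel₀ hl0.ne', ENNReal.ofReal_one]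
  have h2 : xNorm β lam 0 (1 / 2) G ^ 2 + yNorm lam 0 G ^ 2 ≤ wNorm β lam 0 G ^ 2 := by
    rw [wNorm]
    calc _ ≤ xNorm β lam 0 (1 / 2) G ^ 2 + yNorm lam 0 G ^ 2 +
          2 * xNorm β lam 0 (1 / 2) G * yNorm lam 0 G := le_self_add
      _ = _ := by ring
  rw [xNorm_zero_sq, yNorm_zero_sq] at h2
  rw [ENNReal.ofReal_mul zero_le_two, ENNReal.ofReal_ofNat, mul_assoc]
  refine mul_le_mul_right ?_ _
  refine le_trans (le_of_eq ?_) (mul_le_mul_right h2 (ENNReal.ofReal lam))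
  rw [mul_add, ← mul_assoc, ← mul_assoc, hone, one_mul, one_mul]

lemma isWave_of_modeNorm {n : ℤ} (hn : n ≠ 0) (hG : AEStronglyMeasurable (G n))
    (hfin : modeNorm β lam G n ≠ ⊤) : IsWave (disp β lam n) (modeNorm β lam G n).toReal
      (fun t => ∫ τ : ℝ, Complex.exp (Complex.I * t * τ) * G n τ) := by
  refine IsWave.of_ae ENNReal.toReal_nonneg hG (fun t => rfl) ?_ ?_
  · rw [ENNReal.ofReal_toReal hfin, modeNorm, if_neg hn]; exact le_add_self
  · rw [ENNReal.ofReal_toReal hfin, modeNorm, if_neg hn]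
    refine le_trans (le_of_eq (rpow_half_sq _).symm) ?_
    gcongr
    exact le_self_add

/-- A solution `u` for which `Iu` has an extension in `W⁰`. -/
lemma IsSolution.exists_modeFamily (hu : IsSolution β lam s t₀ u) (hs : -1 ≤ s)
    (hβ : β = -1 ∨ β = 0 ∨ β = 1) (hlam : 1 ≤ lam) (hN : 1 ≤ N) (hm : IsSymbol s N B m)
    (hG : IsExtension (Set.Icc (t₀ - 1) (t₀ + 1)) (fun t => fourierMultiplier lam m (u t)) G)
    (hfin : wNorm β lam 0 G ≠ ⊤) :
    ∃ (A b : ℤ → ℝ) (U : ℝ → PeriodicDistribution), IsControlled lam N (2 * N ^ s) A b ∧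
      IsModeFamily β lam (t₀ - 1) (t₀ + 1) b U ∧
      (∀ t ∈ Set.Icc (t₀ - 1) (t₀ + 1), ∀ n, U t n = u t n) ∧
      (∀ n, |m (freq lam n)| * b n ≤ A n) ∧
      ∑' n, ENNReal.ofReal (A n) ^ 2 ≤ ENNReal.ofReal (2 * lam) * wNorm β lam 0 G ^ 2 := by
  have hpos := hm.pos hN
  have hle := tsum_modeNorm_sq_le hlam β G
  have hsum : ∑' n, modeNorm β lam G n ^ 2 ≠ ⊤ := ne_top_of_le_ne_top (by finiteness) hle
  have hA : ∀ n, modeNorm β lam G n ≠ ⊤ := fun n h => by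
    have := ENNReal.ne_top_of_tsum_ne_top hsum n
    rw [h] at this; simp at this
  have hA0 : modeNorm β lam G 0 = 0 := by simp [modeNorm]
  -- `A` measures the coefficients of `Iu` and `b = A / m` those of `u`. Dividing the extension of
  -- `Iu` by `m` extends `u` to all times, and the constant of Fourier inversion is at most `1`.
  set A : ℤ → ℝ := fun n => (modeNorm β lam G n).toReal with hAdef
  set b : ℤ → ℝ := fun n => A n / m (freq lam n) with hbdef
  set c : ℤ → ℂ := fun n => ((Real.sqrt (2 * Real.pi))⁻¹ * (m (freq lam n))⁻¹ : ℝ) with hcdef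
  set U : ℝ → PeriodicDistribution := fun t n => if n = 0 then 0 else
    c n * ∫ τ : ℝ, Complex.exp (Complex.I * t * τ) * G n τ with hUdef
  have hAe : ∑' n, ENNReal.ofReal (A n) ^ 2 = ∑' n, modeNorm β lam G n ^ 2 :=
    tsum_congr fun n => by rw [hAdef, ENNReal.ofReal_toReal (hA n)]
  have hAn : ∀ n, 0 ≤ A n := fun n => ENNReal.toReal_nonneg
  have hbn : ∀ n, 0 ≤ b n := fun n => div_nonneg (hAn n) (hpos _).le
  have hb0 : b 0 = 0 := by simp [hbdef, hAdef, hA0]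
  have hC : IsControlled lam N (2 * N ^ s) A b := by
    refine ⟨hlam, hN, by positivity, hAn, by rwa [hAe], hbn, hb0, fun n => ?_⟩
    rw [hbdef, div_le_iff₀ (hpos _)]
    have := mul_le_mul_of_nonneg_left (hm.one_le_mul hs hN (freq lam n)) (hAn n)
    calc A n = A n * 1 := (mul_one _).symm
      _ ≤ _ := this
      _ = _ := by ring
  have hsq : 1 ≤ Real.sqrt (2 * Real.pi) := by
    rw [Real.one_le_sqrt]; linarith [Real.pi_gt_three]
  have hw : ∀ n, IsWave (disp β lam n) (b n) (fun t => U t n) := by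
    intro n
    rcases eq_or_ne n 0 with rfl | hn
    · simp only [hUdef, if_true, hb0]; exact IsWave.zero _
    · simp only [hUdef, if_neg hn]
      refine ((isWave_of_modeNorm hn (hG n hn).1.aestronglyMeasurable (hA n)).const_mul (c n)).mono ?_
      have h1 : ‖c n‖ ≤ (m (freq lam n))⁻¹ := by
        have := inv_pos.2 (hpos (freq lam n))
        rw [hcdef, Complex.norm_real, Real.norm_eq_abs, abs_of_nonneg (by positivity)]
        exact mul_le_of_le_one_left this.le (inv_le_one_of_one_le₀ hsq)
      show ‖c n‖ * A n ≤ A n / m (freq lam n)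
      rw [div_eq_inv_mul]
      exact mul_le_mul_of_nonneg_right h1 (hAn n)
  have hUu : ∀ t ∈ Set.Icc (t₀ - 1) (t₀ + 1), ∀ n, U t n = u t n := by
    intro t ht n
    rcases eq_or_ne n 0 with rfl | hn
    · rw [hu.mean_zero t ht]; simp [hUdef]
    · have h1 := (hG n hn).2 t ht
      have hm0 : (m (freq lam n) : ℂ) ≠ 0 := Complex.ofReal_ne_zero.2 (hpos _).ne'
      change (m (freq lam n) : ℂ) * u t n = _ at h1
      simp only [hUdef, if_neg hn, hcdef]
      push_cast
      rw [mul_comm (_⁻¹ : ℂ), mul_assoc, ← h1, ← mul_assoc, inv_mul_cancel₀ hm0, one_mul]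
  refine ⟨A, b, U, hC, ⟨fun t => by simp [hUdef], hw, fun n => ?_⟩, hUu, fun n => ?_, ?_⟩
  · exact hasWaveDeriv_of_duhamel hu hUu hw n (hC.summable_bilinear hβ n)
  · rw [abs_of_pos (hpos _), hbdef, mul_div_cancel₀ _ (hpos _).ne']
  · rw [hAe]; exact hle

/-- If `u` is in `W^s`, then `Iu` is in `W⁰`. -/
lemma IsSolution.exists_isExtension (hu : IsSolution β lam s t₀ u) (hs0 : s < 0)
    (hlam : 1 ≤ lam) (hN : 1 ≤ N) (hm : IsSymbol s N B m) : ∃ G : ℤ → ℝ → ℂ,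
      IsExtension (Set.Icc (t₀ - 1) (t₀ + 1)) (fun t => fourierMultiplier lam m (u t)) G ∧
      wNorm β lam 0 G ≠ ⊤ := by
  obtain ⟨G, hG'⟩ := iInf_lt_iff.1 hu.regular
  obtain ⟨hG, hfin⟩ := iInf_lt_iff.1 hG'
  have hl0 : ENNReal.ofReal lam⁻¹ ≠ 0 := by
    rw [ENNReal.ofReal_ne_zero_iff]; exact inv_pos.2 (by linarith)
  refine ⟨fun n τ => (m (freq lam n) : ℂ) * G n τ, fun n hn => ⟨(hG n hn).1.const_mul _,
    fun t ht => ?_⟩, ?_⟩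
  · show (m (freq lam n) : ℂ) * u t n = _
    rw [(hG n hn).2 t ht]
    rw [show (fun τ : ℝ => Complex.exp (Complex.I * t * τ) * ((m (freq lam n) : ℂ) * G n τ)) =
      fun τ : ℝ => (m (freq lam n) : ℂ) * (Complex.exp (Complex.I * t * τ) * G n τ) by
        ext τ; ring, integral_const_mul]
    ring
  set c := 2 ^ (-s) * (bracket (2 * N) ^ (-s) * N ^ (-s)) with hc
  have hle := fun x => hm.le_bracket_rpow hs0 hN x
  have hpos := hm.pos hN
  have hc0 : 0 ≤ c := by
    have := bracket_pos (2 * N); positivity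
  have hen : ∀ n τ, ‖(m (freq lam n) : ℂ) * G n τ‖ₑ ≤
      ENNReal.ofReal c * (ENNReal.ofReal (bracket (freq lam n) ^ s) * ‖G n τ‖ₑ) := fun n τ => by
    rw [enorm_mul, ← mul_assoc, ← ENNReal.ofReal_mul hc0]
    refine mul_le_mul_left ?_ _
    rw [← ofReal_norm, Complex.norm_real, Real.norm_eq_abs, abs_of_pos (hpos _)]
    exact ENNReal.ofReal_le_ofReal (hle _)
  rw [wNorm] at hfin ⊢
  have hx : xNorm β lam s (1 / 2) G < ⊤ := lt_of_le_of_lt le_self_add hfin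
  have hy : yNorm lam s G < ⊤ := lt_of_le_of_lt le_add_self hfin
  rw [xNorm, ENNReal.rpow_lt_top_iff_of_pos (by norm_num)] at hx
  rw [yNorm, ENNReal.rpow_lt_top_iff_of_pos (by norm_num)] at hy
  have hx' := (ENNReal.lt_top_of_mul_ne_top_right hx.ne hl0).ne
  have hy' := (ENNReal.lt_top_of_mul_ne_top_right hy.ne hl0).ne
  refine (ENNReal.add_lt_top.2 ⟨?_, ?_⟩).ne
  · rw [xNorm, ENNReal.rpow_lt_top_iff_of_pos (by norm_num)]
    refine ENNReal.mul_lt_top ENNReal.ofReal_lt_top (lt_of_le_of_lt (ENNReal.tsum_le_tsum fun n =>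
      lintegral_mono (g := fun τ => ENNReal.ofReal c ^ 2 * (ENNReal.ofReal (bracket (freq lam n) ^ s *
        bracket (τ - dispersion β lam (freq lam n)) ^ (1 / 2 : ℝ)) * ‖G n τ‖ₑ) ^ 2) fun τ => ?_) ?_)
    · beta_reduce
      rw [← mul_pow]
      refine pow_le_pow_left' ?_ 2
      have hb : 0 ≤ bracket (freq lam n) ^ s := Real.rpow_nonneg (bracket_pos _).le _
      rw [Real.rpow_zero, one_mul, ENNReal.ofReal_mul hb]
      refine (mul_le_mul_right (hen n τ) _).trans (le_of_eq (by ring))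
    · have e : ∀ n : {n : ℤ // n ≠ 0}, ∫⁻ τ, ENNReal.ofReal c ^ 2 *
          (ENNReal.ofReal (bracket (freq lam n) ^ s *
            bracket (τ - dispersion β lam (freq lam n)) ^ (1 / 2 : ℝ)) * ‖G n τ‖ₑ) ^ 2 =
          ENNReal.ofReal c ^ 2 * ∫⁻ τ, (ENNReal.ofReal (bracket (freq lam n) ^ s *
            bracket (τ - dispersion β lam (freq lam n)) ^ (1 / 2 : ℝ)) * ‖G n τ‖ₑ) ^ 2 := fun n =>
        lintegral_const_mul' _ _ (by finiteness)
      rw [tsum_congr e, ENNReal.tsum_mul_left]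
      exact ENNReal.mul_lt_top (by finiteness) hx'.lt_top
  · rw [yNorm, ENNReal.rpow_lt_top_iff_of_pos (by norm_num)]
    refine ENNReal.mul_lt_top ENNReal.ofReal_lt_top (lt_of_le_of_lt (ENNReal.tsum_le_tsum fun n =>
      (?_ : _ ≤ ENNReal.ofReal c ^ 2 *
        (ENNReal.ofReal (bracket (freq lam n) ^ s) * ∫⁻ τ, ‖G n τ‖ₑ) ^ 2)) ?_)
    · rw [← mul_pow]
      refine pow_le_pow_left' ?_ 2
      rw [Real.rpow_zero, ENNReal.ofReal_one, one_mul]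
      refine (lintegral_mono fun τ => hen n τ).trans (le_of_eq ?_)
      rw [lintegral_const_mul' _ _ ENNReal.ofReal_ne_top,
        lintegral_const_mul' _ _ ENNReal.ofReal_ne_top]
    · rw [ENNReal.tsum_mul_left]
      exact ENNReal.mul_lt_top (by finiteness) hy'.lt_top

end

/-! ### The modified energy in free coordinates -/

section

variable {β lam s N D κ : ℝ} {m : ℝ → ℝ} {A b : ℤ → ℝ} {f : PeriodicDistribution}

lemma injective_init {l : ℕ} :
    Function.Injective fun n : Hyperplane (l + 1) => (Fin.init n.1 : Fin l → ℤ) := by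
  intro n n' h
  have h1 := complete_init n.2.1
  have h2 := complete_init n'.2.1
  exact Subtype.ext (by rw [← h1, ← h2]; exact congrArg complete h)

lemma lambdaTerm_eq {l : ℕ} (X : (Fin (l + 1) → ℝ) → ℂ) (n : Hyperplane (l + 1)) :
    lambdaTerm lam X f n = formConst lam (l + 1) *
      (X (fun i => freq lam (complete (Fin.init n.1 : Fin l → ℤ) i)) *
        ∏ i, f (complete (Fin.init n.1 : Fin l → ℤ) i)) := by
  rw [lambdaTerm, complete_init n.2.1, formConst, convConst, inv_pow, div_eq_mul_inv]

/-- Tuples with a vanishing frequency are excluded from the hyperplane but not from the free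
coordinates; they contribute nothing because `f 0 = 0`. -/
lemma lambdaForm_eq {l : ℕ} (X : (Fin (l + 1) → ℝ) → ℂ) (hf : f 0 = 0) :
    lambdaForm lam X f = formConst lam (l + 1) * ∑' n : Fin l → ℤ,
      X (fun i => freq lam (complete n i)) * ∏ i, f (complete n i) := by
  rw [lambdaForm]
  simp only [lambdaTerm_eq X]
  rw [tsum_mul_left]
  congr 1
  refine injective_init.tsum_eq (f := fun n : Fin l → ℤ =>
    X (fun i => freq lam (complete n i)) * ∏ i, f (complete n i)) fun n hn => ?_
  by_cases h0 : ∀ i, complete n i ≠ 0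
  · exact ⟨⟨complete n, sum_complete n, h0⟩, init_complete n⟩
  · obtain ⟨i, hi⟩ := not_forall.1 h0
    refine absurd ?_ hn
    simp only
    rw [Finset.prod_eq_zero (Finset.mem_univ i) (by rw [not_not.1 hi, hf]), mul_zero]

/-- Real-valuedness makes `|f(n)|²` equal to `f(n) f(-n)`, so the first energy is a bilinear form on
the hyperplane. -/
lemma energy2_eq (hlam : 0 < lam) (hm : ∀ x, m (-x) = m x) (hf : ∀ n, f (-n) = star (f n)) :
    (energy2 lam m f : ℂ) = formConst lam 2 * ∑' n : Fin 1 → ℤ,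
      quadSymbol lam m (complete n) * ∏ i, f (complete n i) := by
  have hc : formConst lam 2 = lam⁻¹ := by
    rw [formConst, convConst, inv_pow, mul_pow, Real.sq_sqrt (by positivity)]
    field_simp
  rw [energy2, hc, Complex.ofReal_mul, Complex.ofReal_tsum,
    ← (Equiv.funUnique (Fin 1) ℤ).symm.tsum_eq]
  congr 1
  refine tsum_congr fun n => ?_
  have h := sum_complete ((Equiv.funUnique (Fin 1) ℤ).symm n)
  have h0 : complete ((Equiv.funUnique (Fin 1) ℤ).symm n) 0 = n := rfl
  rw [Fin.sum_univ_two, h0] at h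
  have h1 : complete ((Equiv.funUnique (Fin 1) ℤ).symm n) 1 = -n := by omega
  rw [quadSymbol, Fin.prod_univ_two, h0, h1, hf, freq_neg, hm, fourierMultiplier, norm_mul, mul_pow,
    Complex.norm_real, Real.norm_eq_abs, sq_abs, Complex.star_def, Complex.mul_conj,
    Complex.normSq_eq_norm_sq]
  push_cast
  ring

lemma energy4_eq (hlam : 0 < lam) (hm : ∀ x, m (-x) = m x) (hf0 : f 0 = 0)
    (hf : ∀ n, f (-n) = star (f n)) : energy4 β lam m f = modeEnergy β lam m f := by
  rw [energy4, energy3, energy2_eq hlam hm hf, lambdaForm_eq _ hf0, lambdaForm_eq _ hf0,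
    modeEnergy]

lemma IsControlled.energyConverges (hA : IsControlled lam N κ A b) (h : IsNice N D m)
    (hβ : β = -1 ∨ β = 0 ∨ β = 1) (hmb : ∀ n, |m (freq lam n)| * b n ≤ A n)
    (hf : ∀ n, ‖f n‖ ≤ b n) : EnergyConverges β lam m f := by
  have hl0 : 0 < lam := by linarith [hA.one_le]
  have key : ∀ {l : ℕ} {X : (Fin (l + 1) → ℝ) → ℂ}, (Summable fun n : Fin l → ℤ =>
      ‖X (fun i => freq lam (complete n i))‖ * ∏ i, b (complete n i)) →
      Summable (lambdaTerm lam X f) := by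
    intro l X hX
    have h1 : Summable fun n : Fin l → ℤ =>
        X (fun i => freq lam (complete n i)) * ∏ i, f (complete n i) := by
      refine Summable.of_norm_bounded hX fun n => ?_
      rw [norm_mul, norm_prod]
      exact mul_le_mul_of_nonneg_left
        (Finset.prod_le_prod (fun _ _ => norm_nonneg _) fun _ _ => hf _) (norm_nonneg _)
    exact ((h1.comp_injective injective_init).mul_left _).congr fun n => (lambdaTerm_eq X n).symm
  refine ⟨?_, key (hA.summable_sigma3 h hβ), key (hA.summable_sigma4 h hβ)⟩
  refine summable_of_tsum_ne_top (C := 1) (g := fun n => A n ^ 2) (fun _ => sq_nonneg _) (fun n => ?_)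
    (fun _ => sq_nonneg _) ?_
  · rw [one_mul, fourierMultiplier, norm_mul, Complex.norm_real, Real.norm_eq_abs]
    exact pow_le_pow_left₀ (by positivity)
      ((mul_le_mul_of_nonneg_left (hf n) (abs_nonneg _)).trans (hmb n)) 2
  · simp only [ENNReal.ofReal_pow (hA.majorant_nonneg _)]
    exact hA.finite

lemma formConst_five_le (hlam : 1 ≤ lam) : formConst lam 5 ≤ (lam ^ 4)⁻¹ := by
  have hl0 : 0 < lam := by linarith
  have hsq : 1 ≤ Real.sqrt (2 * Real.pi) := by
    rw [Real.one_le_sqrt]; linarith [Real.pi_gt_three]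
  have h2 : Real.sqrt (2 * Real.pi) ^ 2 = 2 * Real.pi := Real.sq_sqrt (by positivity)
  rw [formConst, convConst]
  set q := Real.sqrt (2 * Real.pi)
  rw [← h2]
  have : q ^ 2 * lam * (q * lam)⁻¹ ^ 5 = (q ^ 3)⁻¹ * (lam ^ 4)⁻¹ := by field_simp
  rw [this]
  exact mul_le_of_le_one_left (by positivity) (inv_le_one_of_one_le₀ (one_le_pow₀ hsq))

/-- The quintic sum is bounded by the fifth power of the norm, uniformly in `lam`. -/
lemma IsControlled.formConst_mul_tsum_le (hA : IsControlled lam N κ A b) {g : ℝ≥0∞}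
    (hg : ∑' n, ENNReal.ofReal (A n) ^ 2 ≤ ENNReal.ofReal (2 * lam) * g ^ 2) :
    ENNReal.ofReal (formConst lam 5) *
      ∑' n : Fin 4 → ℤ, ENNReal.ofReal (quinticSum lam A (complete n)) ≤
        ENNReal.ofReal (2 ^ 18) * g ^ 5 := by
  have hlam := hA.one_le
  have hl0 : 0 < lam := by linarith
  have e : ∀ c : ℝ, 0 ≤ c → ENNReal.ofReal (c * lam) = ENNReal.ofReal c * ENNReal.ofReal lam :=
    fun c hc => ENNReal.ofReal_mul hc
  -- With `B = 2 lam g²` one may take `Q = 15 lam g`, since `200 ≤ 225`. Both `Q · 100 lam · B²` and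
  -- `Q³ B` are then of order `lam⁴ g⁵`, matching `formConst lam 5 ≤ lam⁻⁴`.
  have hQ : ENNReal.ofReal (100 * lam) * (ENNReal.ofReal (2 * lam) * g ^ 2) ≤
      (ENNReal.ofReal (15 * lam) * g) ^ 2 := by
    rw [e _ (by norm_num), e _ (by norm_num), e _ (by norm_num)]
    rw [show ENNReal.ofReal 100 * ENNReal.ofReal lam * (ENNReal.ofReal 2 * ENNReal.ofReal lam * g ^ 2) =
      (ENNReal.ofReal 100 * ENNReal.ofReal 2) * (ENNReal.ofReal lam ^ 2 * g ^ 2) by ring,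
      show (ENNReal.ofReal 15 * ENNReal.ofReal lam * g) ^ 2 =
        ENNReal.ofReal 15 ^ 2 * (ENNReal.ofReal lam ^ 2 * g ^ 2) by ring]
    refine mul_le_mul_left ?_ _
    rw [← ENNReal.ofReal_mul (by norm_num), ← ENNReal.ofReal_pow (by norm_num)]
    exact ENNReal.ofReal_le_ofReal (by norm_num)
  have h1 := hA.tsum_quinticSum_le hg hQ
  have h2 : ENNReal.ofReal (formConst lam 5) ≤ ENNReal.ofReal ((lam ^ 4)⁻¹) :=
    ENNReal.ofReal_le_ofReal (formConst_five_le hlam)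
  refine (mul_le_mul' h2 h1).trans ?_
  have h4 : ENNReal.ofReal ((lam ^ 4)⁻¹) * ENNReal.ofReal lam ^ 4 = 1 := by
    rw [← ENNReal.ofReal_pow hl0.le, ← ENNReal.ofReal_mul (by positivity),
      inv_mul_cancel₀ (by positivity), ENNReal.ofReal_one]
  rw [e _ (by norm_num), e _ (by norm_num), e _ (by norm_num)]
  calc _ = (ENNReal.ofReal ((lam ^ 4)⁻¹) * ENNReal.ofReal lam ^ 4) *
        ((12 * ENNReal.ofReal 15 * ENNReal.ofReal 100 * ENNReal.ofReal 2 ^ 2 +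
          14 * ENNReal.ofReal 15 ^ 3 * ENNReal.ofReal 2) * g ^ 5) := by ring
    _ ≤ _ := by
        rw [h4, one_mul]
        refine mul_le_mul_left ?_ _
        simp only [ENNReal.ofReal_ofNat, ENNReal.ofReal_pow (zero_le_two : (0 : ℝ) ≤ 2)]
        norm_num

end

/-! ### From a given extension to the restricted norm -/

/-- The almost conservation law with the norm of a given extension. -/
theorem exists_energy4_sub_le {s : ℝ} (hs : -1 ≤ s) (hs0 : s < 0) (B : ℕ → ℝ) :
    ∃ C : ℝ, 0 < C ∧ ∀ (β lam N : ℝ) (m : ℝ → ℝ) (t₀ : ℝ) (u : ℝ → PeriodicDistribution),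
      (β = -1 ∨ β = 0 ∨ β = 1) → 1 ≤ lam → 1 ≤ N → IsSymbol s N B m → IsSolution β lam s t₀ u →
      ∀ G, IsExtension (Set.Icc (t₀ - 1) (t₀ + 1)) (fun t => fourierMultiplier lam m (u t)) G →
      wNorm β lam 0 G ≠ ⊤ → ∀ t ∈ Set.Icc (t₀ - 1) (t₀ + 1), EnergyConverges β lam m (u t) ∧
        ENNReal.ofReal ‖energy4 β lam m (u t) - energy4 β lam m (u t₀)‖ ≤
          ENNReal.ofReal (C * N ^ (5 * s)) * wNorm β lam 0 G ^ 5 := by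
  obtain ⟨D, hD, hnice⟩ := exists_isNice hs hs0 B
  -- `122 = 99 + 5 + 18`: the energy increment, the factor `(2 N ^ s) ^ 5`, and the quintic sum.
  refine ⟨2 ^ 122 * (D + 1), by positivity, ?_⟩
  intro β lam N m t₀ u hβ hlam hN hm hu G hG hfin t ht
  have hl0 : 0 < lam := by linarith
  obtain ⟨hmn, mK, hmK, hsupp, hle, hlim⟩ := hnice N m hN hm
  obtain ⟨A, b, U, hA, hU, hUu, hmb, hsum⟩ := hu.exists_modeFamily hs hβ hlam hN hm hG hfin
  have ht₀ : t₀ ∈ Set.Icc (t₀ - 1) (t₀ + 1) := by constructor <;> linarith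
  have hUt : ∀ t ∈ Set.Icc (t₀ - 1) (t₀ + 1), U t = u t := fun t ht => funext (hUu t ht)
  have hE : ∀ t ∈ Set.Icc (t₀ - 1) (t₀ + 1), energy4 β lam m (u t) = modeEnergy β lam m (U t) :=
    fun t ht => by
      rw [hUt t ht]
      exact energy4_eq hl0 hm.even (hu.mean_zero t ht) (hu.real_valued t ht)
  refine ⟨hA.energyConverges hmn hβ hmb fun n => ?_, ?_⟩
  · rw [← hUu t ht]; exact (hU.wave n).norm_le t
  rw [hE t ht, hE t₀ ht₀]
  refine (modeEnergy_almost_conserved hA hU (by linarith) hβ hmb hmK hsupp hle hlim ht₀ ht).trans ?_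
  have hq := hA.formConst_mul_tsum_le hsum
  have hN0 : 0 < N := by linarith
  have hpow : (2 * N ^ s) ^ 5 = 32 * N ^ (5 * s) := by
    rw [mul_pow, mul_comm 5 s, Real.rpow_mul hN0.le]
    norm_num
  have hf0 : 0 ≤ formConst lam 5 := by
    rw [formConst, convConst]; positivity
  have hNs : 0 < N ^ (5 * s) := Real.rpow_pos_of_pos hN0 _
  calc _ = ENNReal.ofReal (2 ^ 99 * (D + 1) * (32 * N ^ (5 * s))) *
        (ENNReal.ofReal (formConst lam 5) *
          ∑' n : Fin 4 → ℤ, ENNReal.ofReal (quinticSum lam A (complete n))) := by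
        rw [← mul_assoc, ← ENNReal.ofReal_mul (by positivity), hpow,
          show 2 ^ 99 * (D + 1) * (32 * N ^ (5 * s)) * formConst lam 5 =
            2 ^ 99 * formConst lam 5 * (D + 1) * (32 * N ^ (5 * s)) by ring]
    _ ≤ ENNReal.ofReal (2 ^ 99 * (D + 1) * (32 * N ^ (5 * s))) *
        (ENNReal.ofReal (2 ^ 18) * wNorm β lam 0 G ^ 5) := by gcongr
    _ = _ := by
        rw [← mul_assoc, ← ENNReal.ofReal_mul (by positivity),
          show 2 ^ 99 * (D + 1) * (32 * N ^ (5 * s)) * 2 ^ 18 =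
            2 ^ 122 * (D + 1) * N ^ (5 * s) by ring]

/-- The map `y ↦ c y⁵` is continuous and monotone, so it commutes with the infimum over extensions.
The condition `c ≠ 0` gives it the value `∞` at `∞`, as is needed for an infimum over an empty set
and makes extensions of infinite norm harmless. -/
lemma le_mul_wNormOn_pow {x c : ℝ≥0∞} (hc0 : c ≠ 0) (hc : c ≠ ⊤) {β lam s : ℝ} {J : Set ℝ}
    {u : ℝ → PeriodicDistribution} (h : ∀ G, IsExtension J u G → wNorm β lam s G ≠ ⊤ →
      x ≤ c * wNorm β lam s G ^ 5) : x ≤ c * wNormOn β lam s J u ^ 5 := by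
  have hmono : Monotone fun y : ℝ≥0∞ => c * y ^ 5 := fun y z hyz => by
    beta_reduce; gcongr
  have hcont : Continuous fun y : ℝ≥0∞ => c * y ^ 5 :=
    (ENNReal.continuous_const_mul hc).comp (ENNReal.continuous_pow 5)
  have htop : (fun y : ℝ≥0∞ => c * y ^ 5) ⊤ = ⊤ := by
    beta_reduce
    rw [ENNReal.top_pow (by norm_num), ENNReal.mul_top hc0]
  rw [wNormOn]
  change x ≤ (fun y : ℝ≥0∞ => c * y ^ 5) _
  refine le_of_le_of_eq (le_iInf fun G => ?_)
    (hmono.map_iInf_of_continuousAt hcont.continuousAt htop).symm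
  refine le_of_le_of_eq (le_iInf fun hG => ?_)
    (hmono.map_iInf_of_continuousAt hcont.continuousAt htop).symm
  by_cases hfin : wNorm β lam s G = ⊤
  · show x ≤ c * wNorm β lam s G ^ 5
    rw [hfin, ENNReal.top_pow (by norm_num), ENNReal.mul_top hc0]; exact le_top
  · exact h G hG hfin

end Kawahara

theorem proposition5p2 (s : ℝ) (hs : -1 ≤ s) (hs0 : s < 0) (B : ℕ → ℝ) :
    ∃ N₀ C : ℝ, 1 ≤ N₀ ∧ 0 < C ∧
      ∀ (β lam N : ℝ) (m : ℝ → ℝ) (t₀ : ℝ) (u : ℝ → Kawahara.PeriodicDistribution),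
        (β = -1 ∨ β = 0 ∨ β = 1) → 1 ≤ lam → N₀ ≤ N →
        Kawahara.IsSymbol s N B m → Kawahara.IsSolution β lam s t₀ u →
        (∀ t ∈ Set.Icc (t₀ - 1) (t₀ + 1), Kawahara.EnergyConverges β lam m (u t)) ∧
        ∀ t ∈ Set.Icc (t₀ - 1) (t₀ + 1),
          ENNReal.ofReal ‖Kawahara.energy4 β lam m (u t) - Kawahara.energy4 β lam m (u t₀)‖ ≤
            ENNReal.ofReal (C * N ^ (5 * s)) *
              Kawahara.wNormOn β lam 0 (Set.Icc (t₀ - 1) (t₀ + 1))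
                (fun t => Kawahara.fourierMultiplier lam m (u t)) ^ 5 := by
  obtain ⟨C, hC, h⟩ := Kawahara.exists_energy4_sub_le hs hs0 B
  refine ⟨1, C, le_rfl, hC, ?_⟩
  intro β lam N m t₀ u hβ hlam hN hm hu
  have key := h β lam N m t₀ u hβ hlam hN hm hu
  -- Convergence of the energies needs one extension of finite norm, which the regularity of `u`
  -- provides; the inequality needs all of them.
  obtain ⟨G, hG, hfin⟩ := hu.exists_isExtension hs0 hlam hN hm
  refine ⟨fun t ht => (key G hG hfin t ht).1, fun t ht => ?_⟩
  have hpos : 0 < C * N ^ (5 * s) := mul_pos hC (Real.rpow_pos_of_pos (by linarith) _)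
  exact Kawahara.le_mul_wNormOn_pow (ENNReal.ofReal_pos.2 hpos).ne' ENNReal.ofReal_ne_top
    fun G hG hfin => (key G hG hfin t ht).2
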